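/- **Setting.** Let $d\ge 1$. Functions $u=u(t,x)$ on $[0,1]\times\mathbb R^d$ (with values in $\mathbb C$ or $\mathbb C^m$) are measurable maps $t\mapsto u(t)\in L^2(\mathbb R^d)$. Fix a smooth, nonnegative, nonincreasing $\phi_0:[0,\infty)\to\mathbb R$ with $\phi_0=1$ on $[0,1]$ and $\phi_0=0$ on $[2,\infty)$, put $\phi_k(r)=\phi_0(2^{-k}r)-\phi_0(2^{-k+1}r)$ for $k\ge1$, and let $S_k$ be the spatial Fourier multiplier with symbol $\phi_k(|\xi|)$, $S_{<N}=\sum_{0\le k<N}S_k$, $S_{\ge N}=1-S_{<N}$. For each integer $j\ge 0$ let $\mathcal Q_j$ be the partition of $\mathbb R^d$ into the cubes $2^j(m+[0,1)^d)$, $m\in\mathbb Z^d$, and $1=\sum_{Q\in\mathcal Q_j}\chi_Q$ a nonnegative smooth partition of unity with $\chi_Q$ supported in a fixed multiple of $Q$ and $|\partial^\alpha\chi_Q|\lesssim_\alpha 2^{-j|\alpha|}$. Define $$\|u\|_X=\sup_{l\ge0}\sup_{Q\in\mathcal Q_l}2^{-l/2}\|u\|_{L^2([0,1]\times Q)},\qquad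 \|u\|_{X_j}=2^{j/2}\|u\|_X+\|u\|_{L^\infty_tL^2_x},$$ $$\|f\|_Y=\inf\Big\{\sum_n|c_n|:\ f=\sum_n c_na_n,\ a_n\text{ atoms}\Big\},\qquad \|f\|_{Y_j}=\inf_{f=2^{j/2}f_1+f_2}\big(\|f_1\|_Y+\|f_2\|_{L^1_tL^2_x}\big),$$ where an atom is a function $a$ supported in $[0,1]\times Q$ for some $j\geq 0$, $Q\in\mathcal Q_j$, with $\|a\|_{L^2}\le2^{-j/2}$, and $$\|u\|_{l^1X^s}^2=\sum_{j\ge0}2^{2js}\Big(\sum_{Q\in\mathcal Q_j}\|\chi_QS_ju\|_{X_j}\Big)^2,\qquad \|f\|_{l^1Y^s}^2=\sum_{j\ge0}2^{2js}\Big(\sum_{Q\in\mathcal Q_j}\|\chi_QS_jf\|_{Y_j}\Big)^2 .$$ An admissible frequency envelope for $u$ in $l^1X^s$ (with parameter $\delta>0$ and constant $C$) is a positive sequence $(a_j)_{j\ge0}$ with $\|S_ju\|_{l^1X^s}\le a_j\|u\|_{l^1X^s}$, $C^{-1}\le\sum_j a_j^2\le C$, $C^{-1}\le a_0\le C$, and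 $a_j\le2^{\delta|j-k|}a_k$ for all $j,k\ge0$. **Proposition.** All implicit constants below, and the function $c$, are independent of $k\ge0$, of the functions $u,v,g$ and of the envelopes; they may depend on $d$, $\phi_0$, the $\chi_Q$, $s,\sigma,\delta,C$, and on $F$, respectively $A$. (a) Let $s>\frac d2$ and $0<\delta<s-\frac d2$. If $u,v\in l^1X^s$ have admissible frequency envelopes $a_k$, $b_k$ in $l^1X^s$, then $$\|S_k(uv)\|_{l^1X^s}\lesssim(a_k+b_k)\|u\|_{l^1X^s}\|v\|_{l^1X^s}.$$ If $F:\mathbb C^m\to\mathbb C^n$ is smooth (in the real sense) with $F(0)=0$, there is a nondecreasing function $c$ such that for every $\mathbb C^m$-valued $u\in l^1X^s$ with admissible frequency envelope $a_k$ in $l^1X^s$, $u\in L^\infty$ and $$\|S_kF(u)\|_{l^1X^s}\le a_k\|u\|_{l^1X^s}(1+\|u\|_{l^1X^s})\,c(\|u\|_{L^\infty}).$$ (b) Let $s>\frac d2+2$ and $0<\delta<s-\frac d2-2$. Then $$\|S_k(uv)\|_{l^1Y^\sigma}\lesssim(a_k+b_k)\|u\|_{l^1X^{s-1}}\|v\|_{l^1X^{\sigma-1}},\qquad0\le\sigma\le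 s,$$ $$\|S_k(uv)\|_{l^1Y^\sigma}\lesssim(a_k+b_k)\|u\|_{l^1X^{s-2}}\|v\|_{l^1X^{\sigma}},\qquad0\le\sigma\le s-1,$$ $$\|S_k(u\,S_{\ge k-4}v)\|_{l^1Y^\sigma}\lesssim(a_k+b_k)\|u\|_{l^1X^{s-2}}\|v\|_{l^1X^{\sigma}},\qquad0\le\sigma\le s,$$ whenever the norms of $u$ and $v$ on the right hand side are finite; here, in each bound, $a_k$ and $b_k$ are admissible frequency envelopes of $u$ and $v$ in the spaces whose norms appear on the right hand side of that bound. (c) Let $s>\frac d2+2$ and let $A\in S^0$, i.e. $A:\mathbb R^d\to\mathbb C$ is smooth with $|\partial^\alpha A(\xi)|\lesssim_\alpha(1+|\xi|)^{-|\alpha|}$. For every $d\times d$ matrix function $g=(g^{ij})$ with $g-I\in l^1X^s$ and every $u$ with $S_ku\in l^1X^0$, $$\Big\|\sum_{i,j=1}^d\partial_i[S_{<k-4}g^{ij},A(D)]\partial_jS_ku\Big\|_{l^1Y^0}\lesssim\|g-I\|_{l^1X^s}\|S_ku\|_{l^1X^0}.$$ -/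

import Mathlib

open MeasureTheory
open scoped ENNReal NNReal ContDiff FourierTransform

noncomputable section

namespace LocalEnergy

/-! ### Function spaces on `[0,1] × ℝ^d`

A function on `[0,1] × ℝ^d` is a map `u : ℝ → L²(ℝ^d; V)`, `t ↦ u(t)`, of which only the values for
`t ∈ [0,1]` matter: all norms in time are with respect to Lebesgue measure on `[0,1]`. -/

/-- The space `ℝ^d` with its Euclidean norm. -/
abbrev E (d : ℕ) := EuclideanSpace ℝ (Fin d)

/-- `L²(ℝ^d; V)`. -/
abbrev L2 (d : ℕ) (V : Type*) [NormedAddCommGroup V] := Lp V 2 (volume : Measure (E d))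

/-- Lebesgue measure on the time interval `[0,1]`. -/
def timeMeasure : Measure ℝ := volume.restrict (Set.Icc 0 1)

section Operators

variable {d : ℕ} {V W : Type*} [NormedAddCommGroup V] [NormedAddCommGroup W]

open Classical in
/-- The class in `L²` of a function on `ℝ^d` (and `0` if it is not in `L²`). -/
def ofFun (f : E d → V) : L2 d V := if h : MemLp f 2 volume then h.toLp f else 0

/-- The pointwise product `u v` of two scalar functions. -/
def mul (u v : ℝ → L2 d ℂ) : ℝ → L2 d ℂ := fun t => ofFun fun x => u t x * v t x

/-- The superposition `F(u)`. -/
def comp (F : V → W) (u : ℝ → L2 d V) : ℝ → L2 d W := fun t => ofFun fun x => F (u t x)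

/-- The Fourier multiplier `m(D)`, i.e. `f ↦ 𝓕⁻¹ (m · 𝓕 f)`, on the `f ∈ L²` with
`m · 𝓕 f ∈ L²`. -/
def fourierMul [InnerProductSpace ℂ V] [CompleteSpace V] (m : E d → ℂ) (f : L2 d V) : L2 d V :=
  𝓕⁻ (ofFun fun ξ => m ξ • (𝓕 f : L2 d V) ξ)

/-- The partial derivative `∂_i`; with the Fourier transform `∫ exp (-2πi x·ξ) f(x) dx` its symbol
is `2πi ξ_i`. -/
def partialDeriv (i : Fin d) : L2 d ℂ → L2 d ℂ :=
  fourierMul fun ξ => 2 * Real.pi * Complex.I * (ξ i : ℂ)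

/-- The commutator `[b, A(D)] w = b · A(D) w - A(D) (b w)` of multiplication by a function `b` with
the Fourier multiplier `A(D)`. -/
def commutator (b : E d → ℂ) (A : E d → ℂ) (w : L2 d ℂ) : L2 d ℂ :=
  ofFun (fun x => b x * fourierMul A w x) - fourierMul A (ofFun fun x => b x * w x)

/-- The symbol class `S⁰`. -/
def IsSymbolZero (A : E d → ℂ) : Prop :=
  ContDiff ℝ ∞ A ∧
    ∀ n : ℕ, ∃ C : ℝ, ∀ ξ, ‖iteratedFDeriv ℝ n A ξ‖ ≤ C * (1 + ‖ξ‖) ^ (-(n : ℝ))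

end Operators

/-- The dyadic cube of side `2^j` with lower corner `2^j m`; `𝒬_j` consists of the cubes
`cube j m`, `m ∈ ℤ^d`. -/
def cube {d : ℕ} (j : ℕ) (m : Fin d → ℤ) : Set (E d) :=
  {x | ∀ i, (2 : ℝ) ^ j * m i ≤ x i ∧ x i < (2 : ℝ) ^ j * (m i + 1)}

/-- The choices that enter the definition of the function spaces: the cutoff function `φ₀` of the
Littlewood-Paley decomposition, and for each `j ≥ 0` a smooth partition of unity
`1 = ∑_{Q ∈ 𝒬_j} χ_Q` adapted to the cubes of side `2^j`. -/
structure Decomposition (d : ℕ) where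
  /-- The function `φ₀`; only its values on `[0,∞)` are used. -/
  phi : ℝ → ℝ
  phi_smooth : ContDiff ℝ ∞ phi
  phi_nonneg : ∀ r, 0 ≤ r → 0 ≤ phi r
  phi_antitone : AntitoneOn phi (Set.Ici 0)
  phi_one : ∀ r, 0 ≤ r → r ≤ 1 → phi r = 1
  phi_zero : ∀ r, 2 ≤ r → phi r = 0
  /-- `chi j m` is the function `χ_Q` for `Q = cube j m`. -/
  chi : ℕ → (Fin d → ℤ) → E d → ℝ
  chi_smooth : ∀ j m, ContDiff ℝ ∞ (chi j m)
  chi_nonneg : ∀ j m x, 0 ≤ chi j m x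
  chi_sum : ∀ j x, HasSum (fun m => chi j m x) 1
  /-- `χ_Q` is supported in a fixed multiple of `Q`. -/
  chi_supp : ∃ R : ℝ, ∀ j m x, chi j m x ≠ 0 →
    ∀ i, |x i - (2 : ℝ) ^ j * (m i + 1 / 2)| ≤ R * (2 : ℝ) ^ j
  /-- `χ_Q` is smooth on the scale of `Q`. -/
  chi_deriv : ∀ n : ℕ, ∃ C : ℝ, ∀ j m x,
    ‖iteratedFDeriv ℝ n (chi j m) x‖ ≤ C * (2 : ℝ) ^ (-((j : ℝ) * n))

section Norms

variable {d : ℕ} {V : Type*} [NormedAddCommGroup V]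

/-- The norm of `L^∞([0,1] × ℝ^d)`. -/
def linftyNorm (u : ℝ → L2 d V) : ℝ≥0∞ := essSup (fun t => eLpNorm (u t) ⊤ volume) timeMeasure

/-- `‖u‖_X = sup_l sup_{Q ∈ 𝒬_l} 2^{-l/2} ‖u‖_{L²([0,1] × Q)}`. -/
def xNorm (u : ℝ → L2 d V) : ℝ≥0∞ :=
  ⨆ (l : ℕ) (m : Fin d → ℤ), (2 : ℝ≥0∞) ^ (-(l : ℝ) / 2) *
    (∫⁻ t, eLpNorm (u t) 2 (volume.restrict (cube l m)) ^ 2 ∂timeMeasure) ^ (1 / 2 : ℝ)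

/-- `‖u‖_{X_j} = 2^{j/2} ‖u‖_X + ‖u‖_{L^∞ L²}`. -/
def xjNorm (j : ℕ) (u : ℝ → L2 d V) : ℝ≥0∞ :=
  (2 : ℝ≥0∞) ^ ((j : ℝ) / 2) * xNorm u + eLpNorm u ⊤ timeMeasure

/-- An atom of `Y`: supported in `[0,1] × Q` for some `Q ∈ 𝒬_j`, with `L²` norm at most
`2^{-j/2}`. -/
def IsAtom (a : ℝ → L2 d V) : Prop :=
  AEStronglyMeasurable a timeMeasure ∧ ∃ (j : ℕ) (m : Fin d → ℤ),
    (∀ᵐ t ∂timeMeasure, ∀ᵐ x, x ∉ cube j m → a t x = 0) ∧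
    eLpNorm a 2 timeMeasure ≤ (2 : ℝ≥0∞) ^ (-(j : ℝ) / 2)

/-- `‖f‖_Y = inf {∑ |c_n| : f = ∑ c_n a_n, a_n atoms}`, the series converging in
`L²([0,1] × ℝ^d)`; it is `∞` if `f ∉ Y`. -/
def yNorm [NormedSpace ℂ V] (f : ℝ → L2 d V) : ℝ≥0∞ :=
  ⨅ (c : ℕ → ℂ) (a : ℕ → ℝ → L2 d V)
    (_ : (∀ n, IsAtom (a n)) ∧
      Filter.Tendsto (fun N => eLpNorm (f - ∑ n ∈ Finset.range N, c n • a n) 2 timeMeasure)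
        Filter.atTop (nhds 0)),
    ∑' n, ‖c n‖ₑ

/-- `‖f‖_{Y_j} = inf {‖f₁‖_Y + ‖f₂‖_{L¹ L²} : f = 2^{j/2} f₁ + f₂}`. -/
def yjNorm [NormedSpace ℂ V] (j : ℕ) (f : ℝ → L2 d V) : ℝ≥0∞ :=
  ⨅ (f₁ : ℝ → L2 d V) (f₂ : ℝ → L2 d V)
    (_ : AEStronglyMeasurable f₁ timeMeasure ∧ AEStronglyMeasurable f₂ timeMeasure ∧
      ∀ᵐ t ∂timeMeasure, f t = (((2 : ℝ) ^ ((j : ℝ) / 2) : ℝ) : ℂ) • f₁ t + f₂ t),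
    yNorm f₁ + eLpNorm f₂ 1 timeMeasure

end Norms

namespace Decomposition

variable {d : ℕ} (P : Decomposition d)

/-- The functions `φ_k` on `[0,∞)`. -/
def phiK (k : ℕ) (r : ℝ) : ℝ :=
  if k = 0 then P.phi r
  else P.phi ((2 : ℝ) ^ (-(k : ℝ)) * r) - P.phi ((2 : ℝ) ^ (-(k : ℝ) + 1) * r)

section LittlewoodPaley

variable {V : Type*} [NormedAddCommGroup V] [InnerProductSpace ℂ V] [CompleteSpace V]

/-- The Littlewood-Paley projection `S_k`, acting in the space variable. -/
def S (k : ℕ) (u : ℝ → L2 d V) : ℝ → L2 d V :=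
  fun t => fourierMul (fun ξ => (P.phiK k ‖ξ‖ : ℂ)) (u t)

/-- `S_{<N} = ∑_{k<N} S_k`, which is `0` for `N ≤ 0`. -/
def SLt (N : ℕ) (u : ℝ → L2 d V) : ℝ → L2 d V := ∑ k ∈ Finset.range N, P.S k u

/-- `S_{≥N} = ∑_{k≥N} S_k = 1 - S_{<N}`. -/
def SGe (N : ℕ) (u : ℝ → L2 d V) : ℝ → L2 d V := u - P.SLt N u

/-- Multiplication by the cutoff `χ_Q`, `Q = cube j m`. -/
def cut (j : ℕ) (m : Fin d → ℤ) (u : ℝ → L2 d V) : ℝ → L2 d V :=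
  fun t => ofFun fun x => (P.chi j m x : ℂ) • u t x

/-- `‖u‖_{l¹X^s} = (∑_j 2^{2js} ‖S_j u‖²_{l¹_j X_j})^{1/2}`, where
`‖w‖_{l¹_j X_j} = ∑_{Q ∈ 𝒬_j} ‖χ_Q w‖_{X_j}`. -/
def l1X (s : ℝ) (u : ℝ → L2 d V) : ℝ≥0∞ :=
  (∑' j : ℕ, ((2 : ℝ≥0∞) ^ ((j : ℝ) * s) *
    ∑' m : Fin d → ℤ, xjNorm j (P.cut j m (P.S j u))) ^ 2) ^ (1 / 2 : ℝ)

/-- `‖f‖_{l¹Y^s} = (∑_j 2^{2js} ‖S_j f‖²_{l¹_j Y_j})^{1/2}`, where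
`‖w‖_{l¹_j Y_j} = ∑_{Q ∈ 𝒬_j} ‖χ_Q w‖_{Y_j}`. -/
def l1Y (s : ℝ) (f : ℝ → L2 d V) : ℝ≥0∞ :=
  (∑' j : ℕ, ((2 : ℝ≥0∞) ^ ((j : ℝ) * s) *
    ∑' m : Fin d → ℤ, yjNorm j (P.cut j m (P.S j f))) ^ 2) ^ (1 / 2 : ℝ)

/-- `u ∈ l¹X^s`, for functions `u` with `u(t) ∈ L²(ℝ^d)`. If `s ≥ 0` the last condition is no
restriction, since then `l¹X^s ⊆ L^∞([0,1]; L²(ℝ^d))`. -/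
def MemL1X (s : ℝ) (u : ℝ → L2 d V) : Prop :=
  AEStronglyMeasurable u timeMeasure ∧ P.l1X s u < ⊤

/-- `a` is an admissible frequency envelope for `u` in `l¹X^s`, with parameter `δ` of slow
variation, and with the implicit constant `C` in `∑ a_j² ≈ 1` and `a_0 ≈ 1`. -/
structure IsEnvelope (δ C s : ℝ) (u : ℝ → L2 d V) (a : ℕ → ℝ) : Prop where
  pos : ∀ j, 0 < a j
  bound : ∀ j, P.l1X s (P.S j u) ≤ ENNReal.ofReal (a j) * P.l1X s u
  summable : Summable fun j => a j ^ 2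
  le_sum : C⁻¹ ≤ ∑' j, a j ^ 2
  sum_le : ∑' j, a j ^ 2 ≤ C
  le_zero : C⁻¹ ≤ a 0
  zero_le : a 0 ≤ C
  slow : ∀ j k : ℕ, a j ≤ (2 : ℝ) ^ (δ * |(j : ℝ) - k|) * a k

end LittlewoodPaley

/-- The entries `(S_{<N} g)^{ij}(t,x)` for the matrix function `g = I + h`. Here `S_k` acts on a
constant as multiplication by the value `φ_k(0)` of its symbol at frequency zero. -/
def lowMetric (h : ℝ → L2 d (EuclideanSpace ℂ (Fin d × Fin d))) (N : ℕ) (t : ℝ) (i j : Fin d) :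
    E d → ℂ := fun x =>
  (if i = j then ∑ k ∈ Finset.range N, (P.phiK k 0 : ℂ) else 0) + P.SLt N h t x (i, j)

/-- `∇[S_{<k-4} g, A(D)]∇ S_k u = ∑_{i,j} ∂_i [S_{<k-4} g^{ij}, A(D)] ∂_j S_k u` for `g = I + h`.
For `k ≤ 4` the operator `S_{<k-4}` is zero. -/
def metricCommutator (h : ℝ → L2 d (EuclideanSpace ℂ (Fin d × Fin d))) (A : E d → ℂ) (k : ℕ)
    (u : ℝ → L2 d ℂ) : ℝ → L2 d ℂ := fun t =>
  ∑ i, ∑ j, partialDeriv i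
    (commutator (P.lowMetric h (k - 4) t i j) A (partialDeriv j (P.S k u t)))

end Decomposition

end LocalEnergy

end

open LocalEnergy

open MeasureTheory
open scoped ENNReal NNReal ContDiff FourierTransform SchwartzMap

set_option linter.unusedSectionVars false

noncomputable section

namespace LocalEnergy

/-! Everything is reduced to profiles, the functions (t, n) ↦ ‖u(t)‖_{L²(unit cube n)} (`prof`). All
cubes in the definitions have side 2^l ≥ 1. Hence the norms X, L^∞L² and L²L², and their ℓ¹ sums
over the cubes of a given side, depend on u only through its profile. There they are monotone,
countably subadditive and translation invariant up to a constant (`LNorm`). A smooth multiplier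
localized at frequency 2^k, k ≥ 0, has a kernel at scale 2^{-k} ≤ 1, so it acts on profiles as
convolution with a summable weight that does not depend on k (`pr2_mconv_le`), and it is bounded in
all these norms at once. Bernstein's inequality holds in the same local form with the factor
2^{kd/2}, from L² to L^∞ (`mconv_le`) and from L¹ to L² (`pr2_mconv_le_pr1`). The smooth cutoffs χ_Q
may be exchanged for sharp ones (`tsum_cut_le`, `lsum_le_tsum_cut`).

For Y only upper bounds are needed. Cutting f into cubes of side 2^l gives ‖f‖_{Y_j} ≤ 2^{(l-j)/2}
∑_Q ‖f‖_{L²([0,1]×Q)}, and l may be chosen separately for each term of a finite sum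
(`yjNorm_le_sum`, `exists_l1Y_le`).

Products: S_k(S_i u S_j v) vanishes unless the two largest of the three frequencies are comparable
(`S_smulF_eq_zero`). In the low-high part, i < k - 4 and |j - k| ≤ 2, cubes of side 2^i are used.
The low factor carries the ℓ¹ summation and costs 2^{id/2}. The high factor is only measured in X:
its L² norm on a cube is at most 2^{i/2} times its X norm, which gains 2^{-k/2} over X_k. With the
factor 2^{(i-k)/2} of the atoms this is a gain of one full derivative, 2^{i-k}
(`exists_lsum_LH_le`). In the high-high part, i ≥ k - 4 and |i - j| ≤ 6, Bernstein from L¹ to L²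
costs only 2^{kd/2}, and the passage from cubes of side 2^i to cubes of side about 2^k costs
2^{(i-k)d/2} in L² and 2^{(i-k)d} in X_k. The regularity of the two factors pays for this and for
the loss 2^{δ|i-k|} in replacing a_i by a_k (`exists_norm_HH_le`).

Commutator: with β = S_i g and K the kernel of A(D) near frequency 2^k, the commutator has the
kernel K(x-y)(β(x)-β(y)). The difference gives 2^i|x-y| and the decay of K turns |x-y| into 2^{-k}.
The gain 2^{i-k} over the product bound cancels the growth in k of the two derivatives, and s > d/2
+ 2 makes the sum over i converge (`exists_lsum_commPiece_le`, `exists_l1Y_metricCommutator_le`).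

Moser estimate: F is cut off outside the range of u, and F(u) is telescoped into the increments
Γ(S_{<h+1}u) - Γ(S_{<h}u). For h < k + 3, repeated integration by parts against the annular symbol
of S_k gains 2^{-N(k-h)} (`exists_norm_S_incr_le`). For h ≥ k + 3 a bound linear in S_h u is not
enough, because passing to the smaller cubes of side 2^k costs 2^{(h-k)d} while only s > d/2 is
assumed. By Taylor's formula the increment is DΓ(S_{<h}u) S_h u + O(|S_h u|²). The part DΓ(0) S_h u
has no frequencies near 2^k, and of DΓ(S_{<h}u) - DΓ(0) only the frequencies above 2^{h-4} matter,
which are of size 2^{-hs}‖u‖. So the output is quadratic in u, Bernstein from L¹ to L² applies, and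
the sum over h converges (`exists_nX_S_incr_high_le`). This is the origin of the factor 1 + ‖u‖. -/

/-! ### Square roots and Minkowski's inequality in `[0,∞]` -/

/-- The square root on `[0,∞]`. -/
def rt (x : ℝ≥0∞) : ℝ≥0∞ := x ^ (1 / 2 : ℝ)

theorem rt_sq (x : ℝ≥0∞) : rt x ^ 2 = x := by
  rw [rt, ← ENNReal.rpow_natCast, ← ENNReal.rpow_mul]; norm_num

theorem rt_of_sq (x : ℝ≥0∞) : rt (x ^ 2) = x := by
  rw [rt, ← ENNReal.rpow_natCast, ← ENNReal.rpow_mul]; norm_num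

theorem rt_mono {x y : ℝ≥0∞} (h : x ≤ y) : rt x ≤ rt y :=
  ENNReal.rpow_le_rpow h (by norm_num)

theorem rt_mul (x y : ℝ≥0∞) : rt (x * y) = rt x * rt y :=
  ENNReal.mul_rpow_of_nonneg _ _ (by norm_num)

theorem rt_le_iff {x y : ℝ≥0∞} : rt x ≤ y ↔ x ≤ y ^ 2 := by
  constructor
  · intro h; rw [← rt_sq x]; exact pow_le_pow_left' h 2
  · intro h; rw [← rt_of_sq y]; exact rt_mono h

@[simp] theorem rt_zero : rt 0 = 0 := by simp [rt]

theorem measurable_rt : Measurable rt := by unfold rt; fun_prop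

theorem lintegral_mul_le_rt {α : Type*} [MeasurableSpace α] {μ : Measure α} {f g : α → ℝ≥0∞}
    (hf : AEMeasurable f μ) (hg : AEMeasurable g μ) :
    ∫⁻ a, f a * g a ∂μ ≤ rt (∫⁻ a, f a ^ 2 ∂μ) * rt (∫⁻ a, g a ^ 2 ∂μ) := by
  have := ENNReal.lintegral_mul_le_Lp_mul_Lq μ Real.HolderConjugate.two_two hf hg
  simpa [rt] using this

/-- Minkowski's inequality in L² for countable sums: the square is expanded into a double series,
integrated term by term, and each product is bounded by Cauchy-Schwarz. In [0,∞] no finiteness has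
to be assumed. -/
theorem lintegral_tsum_sq_le {α ι : Type*} [MeasurableSpace α] [Countable ι] {μ : Measure α}
    {f : ι → α → ℝ≥0∞} (hf : ∀ i, AEMeasurable (f i) μ) :
    ∫⁻ a, (∑' i, f i a) ^ 2 ∂μ ≤ (∑' i, rt (∫⁻ a, f i a ^ 2 ∂μ)) ^ 2 := by
  have h1 : ∀ a, (∑' i, f i a) ^ 2 = ∑' i, ∑' j, f i a * f j a := by
    intro a
    rw [sq, ← ENNReal.tsum_mul_right]
    exact tsum_congr fun i => by rw [ENNReal.tsum_mul_left]
  simp_rw [h1]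
  rw [lintegral_tsum (f := fun i a => ∑' j, f i a * f j a)
    fun i => AEMeasurable.tsum fun j => (hf i).mul (hf j)]
  rw [sq, ← ENNReal.tsum_mul_right]
  refine ENNReal.tsum_le_tsum fun i => ?_
  rw [lintegral_tsum (f := fun j a => f i a * f j a) fun j => (hf i).mul (hf j), ← ENNReal.tsum_mul_left]
  exact ENNReal.tsum_le_tsum fun j => lintegral_mul_le_rt (hf i) (hf j)

theorem tsum_mul_le_rt {ι : Type*} (f g : ι → ℝ≥0∞) :
    ∑' i, f i * g i ≤ rt (∑' i, f i ^ 2) * rt (∑' i, g i ^ 2) := by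
  let _ : MeasurableSpace ι := ⊤
  have := lintegral_mul_le_rt (μ := Measure.count) (f := f) (g := g)
    (measurable_from_top.aemeasurable) (measurable_from_top.aemeasurable)
  simpa [lintegral_count] using this

theorem tsum_tsum_sq_le {α ι : Type*} [Countable ι] (f : ι → α → ℝ≥0∞) :
    ∑' a, (∑' i, f i a) ^ 2 ≤ (∑' i, rt (∑' a, f i a ^ 2)) ^ 2 := by
  let _ : MeasurableSpace α := ⊤
  have := lintegral_tsum_sq_le (μ := Measure.count) (f := f)
    fun i => measurable_from_top.aemeasurable
  simpa [lintegral_count] using this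

/-! ### Profiles -/

/-- The time interval has length one, so L^∞ in time dominates L² in time with constant one
(`mix2_le_mixTop`). -/
instance : IsProbabilityMeasure timeMeasure := ⟨by simp [timeMeasure]⟩

/-- The index set of the cubes of a fixed size. -/
abbrev Idx (d : ℕ) := Fin d → ℤ

/-- Profiles: nonnegative functions of time and of a unit cube. -/
abbrev Prof (d : ℕ) := ℝ → Idx d → ℝ≥0∞

variable {d : ℕ}

/-- The index of the cube of side `2^l` that contains the unit cube with index `n`. -/
def parent (l : ℕ) (n : Idx d) : Idx d := fun i => n i / 2 ^ l

theorem parent_parent (i j : ℕ) (n : Idx d) : parent j (parent i n) = parent (i + j) n := by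
  funext a
  simp only [parent]
  rw [Int.ediv_ediv_of_nonneg (by positivity), pow_add]

/-- A vertex of the unit cube as an element of `ℤ^d`. -/
def vertex (e : Fin d → Fin 2) : Idx d := fun i => ((e i : ℕ) : ℤ)

/-- The integer part of a sum exceeds the sum of the integer parts by 0 or 1 in each coordinate. So
a translate of a dyadic cube meets at most 2^d cubes of the same side, uniformly in the side and in
the translation. -/
theorem exists_parent_sub (l : ℕ) (n m : Idx d) :
    ∃ e, parent l (n - m) = parent l n + parent l (-m) + vertex e := by
  have h : ∀ i, n i / 2 ^ l + (-m i) / 2 ^ l ≤ (n i - m i) / 2 ^ l ∧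
      (n i - m i) / 2 ^ l ≤ n i / 2 ^ l + (-m i) / 2 ^ l + 1 := by
    intro i
    have hp : (0 : ℤ) < 2 ^ l := by positivity
    set p : ℤ := 2 ^ l
    have a1 := Int.mul_ediv_add_emod (n i) p
    have a2 := Int.emod_nonneg (n i) hp.ne'
    have a3 := Int.emod_lt_of_pos (n i) hp
    have b1 := Int.mul_ediv_add_emod (-m i) p
    have b2 := Int.emod_nonneg (-m i) hp.ne'
    have b3 := Int.emod_lt_of_pos (-m i) hp
    constructor
    · rw [Int.le_ediv_iff_mul_le hp]; nlinarith
    · rw [← Int.lt_add_one_iff, Int.ediv_lt_iff_lt_mul hp]; nlinarith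
  refine ⟨fun i => if (n i - m i) / 2 ^ l = n i / 2 ^ l + (-m i) / 2 ^ l then 0 else 1, ?_⟩
  funext i
  obtain ⟨h1, h2⟩ := h i
  simp only [parent, vertex, Pi.add_apply, Pi.sub_apply, Pi.neg_apply]
  split_ifs with h3
  · simp [h3]
  · simp; omega

/-- The equivalence that splits an index into the index of its parent and a remainder. -/
def splitIdx (r : ℕ) : Idx d ≃ Idx d × (Fin d → Fin (2 ^ r)) where
  toFun n := (parent r n, fun i => ⟨(n i % 2 ^ r).toNat, by
    have h1 := Int.emod_nonneg (n i) (b := 2 ^ r) (by positivity)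
    have h2 := Int.emod_lt_of_pos (n i) (b := 2 ^ r) (by positivity)
    zify; rw [Int.toNat_of_nonneg h1]; exact h2⟩)
  invFun q := fun i => 2 ^ r * q.1 i + (q.2 i : ℕ)
  left_inv n := by
    funext i
    have h1 := Int.emod_nonneg (n i) (b := 2 ^ r) (by positivity)
    simp [parent, Int.toNat_of_nonneg h1, Int.mul_ediv_add_emod]
  right_inv q := by
    have hp : (0 : ℤ) < 2 ^ r := by positivity
    have key : ∀ i, (0 : ℤ) ≤ (q.2 i : ℕ) ∧ ((q.2 i : ℕ) : ℤ) < 2 ^ r := fun i =>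
      ⟨by positivity, by exact_mod_cast (q.2 i).2⟩
    ext i
    · simp only [parent]
      rw [Int.mul_add_ediv_left _ _ hp.ne', Int.ediv_eq_zero_of_lt (key i).1 (key i).2, add_zero]
    · simp [Int.emod_eq_of_lt (key i).1 (key i).2]

theorem tsum_parent (r : ℕ) (f : Idx d → ℝ≥0∞) :
    ∑' n, f (parent r n) = 2 ^ (r * d) * ∑' n, f n := by
  rw [← (splitIdx r).symm.tsum_eq, ENNReal.tsum_prod', ← ENNReal.tsum_mul_left]
  refine tsum_congr fun q => ?_
  have : ∀ e : Fin d → Fin (2 ^ r), parent r ((splitIdx r).symm (q, e)) = q := fun e =>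
    congrArg Prod.fst ((splitIdx r).apply_symm_apply (q, e))
  simp only [this]
  rw [ENNReal.tsum_const]
  simp [← pow_mul]

/-- The restriction of a profile to the cube of side `2^l` with index `m`. -/
def res (l : ℕ) (m : Idx d) (F : Prof d) : Prof d :=
  fun t n => if parent l n = m then F t n else 0

/-- All the components of a profile are measurable in time. -/
def MeasP (F : Prof d) : Prop := ∀ n, AEMeasurable (fun t => F t n) timeMeasure

theorem MeasP.res {F : Prof d} (h : MeasP F) (l : ℕ) (m : Idx d) : MeasP (res l m F) := by
  intro n
  unfold LocalEnergy.res
  by_cases hn : parent l n = m <;> simp [hn, h n]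

theorem MeasP.shift {F : Prof d} (h : MeasP F) (m : Idx d) : MeasP fun t n => F t (n - m) :=
  fun n => h (n - m)

theorem MeasP.smul {F : Prof d} (h : MeasP F) (a : ℝ≥0∞) : MeasP fun t n => a * F t n :=
  fun n => (h n).const_mul a

theorem MeasP.mul {F G : Prof d} (hF : MeasP F) (hG : MeasP G) : MeasP fun t n => F t n * G t n :=
  fun n => (hF n).mul (hG n)

theorem MeasP.tsum {ι : Type} [Countable ι] {F : ι → Prof d} (h : ∀ i, MeasP (F i)) :
    MeasP fun t n => ∑' i, F i t n :=
  fun n => AEMeasurable.tsum fun i => h i n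

/-! ### Monotone translation invariant norms of profiles -/

/-- A monotone, countably subadditive norm of profiles which is invariant under translations up to
the constant `c`. -/
structure LNorm (d : ℕ) where
  /-- The norm of a profile. -/
  toFun : Prof d → ℝ≥0∞
  /-- The constant in the bound for translates. -/
  c : ℝ≥0
  mono : ∀ {F G : Prof d}, (∀ᵐ t ∂timeMeasure, ∀ n, F t n ≤ G t n) → toFun F ≤ toFun G
  tsum_le : ∀ {ι : Type} [Countable ι] {F : ι → Prof d}, (∀ i, MeasP (F i)) →
    toFun (fun t n => ∑' i, F i t n) ≤ ∑' i, toFun (F i)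
  smul_le : ∀ (a : ℝ≥0∞) {F : Prof d}, MeasP F → toFun (fun t n => a * F t n) ≤ a * toFun F
  shift_le : ∀ {F : Prof d} (m : Idx d), MeasP F → toFun (fun t n => F t (n - m)) ≤ c * toFun F

instance : CoeFun (LNorm d) fun _ => Prof d → ℝ≥0∞ := ⟨LNorm.toFun⟩

namespace LNorm

theorem zero (N : LNorm d) : N (fun _ _ => 0) = 0 := by
  have := N.smul_le 0 (F := fun _ _ => 0) fun n => aemeasurable_const
  simpa using this

theorem mul_le (N : LNorm d) {F G : Prof d} {a : ℝ≥0∞} (hF : MeasP F)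
    (h : ∀ᵐ t ∂timeMeasure, ∀ n, G t n ≤ a) : N (fun t n => G t n * F t n) ≤ a * N F :=
  (N.mono (h.mono fun _ ht n => mul_le_mul_left (ht n) _)).trans (N.smul_le a hF)

theorem le_tsum (N : LNorm d) {ι : Type} [Countable ι] {F : Prof d} {G : ι → Prof d}
    (hG : ∀ i, MeasP (G i)) (h : ∀ᵐ t ∂timeMeasure, ∀ n, F t n ≤ ∑' i, G i t n) :
    N F ≤ ∑' i, N (G i) :=
  (N.mono h).trans (N.tsum_le hG)

/-- Discrete convolution with a weight. -/
def smear (w : Idx d → ℝ≥0∞) (F : Prof d) : Prof d := fun t n => ∑' m, w m * F t (n - m)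

theorem _root_.LocalEnergy.MeasP.smear {F : Prof d} (h : MeasP F) (w : Idx d → ℝ≥0∞) :
    MeasP (smear w F) :=
  MeasP.tsum fun m => (h.shift m).smul (w m)

theorem smear_le (N : LNorm d) {F : Prof d} (hF : MeasP F) (w : Idx d → ℝ≥0∞) :
    N (smear w F) ≤ N.c * (∑' m, w m) * N F := by
  refine (N.tsum_le fun m => (hF.shift m).smul (w m)).trans ?_
  rw [mul_comm (N.c : ℝ≥0∞), mul_assoc, ← ENNReal.tsum_mul_right]
  refine ENNReal.tsum_le_tsum fun m => (N.smul_le _ (hF.shift m)).trans ?_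
  gcongr
  exact N.shift_le m hF

theorem res_mono (N : LNorm d) (l : ℕ) (m : Idx d) {F G : Prof d}
    (h : ∀ᵐ t ∂timeMeasure, ∀ n, F t n ≤ G t n) : N (res l m F) ≤ N (res l m G) := by
  refine N.mono (h.mono fun t ht n => ?_)
  unfold res; split_ifs
  · exact ht n
  · rfl

/-- Restricting a translate to a cube is translating a restriction to at most 2^d cubes of the same
side, by `exists_parent_sub`. This makes ℓ¹ sums over cubes, and the supremum in X, translation
invariant up to 2^d. -/
theorem res_shift_le (N : LNorm d) (l : ℕ) (q m : Idx d) {F : Prof d} (hF : MeasP F) :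
    N (res l q fun t n => F t (n - m)) ≤
      ∑ e : Fin d → Fin 2, N.c * N (res l (q + parent l (-m) + vertex e) F) := by
  rw [← tsum_fintype (L := .unconditional _)]
  refine (N.le_tsum (G := fun e t n => res l (q + parent l (-m) + vertex e) F t (n - m))
    (fun e => (hF.res _ _).shift m) ?_).trans
    (ENNReal.tsum_le_tsum fun e => N.shift_le m (hF.res _ _))
  refine .of_forall fun t n => ?_
  by_cases hn : parent l n = q
  · obtain ⟨e, he⟩ := exists_parent_sub l n m
    refine le_trans ?_ (ENNReal.le_tsum e)
    simp [res, hn, he]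
  · simp [res, hn]

/-- The norm `∑_Q N(1_Q F)`, where `Q` runs through the cubes of side `2^j`. -/
def lsum (j : ℕ) (N : LNorm d) : LNorm d where
  toFun F := ∑' m, N (res j m F)
  c := 2 ^ d * N.c
  mono h := ENNReal.tsum_le_tsum fun m => N.res_mono j m h
  tsum_le {ι _ F} hF := by
    rw [ENNReal.tsum_comm]
    refine ENNReal.tsum_le_tsum fun m => N.le_tsum (fun i => (hF i).res j m) (.of_forall fun t n => ?_)
    unfold res; split_ifs <;> simp
  smul_le a F hF := by
    rw [← ENNReal.tsum_mul_left]
    refine ENNReal.tsum_le_tsum fun m => le_trans (N.mono (.of_forall fun t n => ?_)) (N.smul_le a (hF.res j m))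
    unfold res; split_ifs <;> simp
  shift_le {F} m hF := by
    refine (ENNReal.tsum_le_tsum fun q => N.res_shift_le j q m hF).trans ?_
    rw [Summable.tsum_finsetSum fun _ _ => ENNReal.summable]
    have : ∀ e : Fin d → Fin 2, ∑' q, (N.c : ℝ≥0∞) * N (res j (q + parent j (-m) + vertex e) F) =
        N.c * ∑' q, N (res j q F) := by
      intro e
      rw [ENNReal.tsum_mul_left]
      congr 1
      rw [← (Equiv.addRight (parent j (-m) + vertex e)).tsum_eq (fun q => N (res j q F))]
      simp [add_assoc]
    simp only [this]
    simp [mul_assoc]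

theorem lsum_apply (j : ℕ) (N : LNorm d) (F : Prof d) : lsum j N F = ∑' m, N (res j m F) := rfl

theorem le_lsum (j : ℕ) (N : LNorm d) {F : Prof d} (hF : MeasP F) : N F ≤ lsum j N F := by
  refine N.le_tsum (fun m => hF.res j m) (.of_forall fun t n => ?_)
  refine le_trans ?_ (ENNReal.le_tsum (parent j n))
  simp [res]

/-- Passing to coarser cubes. -/
theorem lsum_coarse {i j : ℕ} (hij : i ≤ j) (N : LNorm d) {F : Prof d} (hF : MeasP F) :
    lsum j N F ≤ lsum i N F := by
  obtain ⟨r, rfl⟩ := Nat.exists_eq_add_of_le hij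
  have h : ∀ m, N (res (i + r) m F) ≤ ∑' q, if parent r q = m then N (res i q F) else 0 := by
    intro m
    have h2 : ∀ q, N (if parent r q = m then res i q F else fun _ _ => 0) ≤
        if parent r q = m then N (res i q F) else 0 := by
      intro q; split_ifs
      · rfl
      · rw [N.zero]
    refine (N.le_tsum (G := fun q => if parent r q = m then res i q F else fun _ _ => 0) ?_
      (.of_forall fun t n => ?_)).trans (ENNReal.tsum_le_tsum h2)
    · intro q
      split_ifs
      · exact hF.res i q
      · exact fun n => aemeasurable_const
    · by_cases hn : parent (i + r) n = m
      · refine le_trans ?_ (ENNReal.le_tsum (parent i n))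
        simp [res, parent_parent, hn]
      · simp [res, hn]
  refine (ENNReal.tsum_le_tsum h).trans ?_
  rw [ENNReal.tsum_comm]
  exact ENNReal.tsum_le_tsum fun q => by simp

/-- Passing to finer cubes. -/
theorem lsum_fine (i r : ℕ) (N : LNorm d) (F : Prof d) :
    lsum i N F ≤ 2 ^ (r * d) * lsum (i + r) N F := by
  rw [lsum_apply (i + r), ← tsum_parent]
  refine ENNReal.tsum_le_tsum fun m => N.mono (.of_forall fun t n => ?_)
  by_cases hn : parent i n = m
  · simp [res, ← hn, parent_parent]
  · simp [res, hn]

/-- The sum of two norms. -/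
def add (N N' : LNorm d) : LNorm d where
  toFun F := N F + N' F
  c := max N.c N'.c
  mono h := add_le_add (N.mono h) (N'.mono h)
  tsum_le hF := by
    rw [ENNReal.tsum_add]; exact add_le_add (N.tsum_le hF) (N'.tsum_le hF)
  smul_le a F hF := by rw [mul_add]; exact add_le_add (N.smul_le a hF) (N'.smul_le a hF)
  shift_le {F} m hF := by
    rw [mul_add]
    refine add_le_add ((N.shift_le m hF).trans ?_) ((N'.shift_le m hF).trans ?_) <;>
    · gcongr; simp

/-- A multiple of a norm. -/
def scale (b : ℝ≥0∞) (N : LNorm d) : LNorm d where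
  toFun F := b * N F
  c := N.c
  mono h := mul_le_mul_right (N.mono h) b
  tsum_le hF := by rw [ENNReal.tsum_mul_left]; exact mul_le_mul_right (N.tsum_le hF) b
  smul_le a F hF := by
    rw [mul_left_comm]; exact mul_le_mul_right (N.smul_le a hF) b
  shift_le m hF := by rw [mul_left_comm]; exact mul_le_mul_right (N.shift_le m hF) b

/-! ### The norms L²L², L^∞L² and X of profiles -/

/-- The norm of `L²_t ℓ²`. -/
def mix2 : LNorm d where
  toFun F := rt (∫⁻ t, ∑' n, F t n ^ 2 ∂timeMeasure)
  c := 1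
  mono h := rt_mono (lintegral_mono_ae (h.mono fun t ht =>
    ENNReal.tsum_le_tsum fun n => pow_le_pow_left' (ht n) 2))
  tsum_le {ι _ F} hF := by
    rw [rt_le_iff]
    refine (lintegral_mono fun t => tsum_tsum_sq_le fun i n => F i t n).trans ?_
    refine (lintegral_tsum_sq_le fun i => ?_).trans (le_of_eq ?_)
    · exact measurable_rt.comp_aemeasurable
        (AEMeasurable.tsum fun n => (hF i n).pow_const 2)
    · simp_rw [rt_sq]
  smul_le a F hF := by
    rw [rt_le_iff, mul_pow, rt_sq]
    simp_rw [mul_pow, ENNReal.tsum_mul_left]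
    rw [lintegral_const_mul'' _ (AEMeasurable.tsum fun n => (hF n).pow_const 2)]
  shift_le m hF := by
    simp only [ENNReal.coe_one, one_mul]
    refine rt_mono (lintegral_mono fun t => le_of_eq ?_)
    exact (Equiv.subRight m).tsum_eq fun n => _ ^ 2

/-- The norm of `L^∞_t ℓ²`. -/
def mixTop : LNorm d where
  toFun F := essSup (fun t => rt (∑' n, F t n ^ 2)) timeMeasure
  c := 1
  mono h := essSup_mono_ae (h.mono fun t ht =>
    rt_mono (ENNReal.tsum_le_tsum fun n => pow_le_pow_left' (ht n) 2))
  tsum_le {ι _ F} hF := by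
    refine essSup_le_of_ae_le _ ?_
    have h : ∀ᵐ t ∂timeMeasure, ∀ i, rt (∑' n, F i t n ^ 2) ≤
        essSup (fun t => rt (∑' n, F i t n ^ 2)) timeMeasure :=
      ae_all_iff.2 fun i => ENNReal.ae_le_essSup _
    filter_upwards [h] with t ht
    rw [rt_le_iff]
    exact (tsum_tsum_sq_le fun i n => F i t n).trans
      (pow_le_pow_left' (ENNReal.tsum_le_tsum ht) 2)
  smul_le a F hF := by
    rw [← ENNReal.essSup_const_mul]
    refine essSup_mono_ae (.of_forall fun t => ?_)
    simp_rw [mul_pow, ENNReal.tsum_mul_left, rt_mul, rt_of_sq]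
    rfl
  shift_le {F} m hF := by
    simp only [ENNReal.coe_one, one_mul]
    refine essSup_mono_ae (.of_forall fun t => rt_mono (le_of_eq ?_))
    exact (Equiv.subRight m).tsum_eq fun n => F t n ^ 2

theorem mix2_apply (F : Prof d) : mix2 F = rt (∫⁻ t, ∑' n, F t n ^ 2 ∂timeMeasure) := rfl

theorem mixTop_apply (F : Prof d) :
    mixTop F = essSup (fun t => rt (∑' n, F t n ^ 2)) timeMeasure := rfl

theorem ae_le_mixTop (F : Prof d) : ∀ᵐ t ∂timeMeasure, ∀ n, F t n ≤ mixTop F := by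
  filter_upwards [ENNReal.ae_le_essSup (μ := timeMeasure) fun t => rt (∑' n, F t n ^ 2)] with t ht n
  refine le_trans ?_ ht
  rw [← rt_of_sq (F t n)]
  exact rt_mono (ENNReal.le_tsum n)

theorem mix2_le_mixTop (F : Prof d) : mix2 F ≤ mixTop F := by
  rw [mix2_apply, rt_le_iff]
  have h : ∀ᵐ t ∂timeMeasure, ∑' n, F t n ^ 2 ≤ mixTop F ^ 2 := by
    filter_upwards [ENNReal.ae_le_essSup (μ := timeMeasure) fun t => rt (∑' n, F t n ^ 2)] with t ht
    exact rt_le_iff.1 ht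
  refine (lintegral_mono_ae h).trans ?_
  simp

/-- The norm `X`. -/
def xN : LNorm d where
  toFun F := ⨆ (l : ℕ) (m : Idx d), (2 : ℝ≥0∞) ^ (-(l : ℝ) / 2) * mix2 (res l m F)
  c := 2 ^ d
  mono h := iSup₂_mono fun l m => mul_le_mul_right (mix2.res_mono l m h) _
  tsum_le {ι _ F} hF := by
    refine iSup₂_le fun l m => ?_
    refine (mul_le_mul_right (mix2.le_tsum (G := fun i => res l m (F i))
      (fun i => (hF i).res l m) (.of_forall fun t n => ?_)) _).trans ?_
    · unfold res; split_ifs <;> simp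
    · rw [← ENNReal.tsum_mul_left]
      exact ENNReal.tsum_le_tsum fun i => le_iSup₂ (f := fun (l : ℕ) (m : Idx d) =>
        (2 : ℝ≥0∞) ^ (-(l : ℝ) / 2) * mix2 (res l m (F i))) l m
  smul_le a F hF := by
    refine iSup₂_le fun l m => ?_
    have h : mix2 (res l m fun t n => a * F t n) ≤ a * mix2 (res l m F) := by
      refine le_trans (mix2.mono (.of_forall fun t n => ?_)) (mix2.smul_le a (hF.res l m))
      unfold res; split_ifs <;> simp
    refine (mul_le_mul_right h _).trans ?_
    rw [mul_left_comm]
    exact mul_le_mul_right (le_iSup₂ (f := fun (l : ℕ) (m : Idx d) =>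
        (2 : ℝ≥0∞) ^ (-(l : ℝ) / 2) * mix2 (res l m F)) l m) _
  shift_le {F} m hF := by
    refine iSup₂_le fun l q => ?_
    refine (mul_le_mul_right (mix2.res_shift_le l q m hF) _).trans ?_
    rw [Finset.mul_sum]
    have h : ∀ e : Fin d → Fin 2, (2 : ℝ≥0∞) ^ (-(l : ℝ) / 2) *
        ((mix2 (d := d)).c * mix2 (res l (q + parent l (-m) + vertex e) F)) ≤
        ⨆ (l : ℕ) (m : Idx d), (2 : ℝ≥0∞) ^ (-(l : ℝ) / 2) * mix2 (res l m F) := by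
      intro e
      have : ((mix2 (d := d)).c : ℝ≥0∞) = 1 := rfl
      rw [this, one_mul]
      exact le_iSup₂ (f := fun (l : ℕ) (m : Idx d) =>
        (2 : ℝ≥0∞) ^ (-(l : ℝ) / 2) * mix2 (res l m F)) l _
    refine (Finset.sum_le_sum fun e _ => h e).trans ?_
    simp

theorem xN_apply (F : Prof d) :
    xN F = ⨆ (l : ℕ) (m : Idx d), (2 : ℝ≥0∞) ^ (-(l : ℝ) / 2) * mix2 (res l m F) := rfl

theorem mix2_res_le_xN (l : ℕ) (m : Idx d) (F : Prof d) :
    mix2 (res l m F) ≤ (2 : ℝ≥0∞) ^ ((l : ℝ) / 2) * xN F := by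
  have h : (2 : ℝ≥0∞) ^ (-(l : ℝ) / 2) * mix2 (res l m F) ≤ xN F :=
    le_iSup₂ (f := fun (l : ℕ) (m : Idx d) =>
        (2 : ℝ≥0∞) ^ (-(l : ℝ) / 2) * mix2 (res l m F)) l m
  calc mix2 (res l m F) = (2 : ℝ≥0∞) ^ ((l : ℝ) / 2) * ((2 : ℝ≥0∞) ^ (-(l : ℝ) / 2) *
        mix2 (res l m F)) := by
        rw [← mul_assoc, ← ENNReal.rpow_add _ _ (by simp) (by simp)]
        ring_nf; simp
    _ ≤ _ := by gcongr

/-! ### The norms X_j, their ℓ¹ sums over cubes, and changes of the side -/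

/-- The norm `X_j`. -/
def xjN (j : ℕ) : LNorm d := (scale ((2 : ℝ≥0∞) ^ ((j : ℝ) / 2)) xN).add mixTop

theorem xjN_apply (j : ℕ) (F : Prof d) :
    xjN j F = (2 : ℝ≥0∞) ^ ((j : ℝ) / 2) * xN F + mixTop F := rfl

theorem xjN_c (j : ℕ) : (xjN (d := d) j).c = 2 ^ d := by
  change max (2 ^ d : ℝ≥0) 1 = 2 ^ d
  exact max_eq_left (one_le_pow₀ (by norm_num))

/-- The sharp version of the norm `ℓ¹_j X_j`. -/
def nX (j : ℕ) : LNorm d := lsum j (xjN j)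

theorem nX_c (j : ℕ) : (nX (d := d) j).c = 2 ^ d * 2 ^ d := by
  rw [← xjN_c j]; rw [xjN_c]; change 2 ^ d * (xjN (d := d) j).c = _; rw [xjN_c]

theorem mixTop_le_nX (j : ℕ) {F : Prof d} (hF : MeasP F) : mixTop F ≤ nX j F :=
  le_trans (by rw [xjN_apply]; exact le_add_self) (le_lsum j (xjN j) hF)

theorem lsum_mixTop_le_nX (j : ℕ) (F : Prof d) : lsum j mixTop F ≤ nX j F :=
  ENNReal.tsum_le_tsum fun m => by rw [xjN_apply]; exact le_add_self

/-- The local smoothing gain of half a derivative: X_j carries the weight 2^{j/2} on X. It is used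
for the high frequency factor of a product. -/
theorem xN_le_nX (j : ℕ) {F : Prof d} (hF : MeasP F) :
    xN F ≤ (2 : ℝ≥0∞) ^ (-(j : ℝ) / 2) * nX j F := by
  have h : (2 : ℝ≥0∞) ^ ((j : ℝ) / 2) * xN F ≤ nX j F :=
    le_trans (by rw [xjN_apply]; exact le_self_add) (le_lsum j (xjN j) hF)
  calc xN F = (2 : ℝ≥0∞) ^ (-(j : ℝ) / 2) * ((2 : ℝ≥0∞) ^ ((j : ℝ) / 2) * xN F) := by
        rw [← mul_assoc, ← ENNReal.rpow_add _ _ (by simp) (by simp)]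
        ring_nf; simp
    _ ≤ _ := by gcongr

/-- Passing to coarser cubes costs half a derivative in `ℓ¹_j X_j`. -/
theorem nX_coarse (i r : ℕ) {F : Prof d} (hF : MeasP F) :
    nX (i + r) F ≤ (2 : ℝ≥0∞) ^ ((r : ℝ) / 2) * nX i F := by
  have h : ∀ G : Prof d, xjN (i + r) G ≤ (2 : ℝ≥0∞) ^ ((r : ℝ) / 2) * xjN i G := by
    intro G
    rw [xjN_apply, xjN_apply, mul_add]
    refine add_le_add (le_of_eq ?_) ?_
    · rw [← mul_assoc, ← ENNReal.rpow_add _ _ (by simp) (by simp)]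
      push_cast; ring_nf
    · nth_rewrite 1 [← one_mul (mixTop G)]
      gcongr
      rw [← ENNReal.rpow_zero (x := 2)]
      exact ENNReal.rpow_le_rpow_of_exponent_le (by norm_num) (by positivity)
  calc nX (i + r) F ≤ ∑' m, (2 : ℝ≥0∞) ^ ((r : ℝ) / 2) * xjN i (res (i + r) m F) :=
        ENNReal.tsum_le_tsum fun m => h _
    _ = (2 : ℝ≥0∞) ^ ((r : ℝ) / 2) * lsum (i + r) (xjN i) F := by
        rw [ENNReal.tsum_mul_left, lsum_apply]
    _ ≤ _ := by gcongr; exact lsum_coarse (by omega) _ hF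

/-- Passing to finer cubes in `ℓ¹_j X_j`. -/
theorem nX_fine (i r : ℕ) (F : Prof d) : nX i F ≤ 2 ^ (r * d) * nX (i + r) F := by
  refine le_trans (ENNReal.tsum_le_tsum fun m => ?_) (lsum_fine i r (xjN (i + r)) F)
  rw [xjN_apply, xjN_apply]
  gcongr
  · norm_num
  · omega

theorem lsum_mix2_le (j : ℕ) (F : Prof d) : lsum j mix2 F ≤ lsum j mixTop F :=
  ENNReal.tsum_le_tsum fun _ => mix2_le_mixTop _

/-- The localized product estimate `ℓ¹L^∞ · X ⊂ ℓ¹L²`. -/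
theorem lsum_mix2_mul_le (j : ℕ) {F : Prof d} (G : Prof d) (hF : MeasP F) :
    lsum j mix2 (fun t n => G t n * F t n) ≤
      (2 : ℝ≥0∞) ^ ((j : ℝ) / 2) * lsum j mixTop G * xN F := by
  rw [mul_comm ((2 : ℝ≥0∞) ^ ((j : ℝ) / 2)), mul_assoc, lsum_apply, lsum_apply,
    ← ENNReal.tsum_mul_right]
  refine ENNReal.tsum_le_tsum fun m => ?_
  -- On one cube of side 2^j, `G` is bounded pointwise by its L^∞ℓ² norm there, and `F` has L² norm
  -- at most 2^{j/2} times its X norm. Only `G` is summed over the cubes.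
  refine le_trans ?_ (mul_le_mul_right (mix2_res_le_xN j m F) _)
  refine le_trans (mix2.mono (.of_forall fun t n => ?_))
    (mix2.mul_le (hF.res j m) (ae_le_mixTop (res j m G)))
  unfold res; split_ifs <;> simp

/-- Passing to finer cubes in `ℓ¹L²`. -/
theorem lsum_mix2_fine (i r : ℕ) {F : Prof d} (hF : MeasP F) :
    lsum i mix2 F ≤ (2 : ℝ≥0∞) ^ ((r * d : ℝ) / 2) * lsum (i + r) mix2 F := by
  have h2 : ∀ q, ∑' e : Fin d → Fin (2 ^ r),
      mix2 (res i ((splitIdx r).symm (q, e)) F) ^ 2 ≤ mix2 (res (i + r) q F) ^ 2 := by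
    intro q
    simp_rw [mix2_apply, rt_sq]
    rw [← lintegral_tsum fun e => AEMeasurable.tsum fun n => ((hF.res i _) n).pow_const 2]
    refine lintegral_mono fun t => ?_
    dsimp only
    rw [ENNReal.tsum_comm]
    refine ENNReal.tsum_le_tsum fun n => ?_
    by_cases hn : parent (i + r) n = q
    · have hs : (splitIdx r (parent i n)).1 = q := by
        change parent r (parent i n) = q; rw [parent_parent, hn]
      rw [tsum_eq_single (splitIdx r (parent i n)).2]
      · exact pow_le_pow_left' (by simp [res, hn]; split_ifs <;> simp) 2
      · intro e he
        have : parent i n ≠ (splitIdx r).symm (q, e) := by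
          intro hh
          apply he
          rw [hh]; simp
        simp [res, this]
    · have : ∀ e, parent i n ≠ (splitIdx r).symm (q, e) := by
        intro e hh
        apply hn
        have h3 : (splitIdx r (parent i n)).1 = q := by rw [hh]; simp
        rw [← h3]; change _ = parent r (parent i n); rw [parent_parent]
      simp [res, this]
  rw [lsum_apply, lsum_apply, ← (splitIdx r).symm.tsum_eq, ENNReal.tsum_prod',
    ← ENNReal.tsum_mul_left]
  refine ENNReal.tsum_le_tsum fun q => ?_
  -- Cauchy-Schwarz over the 2^{rd} subcubes of a cube, on which the squares of the L² norms add up.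
  -- The cost is 2^{rd/2}, the square root of the cost in `lsum_fine`.
  have h1 := tsum_mul_le_rt (fun _ : Fin d → Fin (2 ^ r) => (1 : ℝ≥0∞))
    fun e => mix2 (res i ((splitIdx r).symm (q, e)) F)
  simp only [one_mul] at h1
  refine h1.trans (mul_le_mul' (le_of_eq ?_) (rt_le_iff.2 (h2 q)))
  rw [rt, show ∑' _ : Fin d → Fin (2 ^ r), (1 : ℝ≥0∞) ^ 2 = (2 : ℝ≥0∞) ^ ((r * d : ℕ) : ℝ) by
    rw [ENNReal.rpow_natCast]; simp [← pow_mul], ← ENNReal.rpow_mul]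
  push_cast; ring_nf

end LNorm

end LocalEnergy

end

noncomputable section

namespace LocalEnergy

variable {d : ℕ}

/-! ### Unit cubes -/

/-- The index of the unit cube that contains `x`. -/
def idx (x : E d) : Idx d := fun i => ⌊x i⌋

theorem mem_cube_iff (l : ℕ) (m : Idx d) (x : E d) : x ∈ cube l m ↔ parent l (idx x) = m := by
  have h : ∀ i, ((2 : ℝ) ^ l * m i ≤ x i ∧ x i < (2 : ℝ) ^ l * (m i + 1)) ↔
      ⌊x i⌋ / 2 ^ l = m i := by
    intro i
    have hp : (0 : ℤ) < 2 ^ l := by positivity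
    have h1 : (2 : ℝ) ^ l * m i ≤ x i ↔ m i ≤ ⌊x i⌋ / 2 ^ l := by
      rw [Int.le_ediv_iff_mul_le hp, Int.le_floor]; push_cast; rw [mul_comm]
    have h2 : x i < (2 : ℝ) ^ l * (m i + 1) ↔ ⌊x i⌋ / 2 ^ l < m i + 1 := by
      rw [Int.ediv_lt_iff_lt_mul hp, Int.floor_lt]; push_cast; rw [mul_comm]
    rw [h1, h2]; omega
  simp only [cube, Set.mem_ofPred_eq, h, parent, idx, funext_iff]

theorem mem_cube_zero_iff (n : Idx d) (x : E d) : x ∈ cube 0 n ↔ idx x = n := by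
  rw [mem_cube_iff]
  have : parent 0 (idx x) = idx x := by funext i; simp [parent]
  rw [this]

theorem measurable_idx : Measurable (idx : E d → Idx d) := by
  unfold idx
  refine measurable_pi_lambda _ fun i => Int.measurable_floor.comp ?_
  fun_prop

theorem measurableSet_cube (l : ℕ) (m : Idx d) : MeasurableSet (cube l m : Set (E d)) := by
  have : (cube l m : Set (E d)) = idx ⁻¹' {n | parent l n = m} := by
    ext x; simp [mem_cube_iff]
  rw [this]
  exact measurable_idx (Set.to_countable _).measurableSet

theorem lintegral_cube (l : ℕ) (m : Idx d) (f : E d → ℝ≥0∞) :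
    ∫⁻ x in cube l m, f x = ∑' n, if parent l n = m then ∫⁻ x in cube 0 n, f x else 0 := by
  have h : (cube l m : Set (E d)) = ⋃ n : {n : Idx d // parent l n = m}, cube 0 n.1 := by
    ext x; simp [mem_cube_iff l, mem_cube_zero_iff]
  rw [h, lintegral_iUnion (fun n => measurableSet_cube 0 _)]
  · exact (tsum_subtype {n : Idx d | parent l n = m} fun n => ∫⁻ x in cube 0 n, f x).trans
      (tsum_congr fun n => by simp [Set.indicator_apply])
  · intro a b hab
    refine Set.disjoint_left.2 fun x hx hx' => hab (Subtype.ext ?_)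
    rw [mem_cube_zero_iff] at hx hx'
    rw [← hx, ← hx']

theorem lintegral_eq_tsum (f : E d → ℝ≥0∞) : ∫⁻ x, f x = ∑' n, ∫⁻ x in cube 0 n, f x := by
  have h : (Set.univ : Set (E d)) = ⋃ n : Idx d, cube 0 n := by
    ext x; simp [mem_cube_zero_iff]
  rw [← setLIntegral_univ, h, lintegral_iUnion (fun n => measurableSet_cube 0 _)]
  intro a b hab
  refine Set.disjoint_left.2 fun x hx hx' => hab ?_
  rw [mem_cube_zero_iff] at hx hx'
  rw [← hx, ← hx']

theorem volume_cube_zero (n : Idx d) : volume (cube 0 n : Set (E d)) = 1 := by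
  have h : (cube 0 n : Set (E d)) = (WithLp.ofLp : E d → Fin d → ℝ) ⁻¹'
      (Set.univ.pi fun i => Set.Ico (n i : ℝ) (n i + 1)) := by
    ext x; simp [cube]
  rw [h, (PiLp.volume_preserving_ofLp (Fin d)).measure_preimage
    (MeasurableSet.univ_pi fun i => measurableSet_Ico).nullMeasurableSet, Real.volume_pi_Ico]
  simp

/-- The `L²` norms of a function on the unit cubes. -/
def pr2 (f : E d → ℝ≥0∞) (n : Idx d) : ℝ≥0∞ := rt (∫⁻ x in cube 0 n, f x ^ 2)

/-- The `L¹` norms of a function on the unit cubes. -/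
def pr1 (f : E d → ℝ≥0∞) (n : Idx d) : ℝ≥0∞ := ∫⁻ x in cube 0 n, f x

theorem pr2_mono {f g : E d → ℝ≥0∞} (h : ∀ᵐ x, f x ≤ g x) (n : Idx d) : pr2 f n ≤ pr2 g n :=
  rt_mono (lintegral_mono_ae (ae_restrict_of_ae (h.mono fun _ hx => pow_le_pow_left' hx 2)))

theorem pr2_const_mul (a : ℝ≥0∞) {f : E d → ℝ≥0∞} (hf : Measurable f) (n : Idx d) :
    pr2 (fun x => a * f x) n = a * pr2 f n := by
  simp_rw [pr2, mul_pow]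
  rw [lintegral_const_mul _ (by fun_prop), rt_mul, rt_of_sq]

theorem pr1_mul_le {f g : E d → ℝ≥0∞} (hf : Measurable f) (hg : Measurable g) (n : Idx d) :
    pr1 (fun x => f x * g x) n ≤ pr2 f n * pr2 g n :=
  lintegral_mul_le_rt hf.aemeasurable hg.aemeasurable

theorem pr2_mul_le {f g : E d → ℝ≥0∞} (hg : Measurable g) {n : Idx d} {a : ℝ≥0∞}
    (h : ∀ x ∈ cube 0 n, f x ≤ a) : pr2 (fun x => f x * g x) n ≤ a * pr2 g n := by
  rw [← pr2_const_mul a hg]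
  refine rt_mono (setLIntegral_mono' (measurableSet_cube 0 n) fun x hx => ?_)
  exact pow_le_pow_left' (mul_le_mul_left (h x hx) _) 2

theorem pr2_tsum_le {ι : Type*} [Countable ι] {f : ι → E d → ℝ≥0∞} (hf : ∀ i, Measurable (f i))
    (n : Idx d) : pr2 (fun x => ∑' i, f i x) n ≤ ∑' i, pr2 (f i) n :=
  rt_le_iff.2 (lintegral_tsum_sq_le fun i => (hf i).aemeasurable)

theorem pr2_add_le {f g : E d → ℝ≥0∞} (hf : Measurable f) (hg : Measurable g) (n : Idx d) :
    pr2 (fun x => f x + g x) n ≤ pr2 f n + pr2 g n := by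
  have := pr2_tsum_le (ι := Bool) (f := fun b => if b then f else g)
    (by intro b; cases b <;> simp [hf, hg]) n
  simpa [add_comm] using this

theorem tsum_pr2_sq (f : E d → ℝ≥0∞) : ∑' n, pr2 f n ^ 2 = ∫⁻ x, f x ^ 2 := by
  simp_rw [pr2, rt_sq]; rw [← lintegral_eq_tsum]

theorem tsum_pr2_sq_cube (l : ℕ) (m : Idx d) (f : E d → ℝ≥0∞) :
    ∑' n, (if parent l n = m then pr2 f n else 0) ^ 2 = ∫⁻ x in cube l m, f x ^ 2 := by
  rw [lintegral_cube]
  refine tsum_congr fun n => ?_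
  split_ifs
  · rw [pr2, rt_sq]
  · simp

/-! ### Convolution with a rapidly decreasing majorant -/

/-- The standard majorant of a kernel at scale `2^{-k}`. -/
def maj (k : ℕ) (y : E d) : ℝ := (2 ^ k) ^ d * ((1 + 2 ^ k * ‖y‖) ^ (2 * d + 2))⁻¹

/-- The part of the majorant that is used inside a pair of cubes. -/
def core (k : ℕ) (y : E d) : ℝ := (2 ^ k) ^ d * ((1 + 2 ^ k * ‖y‖) ^ (d + 1))⁻¹

theorem maj_nonneg (k : ℕ) (y : E d) : 0 ≤ maj k y := by unfold maj; positivity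

theorem core_nonneg (k : ℕ) (y : E d) : 0 ≤ core k y := by unfold core; positivity

theorem continuous_maj (k : ℕ) : Continuous (maj k : E d → ℝ) := by
  unfold maj
  refine continuous_const.mul (Continuous.inv₀ (by fun_prop) fun x => ?_)
  positivity

theorem continuous_core (k : ℕ) : Continuous (core k : E d → ℝ) := by
  unfold core
  refine continuous_const.mul (Continuous.inv₀ (by fun_prop) fun x => ?_)
  positivity

/-- The decay exponent 2d+2 is split into two halves. One is spent on summability over pairs of unit
cubes, uniformly in k because 2^k ≥ 1; the other stays in `core k`, whose integral does not depend
on k. -/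
theorem maj_le_core (k : ℕ) (y : E d) :
    maj k y ≤ ((1 + ‖y‖) ^ (d + 1))⁻¹ * core k y := by
  have h1 : (1 : ℝ) ≤ 2 ^ k := one_le_pow₀ (by norm_num)
  have h2 : 1 + ‖y‖ ≤ 1 + 2 ^ k * ‖y‖ := by nlinarith [norm_nonneg y]
  unfold maj core
  rw [show 2 * d + 2 = (d + 1) + (d + 1) by ring, pow_add, mul_inv, mul_left_comm]
  gcongr

/-- The integral of `core k`, which does not depend on `k`. -/
def coreMass (d : ℕ) : ℝ≥0∞ := ∫⁻ y : E d, ENNReal.ofReal (core 0 y)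

theorem coreMass_ne_top : coreMass d ≠ ⊤ := by
  have h := finite_integral_one_add_norm (E := E d) (μ := volume) (r := d + 1) (by simp)
  refine ne_of_lt (lt_of_le_of_lt (le_of_eq (lintegral_congr fun y => ?_)) h)
  congr 1
  rw [Real.rpow_neg (by positivity)]
  norm_cast
  simp [core]

theorem lintegral_core (k : ℕ) : ∫⁻ y : E d, ENNReal.ofReal (core k y) = coreMass d := by
  have h2 : (0 : ℝ) < 2 ^ k := by positivity
  have hm : Measurable fun y : E d => ENNReal.ofReal (core 0 y) :=
    (continuous_core 0).measurable.ennreal_ofReal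
  have h : ∀ y : E d, ENNReal.ofReal (core k y) =
      ENNReal.ofReal ((2 ^ k) ^ d) * ENNReal.ofReal (core 0 ((2 ^ k : ℝ) • y)) := by
    intro y
    rw [← ENNReal.ofReal_mul (by positivity)]
    congr 1
    simp [core, norm_smul]
  simp_rw [h]
  rw [lintegral_const_mul' _ _ ENNReal.ofReal_ne_top,
    ← lintegral_map (μ := volume) (g := fun y : E d => (2 ^ k : ℝ) • y) hm (by fun_prop),
    Measure.map_addHaar_smul volume h2.ne', lintegral_smul_measure, coreMass]
  rw [smul_eq_mul, ← mul_assoc, ← ENNReal.ofReal_mul (by positivity)]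
  have : ((2 ^ k) ^ d * |((2 ^ k : ℝ) ^ Module.finrank ℝ (E d))⁻¹|) = 1 := by
    rw [abs_of_pos (by positivity)]
    simp [finrank_euclideanSpace]
  rw [this]; simp

/-- Here `core k` is at most 2^{kd} and has integral `coreMass d`. This is the source of the factor
2^{kd/2} in both forms of Bernstein's inequality. -/
theorem lintegral_core_sq (k : ℕ) :
    ∫⁻ y : E d, ENNReal.ofReal (core k y) ^ 2 ≤ 2 ^ (k * d) * coreMass d := by
  rw [← lintegral_core k, ← lintegral_const_mul _ (continuous_core k).measurable.ennreal_ofReal]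
  refine lintegral_mono fun y => ?_
  rw [sq]
  gcongr
  have : core k y ≤ 2 ^ (k * d) := by
    unfold core
    rw [pow_mul]
    refine mul_le_of_le_one_right (by positivity) (inv_le_one_of_one_le₀ (one_le_pow₀ ?_))
    nlinarith [norm_nonneg y, (by positivity : (0 : ℝ) ≤ 2 ^ k), mul_nonneg (by positivity : (0 : ℝ) ≤ 2 ^ k) (norm_nonneg y)]
  refine (ENNReal.ofReal_le_ofReal this).trans (le_of_eq ?_)
  rw [ENNReal.ofReal_pow (by norm_num)]; norm_num

theorem norm_sub_le_of_idx {v z : E d} {m : Idx d} (hv : ∀ i, |v i - m i| ≤ 1)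
    (hz : z ∈ cube 0 m) : ‖z‖ ≤ ‖v‖ + 2 * d := by
  have h : ‖z - v‖ ≤ 2 * d := by
    have h1 : ∀ i, ‖(z - v) i‖ ≤ 2 := by
      intro i
      have := hz i
      simp only [pow_zero, one_mul] at this
      have h2 := abs_le.1 (hv i)
      rw [Real.norm_eq_abs, abs_le]
      constructor <;> simp <;> linarith [this.1, this.2, h2.1, h2.2]
    calc ‖z - v‖ ≤ ∑ i, ‖(z - v) i‖ := by
          conv_lhs => rw [← (EuclideanSpace.basisFun (Fin d) ℝ).sum_repr (z - v)]
          refine (norm_sum_le _ _).trans (Finset.sum_le_sum fun i _ => ?_)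
          simp [norm_smul]
      _ ≤ ∑ _i : Fin d, (2 : ℝ) := Finset.sum_le_sum fun i _ => h1 i
      _ = 2 * d := by simp [mul_comm]
  have := norm_le_norm_add_norm_sub v z
  rw [norm_sub_rev] at this
  linarith

/-- The summable weight in the bounds for convolutions on unit cubes. -/
def wt (m : Idx d) : ℝ≥0∞ := max 1 (coreMass d) *
  (ENNReal.ofReal ((1 + 2 * d) ^ (d + 1)) * ∫⁻ z in cube 0 m, ENNReal.ofReal (core 0 (z : E d)))

theorem tsum_wt_ne_top : ∑' m : Idx d, wt m ≠ ⊤ := by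
  unfold wt
  rw [ENNReal.tsum_mul_left, ENNReal.tsum_mul_left, ← lintegral_eq_tsum]
  refine ENNReal.mul_ne_top ?_ (ENNReal.mul_ne_top ENNReal.ofReal_ne_top coreMass_ne_top)
  simp [coreMass_ne_top]

/-- The total mass of the weight. -/
def wtMass (d : ℕ) : ℝ≥0 := (∑' m : Idx d, wt m).toNNReal

theorem coe_wtMass : (wtMass d : ℝ≥0∞) = ∑' m : Idx d, wt m := ENNReal.coe_toNNReal tsum_wt_ne_top

/-- For x and y in unit cubes with offset m, the point x - y is within distance comparable to one of
every point of the cube m. So the decay factor is at most a constant times its average over that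
cube, and summing over m turns the averages into one convergent integral. -/
theorem maj_le_wt (k : ℕ) {x y : E d} {n m : Idx d} (hx : x ∈ cube 0 n) (hy : y ∈ cube 0 (n - m)) :
    max 1 (coreMass d) * ENNReal.ofReal (maj k (x - y)) ≤ wt m * ENNReal.ofReal (core k (x - y)) := by
  unfold wt
  rw [mul_assoc]
  gcongr
  refine (ENNReal.ofReal_le_ofReal (maj_le_core k _)).trans ?_
  rw [ENNReal.ofReal_mul (by positivity)]
  gcongr
  have hv : ∀ i, |(x - y) i - m i| ≤ 1 := by
    intro i
    have h1 := hx i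
    have h2 := hy i
    simp only [pow_zero, one_mul, Pi.sub_apply, Int.cast_sub] at h1 h2
    rw [abs_le]
    constructor <;> simp <;> linarith [h1.1, h1.2, h2.1, h2.2]
  rw [← lintegral_const_mul _ (continuous_core 0).measurable.ennreal_ofReal]
  calc ENNReal.ofReal ((1 + ‖x - y‖) ^ (d + 1))⁻¹
      = ∫⁻ _z in (cube 0 m : Set (E d)), ENNReal.ofReal ((1 + ‖x - y‖) ^ (d + 1))⁻¹ := by
        rw [setLIntegral_const, volume_cube_zero, mul_one]
    _ ≤ _ := by
        refine setLIntegral_mono' (measurableSet_cube 0 m) fun z hz => ?_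
        rw [← ENNReal.ofReal_mul (by positivity)]
        refine ENNReal.ofReal_le_ofReal ?_
        have h := norm_sub_le_of_idx hv hz
        unfold core
        simp only [pow_zero, one_pow, one_mul]
        rw [← div_eq_mul_inv, inv_le_comm₀ (by positivity) (by positivity), inv_div, div_le_iff₀ (by positivity),
          ← mul_pow]
        gcongr
        nlinarith [norm_nonneg (x - y), Nat.cast_nonneg (α := ℝ) d, mul_nonneg (norm_nonneg (x - y)) (Nat.cast_nonneg (α := ℝ) d)]

/-- Convolution with the majorant. -/
def mconv (k : ℕ) (f : E d → ℝ≥0∞) (x : E d) : ℝ≥0∞ := ∫⁻ y, ENNReal.ofReal (maj k (x - y)) * f y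

theorem measurable_mconv (k : ℕ) {f : E d → ℝ≥0∞} (hf : Measurable f) : Measurable (mconv k f) := by
  unfold mconv
  refine Measurable.lintegral_prod_right' (f := fun p : E d × E d =>
    ENNReal.ofReal (maj k (p.1 - p.2)) * f p.2) ?_
  exact (((continuous_maj k).measurable.comp (by fun_prop)).ennreal_ofReal).mul (by fun_prop)

theorem mconv_mono (k : ℕ) {f g : E d → ℝ≥0∞} (h : ∀ᵐ x, f x ≤ g x) (x : E d) :
    mconv k f x ≤ mconv k g x :=
  lintegral_mono_ae (h.mono fun _ hy => mul_le_mul_right hy _)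

/-- Convolution with `core k` of the restriction of a function to a unit cube. -/
def cconv (k : ℕ) (f : E d → ℝ≥0∞) (n : Idx d) (x : E d) : ℝ≥0∞ :=
  ∫⁻ y in cube 0 n, ENNReal.ofReal (core k (x - y)) * f y

theorem measurable_cconv (k : ℕ) {f : E d → ℝ≥0∞} (hf : Measurable f) (n : Idx d) :
    Measurable (cconv k f n) := by
  unfold cconv
  refine Measurable.lintegral_prod_right' (f := fun p : E d × E d =>
    ENNReal.ofReal (core k (p.1 - p.2)) * f p.2) ?_
  exact (((continuous_core k).measurable.comp (by fun_prop)).ennreal_ofReal).mul (by fun_prop)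

theorem mconv_le_cconv (k : ℕ) {f : E d → ℝ≥0∞} {x : E d} {n : Idx d} (hx : x ∈ cube 0 n) :
    max 1 (coreMass d) * mconv k f x ≤ ∑' m, wt m * cconv k f (n - m) x := by
  unfold mconv
  rw [lintegral_eq_tsum, ← (Equiv.subLeft n).tsum_eq, ← ENNReal.tsum_mul_left]
  refine ENNReal.tsum_le_tsum fun m => ?_
  rw [cconv, ← lintegral_const_mul' _ _ (by simp [coreMass_ne_top]),
    ← lintegral_const_mul' _ _ (ne_top_of_le_ne_top tsum_wt_ne_top (ENNReal.le_tsum m))]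
  refine setLIntegral_mono' (measurableSet_cube 0 _) fun y hy => ?_
  rw [← mul_assoc, ← mul_assoc]
  exact mul_le_mul_left (maj_le_wt k hx hy) _

/-- The number `max 1 (coreMass d)` dominates both the integral of `core k` and its square root. It
is built into `wt`, so that it can be cancelled and the three bounds for `mconv` carry no further
constant. -/
theorem core_mass_bound : rt (coreMass d) ≤ max 1 (coreMass d) := by
  rcases le_total (coreMass d) 1 with h | h
  · refine (rt_mono h).trans ?_
    simp [rt]
  · rw [rt_le_iff, sq, max_eq_right h]
    exact le_mul_of_one_le_left (by positivity) h

theorem lintegral_core_sub_left (k : ℕ) (x : E d) :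
    ∫⁻ y, ENNReal.ofReal (core k (x - y)) = coreMass d := by
  rw [lintegral_sub_left_eq_self (fun y => ENNReal.ofReal (core k y)), lintegral_core]

theorem lintegral_core_sub_right (k : ℕ) (y : E d) :
    ∫⁻ x, ENNReal.ofReal (core k (x - y)) = coreMass d := by
  rw [lintegral_sub_right_eq_self (fun y => ENNReal.ofReal (core k y)), lintegral_core]

theorem measurable_core_sub (k : ℕ) :
    Measurable fun p : E d × E d => ENNReal.ofReal (core k (p.1 - p.2)) :=
  ((continuous_core k).measurable.comp (by fun_prop)).ennreal_ofReal

theorem measurable_core_left (k : ℕ) (x : E d) :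
    Measurable fun y : E d => ENNReal.ofReal (core k (x - y)) :=
  ((continuous_core k).comp (continuous_const.sub continuous_id)).measurable.ennreal_ofReal

theorem measurable_core_right (k : ℕ) (y : E d) :
    Measurable fun x : E d => ENNReal.ofReal (core k (x - y)) :=
  ((continuous_core k).comp (continuous_id.sub continuous_const)).measurable.ennreal_ofReal

theorem rt_core_sq (k : ℕ) :
    rt (2 ^ (k * d) * coreMass d) ≤ max 1 (coreMass d) * (2 : ℝ≥0∞) ^ ((k : ℝ) * d / 2) := by
  rw [rt_mul, mul_comm]
  refine mul_le_mul' core_mass_bound (le_of_eq ?_)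
  rw [rt, ← ENNReal.rpow_natCast, ← ENNReal.rpow_mul]
  push_cast; ring_nf

theorem cconv_le (k : ℕ) {f : E d → ℝ≥0∞} (hf : Measurable f) (n : Idx d) (x : E d) :
    cconv k f n x ≤ max 1 (coreMass d) * (2 : ℝ≥0∞) ^ ((k : ℝ) * d / 2) * pr2 f n := by
  have hm : Measurable fun y => ENNReal.ofReal (core k (x - y)) :=
    measurable_core_left k x
  refine (lintegral_mul_le_rt hm.aemeasurable hf.aemeasurable).trans ?_
  refine mul_le_mul' (le_trans (rt_mono ?_) (rt_core_sq k)) le_rfl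
  refine (setLIntegral_le_lintegral _ _).trans ?_
  rw [lintegral_sub_left_eq_self (fun y => ENNReal.ofReal (core k y) ^ 2)]
  exact lintegral_core_sq k

/-- Young's inequality L¹ * L² ⊂ L², proved by writing the kernel as the product of its square
roots, applying Cauchy-Schwarz in y and then Tonelli. -/
theorem rt_lintegral_cconv_le (k : ℕ) {f : E d → ℝ≥0∞} (hf : Measurable f) (n : Idx d) :
    rt (∫⁻ x, cconv k f n x ^ 2) ≤ max 1 (coreMass d) * pr2 f n := by
  rw [rt_le_iff, mul_pow, pr2, rt_sq]
  have h1 : ∀ x, cconv k f n x ^ 2 ≤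
      coreMass d * ∫⁻ y in cube 0 n, ENNReal.ofReal (core k (x - y)) * f y ^ 2 := by
    intro x
    have hm : Measurable fun y => ENNReal.ofReal (core k (x - y)) :=
      measurable_core_left k x
    have h := lintegral_mul_le_rt (μ := volume.restrict (cube 0 n))
      (f := fun y => rt (ENNReal.ofReal (core k (x - y))))
      (g := fun y => rt (ENNReal.ofReal (core k (x - y))) * f y)
      (measurable_rt.comp hm).aemeasurable ((measurable_rt.comp hm).mul hf).aemeasurable
    have h2 : ∀ y, rt (ENNReal.ofReal (core k (x - y))) * (rt (ENNReal.ofReal (core k (x - y))) * f y)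
        = ENNReal.ofReal (core k (x - y)) * f y := by
      intro y; rw [← mul_assoc, ← sq, rt_sq]
    simp_rw [h2, mul_pow, rt_sq] at h
    refine (pow_le_pow_left' h 2).trans ?_
    rw [mul_pow, rt_sq, rt_sq]
    gcongr
    exact (setLIntegral_le_lintegral _ _).trans (lintegral_core_sub_left k x).le
  refine (lintegral_mono h1).trans ?_
  have hmm : Measurable fun p : E d × E d => ENNReal.ofReal (core k (p.1 - p.2)) * f p.2 ^ 2 :=
    (measurable_core_sub k).mul (by fun_prop)
  rw [lintegral_const_mul _ hmm.lintegral_prod_right', lintegral_lintegral_swap hmm.aemeasurable, sq, mul_assoc]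
  refine mul_le_mul' (le_max_right _ _) ?_
  rw [← lintegral_const_mul _ (by fun_prop)]
  refine lintegral_mono fun y => ?_
  dsimp only
  rw [lintegral_mul_const _ (measurable_core_right k y), lintegral_core_sub_right]
  gcongr
  exact le_max_right _ _

/-- Young's inequality L² * L¹ ⊂ L². Now the square root of f is split off in Cauchy-Schwarz, and
the L² norm of `core k` gives 2^{kd/2}. -/
theorem rt_lintegral_cconv_le_pr1 (k : ℕ) {f : E d → ℝ≥0∞} (hf : Measurable f) (n : Idx d) :
    rt (∫⁻ x, cconv k f n x ^ 2) ≤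
      max 1 (coreMass d) * (2 : ℝ≥0∞) ^ ((k : ℝ) * d / 2) * pr1 f n := by
  have h1 : ∀ x, cconv k f n x ^ 2 ≤
      pr1 f n * ∫⁻ y in cube 0 n, ENNReal.ofReal (core k (x - y)) ^ 2 * f y := by
    intro x
    have hm : Measurable fun y => ENNReal.ofReal (core k (x - y)) :=
      measurable_core_left k x
    have h := lintegral_mul_le_rt (μ := volume.restrict (cube 0 n))
      (f := fun y => rt (f y)) (g := fun y => ENNReal.ofReal (core k (x - y)) * rt (f y))
      (measurable_rt.comp hf).aemeasurable (hm.mul (measurable_rt.comp hf)).aemeasurable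
    have h2 : ∀ y, rt (f y) * (ENNReal.ofReal (core k (x - y)) * rt (f y))
        = ENNReal.ofReal (core k (x - y)) * f y := by
      intro y; rw [mul_left_comm, ← sq, rt_sq]
    simp_rw [h2, mul_pow, rt_sq] at h
    refine (pow_le_pow_left' h 2).trans ?_
    rw [mul_pow, rt_sq, rt_sq]
    rfl
  have hmm : Measurable fun p : E d × E d => ENNReal.ofReal (core k (p.1 - p.2)) ^ 2 * f p.2 :=
    ((measurable_core_sub k).pow_const 2).mul (by fun_prop)
  have h3 : ∫⁻ x, cconv k f n x ^ 2 ≤ 2 ^ (k * d) * coreMass d * pr1 f n ^ 2 := by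
    refine (lintegral_mono h1).trans ?_
    rw [lintegral_const_mul _ hmm.lintegral_prod_right', lintegral_lintegral_swap hmm.aemeasurable, sq,
      mul_left_comm]
    refine mul_le_mul' le_rfl ?_
    rw [pr1, ← lintegral_const_mul _ hf]
    refine lintegral_mono fun y => ?_
    dsimp only
    rw [lintegral_mul_const _ ((measurable_core_right k y).pow_const 2)]
    gcongr
    rw [lintegral_sub_right_eq_self (fun y => ENNReal.ofReal (core k y) ^ 2)]
    exact lintegral_core_sq k
  refine (rt_mono h3).trans ?_
  rw [rt_mul, rt_of_sq]
  exact mul_le_mul' (rt_core_sq k) le_rfl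

theorem max_one_coreMass_ne_zero : max 1 (coreMass d) ≠ 0 := by
  exact (lt_of_lt_of_le one_pos (le_max_left _ _)).ne'

theorem max_one_coreMass_ne_top : max 1 (coreMass d) ≠ ⊤ := by simp [coreMass_ne_top]

/-- The pointwise bound for convolutions of `L²` functions. -/
theorem mconv_le (k : ℕ) {f : E d → ℝ≥0∞} (hf : Measurable f) {x : E d} {n : Idx d}
    (hx : x ∈ cube 0 n) :
    mconv k f x ≤ (2 : ℝ≥0∞) ^ ((k : ℝ) * d / 2) * ∑' m, wt m * pr2 f (n - m) := by
  rw [← ENNReal.mul_le_mul_iff_right max_one_coreMass_ne_zero max_one_coreMass_ne_top]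
  refine (mconv_le_cconv k hx).trans ?_
  rw [← mul_assoc, ← ENNReal.tsum_mul_left]
  refine ENNReal.tsum_le_tsum fun m => ?_
  rw [mul_left_comm]
  gcongr
  exact cconv_le k hf _ x

theorem pr2_mconv_aux (k : ℕ) {f : E d → ℝ≥0∞} (hf : Measurable f) (n : Idx d) :
    max 1 (coreMass d) * pr2 (mconv k f) n ≤
      ∑' m, wt m * rt (∫⁻ x, cconv k f (n - m) x ^ 2) := by
  rw [← pr2_const_mul _ (measurable_mconv k hf)]
  have h : pr2 (fun x => max 1 (coreMass d) * mconv k f x) n ≤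
      pr2 (fun x => ∑' m, wt m * cconv k f (n - m) x) n :=
    rt_mono (setLIntegral_mono' (measurableSet_cube 0 n) fun x hx =>
      pow_le_pow_left' (mconv_le_cconv k hx) 2)
  refine h.trans ((pr2_tsum_le (fun m => (measurable_cconv k hf _).const_mul _) n).trans ?_)
  refine ENNReal.tsum_le_tsum fun m => ?_
  rw [pr2_const_mul _ (measurable_cconv k hf _)]
  gcongr
  exact rt_mono (setLIntegral_le_lintegral _ _)

/-- Boundedness of convolutions in `L²` on unit cubes. -/
theorem pr2_mconv_le (k : ℕ) {f : E d → ℝ≥0∞} (hf : Measurable f) (n : Idx d) :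
    pr2 (mconv k f) n ≤ ∑' m, wt m * pr2 f (n - m) := by
  rw [← ENNReal.mul_le_mul_iff_right max_one_coreMass_ne_zero max_one_coreMass_ne_top]
  refine (pr2_mconv_aux k hf n).trans ?_
  rw [← ENNReal.tsum_mul_left]
  refine ENNReal.tsum_le_tsum fun m => ?_
  rw [mul_left_comm]
  gcongr
  exact rt_lintegral_cconv_le k hf _

/-- Bernstein's inequality on unit cubes. -/
theorem pr2_mconv_le_pr1 (k : ℕ) {f : E d → ℝ≥0∞} (hf : Measurable f) (n : Idx d) :
    pr2 (mconv k f) n ≤ (2 : ℝ≥0∞) ^ ((k : ℝ) * d / 2) * ∑' m, wt m * pr1 f (n - m) := by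
  rw [← ENNReal.mul_le_mul_iff_right max_one_coreMass_ne_zero max_one_coreMass_ne_top]
  refine (pr2_mconv_aux k hf n).trans ?_
  rw [← mul_assoc, ← ENNReal.tsum_mul_left]
  refine ENNReal.tsum_le_tsum fun m => ?_
  rw [mul_left_comm]
  gcongr
  exact rt_lintegral_cconv_le_pr1 k hf _

end LocalEnergy

end

noncomputable section


namespace LocalEnergy

open scoped SchwartzMap

variable {d : ℕ} {V : Type*} [NormedAddCommGroup V]

/-! ### Classes of functions in `L²` -/

theorem ofFun_ae {f : E d → V} (h : MemLp f 2 volume) : ofFun f =ᵐ[volume] f := by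
  rw [ofFun, dif_pos h]; exact h.coeFn_toLp

theorem ofFun_congr {f g : E d → V} (h : f =ᵐ[volume] g) : ofFun f = ofFun g := by
  by_cases hf : MemLp f 2 volume
  · have hg : MemLp g 2 volume := hf.ae_eq h
    rw [ofFun, ofFun, dif_pos hf, dif_pos hg, MemLp.toLp_eq_toLp_iff]
    exact h
  · have hg : ¬ MemLp g 2 volume := fun hg => hf (hg.ae_eq h.symm)
    rw [ofFun, ofFun, dif_neg hf, dif_neg hg]

theorem ofFun_coeFn (f : L2 d V) : ofFun (f : E d → V) = f := by
  rw [ofFun, dif_pos (Lp.memLp f), Lp.toLp_coeFn]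

theorem eq_ofFun {f : L2 d V} {g : E d → V} (h : f =ᵐ[volume] g) : f = ofFun g := by
  rw [← ofFun_congr h, ofFun_coeFn]

theorem norm_ofFun_le (f : E d → V) : ‖ofFun f‖ₑ ≤ eLpNorm f 2 volume := by
  by_cases hf : MemLp f 2 volume
  · rw [ofFun, dif_pos hf, Lp.enorm_toLp]
  · rw [ofFun, dif_neg hf]; simp

variable [NormedSpace ℂ V]

theorem memLp_bmul {b : E d → ℂ} (hb : MemLp b ⊤ volume) (f : L2 d V) :
    MemLp (fun x => b x • f x) 2 volume := (Lp.memLp f).smul hb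

/-- Multiplication by a bounded function. -/
def bmul (b : E d → ℂ) (hb : MemLp b ⊤ volume) : L2 d V →L[ℂ] L2 d V :=
  LinearMap.mkContinuous
    { toFun := fun f => ofFun fun x => b x • f x
      map_add' := fun f g => by
        apply Lp.ext
        filter_upwards [ofFun_ae (memLp_bmul hb (f + g)), ofFun_ae (memLp_bmul hb f),
          ofFun_ae (memLp_bmul hb g), Lp.coeFn_add f g,
          Lp.coeFn_add (ofFun fun x => b x • f x) (ofFun fun x => b x • g x)] with x h1 h2 h3 h4 h5
        rw [h1, h5, Pi.add_apply, h2, h3, h4, Pi.add_apply, smul_add]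
      map_smul' := fun c f => by
        apply Lp.ext
        filter_upwards [ofFun_ae (memLp_bmul hb (c • f)), ofFun_ae (memLp_bmul hb f),
          Lp.coeFn_smul c f, Lp.coeFn_smul c (ofFun fun x => b x • f x)] with x h1 h2 h3 h4
        simp only [RingHom.id_apply]
        rw [h1, h4, Pi.smul_apply, h2, h3, Pi.smul_apply, smul_comm] }
    (eLpNorm b ⊤ volume).toReal fun f => by
      have h := eLpNorm_smul_le_eLpNorm_top_mul_eLpNorm 2 (Lp.memLp f).1 b
      have h2 : ‖ofFun fun x => b x • f x‖ₑ ≤ eLpNorm b ⊤ volume * ‖f‖ₑ :=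
        (norm_ofFun_le _).trans (h.trans_eq (by rw [Lp.enorm_def]))
      have h3 := ENNReal.toReal_mono (ENNReal.mul_ne_top hb.2.ne (by simp)) h2
      rw [ENNReal.toReal_mul, toReal_enorm, toReal_enorm] at h3
      exact h3

theorem bmul_ae {b : E d → ℂ} (hb : MemLp b ⊤ volume) (f : L2 d V) :
    bmul b hb f =ᵐ[volume] fun x => b x • f x := ofFun_ae (memLp_bmul hb f)

end LocalEnergy

namespace LocalEnergy

open scoped SchwartzMap

variable {d : ℕ} {V : Type*} [NormedAddCommGroup V] [InnerProductSpace ℂ V] [CompleteSpace V]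

/-! ### Fourier multipliers -/

theorem memLp_top_of_continuous {m : E d → ℂ} (hm : Continuous m) {C : ℝ} (h : ∀ ξ, ‖m ξ‖ ≤ C) :
    MemLp m ⊤ volume :=
  memLp_top_of_bound hm.aestronglyMeasurable C (.of_forall h)

/-- The Fourier multiplier with a bounded symbol as a continuous linear map. -/
def fmul (m : E d → ℂ) (hm : MemLp m ⊤ volume) : L2 d V →L[ℂ] L2 d V :=
  (FourierTransform.fourierInvCLM ℂ (L2 d V)).comp
    ((bmul m hm).comp (FourierTransform.fourierCLM ℂ (L2 d V)))

theorem fmul_apply {m : E d → ℂ} (hm : MemLp m ⊤ volume) (f : L2 d V) :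
    fmul m hm f = fourierMul m f := rfl

theorem fourier_fourierMul (m : E d → ℂ) (f : L2 d V) :
    𝓕 (fourierMul m f) = ofFun fun ξ => m ξ • (𝓕 f : L2 d V) ξ := by
  rw [fourierMul, FourierTransform.fourier_fourierInv_eq]

/-- No bound on `m₁` is needed: both sides are the inverse transform of `ofFun` of functions that
agree almost everywhere, whether or not they lie in L². This allows the symbol of a partial
derivative for `m₁`. -/
theorem fourierMul_fourierMul (m₁ : E d → ℂ) {m₂ : E d → ℂ} (hm₂ : MemLp m₂ ⊤ volume) (f : L2 d V) :
    fourierMul m₁ (fourierMul m₂ f) = fourierMul (fun ξ => m₁ ξ * m₂ ξ) f := by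
  rw [fourierMul, fourierMul.eq_1 (fun ξ => m₁ ξ * m₂ ξ)]
  congr 1
  refine ofFun_congr ?_
  have h := fourier_fourierMul m₂ f
  filter_upwards [ofFun_ae (memLp_bmul hm₂ (𝓕 f : L2 d V))] with ξ hξ
  rw [h, hξ, smul_smul]

theorem fourierMul_add (m : E d → ℂ) (hm : MemLp m ⊤ volume) (f g : L2 d V) :
    fourierMul m (f + g) = fourierMul m f + fourierMul m g := (fmul m hm).map_add f g

theorem fourierMul_sub (m : E d → ℂ) (hm : MemLp m ⊤ volume) (f g : L2 d V) :
    fourierMul m (f - g) = fourierMul m f - fourierMul m g := (fmul m hm).map_sub f g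

theorem fourierMul_sum {ι : Type*} (s : Finset ι) (m : E d → ℂ) (hm : MemLp m ⊤ volume)
    (f : ι → L2 d V) : fourierMul m (∑ i ∈ s, f i) = ∑ i ∈ s, fourierMul m (f i) :=
  map_sum (fmul m hm) f s

theorem fourierMul_zero (m : E d → ℂ) : fourierMul m (0 : L2 d V) = 0 := by
  have h : (ofFun fun ξ => m ξ • (𝓕 (0 : L2 d V) : L2 d V) ξ) = 0 := by
    have : (fun ξ => m ξ • (𝓕 (0 : L2 d V) : L2 d V) ξ) =ᵐ[volume] fun _ => (0 : V) := by
      rw [FourierTransform.fourier_zero]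
      filter_upwards [Lp.coeFn_zero V 2 (volume : Measure (E d))] with x hx
      rw [hx]; simp
    rw [ofFun_congr this]
    symm
    exact eq_ofFun (Lp.coeFn_zero V 2 (volume : Measure (E d)))
  rw [fourierMul, h, FourierTransform.fourierInv_zero]

theorem fourierMul_sym_add {m₁ m₂ : E d → ℂ} (h₁ : MemLp m₁ ⊤ volume) (h₂ : MemLp m₂ ⊤ volume)
    (f : L2 d V) :
    fourierMul (fun ξ => m₁ ξ + m₂ ξ) f = fourierMul m₁ f + fourierMul m₂ f := by
  rw [fourierMul, fourierMul, fourierMul, ← FourierTransform.fourierInv_add]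
  congr 1
  symm
  refine eq_ofFun ?_
  filter_upwards [ofFun_ae (memLp_bmul h₁ (𝓕 f : L2 d V)), ofFun_ae (memLp_bmul h₂ (𝓕 f : L2 d V)),
    Lp.coeFn_add (ofFun fun ξ => m₁ ξ • (𝓕 f : L2 d V) ξ)
      (ofFun fun ξ => m₂ ξ • (𝓕 f : L2 d V) ξ)] with ξ a1 a2 a3
  rw [a3, Pi.add_apply, a1, a2, add_smul]

theorem fourierMul_sym_zero (f : L2 d V) : fourierMul (fun _ => 0) f = 0 := by
  rw [fourierMul]
  have : (ofFun fun ξ => (0 : ℂ) • (𝓕 f : L2 d V) ξ) = 0 := by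
    symm
    refine eq_ofFun ?_
    filter_upwards [Lp.coeFn_zero V 2 (volume : Measure (E d))] with x hx
    rw [hx]; simp
  rw [this, FourierTransform.fourierInv_zero]

theorem fourierMul_sym_const_mul (c : ℂ) {m : E d → ℂ} (hm : MemLp m ⊤ volume) (f : L2 d V) :
    fourierMul (fun ξ => c * m ξ) f = c • fourierMul m f := by
  rw [fourierMul, fourierMul, ← FourierTransform.fourierInv_smul]
  congr 1
  symm
  refine eq_ofFun ?_
  filter_upwards [ofFun_ae (memLp_bmul hm (𝓕 f : L2 d V)),
    Lp.coeFn_smul c (ofFun fun ξ => m ξ • (𝓕 f : L2 d V) ξ)] with ξ a1 a2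
  rw [a2, Pi.smul_apply, a1, smul_smul]

/-- Uniformly bounded symbols that converge to `1` give an approximation of the identity. -/
theorem tendsto_fourierMul {m : ℕ → E d → ℂ} (hm : ∀ n, Continuous (m n)) (hb : ∀ n ξ, ‖m n ξ‖ ≤ 1)
    (hlim : ∀ ξ, Filter.Tendsto (fun n => m n ξ) Filter.atTop (nhds 1)) (f : L2 d V) :
    Filter.Tendsto (fun n => fourierMul (m n) f) Filter.atTop (nhds f) := by
  have hm' : ∀ n, MemLp (m n) ⊤ volume := fun n => memLp_top_of_continuous (hm n) (hb n)
  have key : Filter.Tendsto (fun n => bmul (m n) (hm' n) (𝓕 f : L2 d V)) Filter.atTop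
      (nhds (𝓕 f : L2 d V)) := by
    rw [Lp.tendsto_Lp_iff_tendsto_eLpNorm']
    set g : L2 d V := 𝓕 f
    have h1 : ∀ n, eLpNorm ((bmul (m n) (hm' n) g : E d → V) - (g : E d → V)) 2 volume =
        rt (∫⁻ ξ, (‖m n ξ - 1‖ₑ * ‖g ξ‖ₑ) ^ 2) := by
      intro n
      have : ((bmul (m n) (hm' n) g : E d → V) - (g : E d → V)) =ᵐ[volume] fun ξ => (m n ξ - 1) • g ξ := by
        filter_upwards [bmul_ae (hm' n) g] with ξ hξ
        rw [Pi.sub_apply, hξ, sub_smul, one_smul]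
      rw [eLpNorm_congr_ae this, eLpNorm_eq_lintegral_rpow_enorm_toReal (by simp) (by simp)]
      simp [rt, enorm_smul]
    simp_rw [h1]
    have h0 : (0 : ℝ≥0∞) = rt (∫⁻ _ξ : E d, 0) := by simp
    rw [h0]
    have hc : Continuous rt := ENNReal.continuous_rpow_const
    refine (hc.tendsto _).comp ?_
    refine tendsto_lintegral_of_dominated_convergence (fun ξ => 4 * ‖g ξ‖ₑ ^ 2) ?_ ?_ ?_ ?_
    · intro n
      have := (Lp.stronglyMeasurable g).enorm
      have := (hm n).measurable
      fun_prop
    · intro n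
      refine .of_forall fun ξ => ?_
      have : ‖m n ξ - 1‖ₑ ≤ 2 := by
        refine (enorm_sub_le).trans ?_
        have h3 : ‖m n ξ‖ₑ ≤ 1 := by
          rw [← ofReal_norm]; exact ENNReal.ofReal_le_one.2 (hb n ξ)
        refine (add_le_add h3 le_rfl).trans ?_
        simp; norm_num
      calc (‖m n ξ - 1‖ₑ * ‖g ξ‖ₑ) ^ 2 ≤ (2 * ‖g ξ‖ₑ) ^ 2 := by gcongr
        _ = _ := by rw [mul_pow]; norm_num
    · rw [lintegral_const_mul _ (by
        have := (Lp.stronglyMeasurable g).enorm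
        fun_prop)]
      refine ENNReal.mul_ne_top (by simp) ?_
      have h := (Lp.memLp g).2
      rw [eLpNorm_eq_lintegral_rpow_enorm_toReal (by simp) (by simp)] at h
      have h5 : rt (∫⁻ ξ, ‖g ξ‖ₑ ^ 2) < ⊤ := by simpa [rt] using h
      have h6 := rt_sq (∫⁻ ξ, ‖g ξ‖ₑ ^ 2)
      rw [← h6]
      finiteness
    · refine .of_forall fun ξ => ?_
      have h3 : Filter.Tendsto (fun n => ‖m n ξ - 1‖ₑ) Filter.atTop (nhds 0) := by
        have : Filter.Tendsto (fun n => m n ξ - 1) Filter.atTop (nhds (1 - 1)) :=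
          (hlim ξ).sub tendsto_const_nhds
        rw [sub_self] at this
        have h8 := (continuous_enorm.tendsto _).comp this
        rw [enorm_zero] at h8
        exact h8
      have h4 := ENNReal.Tendsto.mul_const (b := ‖g ξ‖ₑ) h3 (by simp)
      rw [zero_mul] at h4
      have h7 := ((ENNReal.continuous_pow 2).tendsto 0).comp h4
      rw [zero_pow two_ne_zero] at h7
      exact h7
  have := ((FourierTransform.fourierInvCLM ℂ (L2 d V)).continuous.tendsto _).comp key
  have h2 : FourierTransform.fourierInvCLM ℂ (L2 d V) (𝓕 f : L2 d V) = f := by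
    rw [FourierTransform.fourierInvCLM_apply, FourierTransform.fourierInv_fourier_eq]
  rw [h2] at this
  exact this

/-! ### Convolutions -/

/-- Convolution of a scalar kernel with a vector valued function. -/
def conv (K : E d → ℂ) (f : E d → V) (x : E d) : V := ∫ y, K (x - y) • f y

theorem conv_congr (K : E d → ℂ) {f g : E d → V} (h : f =ᵐ[volume] g) (x : E d) :
    conv K f x = conv K g x :=
  integral_congr_ae (h.mono fun y hy => by dsimp only; rw [hy])

theorem memLp_schwartz_shift (K : 𝓢(E d, ℂ)) (x : E d) (p : ℝ≥0∞) :
    MemLp (fun y => K (x - y)) p volume :=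
  (K.memLp p volume).comp_measurePreserving (Measure.measurePreserving_sub_left volume x)

theorem integrable_conv (K : 𝓢(E d, ℂ)) {f : E d → V} (hf : MemLp f 2 volume) (x : E d) :
    Integrable fun y => K (x - y) • f y :=
  memLp_one_iff_integrable.1 (hf.smul (memLp_schwartz_shift K x 2))

theorem conv_schwartz (m : 𝓢(E d, ℂ)) (f : 𝓢(E d, V)) :
    fourierMul m (f.toLp 2) =ᵐ[volume] conv (𝓕⁻ m : 𝓢(E d, ℂ)) f := by
  have hm : MemLp m ⊤ volume := m.memLp_top volume
  have h1 : fourierMul m (f.toLp 2) =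
      (SchwartzMap.convolution (ContinuousLinearMap.lsmul ℂ ℂ) (𝓕⁻ m : 𝓢(E d, ℂ)) f).toLp 2 := by
    rw [fourierMul]
    rw [SchwartzMap.toLp_fourier_eq]
    have : (ofFun fun ξ => m ξ • ((𝓕 f : 𝓢(E d, V)).toLp 2 : L2 d V) ξ) =
        (SchwartzMap.pairing (ContinuousLinearMap.lsmul ℂ ℂ) m (𝓕 f : 𝓢(E d, V))).toLp 2 := by
      symm
      refine eq_ofFun ?_
      filter_upwards [SchwartzMap.coeFn_toLp (𝓕 f : 𝓢(E d, V)) 2 volume,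
        SchwartzMap.coeFn_toLp (SchwartzMap.pairing (ContinuousLinearMap.lsmul ℂ ℂ) m
          (𝓕 f : 𝓢(E d, V))) 2 volume] with ξ a1 a2
      rw [a1, a2]; simp
    rw [this, SchwartzMap.toLp_fourierInv_eq]
    congr 1
    simp [SchwartzMap.convolution]
  rw [h1]
  refine (SchwartzMap.coeFn_toLp _ 2 volume).trans (.of_forall fun x => ?_)
  rw [SchwartzMap.convolution_apply, convolution_def, conv]
  simp only [ContinuousLinearMap.lsmul_apply]
  exact (integral_sub_left_eq_self (fun y => (𝓕⁻ m : 𝓢(E d, ℂ)) y • f (x - y)) volume x).symm.trans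
    (integral_congr_ae (.of_forall fun y => by simp))

theorem norm_conv_le (K : 𝓢(E d, ℂ)) (f : L2 d V) (x : E d) :
    ‖conv K f x‖ₑ ≤ eLpNorm K 2 volume * ‖f‖ₑ := by
  refine (enorm_integral_le_lintegral_enorm _).trans ?_
  have h := eLpNorm_smul_le_mul_eLpNorm (p := 2) (q := 2) (r := 1) (Lp.memLp f).1
    (memLp_schwartz_shift K x 2).1
  rw [eLpNorm_one_eq_lintegral_enorm] at h
  refine h.trans (le_of_eq ?_)
  rw [Lp.enorm_def]
  congr 1
  exact eLpNorm_comp_measurePreserving K.continuous.aestronglyMeasurable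
    (Measure.measurePreserving_sub_left volume x)

theorem conv_sub (K : 𝓢(E d, ℂ)) {f g : E d → V} (hf : MemLp f 2 volume) (hg : MemLp g 2 volume)
    (x : E d) : conv K (f - g) x = conv K f x - conv K g x := by
  rw [conv, conv, conv, ← integral_sub (integrable_conv K hf x) (integrable_conv K hg x)]
  simp [smul_sub]

/-- A Fourier multiplier with a Schwartz symbol is a convolution. -/
theorem fourierMul_ae_eq_conv (m : 𝓢(E d, ℂ)) (f : L2 d V) :
    fourierMul m f =ᵐ[volume] conv (𝓕⁻ m : 𝓢(E d, ℂ)) f := by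
  set K : 𝓢(E d, ℂ) := 𝓕⁻ m
  have hm : MemLp m ⊤ volume := m.memLp_top volume
  obtain ⟨g, hg⟩ : ∃ g : ℕ → 𝓢(E d, V),
      Filter.Tendsto (fun n => (g n).toLp 2 volume) Filter.atTop (nhds f) := by
    have h := (SchwartzMap.denseRange_toLpCLM (E := E d) (F := V) (p := 2) (μ := volume)
      ENNReal.ofNat_ne_top).closure_range
    have hf : f ∈ closure (Set.range (SchwartzMap.toLpCLM ℝ V 2 (volume : Measure (E d)))) := by
      rw [h]; trivial
    obtain ⟨v, hv, hlim⟩ := mem_closure_iff_seq_limit.1 hf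
    choose g hg using hv
    refine ⟨g, ?_⟩
    convert hlim using 2 with n
    exact hg n
  have h1 : Filter.Tendsto (fun n => fourierMul m ((g n).toLp 2 volume)) Filter.atTop
      (nhds (fourierMul m f)) := ((fmul m hm).continuous.tendsto f).comp hg
  -- The identity is known on the dense set of Schwartz functions. Along a subsequence the left
  -- sides converge almost everywhere, and the right sides converge at every point by
  -- Cauchy-Schwarz.
  obtain ⟨ns, hns, hae⟩ := (tendstoInMeasure_of_tendsto_Lp h1).exists_seq_tendsto_ae
  have h2 : ∀ᵐ x, ∀ n, fourierMul m ((g n).toLp 2 volume) x = conv K (g n) x :=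
    ae_all_iff.2 fun n => conv_schwartz m (g n)
  filter_upwards [hae, h2] with x hx hx2
  refine tendsto_nhds_unique hx ?_
  simp_rw [hx2]
  rw [tendsto_iff_edist_tendsto_0]
  have hg' := (tendsto_iff_edist_tendsto_0.1 hg).comp hns.tendsto_atTop
  have hfin : eLpNorm K 2 volume ≠ ⊤ := (K.memLp 2 volume).2.ne
  have h3 := ENNReal.Tendsto.const_mul hg' (Or.inr hfin)
  rw [mul_zero] at h3
  refine tendsto_of_tendsto_of_tendsto_of_le_of_le tendsto_const_nhds h3 (fun _ => zero_le) ?_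
  intro n
  simp only [Function.comp]
  rw [edist_eq_enorm_sub, edist_eq_enorm_sub]
  have h5 : conv K (g (ns n)) x - conv K f x = conv K ((g (ns n)).toLp 2 volume - f : L2 d V) x := by
    rw [← conv_congr K (SchwartzMap.coeFn_toLp (g (ns n)) 2 volume), ← conv_sub K (Lp.memLp _) (Lp.memLp _)]
    exact (conv_congr K (Lp.coeFn_sub _ _) x).symm
  rw [h5]
  exact norm_conv_le K _ x

end LocalEnergy

end

noncomputable section

namespace LocalEnergy

open scoped SchwartzMap

variable {d : ℕ} {V : Type*} [NormedAddCommGroup V] [InnerProductSpace ℂ V] [CompleteSpace V]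

/-! ### The frequency support of products -/

/-- A translation multiplies the transform by a phase and so preserves its zeros. The sign in `-v`
comes from taking the inverse transform twice. -/
theorem fourierInv_shift_eq_zero (m : 𝓢(E d, ℂ)) (y v : E d) (h : m (-v) = 0) :
    (𝓕⁻ (SchwartzMap.compSubConstCLM ℂ y (𝓕⁻ m : 𝓢(E d, ℂ))) : 𝓢(E d, ℂ)) v = 0 := by
  rw [SchwartzMap.fourierInv_coe, Real.fourierInv_eq_fourier_neg]
  have h1 : ((SchwartzMap.compSubConstCLM ℂ y (𝓕⁻ m : 𝓢(E d, ℂ)) : 𝓢(E d, ℂ)) : E d → ℂ) =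
      ((𝓕⁻ m : 𝓢(E d, ℂ)) : E d → ℂ) ∘ fun w => w + -y := by
    funext w; simp [sub_eq_add_neg]
  rw [h1, Real.fourier_eq]
  have h2 := congrFun (VectorFourier.fourierIntegral_comp_add_right Real.fourierChar
    (volume : Measure (E d)) (innerₗ (E d)) ((𝓕⁻ m : 𝓢(E d, ℂ)) : E d → ℂ) (-y)) (-v)
  have h3 : VectorFourier.fourierIntegral Real.fourierChar (volume : Measure (E d)) (innerₗ (E d))
      ((𝓕⁻ m : 𝓢(E d, ℂ)) : E d → ℂ) (-v) = 0 := by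
    have h4 : (𝓕 (𝓕⁻ m : 𝓢(E d, ℂ)) : 𝓢(E d, ℂ)) (-v) = 0 := by
      rw [FourierTransform.fourier_fourierInv_eq, h]
    rw [SchwartzMap.fourier_coe] at h4
    exact h4
  rw [h3, smul_zero] at h2
  exact h2

/-- As a function of x the integral is the convolution of the first kernel with the product H of the
two translated kernels, so its transform is m₁ times that of H. The latter is a convolution of
transforms with zeros controlled by those of m₂ and m₃, and the hypothesis makes the product vanish.
-/
theorem integral_kernels_eq_zero (m₁ m₂ m₃ : 𝓢(E d, ℂ))
    (h : ∀ ξ η, m₁ (ξ + η) * (m₂ ξ * m₃ η) = 0) (x y z : E d) :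
    ∫ w, (𝓕⁻ m₁ : 𝓢(E d, ℂ)) (x - w) *
      ((𝓕⁻ m₂ : 𝓢(E d, ℂ)) (w - y) * (𝓕⁻ m₃ : 𝓢(E d, ℂ)) (w - z)) = 0 := by
  set A : 𝓢(E d, ℂ) := SchwartzMap.compSubConstCLM ℂ y (𝓕⁻ m₂ : 𝓢(E d, ℂ)) with hA
  set B : 𝓢(E d, ℂ) := SchwartzMap.compSubConstCLM ℂ z (𝓕⁻ m₃ : 𝓢(E d, ℂ)) with hB
  set H : 𝓢(E d, ℂ) := SchwartzMap.pairing (ContinuousLinearMap.mul ℂ ℂ) A B with hH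
  have hHI : (𝓕⁻ H : 𝓢(E d, ℂ)) =
      SchwartzMap.convolution (ContinuousLinearMap.mul ℂ ℂ) (𝓕⁻ A : 𝓢(E d, ℂ))
        (𝓕⁻ B : 𝓢(E d, ℂ)) := by
    simp [SchwartzMap.convolution, hH]
  have hz : ∀ ξ, m₁ ξ * (𝓕 H : 𝓢(E d, ℂ)) ξ = 0 := by
    intro ξ
    by_cases hξ : m₁ ξ = 0
    · rw [hξ, zero_mul]
    have h1 : (𝓕 H : 𝓢(E d, ℂ)) ξ = (𝓕⁻ H : 𝓢(E d, ℂ)) (-ξ) := by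
      rw [SchwartzMap.fourierInv_coe, Real.fourierInv_eq_fourier_neg, neg_neg,
        SchwartzMap.fourier_coe]
    rw [h1, hHI, SchwartzMap.convolution_apply, convolution_def]
    have h2 : ∀ v, (ContinuousLinearMap.mul ℂ ℂ ((𝓕⁻ A : 𝓢(E d, ℂ)) v))
        ((𝓕⁻ B : 𝓢(E d, ℂ)) (-ξ - v)) = 0 := by
      intro v
      have h3 := h (-v) (-(-ξ - v))
      rw [show -v + -(-ξ - v) = ξ by abel] at h3
      rcases mul_eq_zero.1 ((mul_eq_zero.1 h3).resolve_left hξ) with h4 | h4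
      · simp [hA, fourierInv_shift_eq_zero m₂ y v h4]
      · simp [hB, fourierInv_shift_eq_zero m₃ z _ h4]
    simp_rw [h2]
    simp
  have h5 : SchwartzMap.convolution (ContinuousLinearMap.mul ℂ ℂ) (𝓕⁻ m₁ : 𝓢(E d, ℂ)) H = 0 := by
    have : SchwartzMap.pairing (ContinuousLinearMap.mul ℂ ℂ) m₁ (𝓕 H : 𝓢(E d, ℂ)) = 0 := by
      ext ξ; simpa using hz ξ
    simp [SchwartzMap.convolution, this]
  have h6 := congrArg (fun g : 𝓢(E d, ℂ) => g x) h5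
  simp only [SchwartzMap.convolution_apply, convolution_def] at h6
  rw [← integral_sub_left_eq_self _ volume x] at h6
  simpa [hH, hA, hB] using h6

theorem lintegral_enorm_mul_le {W : Type*} [NormedAddCommGroup W] (K : 𝓢(E d, ℂ)) (u : L2 d W)
    (w : E d) : ∫⁻ y, ‖K (w - y)‖ₑ * ‖u y‖ₑ ≤ eLpNorm K 2 volume * ‖u‖ₑ := by
  have hu : Measurable fun y => ‖u y‖ₑ := (Lp.stronglyMeasurable u).enorm
  have hK : Measurable fun y => ‖K (w - y)‖ₑ :=
    (K.continuous.comp (continuous_const.sub continuous_id)).measurable.enorm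
  refine (lintegral_mul_le_rt hK.aemeasurable hu.aemeasurable).trans (le_of_eq ?_)
  rw [Lp.enorm_def, eLpNorm_eq_lintegral_rpow_enorm_toReal (by simp) (by simp),
    eLpNorm_eq_lintegral_rpow_enorm_toReal (by simp) (by simp)]
  rw [lintegral_sub_left_eq_self (fun y => ‖K y‖ₑ ^ 2)]
  simp [rt]

/-- The integrand of a convolution with a product of two convolutions. -/
def tripleKernel (K₁ K₂ K₃ : 𝓢(E d, ℂ)) (f : L2 d ℂ) (g : L2 d V) (x w : E d) (p : E d × E d) : V :=
  K₁ (x - w) • ((K₂ (w - p.1) * f p.1) • (K₃ (w - p.2) • g p.2))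

theorem measurable_tripleKernel (K₁ K₂ K₃ : 𝓢(E d, ℂ)) (f : L2 d ℂ) (g : L2 d V) (x : E d) :
    AEStronglyMeasurable (Function.uncurry (tripleKernel K₁ K₂ K₃ f g x))
      (volume.prod (volume : Measure (E d × E d))) := by
  have a1 := Lp.stronglyMeasurable f
  have a2 := Lp.stronglyMeasurable g
  refine StronglyMeasurable.aestronglyMeasurable ?_
  have c1 : Continuous fun p : E d × E d × E d => K₁ (x - p.1) := by fun_prop
  have c2 : Continuous fun p : E d × E d × E d => K₂ (p.1 - p.2.1) := by fun_prop
  have c3 : Continuous fun p : E d × E d × E d => K₃ (p.1 - p.2.2) := by fun_prop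
  exact c1.stronglyMeasurable.smul ((c2.stronglyMeasurable.mul
    (a1.comp_measurable (by fun_prop))).smul (c3.stronglyMeasurable.smul
      (a2.comp_measurable (by fun_prop))))

theorem lintegral_tripleKernel_le (K₁ K₂ K₃ : 𝓢(E d, ℂ)) (f : L2 d ℂ) (g : L2 d V) (x w : E d) :
    ∫⁻ p, ‖tripleKernel K₁ K₂ K₃ f g x w p‖ₑ ≤
      ‖K₁ (x - w)‖ₑ * ((eLpNorm K₂ 2 volume * ‖f‖ₑ) * (eLpNorm K₃ 2 volume * ‖g‖ₑ)) := by
  have hf : Measurable fun y => ‖f y‖ₑ := (Lp.stronglyMeasurable f).enorm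
  have hg : Measurable fun y => ‖g y‖ₑ := (Lp.stronglyMeasurable g).enorm
  have hK2 : Measurable fun y => ‖K₂ (w - y)‖ₑ :=
    (K₂.continuous.comp (continuous_const.sub continuous_id)).measurable.enorm
  have hK3 : Measurable fun y => ‖K₃ (w - y)‖ₑ :=
    (K₃.continuous.comp (continuous_const.sub continuous_id)).measurable.enorm
  simp only [tripleKernel, enorm_smul, enorm_mul]
  rw [lintegral_const_mul' _ _ (by simp), Measure.volume_eq_prod]
  refine mul_le_mul' le_rfl ?_
  rw [lintegral_prod_mul (f := fun y => ‖K₂ (w - y)‖ₑ * ‖f y‖ₑ)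
    (g := fun y => ‖K₃ (w - y)‖ₑ * ‖g y‖ₑ) (hK2.mul hf).aemeasurable (hK3.mul hg).aemeasurable]
  exact mul_le_mul' (lintegral_enorm_mul_le K₂ f w) (lintegral_enorm_mul_le K₃ g w)

theorem integrable_tripleKernel (K₁ K₂ K₃ : 𝓢(E d, ℂ)) (f : L2 d ℂ) (g : L2 d V) (x : E d) :
    Integrable (Function.uncurry (tripleKernel K₁ K₂ K₃ f g x))
      (volume.prod (volume : Measure (E d × E d))) := by
  refine ⟨measurable_tripleKernel K₁ K₂ K₃ f g x, ?_⟩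
  rw [hasFiniteIntegral_iff_enorm, lintegral_prod _ (measurable_tripleKernel K₁ K₂ K₃ f g x).enorm]
  refine lt_of_le_of_lt (lintegral_mono (lintegral_tripleKernel_le K₁ K₂ K₃ f g x)) ?_
  have hc : (eLpNorm K₂ 2 volume * ‖f‖ₑ) * (eLpNorm K₃ 2 volume * ‖g‖ₑ) ≠ ⊤ :=
    ENNReal.mul_ne_top (ENNReal.mul_ne_top (K₂.memLp 2 volume).2.ne (by simp))
      (ENNReal.mul_ne_top (K₃.memLp 2 volume).2.ne (by simp))
  rw [lintegral_mul_const' _ _ hc]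
  refine ENNReal.mul_lt_top ?_ hc.lt_top
  have := (memLp_schwartz_shift K₁ x 1).2
  rwa [eLpNorm_one_eq_lintegral_enorm] at this

/-- Fubini isolates an integral over the intermediate point w that involves only the three kernels.
The vanishing of frequencies of a product is thereby reduced to a statement about Schwartz
functions. -/
theorem conv_mul_eq (K₁ K₂ K₃ : 𝓢(E d, ℂ)) (f : L2 d ℂ) (g : L2 d V) (x : E d) :
    conv K₁ (fun w => conv K₂ f w • conv K₃ g w) x =
      ∫ p : E d × E d, (∫ w, K₁ (x - w) * (K₂ (w - p.1) * K₃ (w - p.2))) • (f p.1 • g p.2) := by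
  have h1 : ∀ w, K₁ (x - w) • (conv K₂ f w • conv K₃ g w) =
      ∫ p, tripleKernel K₁ K₂ K₃ f g x w p := by
    intro w
    simp only [tripleKernel]
    rw [integral_smul, Measure.volume_eq_prod, integral_prod_smul (fun y => K₂ (w - y) * f y)
      (fun z => K₃ (w - z) • g z)]
    rfl
  rw [conv]
  simp_rw [h1]
  rw [integral_integral_swap (integrable_tripleKernel K₁ K₂ K₃ f g x)]
  refine integral_congr_ae (.of_forall fun p => ?_)
  have h3 : ∀ w, tripleKernel K₁ K₂ K₃ f g x w p =
      (K₁ (x - w) * (K₂ (w - p.1) * K₃ (w - p.2))) • (f p.1 • g p.2) := by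
    intro w
    simp only [tripleKernel, smul_smul]
    congr 1; ring
  simp_rw [h3]
  rw [integral_smul_const]

/-- A product of two functions has no frequencies outside the sum of their frequency supports. -/
theorem conv_mul_eq_zero (m₁ m₂ m₃ : 𝓢(E d, ℂ)) (h : ∀ ξ η, m₁ (ξ + η) * (m₂ ξ * m₃ η) = 0)
    (f : L2 d ℂ) (g : L2 d V) (x : E d) :
    conv (𝓕⁻ m₁ : 𝓢(E d, ℂ)) (fun w => conv (𝓕⁻ m₂ : 𝓢(E d, ℂ)) f w •
      conv (𝓕⁻ m₃ : 𝓢(E d, ℂ)) g w) x = 0 := by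
  rw [conv_mul_eq]
  simp_rw [integral_kernels_eq_zero m₁ m₂ m₃ h]
  simp

/-! ### Dilations of symbols and bounds for the kernels -/

/-- The linear map `ξ ↦ c ξ`. -/
def homot (c : ℝ) (hc : c ≠ 0) : E d ≃L[ℝ] E d :=
  ContinuousLinearEquiv.smulLeft (Units.mk0 c hc)

/-- The symbol `ξ ↦ m(2^{-k} ξ)`. -/
def dil (k : ℕ) (m : 𝓢(E d, ℂ)) : 𝓢(E d, ℂ) :=
  SchwartzMap.compCLMOfContinuousLinearEquiv ℂ (homot ((2 ^ k)⁻¹ : ℝ) (by positivity)) m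

theorem dil_apply (k : ℕ) (m : 𝓢(E d, ℂ)) (ξ : E d) : dil k m ξ = m ((2 ^ k : ℝ)⁻¹ • ξ) := rfl

theorem fourierInv_dil (k : ℕ) (m : 𝓢(E d, ℂ)) (y : E d) :
    (𝓕⁻ (dil k m) : 𝓢(E d, ℂ)) y =
      (((2 : ℝ) ^ k) ^ d : ℝ) • (𝓕⁻ m : 𝓢(E d, ℂ)) ((2 ^ k : ℝ) • y) := by
  rw [SchwartzMap.fourierInv_coe, SchwartzMap.fourierInv_coe, Real.fourierInv_eq',
    Real.fourierInv_eq']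
  have h := Measure.integral_comp_smul (volume : Measure (E d)) (fun v : E d =>
    Complex.exp (↑(2 * Real.pi * inner ℝ v ((2 ^ k : ℝ) • y)) * Complex.I) • m v) ((2 ^ k : ℝ)⁻¹)
  have h2 : |(((2 ^ k : ℝ)⁻¹) ^ Module.finrank ℝ (E d))⁻¹| = ((2 : ℝ) ^ k) ^ d := by
    rw [abs_of_pos (by positivity)]; simp
  rw [h2] at h
  rw [← h]
  refine integral_congr_ae (.of_forall fun v => ?_)
  simp only [dil_apply]
  congr 4
  rw [inner_smul_left, inner_smul_right]
  have : (2 : ℝ) ^ k ≠ 0 := by positivity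
  simp only [conj_trivial]
  field_simp

/-- A bound for the derivatives of a kernel, in terms of a finite number of seminorms. -/
def kerBound (K : 𝓢(E d, ℂ)) (n : ℕ) : ℝ :=
  2 ^ (2 * d + 3) * ((Finset.Iic (2 * d + 3, n)).sup fun m => SchwartzMap.seminorm ℝ m.1 m.2) K

theorem kerBound_nonneg (K : 𝓢(E d, ℂ)) (n : ℕ) : 0 ≤ kerBound K n :=
  mul_nonneg (by positivity) (apply_nonneg _ _)

/-- The decay exponent 2d+3 exceeds that of `maj` by one. The spare power absorbs the factor ‖y‖ in
`norm_mul_ker_le_maj`, which the commutator needs. -/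
theorem norm_iteratedFDeriv_le_kerBound (K : 𝓢(E d, ℂ)) {n j : ℕ} (hj : j ≤ n) (y : E d) :
    ‖iteratedFDeriv ℝ j K y‖ ≤ kerBound K n * ((1 + ‖y‖) ^ (2 * d + 3))⁻¹ := by
  have h := SchwartzMap.one_add_le_sup_seminorm_apply (𝕜 := ℝ) (m := (2 * d + 3, n))
    (k := 2 * d + 3) (n := j) le_rfl hj K y
  rw [← div_eq_mul_inv, le_div_iff₀ (by positivity), mul_comm]
  exact h

theorem maj_zero (y : E d) : maj 0 y = ((1 + ‖y‖) ^ (2 * d + 2))⁻¹ := by simp [maj]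

theorem maj_eq (k : ℕ) (y : E d) : maj k y = (2 ^ k) ^ d * maj 0 ((2 ^ k : ℝ) • y) := by
  simp [maj, norm_smul]

theorem norm_fderiv_le_maj (K : 𝓢(E d, ℂ)) {n j : ℕ} (hj : j ≤ n) (y : E d) :
    ‖iteratedFDeriv ℝ j K y‖ ≤ kerBound K n * maj 0 y := by
  refine (norm_iteratedFDeriv_le_kerBound K hj y).trans ?_
  rw [maj_zero]
  gcongr
  · exact kerBound_nonneg K n
  · linarith [norm_nonneg y]
  · norm_num

theorem norm_mul_ker_le_maj (K : 𝓢(E d, ℂ)) (n : ℕ) (y : E d) :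
    ‖y‖ * ‖K y‖ ≤ kerBound K n * maj 0 y := by
  have h := norm_iteratedFDeriv_le_kerBound K (Nat.zero_le n) y
  rw [norm_iteratedFDeriv_zero] at h
  rw [maj_zero]
  calc ‖y‖ * ‖K y‖ ≤ (1 + ‖y‖) * (kerBound K n * ((1 + ‖y‖) ^ (2 * d + 3))⁻¹) := by
        gcongr; linarith
    _ = _ := by
        rw [show 2 * d + 3 = (2 * d + 2) + 1 by ring, pow_succ]
        have : 1 + ‖y‖ ≠ 0 := by positivity
        field_simp

theorem norm_dil_le (k : ℕ) (m : 𝓢(E d, ℂ)) (y : E d) :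
    ‖(𝓕⁻ (dil k m) : 𝓢(E d, ℂ)) y‖ ≤ kerBound (𝓕⁻ m) 0 * maj k y := by
  rw [fourierInv_dil, norm_smul, maj_eq, mul_left_comm, Real.norm_of_nonneg (by positivity)]
  gcongr
  have := norm_fderiv_le_maj (𝓕⁻ m : 𝓢(E d, ℂ)) (le_refl 0) ((2 ^ k : ℝ) • y)
  rwa [norm_iteratedFDeriv_zero] at this

theorem norm_mul_dil_le (k : ℕ) (m : 𝓢(E d, ℂ)) (y : E d) :
    2 ^ k * (‖y‖ * ‖(𝓕⁻ (dil k m) : 𝓢(E d, ℂ)) y‖) ≤ kerBound (𝓕⁻ m) 0 * maj k y := by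
  rw [fourierInv_dil, norm_smul, maj_eq, mul_left_comm (kerBound _ _),
    Real.norm_of_nonneg (by positivity)]
  have := norm_mul_ker_le_maj (𝓕⁻ m : 𝓢(E d, ℂ)) 0 ((2 ^ k : ℝ) • y)
  rw [norm_smul, Real.norm_of_nonneg (by positivity)] at this
  calc _ = (2 ^ k) ^ d * (2 ^ k * ‖y‖ * ‖(𝓕⁻ m : 𝓢(E d, ℂ)) ((2 ^ k : ℝ) • y)‖) := by ring
    _ ≤ _ := by gcongr

/-- For ‖y‖ ≥ 1 the triangle inequality suffices. For ‖y‖ ≤ 1 the mean value inequality is used on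
the segment from z - y to z, where 1 + ‖w‖ is at least (1 + ‖z‖)/2; this gives the constant
2^{2d+2}. -/
theorem norm_sub_le_maj (K : 𝓢(E d, ℂ)) (z y : E d) :
    ‖K z - K (z - y)‖ ≤ 2 ^ (2 * d + 2) * kerBound K 1 * ‖y‖ * (maj 0 z + maj 0 (z - y)) := by
  have hC := kerBound_nonneg K 1
  have m1 := maj_nonneg 0 z
  have m2 := maj_nonneg 0 (z - y)
  have h2 : (1 : ℝ) ≤ 2 ^ (2 * d + 2) := one_le_pow₀ (by norm_num)
  rcases le_total 1 ‖y‖ with hy | hy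
  · have a := norm_fderiv_le_maj K (Nat.zero_le 1) z
    have b := norm_fderiv_le_maj K (Nat.zero_le 1) (z - y)
    rw [norm_iteratedFDeriv_zero] at a b
    have h3 : 1 ≤ 2 ^ (2 * d + 2) * ‖y‖ := one_le_mul_of_one_le_of_one_le h2 hy
    calc ‖K z - K (z - y)‖ ≤ 1 * (kerBound K 1 * (maj 0 z + maj 0 (z - y))) := by
          refine (norm_sub_le _ _).trans ?_
          linarith
      _ ≤ (2 ^ (2 * d + 2) * ‖y‖) * (kerBound K 1 * (maj 0 z + maj 0 (z - y))) := by gcongr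
      _ = _ := by ring
  · have key : ∀ w ∈ segment ℝ (z - y) z, ‖fderiv ℝ K w‖ ≤ 2 ^ (2 * d + 2) * kerBound K 1 * maj 0 z := by
      intro w hw
      have hd : ‖z - w‖ ≤ ‖y‖ := by
        obtain ⟨a, b, ha, hb, hab, rfl⟩ := hw
        have : z - (a • (z - y) + b • z) = a • y := by
          have hb' : b = 1 - a := by linarith
          rw [hb']; module
        rw [this, norm_smul, Real.norm_of_nonneg ha]
        exact mul_le_of_le_one_left (norm_nonneg y) (by linarith)
      have h3 := norm_fderiv_le_maj K (le_refl 1) w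
      rw [norm_iteratedFDeriv_one] at h3
      refine h3.trans ?_
      rw [mul_comm (2 ^ (2 * d + 2) : ℝ), mul_assoc]
      gcongr
      rw [maj_zero, maj_zero, ← div_eq_mul_inv, inv_eq_one_div, div_le_div_iff₀ (by positivity) (by positivity), one_mul,
        ← mul_pow]
      gcongr
      have : ‖z‖ ≤ ‖w‖ + ‖z - w‖ := by
        have := norm_add_le w (z - w); rwa [add_sub_cancel] at this
      linarith [norm_nonneg w]
    have h4 := (convex_segment (z - y) z).norm_image_sub_le_of_norm_fderiv_le
      (fun w _ => K.differentiableAt) key (left_mem_segment ℝ _ _) (right_mem_segment ℝ _ _)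
    refine h4.trans ?_
    rw [sub_sub_cancel]
    calc _ = 2 ^ (2 * d + 2) * kerBound K 1 * ‖y‖ * maj 0 z := by ring
      _ ≤ _ := by gcongr; linarith

theorem norm_sub_dil_le (k : ℕ) (m : 𝓢(E d, ℂ)) (z y : E d) :
    ‖(𝓕⁻ (dil k m) : 𝓢(E d, ℂ)) z - (𝓕⁻ (dil k m) : 𝓢(E d, ℂ)) (z - y)‖ ≤
      2 ^ (2 * d + 2) * kerBound (𝓕⁻ m) 1 * (2 ^ k * ‖y‖) * (maj k z + maj k (z - y)) := by
  rw [fourierInv_dil, fourierInv_dil, ← smul_sub, norm_smul, maj_eq k z, maj_eq k (z - y),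
    Real.norm_of_nonneg (by positivity), smul_sub]
  have := norm_sub_le_maj (𝓕⁻ m : 𝓢(E d, ℂ)) ((2 ^ k : ℝ) • z) ((2 ^ k : ℝ) • y)
  rw [norm_smul, Real.norm_of_nonneg (by positivity : (0 : ℝ) ≤ 2 ^ k)] at this
  refine (mul_le_mul_of_nonneg_left this (by positivity)).trans (le_of_eq ?_)
  ring

/-- The kernel of a dilated symbol is dominated by the standard majorant. -/
theorem enorm_conv_dil_le (k : ℕ) (m : 𝓢(E d, ℂ)) (f : E d → V) (x : E d) :
    ‖conv (𝓕⁻ (dil k m) : 𝓢(E d, ℂ)) f x‖ₑ ≤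
      ENNReal.ofReal (kerBound (𝓕⁻ m) 0) * mconv k (fun y => ‖f y‖ₑ) x := by
  refine (enorm_integral_le_lintegral_enorm _).trans ?_
  rw [mconv, ← lintegral_const_mul' _ _ ENNReal.ofReal_ne_top]
  refine lintegral_mono fun y => ?_
  rw [enorm_smul, ← mul_assoc]
  gcongr
  rw [← ENNReal.ofReal_mul (kerBound_nonneg _ _), ← ofReal_norm]
  exact ENNReal.ofReal_le_ofReal (norm_dil_le k m _)

end LocalEnergy

end

noncomputable section

namespace LocalEnergy

open scoped SchwartzMap

variable {d : ℕ} {V : Type*} [NormedAddCommGroup V] [InnerProductSpace ℂ V] [CompleteSpace V]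

namespace Decomposition

variable (P : Decomposition d)

/-! ### The symbols of the Littlewood-Paley decomposition -/

theorem phi_le_one {r : ℝ} (hr : 0 ≤ r) : P.phi r ≤ 1 := by
  rw [← P.phi_one 0 le_rfl zero_le_one]
  exact P.phi_antitone Set.self_mem_Ici hr hr

/-- The cutoff is constant near the origin, the only point at which the norm is not smooth. -/
theorem contDiff_phi_norm : ContDiff ℝ ∞ fun ξ : E d => ((P.phi ‖ξ‖ : ℝ) : ℂ) := by
  rw [contDiff_iff_contDiffAt]
  intro ξ
  by_cases h : ξ = 0
  · have : (fun ξ : E d => ((P.phi ‖ξ‖ : ℝ) : ℂ)) =ᶠ[nhds ξ] fun _ => 1 := by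
      rw [h]
      filter_upwards [Metric.ball_mem_nhds (0 : E d) one_pos] with η hη
      rw [P.phi_one _ (norm_nonneg _) (mem_ball_zero_iff.1 hη).le]
      simp
    exact contDiffAt_const.congr_of_eventuallyEq this
  · exact Complex.ofRealCLM.contDiff.contDiffAt.comp ξ
      (P.phi_smooth.contDiffAt.comp ξ (contDiffAt_norm ℝ h))

theorem hasCompactSupport_phi_norm : HasCompactSupport fun ξ : E d => ((P.phi ‖ξ‖ : ℝ) : ℂ) := by
  refine HasCompactSupport.of_support_subset_isCompact (isCompact_closedBall (0 : E d) 2) ?_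
  intro ξ hξ
  rw [mem_closedBall_zero_iff]
  by_contra hcon
  exact hξ (by simp [P.phi_zero _ (not_le.1 hcon).le])

/-- The symbol of `S_0`. -/
def base : 𝓢(E d, ℂ) := P.hasCompactSupport_phi_norm.toSchwartzMap P.contDiff_phi_norm

theorem base_apply (ξ : E d) : P.base ξ = P.phi ‖ξ‖ := rfl

/-- The symbol `φ_0(2^{-N}|ξ|)`. -/
def low (N : ℕ) : 𝓢(E d, ℂ) := dil N P.base

theorem low_apply (N : ℕ) (ξ : E d) : P.low N ξ = P.phi ((2 : ℝ) ^ (-(N : ℝ)) * ‖ξ‖) := by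
  rw [low, dil_apply, base_apply, norm_smul, norm_inv, Real.norm_of_nonneg (by positivity),
    Real.rpow_neg (by norm_num), Real.rpow_natCast]

/-- The symbol `φ_0(|ξ|) - φ_0(2|ξ|)`. -/
def ann : 𝓢(E d, ℂ) :=
  P.base - SchwartzMap.compCLMOfContinuousLinearEquiv ℂ (homot 2 two_ne_zero) P.base

theorem ann_apply (ξ : E d) : P.ann ξ = P.phi ‖ξ‖ - P.phi (2 * ‖ξ‖) := by
  change P.base ξ - P.base ((2 : ℝ) • ξ) = _
  rw [base_apply, base_apply, norm_smul]; simp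

/-- The symbol of `S_k`. -/
def sym (k : ℕ) : 𝓢(E d, ℂ) := dil k (if k = 0 then P.base else P.ann)

theorem sym_apply (k : ℕ) (ξ : E d) : P.sym k ξ = P.phiK k ‖ξ‖ := by
  rw [sym, dil_apply, phiK]
  split_ifs with h
  · subst h; simp [base_apply]
  · rw [ann_apply, norm_smul, norm_inv, Real.norm_of_nonneg (by positivity),
      Real.rpow_neg (by norm_num), Real.rpow_add (by norm_num), Real.rpow_neg (by norm_num),
      Real.rpow_natCast, Real.rpow_one]
    push_cast
    rw [show (2:ℝ) * ((2^k)⁻¹ * ‖ξ‖) = (2^k)⁻¹ * 2 * ‖ξ‖ by ring]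

theorem coe_sym (k : ℕ) : (fun ξ : E d => (P.phiK k ‖ξ‖ : ℂ)) = P.sym k := by
  funext ξ; rw [sym_apply]

theorem sum_phiK (N : ℕ) (r : ℝ) :
    ∑ k ∈ Finset.range (N + 1), P.phiK k r = P.phi ((2 : ℝ) ^ (-(N : ℝ)) * r) := by
  induction N with
  | zero => simp [phiK]
  | succ N ih =>
    rw [Finset.sum_range_succ, ih, phiK]
    simp only [Nat.add_eq_zero_iff, one_ne_zero, and_false, if_false]
    push_cast
    rw [show -((N : ℝ) + 1) + 1 = -(N : ℝ) by ring]; ring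

theorem phiK_eq_zero_of_le {k : ℕ} {r : ℝ} (h : 2 ^ (k + 1) ≤ r) : P.phiK k r = 0 := by
  have hr : (0 : ℝ) ≤ r := le_trans (by positivity) h
  have h1 : 2 ≤ (2 : ℝ) ^ (-(k : ℝ)) * r := by
    rw [Real.rpow_neg (by norm_num), Real.rpow_natCast, ← div_eq_inv_mul, le_div_iff₀ (by positivity)]
    calc (2 : ℝ) * 2 ^ k = 2 ^ (k + 1) := by ring
      _ ≤ r := h
  unfold phiK
  split_ifs with hk
  · subst hk; exact P.phi_zero _ (by simpa using h)
  · rw [P.phi_zero _ h1, P.phi_zero, sub_zero]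
    rw [Real.rpow_add (by norm_num), Real.rpow_one]; linarith

theorem phiK_eq_zero_of_ge {k : ℕ} (hk : 0 < k) {r : ℝ} (hr : 0 ≤ r) (h : r ≤ 2 ^ (k - 1)) :
    P.phiK k r = 0 := by
  obtain ⟨k, rfl⟩ := Nat.exists_eq_succ_of_ne_zero hk.ne'
  have h1 : (2 : ℝ) ^ (-((k : ℝ) + 1) + 1) * r ≤ 1 := by
    rw [show -((k : ℝ) + 1) + 1 = -(k : ℝ) by ring, Real.rpow_neg (by norm_num), Real.rpow_natCast,
      ← div_eq_inv_mul, div_le_one (by positivity)]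
    simpa using h
  have h2 : (2 : ℝ) ^ (-((k : ℝ) + 1)) * r ≤ 1 := by
    refine le_trans ?_ h1
    gcongr <;> linarith
  unfold phiK
  simp only [Nat.succ_ne_zero, if_false]
  push_cast
  rw [P.phi_one _ (by positivity) h1, P.phi_one _ (by positivity) h2, sub_self]

theorem low_eq_one {N : ℕ} {ξ : E d} (h : ‖ξ‖ ≤ 2 ^ N) : P.low N ξ = 1 := by
  rw [low_apply, P.phi_one _ (by positivity)]
  · simp
  · rw [Real.rpow_neg (by norm_num), Real.rpow_natCast, ← div_eq_inv_mul, div_le_one (by positivity)]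
    exact h

theorem sym_eq_zero_of_le {k : ℕ} {ξ : E d} (h : 2 ^ (k + 1) ≤ ‖ξ‖) : P.sym k ξ = 0 := by
  rw [sym_apply, P.phiK_eq_zero_of_le h]; simp

theorem sym_eq_zero_of_ge {k : ℕ} (hk : 0 < k) {ξ : E d} (h : ‖ξ‖ ≤ 2 ^ (k - 1)) :
    P.sym k ξ = 0 := by
  rw [sym_apply, P.phiK_eq_zero_of_ge hk (norm_nonneg _) h]; simp

theorem norm_low_le (N : ℕ) (ξ : E d) : ‖P.low N ξ‖ ≤ 1 := by
  rw [low_apply, Complex.norm_real, Real.norm_of_nonneg (P.phi_nonneg _ (by positivity))]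
  exact P.phi_le_one (by positivity)

theorem low_mul_sym {k N : ℕ} (h : k < N) (ξ : E d) : P.low N ξ * P.sym k ξ = P.sym k ξ := by
  rcases le_total ‖ξ‖ (2 ^ N) with h1 | h1
  · rw [P.low_eq_one h1, one_mul]
  · rw [P.sym_eq_zero_of_le (le_trans (pow_le_pow_right₀ (by norm_num) h) h1), mul_zero]

theorem sym_mul_sym {j k : ℕ} (h : j + 1 < k ∨ k + 1 < j) (ξ : E d) :
    P.sym j ξ * P.sym k ξ = 0 := by
  rcases h with h | h
  · rcases le_total ‖ξ‖ (2 ^ (k - 1)) with h1 | h1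
    · rw [P.sym_eq_zero_of_ge (by omega) h1, mul_zero]
    · rw [P.sym_eq_zero_of_le (le_trans (pow_le_pow_right₀ (by norm_num) (by omega)) h1), zero_mul]
  · rcases le_total ‖ξ‖ (2 ^ (j - 1)) with h1 | h1
    · rw [P.sym_eq_zero_of_ge (by omega) h1, zero_mul]
    · rw [P.sym_eq_zero_of_le (k := k) (le_trans (pow_le_pow_right₀ (by norm_num) (by omega)) h1), mul_zero]

theorem memLp_sym (k : ℕ) : MemLp (P.sym k) ⊤ volume := (P.sym k).memLp_top volume

theorem memLp_low (N : ℕ) : MemLp (P.low N) ⊤ volume := (P.low N).memLp_top volume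

theorem sum_sym (N : ℕ) (ξ : E d) : ∑ k ∈ Finset.range (N + 1), P.sym k ξ = P.low N ξ := by
  simp_rw [sym_apply, low_apply, ← P.sum_phiK N ‖ξ‖]
  push_cast; rfl

/-! ### The Littlewood-Paley projections -/

theorem S_apply (k : ℕ) (u : ℝ → L2 d V) (t : ℝ) : P.S k u t = fourierMul (P.sym k) (u t) := by
  rw [S, coe_sym]

theorem SLt_apply (N : ℕ) (u : ℝ → L2 d V) (t : ℝ) :
    P.SLt N u t = ∑ k ∈ Finset.range N, P.S k u t := by
  rw [SLt, Finset.sum_apply]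

theorem SLt_succ_apply (N : ℕ) (u : ℝ → L2 d V) (t : ℝ) :
    P.SLt (N + 1) u t = fourierMul (P.low N) (u t) := by
  rw [SLt_apply]
  have h : ∀ M, ∑ k ∈ Finset.range (M + 1), P.S k u t =
      fourierMul (fun ξ => ∑ k ∈ Finset.range (M + 1), P.sym k ξ) (u t) := by
    intro M
    induction M with
    | zero => simp [S_apply]
    | succ M ih =>
      rw [Finset.sum_range_succ, ih, S_apply, ← fourierMul_sym_add ?_ (P.memLp_sym _)]
      · simp_rw [Finset.sum_range_succ _ (M + 1)]
      · simp_rw [sum_sym]; exact P.memLp_low M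
  rw [h]
  simp_rw [sum_sym]

theorem tendsto_SLt (u : ℝ → L2 d V) (t : ℝ) :
    Filter.Tendsto (fun N => P.SLt N u t) Filter.atTop (nhds (u t)) := by
  rw [← Filter.tendsto_add_atTop_iff_nat 1]
  simp_rw [SLt_succ_apply]
  refine tendsto_fourierMul (fun N => (P.low N).continuous) (fun N ξ => P.norm_low_le N ξ) ?_ _
  intro ξ
  obtain ⟨M, hM⟩ := pow_unbounded_of_one_lt ‖ξ‖ (by norm_num : (1 : ℝ) < 2)
  refine tendsto_const_nhds.congr' ?_
  filter_upwards [Filter.eventually_ge_atTop M] with N hN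
  rw [P.low_eq_one]
  exact hM.le.trans (pow_le_pow_right₀ (by norm_num) hN)

theorem S_S_eq_zero {j k : ℕ} (h : j + 1 < k ∨ k + 1 < j) (u : ℝ → L2 d V) :
    P.S j (P.S k u) = 0 := by
  funext t
  rw [S_apply, S_apply, fourierMul_fourierMul _ (P.memLp_sym k)]
  have : (fun ξ => P.sym j ξ * P.sym k ξ) = fun _ => 0 := funext (P.sym_mul_sym h)
  rw [this, fourierMul_sym_zero]; rfl

/-- `S_k u` is reproduced by the low frequency multipliers. -/
theorem low_S {k N : ℕ} (h : k < N) (u : ℝ → L2 d V) (t : ℝ) :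
    fourierMul (P.low N) (P.S k u t) = P.S k u t := by
  rw [S_apply, fourierMul_fourierMul _ (P.memLp_sym k)]
  congr 1; funext ξ; exact P.low_mul_sym h ξ

theorem S_eq_sum (k : ℕ) (u : ℝ → L2 d V) (t : ℝ) :
    P.S k u t = ∑ j ∈ Finset.Icc (k - 1) (k + 1), P.S j (P.S k u) t := by
  have h := P.low_S (Nat.lt_succ_self k) u t
  rw [← SLt_succ_apply P (k + 1) (P.S k u) t, SLt_apply] at h
  rw [← h]
  symm
  refine Finset.sum_subset (fun j hj => ?_) fun j hj hj' => ?_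
  · simp at hj ⊢; omega
  · have : j + 1 < k ∨ k + 1 < j := by simp at hj hj'; omega
    rw [P.S_S_eq_zero this]; rfl

theorem aesm_S {u : ℝ → L2 d V} (hu : AEStronglyMeasurable u timeMeasure) (k : ℕ) :
    AEStronglyMeasurable (P.S k u) timeMeasure := by
  have : P.S k u = fun t => fmul (P.sym k) (P.memLp_sym k) (u t) := by
    funext t; rw [S_apply, fmul_apply]
  rw [this]
  exact (fmul (V := V) (P.sym k) (P.memLp_sym k)).continuous.comp_aestronglyMeasurable hu

/-- The constant in the bounds for the kernels of `S_k`. -/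
def kerC : ℝ≥0 :=
  (max (kerBound (𝓕⁻ P.base) 0) (max (kerBound (𝓕⁻ P.ann) 0) (kerBound (𝓕⁻ (dil 1 P.base)) 0))).toNNReal

theorem enorm_S_le (k : ℕ) (u : ℝ → L2 d V) (t : ℝ) :
    ∀ᵐ x, ‖P.S k u t x‖ₑ ≤ P.kerC * mconv k (fun y => ‖u t y‖ₑ) x := by
  rw [S_apply]
  filter_upwards [fourierMul_ae_eq_conv (P.sym k) (u t)] with x hx
  rw [hx, sym]
  refine (enorm_conv_dil_le k _ _ x).trans ?_
  gcongr
  refine ENNReal.ofReal_le_ofReal ?_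
  split_ifs <;> simp

theorem dil_dil (j k : ℕ) (m : 𝓢(E d, ℂ)) : dil j (dil k m) = dil (j + k) m := by
  ext ξ
  simp only [dil_apply, smul_smul]
  congr 2; rw [pow_add, mul_inv, mul_comm]

/-- The multiplier `low (k+1)` reproduces S_k u, and its kernel is the dilate at scale 2^{-k} of
that of `dil 1 P.base`. Having S_k u on the right too is what bounds it pointwise by its own
profile. -/
theorem enorm_S_le_self (k : ℕ) (u : ℝ → L2 d V) (t : ℝ) :
    ∀ᵐ x, ‖P.S k u t x‖ₑ ≤ P.kerC * mconv k (fun y => ‖P.S k u t y‖ₑ) x := by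
  have h := fourierMul_ae_eq_conv (P.low (k + 1)) (P.S k u t)
  rw [P.low_S (Nat.lt_succ_self k)] at h
  filter_upwards [h] with x hx
  rw [hx, low, ← dil_dil]
  refine (enorm_conv_dil_le k _ _ x).trans ?_
  gcongr
  exact ENNReal.ofReal_le_ofReal (by simp)

end Decomposition

/-! ### The profile of a function -/

/-- The `L²` norms of `u(t)` on the unit cubes. -/
def prof (u : ℝ → L2 d V) : Prof d := fun t => pr2 fun x => ‖u t x‖ₑ

theorem measurable_enorm (f : L2 d V) : Measurable fun x => ‖f x‖ₑ :=
  (Lp.stronglyMeasurable f).enorm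

theorem enorm_eq_rt (f : L2 d V) : ‖f‖ₑ = rt (∫⁻ x, ‖f x‖ₑ ^ 2) := by
  rw [Lp.enorm_def, eLpNorm_eq_lintegral_rpow_enorm_toReal (by simp) (by simp)]
  simp [rt]

theorem eLpNorm_cube (l : ℕ) (m : Idx d) (f : L2 d V) :
    eLpNorm f 2 (volume.restrict (cube l m)) ^ 2 = ∫⁻ x in cube l m, ‖f x‖ₑ ^ 2 := by
  rw [eLpNorm_eq_lintegral_rpow_enorm_toReal (by simp) (by simp), ← rt_sq (∫⁻ x in cube l m, ‖f x‖ₑ ^ 2)]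
  simp [rt]

theorem tsum_prof_sq (u : ℝ → L2 d V) (t : ℝ) : rt (∑' n, prof u t n ^ 2) = ‖u t‖ₑ := by
  rw [enorm_eq_rt, ← tsum_pr2_sq]; rfl

theorem prof_le (u : ℝ → L2 d V) (t : ℝ) (n : Idx d) : prof u t n ≤ ‖u t‖ₑ := by
  rw [← tsum_prof_sq, ← rt_of_sq (prof u t n)]
  exact rt_mono (ENNReal.le_tsum n)

theorem memLp_indicator_cube (l : ℕ) (m : Idx d) :
    MemLp ((cube l m : Set (E d)).indicator fun _ => (1 : ℂ)) ⊤ volume :=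
  memLp_top_of_bound ((measurable_const.indicator (measurableSet_cube l m)).aestronglyMeasurable) 1
    (.of_forall fun x => by
      by_cases hx : x ∈ (cube l m : Set (E d)) <;> simp [hx])

/-- Restriction to a cube. -/
def toCube (l : ℕ) (m : Idx d) : L2 d V →L[ℂ] L2 d V := bmul _ (memLp_indicator_cube l m)

theorem toCube_ae (l : ℕ) (m : Idx d) (f : L2 d V) :
    toCube l m f =ᵐ[volume] (cube l m : Set (E d)).indicator f := by
  filter_upwards [bmul_ae (memLp_indicator_cube l m) f] with x hx
  rw [toCube, hx]
  by_cases h : x ∈ (cube l m : Set (E d)) <;> simp [h]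

theorem enorm_toCube (l : ℕ) (m : Idx d) (f : L2 d V) :
    ‖toCube l m f‖ₑ = rt (∫⁻ x in cube l m, ‖f x‖ₑ ^ 2) := by
  rw [enorm_eq_rt, ← lintegral_indicator (measurableSet_cube l m)]
  congr 1
  refine lintegral_congr_ae ?_
  filter_upwards [toCube_ae l m f] with x hx
  rw [hx]
  by_cases h : x ∈ (cube l m : Set (E d)) <;> simp [h]

theorem measP_prof {u : ℝ → L2 d V} (hu : AEStronglyMeasurable u timeMeasure) : MeasP (prof u) := by
  intro n
  have : (fun t => prof u t n) = fun t => ‖toCube 0 n (u t)‖ₑ := by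
    funext t; rw [enorm_toCube]; rfl
  rw [this]
  exact ((toCube (V := V) 0 n).continuous.comp_aestronglyMeasurable hu).enorm

theorem prof_add_le (u v : ℝ → L2 d V) (t : ℝ) (n : Idx d) :
    prof (u + v) t n ≤ prof u t n + prof v t n := by
  refine le_trans (pr2_mono ?_ n) (pr2_add_le (measurable_enorm (u t)) (measurable_enorm (v t)) n)
  filter_upwards [Lp.coeFn_add (u t) (v t)] with x hx
  rw [Pi.add_apply, hx]; exact enorm_add_le _ _

theorem prof_zero (t : ℝ) (n : Idx d) : prof (0 : ℝ → L2 d V) t n = 0 := by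
  have := prof_le (0 : ℝ → L2 d V) t n
  simpa using this

theorem prof_sum_le {ι : Type*} (s : Finset ι) (u : ι → ℝ → L2 d V) (t : ℝ) (n : Idx d) :
    prof (∑ i ∈ s, u i) t n ≤ ∑ i ∈ s, prof (u i) t n := by
  classical
  induction s using Finset.induction_on with
  | empty => simp [prof_zero]
  | insert a s ha ih =>
    rw [Finset.sum_insert ha, Finset.sum_insert ha]
    exact (prof_add_le _ _ t n).trans (add_le_add le_rfl ih)

theorem prof_congr {u v : ℝ → L2 d V} {t : ℝ} (h : u t = v t) (n : Idx d) :
    prof u t n = prof v t n := by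
  unfold prof; rw [h]

theorem xNorm_eq (u : ℝ → L2 d V) : xNorm u = LNorm.xN (prof u) := by
  rw [xNorm, LNorm.xN_apply]
  congr 1; funext l; congr 1; funext m
  congr 1
  rw [LNorm.mix2_apply, rt]
  congr 1
  refine lintegral_congr fun t => ?_
  rw [eLpNorm_cube, ← tsum_pr2_sq_cube]
  rfl

theorem eLpNorm_top_eq (u : ℝ → L2 d V) : eLpNorm u ⊤ timeMeasure = LNorm.mixTop (prof u) := by
  rw [eLpNorm_exponent_top, eLpNormEssSup, LNorm.mixTop_apply]
  simp_rw [tsum_prof_sq]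

theorem xjNorm_eq (j : ℕ) (u : ℝ → L2 d V) : xjNorm j u = LNorm.xjN j (prof u) := by
  rw [xjNorm, xNorm_eq, eLpNorm_top_eq, LNorm.xjN_apply]

namespace Decomposition

variable (P : Decomposition d)

theorem prof_S_le (k : ℕ) (u : ℝ → L2 d V) (t : ℝ) (n : Idx d) :
    prof (P.S k u) t n ≤ P.kerC * LNorm.smear wt (prof u) t n := by
  have h := measurable_mconv k (measurable_enorm (u t))
  refine (pr2_mono (P.enorm_S_le k u t) n).trans ?_
  rw [pr2_const_mul _ h]
  gcongr
  exact pr2_mconv_le k (measurable_enorm (u t)) n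

/-- The kernel of S_k lives at scale 2^{-k} ≤ 1 and so reaches other unit cubes only through its
summable tails. Hence S_k is bounded uniformly in k for every such norm, including ℓ¹ sums over
cubes of any side. -/
theorem norm_prof_S_le (N : LNorm d) (k : ℕ) {u : ℝ → L2 d V}
    (hu : AEStronglyMeasurable u timeMeasure) :
    N (prof (P.S k u)) ≤ P.kerC * (N.c * wtMass d) * N (prof u) := by
  refine (N.mono (.of_forall fun t n => P.prof_S_le k u t n)).trans ?_
  refine (N.smul_le _ ((measP_prof hu).smear wt)).trans ?_
  rw [mul_assoc]
  gcongr
  rw [coe_wtMass]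
  exact N.smear_le (measP_prof hu) wt

/-! ### Smooth and sharp localization to cubes -/

theorem chi_le_one (j : ℕ) (m : Idx d) (x : E d) : P.chi j m x ≤ 1 := by
  rw [← (P.chi_sum j x).tsum_eq]
  exact (P.chi_sum j x).summable.le_tsum m fun _ _ => P.chi_nonneg j _ x

theorem memLp_chi (j : ℕ) (m : Idx d) : MemLp (fun x => (P.chi j m x : ℂ)) ⊤ volume :=
  memLp_top_of_continuous (Complex.continuous_ofReal.comp (P.chi_smooth j m).continuous) (C := 1)
    fun x => by
      rw [Complex.norm_real, Real.norm_of_nonneg (P.chi_nonneg j m x)]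
      exact P.chi_le_one j m x

theorem cut_apply (j : ℕ) (m : Idx d) (u : ℝ → L2 d V) (t : ℝ) :
    P.cut j m u t = bmul _ (P.memLp_chi j m) (u t) := rfl

theorem aesm_cut {u : ℝ → L2 d V} (hu : AEStronglyMeasurable u timeMeasure) (j : ℕ) (m : Idx d) :
    AEStronglyMeasurable (P.cut j m u) timeMeasure :=
  (bmul (V := V) _ (P.memLp_chi j m)).continuous.comp_aestronglyMeasurable hu

theorem enorm_cut_ae (j : ℕ) (m : Idx d) (u : ℝ → L2 d V) (t : ℝ) :
    ∀ᵐ x, ‖P.cut j m u t x‖ₑ = ENNReal.ofReal (P.chi j m x) * ‖u t x‖ₑ := by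
  filter_upwards [bmul_ae (P.memLp_chi j m) (u t)] with x hx
  rw [cut_apply, hx, enorm_smul]
  congr 1
  rw [← ofReal_norm, Complex.norm_real, Real.norm_of_nonneg (P.chi_nonneg j m x)]

/-- The set of offsets between a cube and the cubes that meet the support of its cutoff. -/
def offsets : Finset (Idx d) :=
  Fintype.piFinset fun _ => Finset.Icc (-(⌈P.chi_supp.choose⌉ + 1)) (⌈P.chi_supp.choose⌉ + 1)

theorem mem_offsets {j : ℕ} {m : Idx d} {x : E d} (h : P.chi j m x ≠ 0) :
    parent j (idx x) - m ∈ P.offsets := by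
  have hx := P.chi_supp.choose_spec j m x h
  rw [offsets, Fintype.mem_piFinset]
  intro i
  have h1 := hx i
  have h2 := (mem_cube_iff j (parent j (idx x)) x).2 rfl i
  set R := P.chi_supp.choose
  set q : ℤ := parent j (idx x) i
  have hR := Int.le_ceil R
  have hp : (0 : ℝ) < 2 ^ j := by positivity
  rw [abs_le] at h1
  have e1 : (q : ℝ) - m i < R + 1 := by
    have : (2 : ℝ) ^ j * (q - m i) < 2 ^ j * (R + 1) := by nlinarith [h1.1, h1.2, h2.1, h2.2]
    exact lt_of_mul_lt_mul_left this hp.le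
  have e2 : -(R + 1) < (q : ℝ) - m i := by
    have : (2 : ℝ) ^ j * (-(R + 1)) < 2 ^ j * (q - m i) := by nlinarith [h1.1, h1.2, h2.1, h2.2]
    exact lt_of_mul_lt_mul_left this hp.le
  rw [Finset.mem_Icc, Pi.sub_apply]
  constructor
  · have : ((-(⌈R⌉ + 1) : ℤ) : ℝ) ≤ ((q - m i : ℤ) : ℝ) := by push_cast; linarith
    exact_mod_cast this
  · have : ((q - m i : ℤ) : ℝ) ≤ ((⌈R⌉ + 1 : ℤ) : ℝ) := by push_cast; linarith
    exact_mod_cast this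

theorem prof_cut_le (j : ℕ) (m : Idx d) (u : ℝ → L2 d V) (t : ℝ) (n : Idx d) :
    prof (P.cut j m u) t n ≤ if parent j n - m ∈ P.offsets then prof u t n else 0 := by
  split_ifs with h
  · refine pr2_mono ?_ n
    filter_upwards [P.enorm_cut_ae j m u t] with x hx
    rw [hx]
    exact mul_le_of_le_one_left (by positivity) (ENNReal.ofReal_le_one.2 (P.chi_le_one j m x))
  · have : prof (P.cut j m u) t n = 0 := by
      rw [prof, pr2]
      have h0 : ∫⁻ x in cube 0 n, ‖P.cut j m u t x‖ₑ ^ 2 = ∫⁻ _x in (cube 0 n : Set (E d)), 0 := by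
        refine setLIntegral_congr_fun_ae (measurableSet_cube 0 n) ?_
        filter_upwards [P.enorm_cut_ae j m u t] with x hx hxn
        rw [hx]
        have : P.chi j m x = 0 := by
          by_contra hc
          apply h
          rw [← (mem_cube_zero_iff n x).1 hxn]
          exact P.mem_offsets hc
        simp [this]
      rw [h0]; simp
    rw [this]

/-- The constant in the comparison of the smooth and the sharp localization. -/
def cutC : ℝ≥0 := P.offsets.card

theorem tsum_cut_le (N : LNorm d) (j : ℕ) {u : ℝ → L2 d V}
    (hu : AEStronglyMeasurable u timeMeasure) :
    ∑' m, N (prof (P.cut j m u)) ≤ P.cutC * N.lsum j (prof u) := by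
  have h : ∀ m, N (prof (P.cut j m u)) ≤ ∑ e ∈ P.offsets, N (res j (m + e) (prof u)) := by
    intro m
    rw [← Finset.tsum_subtype]
    refine N.le_tsum (fun e => (measP_prof hu).res j _) (.of_forall fun t n => ?_)
    refine (P.prof_cut_le j m u t n).trans ?_
    split_ifs with h
    · refine le_trans ?_ (ENNReal.le_tsum (⟨_, h⟩ : P.offsets))
      simp [res]
    · simp
  refine (ENNReal.tsum_le_tsum h).trans ?_
  rw [Summable.tsum_finsetSum fun _ _ => ENNReal.summable]
  have h2 : ∀ e, ∑' m, N (res j (m + e) (prof u)) = N.lsum j (prof u) := fun e =>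
    (Equiv.addRight e).tsum_eq fun m => N (res j m (prof u))
  simp [h2, cutC]

theorem lsum_le_tsum_cut (N : LNorm d) (j : ℕ) {u : ℝ → L2 d V}
    (hu : AEStronglyMeasurable u timeMeasure) :
    N.lsum j (prof u) ≤ P.cutC * ∑' m, N (prof (P.cut j m u)) := by
  have h : ∀ q, N (res j q (prof u)) ≤ ∑ e ∈ P.offsets, N (prof (P.cut j (q - e) u)) := by
    intro q
    rw [← Finset.tsum_subtype P.offsets fun e => N (prof (P.cut j (q - e) u))]
    refine N.le_tsum (fun e => measP_prof (P.aesm_cut hu j _)) (.of_forall fun t n => ?_)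
    unfold res
    split_ifs with hq
    · have h1 : prof u t n ≤ pr2 (fun x => ∑' e : P.offsets, ‖P.cut j (q - e) u t x‖ₑ) n := by
        refine rt_mono (lintegral_mono_ae ?_)
        have hae : ∀ᵐ x, ∀ m, ‖P.cut j m u t x‖ₑ = ENNReal.ofReal (P.chi j m x) * ‖u t x‖ₑ :=
          ae_all_iff.2 fun m => P.enorm_cut_ae j m u t
        filter_upwards [ae_restrict_of_ae hae, ae_restrict_mem (measurableSet_cube 0 n)] with x hx hxn
        refine pow_le_pow_left' ?_ 2
        simp_rw [hx]
        rw [ENNReal.tsum_mul_right]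
        -- At a point of the cube `q`, cutoffs whose offset lies outside `offsets` vanish, so the
        -- remaining ones already add up to one.
        have h2 : (1 : ℝ≥0∞) ≤ ∑' e : P.offsets, ENNReal.ofReal (P.chi j (q - e) x) := by
          have h3 : ∑' m, ENNReal.ofReal (P.chi j m x) = 1 := by
            rw [← ENNReal.ofReal_tsum_of_nonneg (fun m => P.chi_nonneg j m x) (P.chi_sum j x).summable,
              (P.chi_sum j x).tsum_eq, ENNReal.ofReal_one]
          rw [← h3, ← (Equiv.subLeft q).tsum_eq,
            Finset.tsum_subtype P.offsets fun e => ENNReal.ofReal (P.chi j (q - e) x)]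
          refine le_of_eq (tsum_eq_sum fun e he => ?_)
          have : P.chi j (q - e) x = 0 := by
            by_contra hc
            apply he
            have := P.mem_offsets hc
            rwa [(mem_cube_zero_iff n x).1 hxn, hq, sub_sub_cancel] at this
          simp [this]
        calc ‖u t x‖ₑ = 1 * ‖u t x‖ₑ := (one_mul _).symm
          _ ≤ _ := by gcongr
      exact h1.trans (pr2_tsum_le (fun e => measurable_enorm _) n)
    · simp
  refine (ENNReal.tsum_le_tsum h).trans ?_
  rw [Summable.tsum_finsetSum fun _ _ => ENNReal.summable]
  have h2 : ∀ e, ∑' m, N (prof (P.cut j (m - e) u)) = ∑' m, N (prof (P.cut j m u)) := fun e =>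
    (Equiv.subRight e).tsum_eq fun m => N (prof (P.cut j m u))
  simp [h2, cutC]

end Decomposition

end LocalEnergy

end

noncomputable section

namespace LocalEnergy

open scoped SchwartzMap

variable {d : ℕ} {V : Type*} [NormedAddCommGroup V] [InnerProductSpace ℂ V] [CompleteSpace V]

/-! ### Powers of two -/

/-- The weight `2^x`. -/
def pw (x : ℝ) : ℝ≥0∞ := (2 : ℝ≥0∞) ^ x

theorem pw_add (x y : ℝ) : pw (x + y) = pw x * pw y :=
  ENNReal.rpow_add _ _ (by simp) (by simp)

theorem pw_zero : pw 0 = 1 := ENNReal.rpow_zero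

theorem pw_mono {x y : ℝ} (h : x ≤ y) : pw x ≤ pw y :=
  ENNReal.rpow_le_rpow_of_exponent_le (by norm_num) h

theorem pw_ne_top (x : ℝ) : pw x ≠ ⊤ := ENNReal.rpow_ne_top_of_ne_zero (by simp) (by simp)

theorem pw_natCast (n : ℕ) : pw n = 2 ^ n := ENNReal.rpow_natCast _ _

theorem pw_eq_ofReal (x : ℝ) : pw x = ENNReal.ofReal ((2 : ℝ) ^ x) := by
  rw [pw, ← ENNReal.ofReal_rpow_of_pos (by norm_num)]; simp

theorem coe_toNNReal_pw (x : ℝ) : ((pw x).toNNReal : ℝ≥0∞) = pw x := ENNReal.coe_toNNReal (pw_ne_top x)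

/-- The ℓ² sum over frequencies is replaced by an ℓ¹ sum. Only boundedly many terms are nonzero
where this is applied, since the functions there are localized in frequency. -/
theorem rt_tsum_sq_le {ι : Type*} (g : ι → ℝ≥0∞) : rt (∑' j, g j ^ 2) ≤ ∑' j, g j := by
  rw [rt_le_iff, sq (∑' j, g j), ← ENNReal.tsum_mul_right]
  refine ENNReal.tsum_le_tsum fun j => ?_
  rw [sq]
  gcongr
  exact ENNReal.le_tsum j

namespace LNorm

theorem nX_le_nX {j k r : ℕ} (h1 : j ≤ k + r) (h2 : k ≤ j + r) {F : Prof d} (hF : MeasP F) :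
    nX k F ≤ 2 ^ (r * d + r) * nX j F := by
  rcases le_total j k with h | h
  · obtain ⟨q, rfl⟩ := Nat.exists_eq_add_of_le h
    refine (nX_coarse j q hF).trans ?_
    gcongr
    rw [← ENNReal.rpow_natCast]
    refine ENNReal.rpow_le_rpow_of_exponent_le (by norm_num) ?_
    have : (q : ℝ) ≤ r := by exact_mod_cast (by omega : q ≤ r)
    push_cast
    nlinarith [(Nat.cast_nonneg d : (0 : ℝ) ≤ d), (Nat.cast_nonneg q : (0 : ℝ) ≤ q),
      mul_nonneg (Nat.cast_nonneg r : (0 : ℝ) ≤ r) (Nat.cast_nonneg d : (0 : ℝ) ≤ d)]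
  · obtain ⟨q, rfl⟩ := Nat.exists_eq_add_of_le h
    refine (nX_fine k q F).trans ?_
    have hq : q ≤ r := by omega
    gcongr
    · norm_num
    · exact le_trans (Nat.mul_le_mul_right _ hq) (Nat.le_add_right _ _)

/-- Each cube of side 2^i lies in exactly one cube of side 2^j, so the additional summation over
larger cubes counts nothing twice. In ℓ¹Y this makes the sum over the cutoffs at scale 2^j free for
pieces already cut at a smaller scale. -/
theorem lsum_lsum {i j : ℕ} (h : i ≤ j) (N : LNorm d) (F : Prof d) :
    lsum j (lsum i N) F = lsum i N F := by
  obtain ⟨r, rfl⟩ := Nat.exists_eq_add_of_le h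
  simp_rw [lsum_apply]
  rw [ENNReal.tsum_comm]
  refine tsum_congr fun m => ?_
  rw [tsum_eq_single (parent r m)]
  · congr 1; funext t n
    unfold res
    by_cases hn : parent i n = m
    · simp [← hn, parent_parent]
    · simp [hn]
  · intro q hq
    rw [show res i m (res (i + r) q F) = fun _ _ => 0 from ?_, N.zero]
    funext t n
    unfold res
    by_cases hn : parent i n = m
    · have : parent (i + r) n ≠ q := by rw [← parent_parent, hn]; exact hq.symm
      simp [this]
    · simp [hn]

end LNorm

open LNorm

namespace Decomposition

variable (P : Decomposition d)

/-! ### The spaces `ℓ¹X^s` in terms of profiles -/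

theorem tsum_xjNorm_cut (j k : ℕ) (u : ℝ → L2 d V) :
    ∑' m, xjNorm j (P.cut k m u) = ∑' m, xjN j (prof (P.cut k m u)) := by
  simp_rw [xjNorm_eq]

theorem pw_mul_nX_le_l1X (s : ℝ) (j : ℕ) {u : ℝ → L2 d V}
    (hu : AEStronglyMeasurable u timeMeasure) :
    pw (j * s) * nX j (prof (P.S j u)) ≤ P.cutC * P.l1X s u := by
  have h1 := P.lsum_le_tsum_cut (xjN j) j (P.aesm_S hu j)
  calc pw (j * s) * nX j (prof (P.S j u))
      ≤ pw (j * s) * (P.cutC * ∑' m, xjN j (prof (P.cut j m (P.S j u)))) := by gcongr; exact h1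
    _ = P.cutC * (pw (j * s) * ∑' m, xjNorm j (P.cut j m (P.S j u))) := by
        rw [tsum_xjNorm_cut]; ring
    _ ≤ P.cutC * P.l1X s u := by
        gcongr
        rw [← rt_of_sq (pw (j * s) * _)]
        exact rt_mono (ENNReal.le_tsum (f := fun j : ℕ => ((2 : ℝ≥0∞) ^ ((j : ℝ) * s) *
          ∑' m : Fin d → ℤ, xjNorm j (P.cut j m (P.S j u))) ^ 2) j)

theorem pw_le_of_near (s : ℝ) {j k r : ℕ} (h1 : j ≤ k + r) (h2 : k ≤ j + r) :
    pw (k * s) ≤ pw (r * |s|) * pw (j * s) := by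
  rw [← pw_add]
  apply pw_mono
  have h3 : |((k : ℝ) - j)| ≤ r := by
    rw [abs_le]
    have h1' : (j : ℝ) ≤ k + r := by exact_mod_cast h1
    have h2' : (k : ℝ) ≤ j + r := by exact_mod_cast h2
    constructor <;> linarith
  have h4 : ((k : ℝ) - j) * s ≤ r * |s| := by
    calc ((k : ℝ) - j) * s ≤ |((k : ℝ) - j) * s| := le_abs_self _
      _ = |((k : ℝ) - j)| * |s| := abs_mul _ _
      _ ≤ r * |s| := by gcongr
  linarith

theorem S_eq_sum' (k : ℕ) (u : ℝ → L2 d V) :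
    P.S k u = ∑ j ∈ Finset.Icc (k - 1) (k + 1), P.S j (P.S k u) := by
  funext t; rw [Finset.sum_apply]; exact P.S_eq_sum k u t

theorem norm_sum_le (N : LNorm d) {ι : Type} (s : Finset ι) (u : ι → ℝ → L2 d V)
    (hu : ∀ i ∈ s, AEStronglyMeasurable (u i) timeMeasure) :
    N (prof (∑ i ∈ s, u i)) ≤ ∑ i ∈ s, N (prof (u i)) := by
  rw [← Finset.tsum_subtype s fun i => N (prof (u i))]
  refine N.le_tsum (G := fun i : s => prof (u i)) (fun i => measP_prof (hu i i.2))
    (.of_forall fun t n => ?_)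
  rw [Finset.tsum_subtype s fun i => prof (u i) t n]
  exact prof_sum_le s u t n

/-- Writing S_k u as the sum of S_j S_k u over |j - k| ≤ 1 bounds it by finitely many terms of the
ℓ¹X^s norm. Measurability is asked of S_k u alone, which is all that is available for u in the
commutator bound. -/
theorem exists_pw_mul_nX_le_l1X_S (s : ℝ) :
    ∃ C : ℝ≥0, ∀ (u : ℝ → L2 d V) (k : ℕ), AEStronglyMeasurable (P.S k u) timeMeasure →
      pw (k * s) * nX k (prof (P.S k u)) ≤ C * P.l1X s (P.S k u) := by
  refine ⟨3 * ((pw (1 * |s|)).toNNReal * 2 ^ (d + 1) * P.cutC), fun u k hu => ?_⟩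
  have h1 : nX k (prof (P.S k u)) ≤
      ∑ j ∈ Finset.Icc (k - 1) (k + 1), nX k (prof (P.S j (P.S k u))) := by
    conv_lhs => rw [P.S_eq_sum' k u]
    exact norm_sum_le _ _ _ fun j _ => P.aesm_S hu j
  calc pw (k * s) * nX k (prof (P.S k u))
      ≤ pw (k * s) * ∑ j ∈ Finset.Icc (k - 1) (k + 1), nX k (prof (P.S j (P.S k u))) := by gcongr
    _ ≤ ∑ j ∈ Finset.Icc (k - 1) (k + 1),
          pw (1 * |s|) * 2 ^ (d + 1) * P.cutC * P.l1X s (P.S k u) := by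
        rw [Finset.mul_sum]
        refine Finset.sum_le_sum fun j hj => ?_
        rw [Finset.mem_Icc] at hj
        have ha := P.aesm_S hu j
        have h2 := nX_le_nX (j := j) (k := k) (r := 1) (by omega) (by omega) (measP_prof ha)
        have h3 := pw_le_of_near s (j := j) (k := k) (r := 1) (by omega) (by omega)
        have h4 := P.pw_mul_nX_le_l1X s j hu
        simp only [one_mul, Nat.cast_one] at h2 h3 ⊢
        calc pw (k * s) * nX k (prof (P.S j (P.S k u)))
            ≤ (pw |s| * pw (j * s)) * (2 ^ (d + 1) * nX j (prof (P.S j (P.S k u)))) := by gcongr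
          _ = pw |s| * 2 ^ (d + 1) * (pw (j * s) * nX j (prof (P.S j (P.S k u)))) := by ring
          _ ≤ pw |s| * 2 ^ (d + 1) * (P.cutC * P.l1X s (P.S k u)) := by gcongr
          _ = _ := by ring
    _ ≤ 3 * (pw (1 * |s|) * 2 ^ (d + 1) * P.cutC * P.l1X s (P.S k u)) := by
        rw [Finset.sum_const, nsmul_eq_mul]
        gcongr
        rw [Nat.card_Icc]
        exact_mod_cast (by omega : k + 1 + 1 - (k - 1) ≤ 3)
    _ = _ := by
        push_cast
        rw [coe_toNNReal_pw]; ring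

/-- Only |j - k| ≤ 1 contributes to the norm of S_k w. Together with the preceding bound this makes
the ℓ¹X^s norm of S_k w equivalent to 2^{ks} times the sharp ℓ¹_k X_k norm of its profile. -/
theorem exists_l1X_S_le (s : ℝ) :
    ∃ C : ℝ≥0, ∀ (w : ℝ → L2 d V), AEStronglyMeasurable w timeMeasure → ∀ k : ℕ,
      P.l1X s (P.S k w) ≤ C * (pw (k * s) * nX k (prof (P.S k w))) := by
  refine ⟨3 * ((pw (1 * |s|)).toNNReal * P.cutC * 2 ^ (d + 1) *
    (P.kerC * (2 ^ d * 2 ^ d * wtMass d))), fun w hw k => ?_⟩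
  refine (rt_tsum_sq_le _).trans ?_
  rw [tsum_eq_sum (s := Finset.Icc (k - 1) (k + 1)) ?_]
  · have h : ∀ j ∈ Finset.Icc (k - 1) (k + 1), (2 : ℝ≥0∞) ^ ((j : ℝ) * s) *
        ∑' m, xjNorm j (P.cut j m (P.S j (P.S k w))) ≤
        pw (1 * |s|) * P.cutC * 2 ^ (d + 1) * (P.kerC * (2 ^ d * 2 ^ d * wtMass d)) *
          (pw (k * s) * nX k (prof (P.S k w))) := by
      intro j hj
      rw [Finset.mem_Icc] at hj
      have ha := P.aesm_S (P.aesm_S hw k) j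
      have h1 := P.tsum_cut_le (xjN j) j ha
      have h2 := nX_le_nX (j := k) (k := j) (r := 1) (by omega) (by omega) (measP_prof ha)
      have h3 := pw_le_of_near s (j := k) (k := j) (r := 1) (by omega) (by omega)
      have h4 := P.norm_prof_S_le (nX k) j (P.aesm_S hw k)
      simp only [nX_c, ENNReal.coe_mul, ENNReal.coe_pow, ENNReal.coe_ofNat] at h4
      simp only [one_mul, Nat.cast_one] at h2 h3 ⊢
      rw [tsum_xjNorm_cut]
      calc pw (j * s) * ∑' m, xjN j (prof (P.cut j m (P.S j (P.S k w))))
          ≤ (pw |s| * pw (k * s)) * (P.cutC * (2 ^ (d + 1) *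
            (P.kerC * (2 ^ d * 2 ^ d * wtMass d) * nX k (prof (P.S k w))))) := by
            gcongr
            exact h1.trans (mul_le_mul_right (h2.trans (mul_le_mul_right h4 _)) _)
        _ = _ := by ring
    refine (Finset.sum_le_sum h).trans ?_
    rw [Finset.sum_const, nsmul_eq_mul]
    push_cast
    rw [coe_toNNReal_pw]
    calc _ ≤ 3 * (pw (1 * |s|) * P.cutC * 2 ^ (d + 1) * (P.kerC * (2 ^ d * 2 ^ d * wtMass d)) *
          (pw (k * s) * nX k (prof (P.S k w)))) := by
          gcongr
          rw [Nat.card_Icc]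
          exact_mod_cast (by omega : k + 1 + 1 - (k - 1) ≤ 3)
      _ = _ := by ring
  · intro j hj
    rw [Finset.mem_Icc] at hj
    have hz : P.S j (P.S k w) = 0 := P.S_S_eq_zero (by omega) w
    have : ∀ m, xjNorm j (P.cut j m (P.S j (P.S k w))) = 0 := by
      intro m
      rw [hz, xjNorm_eq, show prof (P.cut j m (0 : ℝ → L2 d V)) = fun _ _ => 0 from ?_, LNorm.zero]
      funext t n
      have := P.prof_cut_le j m (0 : ℝ → L2 d V) t n
      simpa [prof_zero] using this
    simp [this]

end Decomposition

/-! ### Bounds for the atomic space `Y` -/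

theorem hasSum_toCube (l : ℕ) (f : L2 d V) : HasSum (fun m => toCube l m f) f := by
  have hfin : ∑' m, ∫⁻ x in cube l m, ‖f x‖ₑ ^ 2 ≠ ⊤ := by
    have h1 : ∑' m, ∫⁻ x in cube l m, ‖f x‖ₑ ^ 2 = ‖f‖ₑ ^ 2 := by
      rw [enorm_eq_rt, rt_sq, ← lintegral_iUnion (fun m => measurableSet_cube l m)]
      · rw [show (⋃ m, cube l m : Set (E d)) = Set.univ from ?_, Measure.restrict_univ]
        refine Set.eq_univ_of_forall fun x => Set.mem_iUnion.2 ⟨_, (mem_cube_iff l _ x).2 rfl⟩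
      · intro m m' hm
        refine Set.disjoint_left.2 fun x hx hx' => hm ?_
        rw [← (mem_cube_iff l m x).1 hx, ← (mem_cube_iff l m' x).1 hx']
    rw [h1]; exact ENNReal.pow_ne_top enorm_ne_top
  have key : ∀ s : Finset (Idx d), ‖f - ∑ m ∈ s, toCube l m f‖ₑ ^ 2 =
      ∑' m : {m // m ∉ s}, ∫⁻ x in cube l m.1, ‖f x‖ₑ ^ 2 := by
    intro s
    have hU : (⋃ m : {m // m ∉ s}, cube l m.1 : Set (E d)) = {x | parent l (idx x) ∉ s} := by
      ext x
      simp only [Set.mem_iUnion, Set.mem_ofPred_eq, Subtype.exists, exists_prop]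
      constructor
      · rintro ⟨m, hm, hx⟩; rwa [(mem_cube_iff l m x).1 hx]
      · intro h; exact ⟨_, h, (mem_cube_iff l _ x).2 rfl⟩
    rw [enorm_eq_rt, rt_sq, ← lintegral_iUnion (fun m : {m // m ∉ s} => measurableSet_cube l m.1)]
    · rw [← lintegral_indicator (MeasurableSet.iUnion fun m => measurableSet_cube l _)]
      refine lintegral_congr_ae ?_
      have hs : ∀ᵐ x, ∀ m, toCube l m f x = (cube l m : Set (E d)).indicator f x :=
        ae_all_iff.2 fun m => toCube_ae l m f
      filter_upwards [Lp.coeFn_sub f (∑ m ∈ s, toCube l m f), hs,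
        Lp.coeFn_fun_finsetSum s (fun m => toCube l m f)] with x h1 h2 h3
      rw [h1, Pi.sub_apply, h3, hU]
      simp_rw [h2]
      by_cases hx : parent l (idx x) ∈ s
      · rw [Set.indicator_of_notMem (by simpa using hx), Finset.sum_eq_single_of_mem _ hx]
        · rw [Set.indicator_of_mem ((mem_cube_iff l _ x).2 rfl)]; simp
        · intro m _ hm
          exact Set.indicator_of_notMem (fun h => hm ((mem_cube_iff l m x).1 h).symm) _
      · rw [Set.indicator_of_mem (by simpa using hx), Finset.sum_eq_zero, sub_zero]
        intro m hm
        refine Set.indicator_of_notMem (fun h => hx ?_) _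
        rwa [(mem_cube_iff l m x).1 h]
    · intro m m' hm
      refine Set.disjoint_left.2 fun x hx hx' => hm (Subtype.ext ?_)
      rw [← (mem_cube_iff l m x).1 hx, ← (mem_cube_iff l m' x).1 hx']
  have ht := ENNReal.tendsto_tsum_compl_atTop_zero hfin
  have h2 : Filter.Tendsto (fun s : Finset (Idx d) => ‖f - ∑ m ∈ s, toCube l m f‖ₑ ^ 2)
      Filter.atTop (nhds 0) := by simp_rw [key]; exact ht
  have h3 : Filter.Tendsto (fun s : Finset (Idx d) => ‖f - ∑ m ∈ s, toCube l m f‖ₑ)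
      Filter.atTop (nhds 0) := by
    have := (ENNReal.continuous_rpow_const (y := 1 / 2)).continuousAt.tendsto.comp h2
    simp only [Function.comp_def] at this
    have e : ∀ x : ℝ≥0∞, (x ^ 2) ^ (1 / 2 : ℝ) = x := rt_of_sq
    simp_rw [e] at this
    simpa using this
  rw [HasSum, SummationFilter.unconditional_filter, tendsto_iff_edist_tendsto_0]
  refine h3.congr fun s => ?_
  rw [edist_comm, edist_eq_enorm_sub]

/-- Fatou's lemma, applied to the partial sums of the tail, turns convergence in L²(ℝ^d) for almost
every t into a bound in L² of space-time. -/
theorem eLpNorm_sub_sum_le {g : ℕ → ℝ → L2 d V} {f : ℝ → L2 d V}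
    (hg : ∀ n, AEStronglyMeasurable (g n) timeMeasure)
    (hs : ∀ᵐ t ∂timeMeasure, HasSum (fun n => g n t) (f t)) (N : ℕ) :
    eLpNorm (f - ∑ n ∈ Finset.range N, g n) 2 timeMeasure ≤
      ∑' n, eLpNorm (g (n + N)) 2 timeMeasure := by
  have h := Lp.eLpNorm_lim_le_liminf_eLpNorm (p := 2) (μ := timeMeasure)
    (f := fun M => ∑ n ∈ Finset.range M, g (n + N))
    (fun M => Finset.aestronglyMeasurable_sum _ fun n _ => hg (n + N))
    (f - ∑ n ∈ Finset.range N, g n) ?_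
  · refine h.trans (Filter.liminf_le_of_le (by isBoundedDefault) fun b hb => ?_)
    obtain ⟨M, hM⟩ := hb.exists
    refine hM.trans ((eLpNorm_sum_le (fun n _ => hg (n + N)) (by norm_num)).trans ?_)
    exact ENNReal.sum_le_tsum _
  · filter_upwards [hs] with t ht
    have h2 := ht.tendsto_sum_nat
    have h3 := ((Filter.tendsto_add_atTop_iff_nat N).2 h2).sub_const (∑ n ∈ Finset.range N, g n t)
    simp only [Pi.sub_apply, Finset.sum_apply]
    refine h3.congr fun M => ?_
    rw [add_comm M N, Finset.sum_range_add, add_sub_cancel_left]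
    simp_rw [add_comm N]

/-- An absolutely convergent decomposition into pieces supported in cubes bounds the `Y` norm. -/
theorem yNorm_le_tsum {g : ℕ → ℝ → L2 d V} {f : ℝ → L2 d V} {b : ℕ → ℝ≥0∞}
    (hg : ∀ n, AEStronglyMeasurable (g n) timeMeasure)
    (hs : ∀ᵐ t ∂timeMeasure, HasSum (fun n => g n t) (f t))
    (hb : ∀ n, ∃ (l : ℕ) (m : Idx d), (∀ᵐ t ∂timeMeasure, ∀ᵐ x, x ∉ cube l m → g n t x = 0) ∧
      pw ((l : ℝ) / 2) * eLpNorm (g n) 2 timeMeasure ≤ b n) :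
    yNorm f ≤ ∑' n, b n := by
  by_cases htop : ∑' n, b n = ⊤
  · rw [htop]; exact le_top
  have hbt : ∀ n, b n ≠ ⊤ := fun n => ENNReal.ne_top_of_tsum_ne_top htop n
  have hgb : ∀ n, eLpNorm (g n) 2 timeMeasure ≤ b n := by
    intro n
    obtain ⟨l, m, -, h⟩ := hb n
    refine le_trans ?_ h
    nth_rewrite 1 [← one_mul (eLpNorm (g n) 2 timeMeasure)]
    gcongr
    rw [← pw_zero]; exact pw_mono (by positivity)
  -- The coefficients are the prescribed bounds `b n`, so that `g n` divided by `c n` is an atom. If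
  -- `b n = 0`, then `g n` vanishes for almost every t, and the convention 0⁻¹ = 0 does no harm.
  set c : ℕ → ℂ := fun n => ((b n).toReal : ℂ) with hc
  set a : ℕ → ℝ → L2 d V := fun n => (c n)⁻¹ • g n with ha
  have hcn : ∀ n, ‖c n‖ₑ = b n := by
    intro n
    rw [hc, ← ofReal_norm, Complex.norm_real, Real.norm_of_nonneg ENNReal.toReal_nonneg,
      ENNReal.ofReal_toReal (hbt n)]
  have hca : ∀ n, c n • a n =ᵐ[timeMeasure] g n := by
    intro n
    by_cases h0 : c n = 0
    · have h1 : eLpNorm (g n) 2 timeMeasure = 0 := by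
        have := hcn n
        rw [h0, enorm_zero] at this
        exact le_antisymm (this ▸ hgb n) (by simp)
      rw [eLpNorm_eq_zero_iff (hg n) (by norm_num)] at h1
      filter_upwards [h1] with t ht
      simp [h0, ht]
    · refine .of_eq ?_
      rw [ha]; simp [smul_smul, h0]
  refine iInf_le_of_le c (iInf_le_of_le a (iInf_le_of_le ⟨?_, ?_⟩ ?_))
  · intro n
    refine ⟨(hg n).const_smul _, ?_⟩
    obtain ⟨l, m, h1, h2⟩ := hb n
    refine ⟨l, m, ?_, ?_⟩
    · filter_upwards [h1] with t ht
      have e : a n t = (c n)⁻¹ • g n t := rfl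
      filter_upwards [ht, Lp.coeFn_smul (c n)⁻¹ (g n t)] with x hx h3 hxm
      rw [e, h3, Pi.smul_apply, hx hxm, smul_zero]
    · rw [ha, eLpNorm_const_smul]
      change _ ≤ pw (-(l : ℝ) / 2)
      by_cases h0 : c n = 0
      · simp [h0]
      · rw [enorm_inv h0, hcn]
        have hb0 : b n ≠ 0 := by rw [← hcn]; simpa using h0
        rw [mul_comm, ← ENNReal.div_eq_inv_mul.trans (mul_comm _ _), ENNReal.div_le_iff hb0 (hbt n)]
        calc eLpNorm (g n) 2 timeMeasure
            = pw (-(l : ℝ) / 2) * (pw ((l : ℝ) / 2) * eLpNorm (g n) 2 timeMeasure) := by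
              rw [← mul_assoc, ← pw_add, show -(l : ℝ) / 2 + l / 2 = 0 by ring, pw_zero, one_mul]
          _ ≤ _ := by gcongr
  · have hlim := ENNReal.tendsto_sum_nat_add b htop
    refine tendsto_of_tendsto_of_tendsto_of_le_of_le tendsto_const_nhds hlim (fun _ => by simp) ?_
    intro N
    have e : f - ∑ n ∈ Finset.range N, c n • a n =ᵐ[timeMeasure] f - ∑ n ∈ Finset.range N, g n := by
      have := ae_all_iff.2 hca
      filter_upwards [this] with t ht
      simp only [Pi.sub_apply, Finset.sum_apply]
      congr 1
      exact Finset.sum_congr rfl fun n _ => ht n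
    change eLpNorm (f - ∑ n ∈ Finset.range N, c n • a n) 2 timeMeasure ≤ _
    rw [eLpNorm_congr_ae e]
    exact (eLpNorm_sub_sum_le hg hs N).trans (ENNReal.tsum_le_tsum fun n => hgb (n + N))
  · exact le_of_eq (tsum_congr hcn)

theorem eLpNorm_two_eq (u : ℝ → L2 d V) : eLpNorm u 2 timeMeasure = mix2 (prof u) := by
  rw [eLpNorm_eq_lintegral_rpow_enorm_toReal (by simp) (by simp), mix2_apply]
  have : ∀ t, ‖u t‖ₑ ^ 2 = ∑' n, prof u t n ^ 2 := fun t => by rw [← tsum_prof_sq, rt_sq]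
  simp_rw [← this]
  simp [rt]

theorem prof_toCube (l : ℕ) (m : Idx d) (u : ℝ → L2 d V) :
    prof (fun t => toCube l m (u t)) = res l m (prof u) := by
  funext t n
  unfold res
  have h : prof (fun t => toCube l m (u t)) t n =
      rt (∫⁻ x in cube 0 n, ‖(cube l m : Set (E d)).indicator (u t) x‖ₑ ^ 2) := by
    rw [prof, pr2]; congr 1
    refine lintegral_congr_ae (ae_restrict_of_ae ?_)
    filter_upwards [toCube_ae l m (u t)] with x hx
    rw [hx]
  rw [h]
  split_ifs with hn
  · rw [prof, pr2]; congr 1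
    refine setLIntegral_congr_fun (measurableSet_cube 0 n) fun x hx => ?_
    rw [Set.indicator_of_mem]
    rw [mem_cube_iff, (mem_cube_zero_iff n x).1 hx, hn]
  · rw [setLIntegral_congr_fun (g := fun _ => 0) (measurableSet_cube 0 n)]
    · simp
    · intro x hx
      dsimp only
      rw [Set.indicator_of_notMem]
      · simp
      · rwa [mem_cube_iff, (mem_cube_zero_iff n x).1 hx]

/-- A finite sum of functions, each decomposed at its own scale, bounds the `Y_j` norm. -/
theorem yjNorm_le_sum (j : ℕ) {ι : Type} [Fintype ι] (p : ι → ℝ → L2 d V) (l : ι → ℕ)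
    (hp : ∀ i, AEStronglyMeasurable (p i) timeMeasure) {f : ℝ → L2 d V}
    (hf : ∀ᵐ t ∂timeMeasure, f t = ∑ i, p i t) :
    yjNorm j f ≤ ∑ i, pw (((l i : ℝ) - j) / 2) * lsum (l i) mix2 (prof (p i)) := by
  classical
  set z : ℂ := (((2 : ℝ) ^ ((j : ℝ) / 2) : ℝ) : ℂ) with hz
  have hz0 : z ≠ 0 := by
    rw [hz]; exact_mod_cast (Real.rpow_pos_of_pos (by norm_num) _).ne'
  have hze : ‖z⁻¹‖ₑ = pw (-(j : ℝ) / 2) := by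
    rw [enorm_inv hz0, hz, ← ofReal_norm, Complex.norm_real, Real.norm_of_nonneg (by positivity),
      ← pw_eq_ofReal]
    rw [← ENNReal.eq_inv_of_mul_eq_one_left (a := pw (-(j : ℝ) / 2))]
    rw [← pw_add, show -(j : ℝ) / 2 + j / 2 = 0 by ring, pw_zero]
  have hf1 : AEStronglyMeasurable (fun t => z⁻¹ • ∑ i, p i t) timeMeasure :=
    (Finset.aestronglyMeasurable_fun_sum Finset.univ fun i _ => hp i).fun_const_smul _
  -- Only the atomic part of Y_j is used, with f₂ = 0. A piece on a cube of side 2^l costs 2^{l/2}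
  -- as a multiple of an atom, and the factor `z⁻¹` contributes 2^{-j/2}.
  refine iInf_le_of_le (fun t => z⁻¹ • ∑ i, p i t) (iInf_le_of_le 0 (iInf_le_of_le
    ⟨hf1, aestronglyMeasurable_const, ?_⟩ ?_))
  · filter_upwards [hf] with t ht
    rw [ht, smul_smul, mul_inv_cancel₀ hz0]; simp
  rw [eLpNorm_zero, add_zero]
  -- The definition of Y indexes atoms by ℕ, whereas the pieces are indexed by a summand and a cube.
  -- This countable index set is encoded in ℕ, and the families are extended by zero.
  obtain ⟨enc⟩ : Nonempty (Encodable (ι × Idx d)) := nonempty_encodable _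
  set G : ι × Idx d → ℝ → L2 d V := fun q t => z⁻¹ • toCube (l q.1) q.2 (p q.1 t) with hG
  set B : ι × Idx d → ℝ≥0∞ := fun q =>
    pw (((l q.1 : ℝ) - j) / 2) * mix2 (res (l q.1) q.2 (prof (p q.1))) with hB
  have hinj := Encodable.encode_injective (α := ι × Idx d)
  have hmain := yNorm_le_tsum (f := fun t => z⁻¹ • ∑ i, p i t)
    (g := Function.extend Encodable.encode G 0) (b := Function.extend Encodable.encode B 0) ?_ ?_ ?_
  · refine hmain.trans (le_of_eq ?_)
    rw [tsum_extend_zero hinj, ENNReal.tsum_prod', tsum_fintype]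
    refine Finset.sum_congr rfl fun i _ => ?_
    rw [lsum_apply, ← ENNReal.tsum_mul_left]
  · intro n
    by_cases hn : ∃ q : ι × Idx d, Encodable.encode q = n
    · obtain ⟨q, rfl⟩ := hn
      rw [hinj.extend_apply]
      exact (((toCube (V := V) (l q.1) q.2).continuous.comp_aestronglyMeasurable (hp q.1)).const_smul z⁻¹)
    · rw [Function.extend_apply' _ _ _ hn]
      exact aestronglyMeasurable_const
  · refine .of_forall fun t => ?_
    have e : (fun n => Function.extend Encodable.encode G 0 n t) =
        Function.extend Encodable.encode (fun q => G q t) 0 := by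
      funext n
      by_cases hn : ∃ q : ι × Idx d, Encodable.encode q = n
      · obtain ⟨q, rfl⟩ := hn
        rw [hinj.extend_apply, hinj.extend_apply]
      · rw [Function.extend_apply' _ _ _ hn, Function.extend_apply' _ _ _ hn]; rfl
    rw [e, hasSum_extend_zero hinj]
    have h1 : ∀ i, HasSum (fun q : ι × Idx d => if q.1 = i then toCube (l q.1) q.2 (p q.1 t) else 0)
        (p i t) := by
      intro i
      have hi : Function.Injective fun m : Idx d => (i, m) := fun _ _ h => congrArg Prod.snd h
      rw [← hi.hasSum_iff]
      · simpa [Function.comp_def] using hasSum_toCube (l i) (p i t)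
      · intro q hq
        rw [if_neg]
        rintro rfl
        exact hq ⟨q.2, rfl⟩
    have h2 := (hasSum_sum fun i (_ : i ∈ (Finset.univ : Finset ι)) => h1 i).const_smul z⁻¹
    refine h2.congr_fun fun q => ?_
    rw [hG]
    simp
  · intro n
    by_cases hn : ∃ q : ι × Idx d, Encodable.encode q = n
    · obtain ⟨q, rfl⟩ := hn
      rw [hinj.extend_apply, hinj.extend_apply]
      refine ⟨l q.1, q.2, .of_forall fun t => ?_, ?_⟩
      · filter_upwards [Lp.coeFn_smul z⁻¹ (toCube (l q.1) q.2 (p q.1 t)),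
          toCube_ae (l q.1) q.2 (p q.1 t)] with x h1 h2 hx
        rw [hG]; dsimp only
        rw [h1, Pi.smul_apply, h2, Set.indicator_of_notMem hx, smul_zero]
      · have : G q = z⁻¹ • fun t => toCube (l q.1) q.2 (p q.1 t) := rfl
        rw [this, eLpNorm_const_smul, hze, eLpNorm_two_eq, prof_toCube, ← mul_assoc, ← pw_add, hB]
        refine le_of_eq ?_
        dsimp only; ring_nf
    · rw [Function.extend_apply' _ _ _ hn, Function.extend_apply' _ _ _ hn]
      refine ⟨0, 0, .of_forall fun t => ?_, by simp⟩
      filter_upwards [Lp.coeFn_zero V 2 (volume : Measure (E d))] with x hx _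
      exact hx

theorem yjNorm_zero (j : ℕ) {f : ℝ → L2 d V} (hf : ∀ᵐ t ∂timeMeasure, f t = 0) :
    yjNorm j f = 0 := by
  have := yjNorm_le_sum j (ι := Empty) (fun _ => 0) (fun _ => 0) (fun i => i.elim) (f := f)
    (by simpa using hf)
  simpa using this

namespace Decomposition

variable (P : Decomposition d)

theorem cut_S_sum (j k : ℕ) (m : Idx d) {ι : Type} [Fintype ι] (p : ι → ℝ → L2 d V)
    {f : ℝ → L2 d V} {t : ℝ} (h : f t = ∑ i, p i t) :
    P.cut k m (P.S j f) t = ∑ i, P.cut k m (P.S j (p i)) t := by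
  simp_rw [cut_apply, S_apply, ← fmul_apply (P.memLp_sym j), h, map_sum]

/-- The main bound for the norm of `ℓ¹Y^σ`, for functions of frequency about `2^k`. -/
theorem exists_l1Y_le (σ : ℝ) :
    ∃ C : ℝ≥0, ∀ (ι : Type) [Fintype ι] (p : ι → ℝ → L2 d V) (l : ι → ℕ) (f : ℝ → L2 d V) (k : ℕ),
      (∀ i, AEStronglyMeasurable (p i) timeMeasure) → (∀ᵐ t ∂timeMeasure, f t = ∑ i, p i t) →
      (∀ i, l i ≤ k - 3) →
      (∀ j, j + 3 < k ∨ k + 3 < j → ∀ᵐ t ∂timeMeasure, P.S j f t = 0) →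
      P.l1Y σ f ≤ C * (pw (k * σ) * ∑ i, pw (((l i : ℝ) - k) / 2) *
        lsum (l i) mix2 (prof (p i))) := by
  refine ⟨7 * ((pw (3 * |σ|)).toNNReal * (pw (3 / 2)).toNNReal * P.cutC *
    (P.kerC * (2 ^ d * (mix2 (d := d)).c * wtMass d))), fun ι _ p l f k hp hf hl hloc => ?_⟩
  refine (rt_tsum_sq_le _).trans ?_
  rw [tsum_eq_sum (s := Finset.Icc (k - 3) (k + 3)) ?_]
  · have h : ∀ j ∈ Finset.Icc (k - 3) (k + 3), (2 : ℝ≥0∞) ^ ((j : ℝ) * σ) *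
        ∑' m, yjNorm j (P.cut j m (P.S j f)) ≤
        pw (3 * |σ|) * pw (3 / 2) * P.cutC * (P.kerC * (2 ^ d * (mix2 (d := d)).c * wtMass d)) *
          (pw (k * σ) * ∑ i, pw (((l i : ℝ) - k) / 2) * lsum (l i) mix2 (prof (p i))) := by
      intro j hj
      rw [Finset.mem_Icc] at hj
      have h1 : ∀ m, yjNorm j (P.cut j m (P.S j f)) ≤ ∑ i, pw (((l i : ℝ) - j) / 2) *
          lsum (l i) mix2 (prof (P.cut j m (P.S j (p i)))) := fun m =>
        yjNorm_le_sum j (fun i => P.cut j m (P.S j (p i))) l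
          (fun i => P.aesm_cut (P.aesm_S (hp i) j) j m)
          (hf.mono fun t ht => P.cut_S_sum j j m p ht)
      have h2 : ∀ i, ∑' m, lsum (l i) mix2 (prof (P.cut j m (P.S j (p i)))) ≤
          P.cutC * (P.kerC * (2 ^ d * (mix2 (d := d)).c * wtMass d) *
            lsum (l i) mix2 (prof (p i))) := by
        intro i
        refine (P.tsum_cut_le _ j (P.aesm_S (hp i) j)).trans ?_
        -- Since l i ≤ k - 3 ≤ j, the cubes of side 2^{l i} refine those of side 2^j, and the sum
        -- over the cutoffs at scale 2^j costs nothing more. With truncated subtraction this also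
        -- covers k < 3.
        rw [lsum_lsum ((hl i).trans hj.1)]
        gcongr
        have := P.norm_prof_S_le (lsum (l i) mix2) j (hp i)
        simpa [lsum] using this
      have h3 := pw_le_of_near σ (j := k) (k := j) (r := 3) (by omega) (by omega)
      have h4 : ∀ i, pw (((l i : ℝ) - j) / 2) ≤ pw (3 / 2) * pw (((l i : ℝ) - k) / 2) := by
        intro i
        rw [← pw_add]
        apply pw_mono
        have : (k : ℝ) ≤ j + 3 := by exact_mod_cast (by omega : k ≤ j + 3)
        linarith
      calc pw (j * σ) * ∑' m, yjNorm j (P.cut j m (P.S j f))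
          ≤ (pw (3 * |σ|) * pw (k * σ)) * ∑' m, ∑ i, pw (((l i : ℝ) - j) / 2) *
            lsum (l i) mix2 (prof (P.cut j m (P.S j (p i)))) := by
            gcongr
            · exact_mod_cast h3
            · exact h1 _
        _ = (pw (3 * |σ|) * pw (k * σ)) * ∑ i, pw (((l i : ℝ) - j) / 2) *
            ∑' m, lsum (l i) mix2 (prof (P.cut j m (P.S j (p i)))) := by
            rw [Summable.tsum_finsetSum fun _ _ => ENNReal.summable]
            simp_rw [ENNReal.tsum_mul_left]
        _ ≤ (pw (3 * |σ|) * pw (k * σ)) * ∑ i, (pw (3 / 2) * pw (((l i : ℝ) - k) / 2)) *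
            (P.cutC * (P.kerC * (2 ^ d * (mix2 (d := d)).c * wtMass d) *
            lsum (l i) mix2 (prof (p i)))) := by
            gcongr with i
            · exact h4 i
            · exact h2 i
        _ = _ := by
            simp_rw [Finset.mul_sum]
            refine Finset.sum_congr rfl fun i _ => ?_
            ring
    refine (Finset.sum_le_sum h).trans ?_
    rw [Finset.sum_const, nsmul_eq_mul]
    push_cast
    rw [coe_toNNReal_pw, coe_toNNReal_pw, mul_assoc (7 : ℝ≥0∞)]
    gcongr
    rw [Nat.card_Icc]
    exact_mod_cast (by omega : k + 3 + 1 - (k - 3) ≤ 7)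
  · intro j hj
    rw [Finset.mem_Icc] at hj
    have hz : ∀ m, yjNorm j (P.cut j m (P.S j f)) = 0 := by
      intro m
      refine yjNorm_zero j ?_
      filter_upwards [hloc j (by omega)] with t ht
      rw [cut_apply, ht, map_zero]
    simp [hz]

end Decomposition

end LocalEnergy

end

noncomputable section

namespace LocalEnergy

open scoped SchwartzMap

variable {d : ℕ} {V : Type*} [NormedAddCommGroup V] [InnerProductSpace ℂ V] [CompleteSpace V]

open LNorm

/-! ### Products -/

/-- The product of a scalar and a vector valued function. -/
def smulF (f : ℝ → L2 d ℂ) (g : ℝ → L2 d V) : ℝ → L2 d V := fun t => ofFun fun x => f t x • g t x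

theorem mul_eq_smulF (u v : ℝ → L2 d ℂ) : mul u v = smulF u v := rfl

theorem smulF_comm (u v : ℝ → L2 d ℂ) : smulF u v = smulF v u := by
  funext t; unfold smulF; congr 1; funext x; exact mul_comm _ _

theorem smulF_apply {f : ℝ → L2 d ℂ} (g : ℝ → L2 d V) {t : ℝ} (hf : MemLp (f t) ⊤ volume) :
    smulF f g t = bmul (f t) hf (g t) := rfl

theorem smulF_ae {f : ℝ → L2 d ℂ} (g : ℝ → L2 d V) {t : ℝ} (hf : MemLp (f t) ⊤ volume) :
    smulF f g t =ᵐ[volume] fun x => f t x • g t x := bmul_ae hf (g t)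

theorem smulF_ae' (f : ℝ → L2 d ℂ) {g : ℝ → L2 d V} {t : ℝ} (hg : MemLp (g t) ⊤ volume) :
    smulF f g t =ᵐ[volume] fun x => f t x • g t x :=
  ofFun_ae (hg.smul (p := 2) (q := ⊤) (Lp.memLp (f t)))

theorem norm_smulF_le (f : ℝ → L2 d ℂ) (g : ℝ → L2 d V) (t : ℝ) :
    ‖smulF f g t‖ₑ ≤ ‖f t‖ₑ * eLpNorm (g t) ⊤ volume := by
  refine (norm_ofFun_le _).trans ?_
  rw [Lp.enorm_def]
  exact eLpNorm_smul_le_mul_eLpNorm (p := 2) (q := ⊤) (r := 2) (Lp.aestronglyMeasurable _)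
    (Lp.aestronglyMeasurable _)

theorem enorm_ae_le_fourierMul (m : 𝓢(E d, ℂ)) (f : L2 d V) :
    ∀ᵐ x, ‖fourierMul m f x‖ₑ ≤ eLpNorm (𝓕⁻ m : 𝓢(E d, ℂ)) 2 volume * ‖f‖ₑ := by
  filter_upwards [fourierMul_ae_eq_conv m f] with x hx
  rw [hx]; exact norm_conv_le _ _ _

theorem eLpNorm_fourierMul_le (m : 𝓢(E d, ℂ)) (f : L2 d V) :
    eLpNorm (fourierMul m f) ⊤ volume ≤ eLpNorm (𝓕⁻ m : 𝓢(E d, ℂ)) 2 volume * ‖f‖ₑ := by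
  rw [eLpNorm_exponent_top]
  exact essSup_le_of_ae_le _ (enorm_ae_le_fourierMul m f)

theorem memLp_top_fourierMul (m : 𝓢(E d, ℂ)) (f : L2 d V) : MemLp (fourierMul m f) ⊤ volume :=
  ⟨Lp.aestronglyMeasurable _, lt_of_le_of_lt (eLpNorm_fourierMul_le m f)
    (ENNReal.mul_lt_top ((𝓕⁻ m : 𝓢(E d, ℂ)).memLp 2 volume).2 (by simp))⟩

/-- Multiplication of a function with a frequency localized function. -/
def mulLoc (m : 𝓢(E d, ℂ)) (p : L2 d ℂ × L2 d V) : L2 d V :=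
  smulF (fun _ => p.1) (fun _ => fourierMul m p.2) 0

theorem mulLoc_ae (m : 𝓢(E d, ℂ)) (p : L2 d ℂ × L2 d V) :
    mulLoc m p =ᵐ[volume] fun x => p.1 x • fourierMul m p.2 x :=
  smulF_ae' (fun _ => p.1) (g := fun _ => fourierMul m p.2) (t := 0) (memLp_top_fourierMul m p.2)

theorem isBoundedBilinearMap_mulLoc (m : 𝓢(E d, ℂ)) :
    IsBoundedBilinearMap ℂ (mulLoc (V := V) m) where
  add_left f f' g := by
    apply Lp.ext
    filter_upwards [mulLoc_ae m (f + f', g), mulLoc_ae m (f, g), mulLoc_ae m (f', g),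
      Lp.coeFn_add f f', Lp.coeFn_add (mulLoc m (f, g)) (mulLoc m (f', g))] with x h1 h2 h3 h4 h5
    rw [h1, h5, Pi.add_apply, h2, h3]
    simp only [h4, Pi.add_apply, add_smul]
  smul_left c f g := by
    apply Lp.ext
    filter_upwards [mulLoc_ae m (c • f, g), mulLoc_ae m (f, g),
      Lp.coeFn_smul c f, Lp.coeFn_smul c (mulLoc m (f, g))] with x h1 h2 h4 h5
    rw [h1, h5, Pi.smul_apply, h2]
    simp only [h4, Pi.smul_apply, smul_assoc]
  add_right f g g' := by
    have e : fourierMul m (g + g') = fourierMul m g + fourierMul m g' :=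
      fourierMul_add m (m.memLp_top volume) g g'
    apply Lp.ext
    filter_upwards [mulLoc_ae m (f, g + g'), mulLoc_ae m (f, g), mulLoc_ae m (f, g'),
      Lp.coeFn_add (fourierMul m g) (fourierMul m g'),
      Lp.coeFn_add (mulLoc m (f, g)) (mulLoc m (f, g'))] with x h1 h2 h3 h4 h5
    rw [h1, h5, Pi.add_apply, h2, h3]
    simp only [e, h4, Pi.add_apply, smul_add]
  smul_right c f g := by
    have e : fourierMul m (c • g) = c • fourierMul m g := (fmul m (m.memLp_top volume)).map_smul c g
    apply Lp.ext
    filter_upwards [mulLoc_ae m (f, c • g), mulLoc_ae m (f, g),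
      Lp.coeFn_smul c (fourierMul m g), Lp.coeFn_smul c (mulLoc m (f, g))] with x h1 h2 h4 h5
    rw [h1, h5, Pi.smul_apply, h2]
    simp only [e, h4, Pi.smul_apply, smul_comm c]
  bound := by
    set B := (eLpNorm (𝓕⁻ m : 𝓢(E d, ℂ)) 2 volume) with hB
    have hBt : B ≠ ⊤ := ((𝓕⁻ m : 𝓢(E d, ℂ)).memLp 2 volume).2.ne
    refine ⟨B.toReal + 1, by positivity, fun f g => ?_⟩
    have h1 : ‖mulLoc m (f, g)‖ₑ ≤ ‖f‖ₑ * (B * ‖g‖ₑ) :=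
      (norm_smulF_le (fun _ => f) (fun _ => fourierMul m g) 0).trans
        (mul_le_mul_right (eLpNorm_fourierMul_le m g) _)
    have h2 := ENNReal.toReal_mono (by finiteness) h1
    rw [ENNReal.toReal_mul, ENNReal.toReal_mul, toReal_enorm, toReal_enorm, toReal_enorm] at h2
    nlinarith [norm_nonneg f, norm_nonneg g, mul_nonneg (norm_nonneg f) (norm_nonneg g)]

namespace Decomposition

variable (P : Decomposition d)

/-- The pointwise product is not continuous on L² × L², so measurability in time is obtained as a
limit: the maps (f, g) ↦ f · low_N(D)g are bounded bilinear, and they converge to the product for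
each t at which f(t) is bounded. -/
theorem aesm_smulF (P : Decomposition d) {f : ℝ → L2 d ℂ} {g : ℝ → L2 d V} (hf : AEStronglyMeasurable f timeMeasure)
    (hg : AEStronglyMeasurable g timeMeasure) (hb : ∀ᵐ t ∂timeMeasure, MemLp (f t) ⊤ volume) :
    AEStronglyMeasurable (smulF f g) timeMeasure := by
  refine aestronglyMeasurable_of_tendsto_ae Filter.atTop
    (f := fun (N : ℕ) t => mulLoc (P.low N) (f t, g t)) (fun N => ?_) ?_
  · exact (isBoundedBilinearMap_mulLoc (P.low N)).continuous.comp_aestronglyMeasurable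
      (hf.prodMk hg)
  · filter_upwards [hb] with t ht
    have h1 : ∀ N, mulLoc (P.low N) (f t, g t) = bmul (f t) ht (P.SLt (N + 1) g t) := by
      intro N; rw [SLt_succ_apply]; rfl
    simp_rw [h1]
    rw [smulF_apply g ht]
    exact ((bmul (f t) ht).continuous.tendsto _).comp
      ((Filter.tendsto_add_atTop_iff_nat 1).2 (P.tendsto_SLt g t))

theorem memLp_top_S (k : ℕ) (u : ℝ → L2 d V) (t : ℝ) : MemLp (P.S k u t) ⊤ volume := by
  rw [S_apply]; exact memLp_top_fourierMul _ _

theorem aesm_smulF_S {f : ℝ → L2 d ℂ} {g : ℝ → L2 d V} (hf : AEStronglyMeasurable f timeMeasure)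
    (hg : AEStronglyMeasurable g timeMeasure) (i : ℕ) :
    AEStronglyMeasurable (smulF (P.S i f) g) timeMeasure :=
  P.aesm_smulF (P.aesm_S hf i) hg (.of_forall fun t => P.memLp_top_S i f t)

end Decomposition

/-! ### Limits of profiles -/

theorem prof_eq_enorm (u : ℝ → L2 d V) (t : ℝ) (n : Idx d) : prof u t n = ‖toCube 0 n (u t)‖ₑ := by
  rw [enorm_toCube]; rfl

theorem prof_le_tsum {w : ℝ → L2 d V} {p : ℕ → ℝ → L2 d V} {t : ℝ}
    (h : Filter.Tendsto (fun N => ∑ j ∈ Finset.range N, p j t) Filter.atTop (nhds (w t)))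
    (n : Idx d) : prof w t n ≤ ∑' j, prof (p j) t n := by
  have h1 := ((toCube (V := V) 0 n).continuous.enorm.tendsto _).comp h
  simp only [Function.comp_def, ← prof_eq_enorm w] at h1
  refine le_of_tendsto' h1 fun N => ?_
  have := prof_sum_le (Finset.range N) p t n
  rw [prof_eq_enorm, Finset.sum_apply] at this
  exact this.trans (ENNReal.sum_le_tsum _)

namespace Decomposition

variable (P : Decomposition d)

theorem prof_S_le_tsum (k : ℕ) {w : ℝ → L2 d V} {p : ℕ → ℝ → L2 d V} {t : ℝ}
    (h : Filter.Tendsto (fun N => ∑ j ∈ Finset.range N, p j t) Filter.atTop (nhds (w t)))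
    (n : Idx d) : prof (P.S k w) t n ≤ ∑' j, prof (P.S k (p j)) t n := by
  refine prof_le_tsum ?_ n
  have h1 := ((fmul (V := V) (P.sym k) (P.memLp_sym k)).continuous.tendsto _).comp h
  simp only [Function.comp_def, map_sum, fmul_apply] at h1
  simp_rw [S_apply]
  exact h1

/-- The pieces of `S_{≥M} v`. -/
def piece (M : ℕ) (v : ℝ → L2 d V) (j : ℕ) : ℝ → L2 d V := if M ≤ j then P.S j v else 0

theorem tendsto_piece (M : ℕ) (v : ℝ → L2 d V) (t : ℝ) :
    Filter.Tendsto (fun N => ∑ j ∈ Finset.range N, P.piece M v j t) Filter.atTop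
      (nhds (P.SGe M v t)) := by
  have h1 := (P.tendsto_SLt v t).sub_const (P.SLt M v t)
  refine h1.congr' ?_
  filter_upwards [Filter.eventually_ge_atTop M] with N hN
  rw [SLt_apply, SLt_apply, ← Finset.sum_range_add_sum_Ico _ hN, add_sub_cancel_left,
    ← Finset.sum_range_add_sum_Ico (fun j => P.piece M v j t) hN]
  have h2 : ∑ j ∈ Finset.range M, P.piece M v j t = 0 := by
    refine Finset.sum_eq_zero fun j hj => ?_
    rw [piece, if_neg (by simpa using hj)]; rfl
  rw [h2, zero_add]
  refine Finset.sum_congr rfl fun j hj => ?_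
  rw [piece, if_pos (Finset.mem_Ico.1 hj).1]

theorem SGe_zero (v : ℝ → L2 d V) : P.SGe 0 v = v := by simp [SGe, SLt]

theorem aesm_piece {v : ℝ → L2 d V} (hv : AEStronglyMeasurable v timeMeasure) (M j : ℕ) :
    AEStronglyMeasurable (P.piece M v j) timeMeasure := by
  unfold piece; split_ifs
  · exact P.aesm_S hv j
  · exact aestronglyMeasurable_const

theorem memLp_top_piece (M : ℕ) (v : ℝ → L2 d V) (j : ℕ) (t : ℝ) :
    MemLp (P.piece M v j t) ⊤ volume := by
  unfold piece; split_ifs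
  · exact P.memLp_top_S j v t
  · exact (memLp_congr_ae (Lp.coeFn_zero V 2 volume)).2 MemLp.zero

theorem aesm_SLt {v : ℝ → L2 d V} (hv : AEStronglyMeasurable v timeMeasure) (M : ℕ) :
    AEStronglyMeasurable (P.SLt M v) timeMeasure :=
  Finset.aestronglyMeasurable_sum _ fun j _ => P.aesm_S hv j

theorem aesm_SGe {v : ℝ → L2 d V} (hv : AEStronglyMeasurable v timeMeasure) (M : ℕ) :
    AEStronglyMeasurable (P.SGe M v) timeMeasure := hv.sub (P.aesm_SLt hv M)

theorem prof_S_smulF_right_le (k M : ℕ) {u : ℝ → L2 d ℂ} (v : ℝ → L2 d V) {t : ℝ}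
    (hu : MemLp (u t) ⊤ volume) (n : Idx d) :
    prof (P.S k (smulF u (P.SGe M v))) t n ≤ ∑' j, prof (P.S k (smulF u (P.piece M v j))) t n := by
  refine P.prof_S_le_tsum k ?_ n
  have h1 := ((bmul (V := V) (u t) hu).continuous.tendsto _).comp (P.tendsto_piece M v t)
  simp only [Function.comp_def, map_sum] at h1
  exact h1

theorem prof_S_smulF_left_le (k M j : ℕ) {u : ℝ → L2 d ℂ} (v : ℝ → L2 d V) (t : ℝ) (n : Idx d) :
    prof (P.S k (smulF (P.SGe M u) (P.S j v))) t n ≤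
      ∑' i, prof (P.S k (smulF (P.piece M u i) (P.S j v))) t n := by
  refine P.prof_S_le_tsum k ?_ n
  have hB := isBoundedBilinearMap_mulLoc (V := V) (P.sym j)
  have e : ∀ f : ℝ → L2 d ℂ, smulF f (P.S j v) t = hB.toContinuousLinearMap (f t) (v t) := by
    intro f
    change smulF f (fun t => P.S j v t) t = _
    simp_rw [S_apply]
    rfl
  simp_rw [e]
  have h1 := (((hB.toContinuousLinearMap.flip (v t))).continuous.tendsto _).comp (P.tendsto_piece M u t)
  simp only [Function.comp_def, map_sum, ContinuousLinearMap.flip_apply] at h1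
  exact h1

/-! ### The frequency support of products -/

/-- For q > 0 the symbol of S_q vanishes off 2^{q-1} < |ζ| < 2^{q+1}, and the upper bound also holds
for q = 0. A gap of 3 gives 2^{a+1} + 2^{b+1} ≤ 2^{c-1}, so the frequency of size 2^c cannot be
balanced by the other two, whichever of the three it is. -/
theorem S_smulF_eq_zero {i j k : ℕ} (h : (i + 3 ≤ k ∧ j + 3 ≤ k) ∨ (i + 3 ≤ j ∧ k + 3 ≤ j) ∨
    (j + 3 ≤ i ∧ k + 3 ≤ i)) (u : ℝ → L2 d ℂ) (v : ℝ → L2 d V) (t : ℝ) :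
    P.S k (smulF (P.S i u) (P.S j v)) t = 0 := by
  have hsym : ∀ ξ η, P.sym k (ξ + η) * (P.sym i ξ * P.sym j η) = 0 := by
    intro ξ η
    by_contra hne
    have hk : P.sym k (ξ + η) ≠ 0 := fun h0 => hne (by rw [h0, zero_mul])
    have hi : P.sym i ξ ≠ 0 := fun h0 => hne (by rw [h0]; simp)
    have hj : P.sym j η ≠ 0 := fun h0 => hne (by rw [h0]; simp)
    have up : ∀ {q : ℕ} {ζ : E d}, P.sym q ζ ≠ 0 → ‖ζ‖ < 2 ^ (q + 1) := fun {q ζ} h0 =>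
      not_le.1 fun h1 => h0 (P.sym_eq_zero_of_le h1)
    have lo : ∀ {q : ℕ} {ζ : E d}, 0 < q → P.sym q ζ ≠ 0 → 2 ^ (q - 1) < ‖ζ‖ := fun {q ζ} hq h0 =>
      not_le.1 fun h1 => h0 (P.sym_eq_zero_of_ge hq h1)
    have key : ∀ {a b c : ℕ}, a + 3 ≤ c → b + 3 ≤ c → (2 : ℝ) ^ (a + 1) + 2 ^ (b + 1) ≤ 2 ^ (c - 1) := by
      intro a b c ha hb
      have h1 : (2 : ℝ) ^ (a + 1) ≤ 2 ^ (c - 2) := pow_le_pow_right₀ (by norm_num) (by omega)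
      have h2 : (2 : ℝ) ^ (b + 1) ≤ 2 ^ (c - 2) := pow_le_pow_right₀ (by norm_num) (by omega)
      have h3 : (2 : ℝ) ^ (c - 1) = 2 ^ (c - 2) + 2 ^ (c - 2) := by
        rw [show c - 1 = (c - 2) + 1 by omega, pow_succ]; ring
      linarith
    rcases h with ⟨h1, h2⟩ | ⟨h1, h2⟩ | ⟨h1, h2⟩
    · have := key h1 h2
      have a1 := lo (by omega) hk
      have a2 := norm_add_le ξ η
      linarith [up hi, up hj]
    · have := key h1 h2
      have a1 := lo (by omega) hj
      have a2 : ‖η‖ ≤ ‖ξ + η‖ + ‖ξ‖ := by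
        calc ‖η‖ = ‖(ξ + η) - ξ‖ := by congr 1; abel
          _ ≤ _ := norm_sub_le _ _
      linarith [up hi, up hk]
    · have := key h1 h2
      have a1 := lo (by omega) hi
      have a2 : ‖ξ‖ ≤ ‖ξ + η‖ + ‖η‖ := by
        calc ‖ξ‖ = ‖(ξ + η) - η‖ := by congr 1; abel
          _ ≤ _ := norm_sub_le _ _
      linarith [up hj, up hk]
  have h1 := fourierMul_ae_eq_conv (P.sym k) (smulF (P.S i u) (P.S j v) t)
  rw [S_apply]
  apply Lp.ext
  filter_upwards [h1, Lp.coeFn_zero V 2 (volume : Measure (E d))] with x hx h0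
  rw [hx, h0, Pi.zero_apply, ← conv_mul_eq_zero (P.sym k) (P.sym i) (P.sym j) hsym (u t) (v t) x]
  refine conv_congr _ ?_ x
  refine (smulF_ae (P.S j v) (P.memLp_top_S i u t)).trans ?_
  have h2 := fourierMul_ae_eq_conv (P.sym i) (u t)
  have h3 := fourierMul_ae_eq_conv (P.sym j) (v t)
  rw [← S_apply] at h2 h3
  filter_upwards [h2, h3] with w hw2 hw3
  rw [hw2, hw3]

/-! ### Product estimates -/

theorem enorm_S_le_smear (i : ℕ) (u : ℝ → L2 d V) (t : ℝ) :
    ∀ᵐ x, ‖P.S i u t x‖ₑ ≤ P.kerC * (pw (i * d / 2) * smear wt (prof (P.S i u)) t (idx x)) := by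
  filter_upwards [P.enorm_S_le_self i u t] with x hx
  refine hx.trans ?_
  gcongr
  exact mconv_le i (measurable_enorm _) ((mem_cube_zero_iff _ x).2 rfl)

theorem prof_smulF_S_le (i : ℕ) (u : ℝ → L2 d ℂ) (w : ℝ → L2 d V) (t : ℝ) (n : Idx d) :
    prof (smulF (P.S i u) w) t n ≤
      P.kerC * pw (i * d / 2) * (smear wt (prof (P.S i u)) t n * prof w t n) := by
  have h1 : prof (smulF (P.S i u) w) t n ≤
      pr2 (fun x => (P.kerC * (pw (i * d / 2) * smear wt (prof (P.S i u)) t (idx x))) * ‖w t x‖ₑ) n := by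
    refine pr2_mono ?_ n
    filter_upwards [smulF_ae w (P.memLp_top_S i u t), P.enorm_S_le_smear i u t] with x h1 h2
    rw [h1, enorm_smul]
    gcongr
  refine h1.trans ((pr2_mul_le (measurable_enorm (w t))
    (a := P.kerC * (pw (i * d / 2) * smear wt (prof (P.S i u)) t n)) ?_).trans
    (le_of_eq (by simp only [prof]; ring)))
  intro x hx
  rw [(mem_cube_zero_iff n x).1 hx]

theorem smear_le_mixTop {F : Prof d} :
    ∀ᵐ t ∂timeMeasure, ∀ n, smear wt F t n ≤ wtMass d * mixTop F := by
  filter_upwards [ae_le_mixTop F] with t ht n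
  unfold smear
  rw [coe_wtMass, ← ENNReal.tsum_mul_right]
  exact ENNReal.tsum_le_tsum fun m => mul_le_mul_right (ht _) _

/-- The product of a low frequency and a high frequency function. -/
theorem norm_smulF_S_le (N : LNorm d) (i : ℕ) (u : ℝ → L2 d ℂ) {w : ℝ → L2 d V}
    (hw : AEStronglyMeasurable w timeMeasure) :
    N (prof (smulF (P.S i u) w)) ≤
      P.kerC * wtMass d * (pw (i * d / 2) * mixTop (prof (P.S i u)) * N (prof w)) := by
  have hG : ∀ᵐ t ∂timeMeasure, ∀ n, P.kerC * pw (i * d / 2) * smear wt (prof (P.S i u)) t n ≤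
      P.kerC * pw (i * d / 2) * (wtMass d * mixTop (prof (P.S i u))) :=
    smear_le_mixTop.mono fun t ht n => mul_le_mul_right (ht n) _
  have h1 := N.mul_le (measP_prof hw) hG
  refine le_trans (N.mono (.of_forall fun t n => ?_)) (h1.trans (le_of_eq (by ring)))
  exact (P.prof_smulF_S_le i u w t n).trans (le_of_eq (by ring))

/-- The estimate behind the low-high bound in Y. The ℓ¹ sum over cubes of side 2^i is carried by the
low factor S_i u, at the cost 2^{id/2} of Bernstein; the other factor enters only through X, at the
cost 2^{i/2}. -/
theorem lsum_mix2_smulF_S_le (i : ℕ) {u : ℝ → L2 d ℂ} {w : ℝ → L2 d V}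
    (hu : AEStronglyMeasurable u timeMeasure) (hw : AEStronglyMeasurable w timeMeasure) :
    lsum i mix2 (prof (smulF (P.S i u) w)) ≤
      P.kerC * (2 ^ d * (mixTop (d := d)).c * wtMass d) *
        (pw (i * d / 2 + i / 2) * nX i (prof (P.S i u)) * xN (prof w)) := by
  have hS := measP_prof (P.aesm_S hu i)
  have h1 : lsum i mix2 (prof (smulF (P.S i u) w)) ≤ P.kerC * pw (i * d / 2) *
      lsum i mix2 (fun t n => smear wt (prof (P.S i u)) t n * prof w t n) :=
    ((lsum i mix2).mono (.of_forall fun t n => P.prof_smulF_S_le i u w t n)).trans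
      ((lsum i mix2).smul_le _ ((hS.smear wt).mul (measP_prof hw)))
  have h2 := lsum_mix2_mul_le i (smear wt (prof (P.S i u))) (measP_prof hw)
  have h3 := (lsum i mixTop).smear_le hS wt
  rw [← coe_wtMass] at h3
  have h4 := lsum_mixTop_le_nX i (prof (P.S i u))
  have h5 : ((lsum i (mixTop (d := d))).c : ℝ≥0∞) = 2 ^ d * (mixTop (d := d)).c := by simp [lsum]
  rw [h5] at h3
  calc _ ≤ P.kerC * pw (i * d / 2) * (pw ((i : ℝ) / 2) *
        (2 ^ d * (mixTop (d := d)).c * wtMass d * nX i (prof (P.S i u))) * xN (prof w)) := by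
        refine h1.trans (mul_le_mul_right (h2.trans ?_) _)
        gcongr ?_ * ?_ * _
        · exact le_rfl
        · exact h3.trans (mul_le_mul_right h4 _)
    _ = _ := by rw [pw_add]; ring

/-- The frequency `2^k` part of a function bounded by a product. -/
theorem norm_S_le_of_le_mul (N : LNorm d) (k : ℕ) {w : ℝ → L2 d V}
    {V₁ V₂ : Type*} [NormedAddCommGroup V₁] [InnerProductSpace ℂ V₁] [CompleteSpace V₁]
    [NormedAddCommGroup V₂] [InnerProductSpace ℂ V₂] [CompleteSpace V₂]
    {f : ℝ → L2 d V₁} {g : ℝ → L2 d V₂} (hf : AEStronglyMeasurable f timeMeasure)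
    (hg : AEStronglyMeasurable g timeMeasure) {a : ℝ≥0}
    (h : ∀ᵐ t ∂timeMeasure, ∀ᵐ x, ‖w t x‖ₑ ≤ a * (‖f t x‖ₑ * ‖g t x‖ₑ)) :
    N (prof (P.S k w)) ≤ P.kerC * N.c * wtMass d * a *
      (pw (k * d / 2) * mixTop (prof f) * N (prof g)) := by
  have h1 : ∀ᵐ t ∂timeMeasure, ∀ n, prof (P.S k w) t n ≤
      (P.kerC * a * pw (k * d / 2)) * smear wt (fun t n => prof f t n * prof g t n) t n := by
    filter_upwards [h] with t ht n
    have hm : Measurable fun x => ‖f t x‖ₑ * ‖g t x‖ₑ :=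
      (measurable_enorm (f t)).mul (measurable_enorm (g t))
    have h2 : ∀ᵐ x, ‖P.S k w t x‖ₑ ≤ P.kerC * a * mconv k (fun y => ‖f t y‖ₑ * ‖g t y‖ₑ) x := by
      filter_upwards [P.enorm_S_le k w t] with x hx
      refine hx.trans ?_
      rw [mul_assoc]
      gcongr
      refine (mconv_mono k ht x).trans (le_of_eq ?_)
      rw [mconv, mconv, ← lintegral_const_mul' _ _ (by simp)]
      refine lintegral_congr fun y => ?_
      ring
    refine (pr2_mono h2 n).trans ?_
    rw [pr2_const_mul _ (measurable_mconv k hm), mul_assoc (_ * _ : ℝ≥0∞)]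
    gcongr
    -- Bernstein from L¹ to L² at the output frequency, after which Cauchy-Schwarz in each unit cube
    -- separates the factors. The loss is governed by k and not by the possibly much higher
    -- frequencies of f and g.
    refine (pr2_mconv_le_pr1 k hm n).trans ?_
    change pw (k * d / 2) * _ ≤ _
    gcongr
    exact ENNReal.tsum_le_tsum fun m => mul_le_mul_right
      (pr1_mul_le (measurable_enorm (f t)) (measurable_enorm (g t)) _) _
  have hfg : MeasP fun t n => prof f t n * prof g t n := (measP_prof hf).mul (measP_prof hg)
  refine (N.mono h1).trans ((N.smul_le _ (hfg.smear wt)).trans ?_)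
  have h3 := N.smear_le hfg wt
  have h4 := N.mul_le (measP_prof hg) (ae_le_mixTop (prof f))
  rw [← coe_wtMass] at h3
  calc _ ≤ P.kerC * a * pw (k * d / 2) * (N.c * wtMass d * (mixTop (prof f) * N (prof g))) := by
        gcongr; exact h3.trans (mul_le_mul_right h4 _)
    _ = _ := by ring

end Decomposition

end LocalEnergy

end

noncomputable section

namespace LocalEnergy

open scoped SchwartzMap

variable {d : ℕ} {V : Type*} [NormedAddCommGroup V] [InnerProductSpace ℂ V] [CompleteSpace V]

open LNorm

/-! ### Geometric series -/

/-- The sum of the geometric series with ratio `2^e`. -/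
def geo (e : ℝ) : ℝ≥0∞ := ∑' r : ℕ, pw (e * r)

theorem geo_ne_top {e : ℝ} (he : e < 0) : geo e ≠ ⊤ := by
  have h : ∀ r : ℕ, pw (e * r) = pw e ^ r := by
    intro r; rw [pw, pw, ENNReal.rpow_mul, ENNReal.rpow_natCast]
  unfold geo
  simp_rw [h]
  rw [ENNReal.tsum_geometric]
  have h1 : pw e < 1 := ENNReal.rpow_lt_one_of_one_lt_of_neg (by norm_num) he
  simpa [tsub_eq_zero_iff_le] using h1

theorem sum_range_pw_le (e : ℝ) (k : ℕ) : ∑ i ∈ Finset.range k, pw (e * i) ≤ geo e :=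
  ENNReal.sum_le_tsum _

theorem tsum_ge_pw_le {e : ℝ} (he : e ≤ 0) (k : ℕ) :
    ∑' i : ℕ, (if k - 4 ≤ i then pw (e * ((i : ℝ) - k)) else 0) ≤ pw (-4 * e) * geo e := by
  have h : ∀ i, (if k - 4 ≤ i then pw (e * ((i : ℝ) - k)) else 0) =
      (Set.range fun r => r + (k - 4)).indicator (fun i : ℕ => pw (e * ((i : ℝ) - k))) i := by
    intro i
    by_cases hi : k - 4 ≤ i
    · rw [if_pos hi, Set.indicator_of_mem]
      exact ⟨i - (k - 4), by dsimp only; omega⟩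
    · rw [if_neg hi, Set.indicator_of_notMem]
      rintro ⟨r, hr⟩; dsimp only at hr; omega
  simp_rw [h]
  rw [← tsum_subtype, tsum_range (f := fun i : ℕ => pw (e * ((i : ℝ) - k)))
    (add_left_injective (k - 4)), geo, ← ENNReal.tsum_mul_left]
  refine ENNReal.tsum_le_tsum fun r => ?_
  rw [← pw_add]
  apply pw_mono
  -- The subtraction k - 4 is truncated at zero, so only an inequality holds. It points in the right
  -- direction because e ≤ 0.
  have h1 : (r : ℝ) - 4 ≤ ((r + (k - 4) : ℕ) : ℝ) - k := by
    have : r + k ≤ r + (k - 4) + 4 := by omega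
    have h2 : (r : ℝ) + k ≤ ((r + (k - 4) : ℕ) : ℝ) + 4 := by exact_mod_cast this
    linarith
  nlinarith

namespace Decomposition

variable (P : Decomposition d)

/-! ### The size of the Littlewood-Paley pieces -/

theorem nX_S_le (s : ℝ) {u : ℝ → L2 d V} (hu : AEStronglyMeasurable u timeMeasure) (i : ℕ) :
    nX i (prof (P.S i u)) ≤ P.cutC * (pw (-(i * s)) * P.l1X s u) := by
  have h := P.pw_mul_nX_le_l1X s i hu
  calc nX i (prof (P.S i u)) = pw (-(i * s)) * (pw (i * s) * nX i (prof (P.S i u))) := by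
        rw [← mul_assoc, ← pw_add, neg_add_cancel, pw_zero, one_mul]
    _ ≤ pw (-(i * s)) * (P.cutC * P.l1X s u) := by gcongr
    _ = _ := by ring

theorem mixTop_S_le (s : ℝ) {u : ℝ → L2 d V} (hu : AEStronglyMeasurable u timeMeasure) (i : ℕ) :
    mixTop (prof (P.S i u)) ≤ P.cutC * (pw (-(i * s)) * P.l1X s u) :=
  (mixTop_le_nX i (measP_prof (P.aesm_S hu i))).trans (P.nX_S_le s hu i)

variable {P} in
theorem IsEnvelope.ofReal_le {δ C s : ℝ} {u : ℝ → L2 d V} {a : ℕ → ℝ}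
    (h : P.IsEnvelope δ C s u a) (j k : ℕ) :
    ENNReal.ofReal (a j) ≤ pw (δ * |(j : ℝ) - k|) * ENNReal.ofReal (a k) := by
  rw [pw_eq_ofReal, ← ENNReal.ofReal_mul (by positivity)]
  exact ENNReal.ofReal_le_ofReal (h.slow j k)

theorem exists_nX_S_le_envelope (V : Type*) [NormedAddCommGroup V] [InnerProductSpace ℂ V]
    [CompleteSpace V] (s δ C : ℝ) :
    ∃ K : ℝ≥0∞, K ≠ ⊤ ∧ ∀ (u : ℝ → L2 d V) (a : ℕ → ℝ), AEStronglyMeasurable u timeMeasure →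
      P.IsEnvelope δ C s u a → ∀ i k : ℕ, nX i (prof (P.S i u)) ≤
        K * (pw (-(i * s) + δ * |(i : ℝ) - k|) * ENNReal.ofReal (a k) * P.l1X s u) := by
  obtain ⟨K, hK⟩ := P.exists_pw_mul_nX_le_l1X_S (V := V) s
  refine ⟨K, ENNReal.coe_ne_top, fun u a hu ha i k => ?_⟩
  calc nX i (prof (P.S i u)) = pw (-(i * s)) * (pw (i * s) * nX i (prof (P.S i u))) := by
        rw [← mul_assoc, ← pw_add, neg_add_cancel, pw_zero, one_mul]
    _ ≤ pw (-(i * s)) * (K * (pw (δ * |(i : ℝ) - k|) * ENNReal.ofReal (a k) * P.l1X s u)) := by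
        refine mul_le_mul_right ((hK u i (P.aesm_S hu i)).trans (mul_le_mul_right ?_ _)) _
        refine (ha.bound i).trans ?_
        gcongr
        exact ha.ofReal_le i k
    _ = _ := by rw [pw_add]; ring

/-! ### Boundedness -/

/-- Functions in `ℓ¹X^s`, `s > d/2`, are bounded. -/
theorem exists_ae_le {s : ℝ} (hs : (d : ℝ) / 2 < s) {u : ℝ → L2 d V} (hu : P.MemL1X s u) :
    ∃ B : ℝ≥0, ∀ᵐ t ∂timeMeasure, ∀ᵐ x, ‖u t x‖ₑ ≤ B := by
  have hT : ∀ i, ∀ᵐ t ∂timeMeasure, ∀ᵐ x, ‖P.S i u t x‖ₑ ≤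
      P.kerC * wtMass d * P.cutC * P.l1X s u * pw ((d / 2 - s) * i) := by
    intro i
    filter_upwards [smear_le_mixTop (F := prof (P.S i u))] with t ht
    filter_upwards [P.enorm_S_le_smear i u t] with x hx
    refine hx.trans ?_
    calc P.kerC * (pw (i * d / 2) * smear wt (prof (P.S i u)) t (idx x))
        ≤ P.kerC * (pw (i * d / 2) * (wtMass d * (P.cutC * (pw (-(i * s)) * P.l1X s u)))) := by
          gcongr
          exact (ht _).trans (mul_le_mul_right (P.mixTop_S_le s hu.1 i) _)
      _ = P.kerC * wtMass d * P.cutC * P.l1X s u * (pw (i * d / 2) * pw (-(i * s))) := by ring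
      _ = _ := by rw [← pw_add]; congr 2; ring
  set B : ℝ≥0∞ := P.kerC * wtMass d * P.cutC * P.l1X s u * geo (d / 2 - s) with hB
  have hBt : B ≠ ⊤ := by
    have h1 := hu.2.ne
    have h2 := geo_ne_top (e := d / 2 - s) (by linarith)
    rw [hB]; finiteness
  refine ⟨B.toNNReal, ?_⟩
  rw [ENNReal.coe_toNNReal hBt]
  filter_upwards [ae_all_iff.2 hT] with t ht
  -- The partial sums S_{<N}u(t) converge in L², hence almost everywhere along a subsequence, and
  -- each is bounded by the geometric series of the Bernstein bounds.
  obtain ⟨φ, -, hφ⟩ := (tendstoInMeasure_of_tendsto_Lp (P.tendsto_SLt u t)).exists_seq_tendsto_ae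
  have hsum : ∀ᵐ x, ∀ N, P.SLt N u t x = ∑ k ∈ Finset.range N, P.S k u t x := by
    refine ae_all_iff.2 fun N => ?_
    rw [SLt_apply]
    exact Lp.coeFn_fun_finsetSum _ _
  filter_upwards [hφ, ae_all_iff.2 ht, hsum] with x h1 h2 h3
  refine le_of_tendsto' h1.enorm fun N => ?_
  rw [h3]
  refine (enorm_sum_le _ _).trans ((Finset.sum_le_sum fun i _ => h2 i).trans ?_)
  rw [← Finset.mul_sum, hB]
  gcongr
  exact sum_range_pw_le _ _

theorem ae_memLp_top {s : ℝ} (hs : (d : ℝ) / 2 < s) {u : ℝ → L2 d V} (hu : P.MemL1X s u) :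
    ∀ᵐ t ∂timeMeasure, MemLp (u t) ⊤ volume := by
  obtain ⟨B, hB⟩ := P.exists_ae_le hs hu
  filter_upwards [hB] with t ht
  refine memLp_top_of_bound (Lp.aestronglyMeasurable _) B ?_
  filter_upwards [ht] with x hx
  rw [← ofReal_norm] at hx
  exact (ENNReal.ofReal_le_coe.1 hx)

/-! ### Low-high and high-high interactions -/

theorem prof_S_smulF_piece_eq_zero {i j k M : ℕ} (h : (i + 3 ≤ k ∧ j + 3 ≤ k) ∨
    (i + 3 ≤ j ∧ k + 3 ≤ j) ∨ (j + 3 ≤ i ∧ k + 3 ≤ i)) (u : ℝ → L2 d ℂ) (v : ℝ → L2 d V)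
    (t : ℝ) (n : Idx d) : prof (P.S k (smulF (P.S i u) (P.piece M v j))) t n = 0 := by
  have h0 : P.S k (smulF (P.S i u) (P.piece M v j)) t = (0 : ℝ → L2 d V) t := by
    unfold piece
    split_ifs
    · exact P.S_smulF_eq_zero h u v t
    · rw [S_apply, smulF_apply _ (P.memLp_top_S i u t), Pi.zero_apply, map_zero, fourierMul_zero]
  rw [prof_congr h0, prof_zero]

/-- With a low factor at frequency 2^i, i ≤ k - 3, only the parts of v with |j - k| ≤ 2 reach the
output frequency 2^k. The projection S_{≥M} is kept so that the same bound serves M = 0 (all of v)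
and M = k - 4. -/
theorem norm_LH_le (N : LNorm d) {i k : ℕ} (hik : i + 3 ≤ k) (M : ℕ) {u : ℝ → L2 d ℂ}
    {v : ℝ → L2 d V} (hu : AEStronglyMeasurable u timeMeasure)
    (hv : AEStronglyMeasurable v timeMeasure) :
    N (prof (P.S k (smulF (P.S i u) (P.SGe M v)))) ≤
      P.kerC * (N.c * wtMass d) * ∑ j ∈ Finset.Icc (k - 2) (k + 2),
        N (prof (smulF (P.S i u) (P.S j v))) := by
  have hm : ∀ j, AEStronglyMeasurable (smulF (P.S i u) (P.piece M v j)) timeMeasure := fun j =>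
    P.aesm_smulF_S hu (P.aesm_piece hv M j) i
  have h1 : N (prof (P.S k (smulF (P.S i u) (P.SGe M v)))) ≤
      ∑' j, N (prof (P.S k (smulF (P.S i u) (P.piece M v j)))) :=
    N.le_tsum (fun j => measP_prof (P.aesm_S (hm j) k)) (.of_forall fun t n =>
      P.prof_S_smulF_right_le k M v (P.memLp_top_S i u t) n)
  refine h1.trans ?_
  rw [tsum_eq_sum (s := Finset.Icc (k - 2) (k + 2)), Finset.mul_sum]
  · refine Finset.sum_le_sum fun j _ => (P.norm_prof_S_le N k (hm j)).trans ?_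
    gcongr
    refine N.mono (.of_forall fun t n => ?_)
    by_cases hj : M ≤ j
    · rw [piece, if_pos hj]
    · rw [piece, if_neg hj]
      have : smulF (P.S i u) (0 : ℝ → L2 d V) t = (0 : ℝ → L2 d V) t := by
        rw [smulF_apply _ (P.memLp_top_S i u t), Pi.zero_apply, map_zero]
      rw [prof_congr this, prof_zero]; exact zero_le
  · intro j hj
    rw [Finset.mem_Icc] at hj
    have : prof (P.S k (smulF (P.S i u) (P.piece M v j))) = fun _ _ => 0 := by
      funext t n
      exact P.prof_S_smulF_piece_eq_zero (by omega) u v t n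
    rw [this, N.zero]

theorem piece_of_le {M j : ℕ} (h : M ≤ j) (v : ℝ → L2 d V) : P.piece M v j = P.S j v := if_pos h

theorem piece_of_lt {M j : ℕ} (h : ¬ M ≤ j) (v : ℝ → L2 d V) : P.piece M v j = 0 := if_neg h

theorem smulF_zero_right (f : ℝ → L2 d ℂ) : smulF f (0 : ℝ → L2 d V) = 0 := by
  funext t
  symm
  refine eq_ofFun ?_
  filter_upwards [Lp.coeFn_zero V 2 (volume : Measure (E d))] with x hx
  rw [Pi.zero_apply, hx]; simp

theorem smulF_zero_left (g : ℝ → L2 d V) : smulF (0 : ℝ → L2 d ℂ) g = 0 := by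
  funext t
  symm
  refine eq_ofFun ?_
  filter_upwards [Lp.coeFn_zero V 2 (volume : Measure (E d)),
    Lp.coeFn_zero ℂ 2 (volume : Measure (E d))] with x hx hx'
  rw [Pi.zero_apply, Pi.zero_apply, hx, hx']; simp

theorem S_zero (k : ℕ) : P.S k (0 : ℝ → L2 d V) = 0 := by
  funext t; rw [S_apply, Pi.zero_apply, fourierMul_zero]

theorem prof_zero' : prof (0 : ℝ → L2 d V) = fun _ _ => 0 := by
  funext t n; exact prof_zero t n

theorem memLp_top_SGe {u : ℝ → L2 d V} {t : ℝ} (hu : MemLp (u t) ⊤ volume) (M : ℕ) :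
    MemLp (P.SGe M u t) ⊤ volume := by
  have h1 : MemLp (P.SLt M u t) ⊤ volume := by
    rw [SLt_apply]
    refine (memLp_congr_ae (Lp.coeFn_fun_finsetSum _ _)).2 ?_
    exact memLp_finsetSum _ fun i _ => P.memLp_top_S i u t
  exact (memLp_congr_ae (Lp.coeFn_sub _ _)).2 (hu.sub h1)

/-- If i, j ≥ k - 4 and |i - j| > 6, the larger of i and j exceeds both the other one and k by at
least 3, and the output vanishes. The remaining pairs fall under Bernstein from L¹ to L². The factor
v is expanded first, since the boundedness of u makes multiplication by S_{≥M}u continuous;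
afterwards each S_j v is bounded and u can be expanded. -/
theorem norm_HH_le (N : LNorm d) (k : ℕ) {u : ℝ → L2 d ℂ} {v : ℝ → L2 d V}
    (hu : AEStronglyMeasurable u timeMeasure) (hv : AEStronglyMeasurable v timeMeasure)
    (hb : ∀ᵐ t ∂timeMeasure, MemLp (u t) ⊤ volume) :
    N (prof (P.S k (smulF (P.SGe (k - 4) u) (P.SGe (k - 4) v)))) ≤
      P.kerC * N.c * wtMass d * pw (k * d / 2) *
        ∑' i, (if k - 4 ≤ i then N (prof (P.S i u)) else 0) *
          ∑ j ∈ Finset.Icc (i - 6) (i + 6), mixTop (prof (P.S j v)) := by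
  set M := k - 4 with hM
  have hm : ∀ i j, AEStronglyMeasurable (smulF (P.piece M u i) (P.piece M v j)) timeMeasure :=
    fun i j => P.aesm_smulF (P.aesm_piece hu M i) (P.aesm_piece hv M j)
      (.of_forall fun t => P.memLp_top_piece M u i t)
  have hm' : ∀ j, AEStronglyMeasurable (smulF (P.SGe M u) (P.piece M v j)) timeMeasure :=
    fun j => P.aesm_smulF (P.aesm_SGe hu M) (P.aesm_piece hv M j)
      (hb.mono fun t ht => P.memLp_top_SGe ht M)
  have h1 : N (prof (P.S k (smulF (P.SGe M u) (P.SGe M v)))) ≤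
      ∑' j, N (prof (P.S k (smulF (P.SGe M u) (P.piece M v j)))) :=
    N.le_tsum (fun j => measP_prof (P.aesm_S (hm' j) k)) (hb.mono fun t ht n =>
      P.prof_S_smulF_right_le k M v (P.memLp_top_SGe ht M) n)
  have h2 : ∀ j, N (prof (P.S k (smulF (P.SGe M u) (P.piece M v j)))) ≤
      ∑' i, N (prof (P.S k (smulF (P.piece M u i) (P.piece M v j)))) := by
    intro j
    by_cases hj : M ≤ j
    · rw [P.piece_of_le hj]
      refine N.le_tsum (fun i => measP_prof (P.aesm_S ?_ k)) (.of_forall fun t n =>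
        P.prof_S_smulF_left_le k M j v t n)
      have := hm i j
      rwa [P.piece_of_le hj] at this
    · rw [P.piece_of_lt hj, smulF_zero_right, S_zero, prof_zero', N.zero]
      exact zero_le
  refine h1.trans ((ENNReal.tsum_le_tsum h2).trans ?_)
  rw [ENNReal.tsum_comm, ← ENNReal.tsum_mul_left]
  refine ENNReal.tsum_le_tsum fun i => ?_
  split_ifs with hi
  · rw [P.piece_of_le hi, tsum_eq_sum (s := Finset.Icc (i - 6) (i + 6)), Finset.mul_sum,
      Finset.mul_sum]
    · refine Finset.sum_le_sum fun j _ => ?_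
      by_cases hj : M ≤ j
      · rw [P.piece_of_le hj]
        have h3 := P.norm_S_le_of_le_mul N k (w := smulF (P.S i u) (P.S j v)) (a := 1)
          (P.aesm_S hv j) (P.aesm_S hu i) (.of_forall fun t => ?_)
        · refine h3.trans (le_of_eq ?_)
          push_cast; ring
        · filter_upwards [smulF_ae (P.S j v) (P.memLp_top_S i u t)] with x hx
          rw [hx, enorm_smul, ENNReal.coe_one, one_mul, mul_comm]
      · rw [P.piece_of_lt hj, smulF_zero_right, S_zero, prof_zero', N.zero]
        exact zero_le
    · intro j hj
      rw [Finset.mem_Icc] at hj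
      by_cases hj' : M ≤ j
      · have : prof (P.S k (smulF (P.S i u) (P.piece M v j))) = fun _ _ => 0 := by
          funext t n
          exact P.prof_S_smulF_piece_eq_zero (by omega) u v t n
        rw [this, N.zero]
      · rw [P.piece_of_lt hj', smulF_zero_right, S_zero, prof_zero', N.zero]
  · rw [P.piece_of_lt hi]
    simp_rw [smulF_zero_left, S_zero, prof_zero', N.zero]
    simp

theorem sum_mixTop_le (s : ℝ) {v : ℝ → L2 d V} (hv : AEStronglyMeasurable v timeMeasure) (i : ℕ) :
    ∑ j ∈ Finset.Icc (i - 6) (i + 6), mixTop (prof (P.S j v)) ≤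
      13 * pw (6 * |s|) * P.cutC * (pw (-(i * s)) * P.l1X s v) := by
  have h : ∀ j ∈ Finset.Icc (i - 6) (i + 6), mixTop (prof (P.S j v)) ≤
      pw (6 * |s|) * P.cutC * (pw (-(i * s)) * P.l1X s v) := by
    intro j hj
    rw [Finset.mem_Icc] at hj
    refine (P.mixTop_S_le s hv j).trans ?_
    have h3 := pw_le_of_near (-s) (j := i) (k := j) (r := 6) (by omega) (by omega)
    rw [abs_neg, mul_neg, mul_neg] at h3
    calc P.cutC * (pw (-(j * s)) * P.l1X s v)
        ≤ P.cutC * ((pw (6 * |s|) * pw (-(i * s))) * P.l1X s v) := by gcongr; exact_mod_cast h3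
      _ = _ := by ring
  refine (Finset.sum_le_sum h).trans ?_
  rw [Finset.sum_const, nsmul_eq_mul, mul_assoc (13 : ℝ≥0∞), mul_assoc (13 : ℝ≥0∞)]
  gcongr
  rw [Nat.card_Icc]; exact_mod_cast (by omega : i + 6 + 1 - (i - 6) ≤ 13)

/-- The side 2^{k-3} is the largest that `exists_l1Y_le` admits. Going down to it from the natural
side 2^i costs the square root of the number of subcubes, about 2^{(i-k)d/2}. -/
theorem lsum_mix2_S_le {i k : ℕ} (h : k - 4 ≤ i) {u : ℝ → L2 d V}
    (hu : AEStronglyMeasurable u timeMeasure) :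
    lsum (k - 3) mix2 (prof (P.S i u)) ≤
      pw (2 * d) * pw (((i : ℝ) - k) * d / 2) * nX i (prof (P.S i u)) := by
  have hm := measP_prof (P.aesm_S hu i)
  have h0 : lsum i mix2 (prof (P.S i u)) ≤ nX i (prof (P.S i u)) :=
    (lsum_mix2_le i _).trans (lsum_mixTop_le_nX i _)
  have hd : (0 : ℝ) ≤ d := Nat.cast_nonneg d
  rcases le_total i (k - 3) with hi | hi
  · refine (lsum_coarse hi mix2 hm).trans (h0.trans ?_)
    rw [← pw_add]
    nth_rewrite 1 [← one_mul (nX i (prof (P.S i u)))]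
    gcongr
    rw [← pw_zero]
    apply pw_mono
    have : (k : ℝ) ≤ i + 4 := by exact_mod_cast (by omega : k ≤ i + 4)
    nlinarith
  · obtain ⟨r, rfl⟩ := Nat.exists_eq_add_of_le hi
    refine (lsum_mix2_fine (k - 3) r hm).trans ?_
    rw [← pw_add]
    gcongr
    change pw _ ≤ _
    apply pw_mono
    have : (r : ℝ) + k ≤ ((k - 3 + r : ℕ) : ℝ) + 3 := by
      exact_mod_cast (by omega : r + k ≤ k - 3 + r + 3)
    nlinarith

/-- The supremum in t may be attained at different times on different subcubes, so orthogonality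
gives nothing here, and the full number 2^{(i-k)d} of subcubes is paid. -/
theorem nX_S_fine_le {i k : ℕ} (h : k - 4 ≤ i) {u : ℝ → L2 d V}
    (hu : AEStronglyMeasurable u timeMeasure) :
    nX k (prof (P.S i u)) ≤ pw (2 + 4 * d) * pw (((i : ℝ) - k) * d) * nX i (prof (P.S i u)) := by
  have hm := measP_prof (P.aesm_S hu i)
  have hd : (0 : ℝ) ≤ d := Nat.cast_nonneg d
  rcases le_total i k with hi | hi
  · obtain ⟨r, rfl⟩ := Nat.exists_eq_add_of_le hi
    refine (nX_coarse i r hm).trans ?_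
    rw [← pw_add]
    gcongr
    change pw _ ≤ _
    apply pw_mono
    have : (r : ℝ) ≤ 4 := by exact_mod_cast (by omega : r ≤ 4)
    push_cast
    nlinarith
  · obtain ⟨r, rfl⟩ := Nat.exists_eq_add_of_le hi
    refine (nX_fine k r _).trans ?_
    rw [← pw_add, ← pw_natCast]
    gcongr
    apply pw_mono
    push_cast
    nlinarith

theorem SLt_add_SGe (M : ℕ) (u : ℝ → L2 d V) (t : ℝ) : u t = P.SLt M u t + P.SGe M u t := by
  simp [SGe]

theorem smulF_split {u : ℝ → L2 d ℂ} {t : ℝ} (hu : MemLp (u t) ⊤ volume) (M : ℕ) (w : ℝ → L2 d V) :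
    smulF u w t = ∑ i ∈ Finset.range M, smulF (P.S i u) w t + smulF (P.SGe M u) w t := by
  apply Lp.ext
  have h1 : ∀ᵐ x, ∀ i, smulF (P.S i u) w t x = P.S i u t x • w t x :=
    ae_all_iff.2 fun i => smulF_ae w (P.memLp_top_S i u t)
  have h3 : u t =ᵐ[volume] fun x => ∑ i ∈ Finset.range M, P.S i u t x + P.SGe M u t x := by
    have e := P.SLt_add_SGe M u t
    rw [SLt_apply] at e
    conv_lhs => rw [e]
    refine (Lp.coeFn_add _ _).trans ?_
    filter_upwards [Lp.coeFn_fun_finsetSum (Finset.range M) fun i => P.S i u t] with x hx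
    rw [Pi.add_apply, hx]
  filter_upwards [smulF_ae w hu, smulF_ae w (P.memLp_top_SGe hu M), h1, h3,
    Lp.coeFn_add (∑ i ∈ Finset.range M, smulF (P.S i u) w t) (smulF (P.SGe M u) w t),
    Lp.coeFn_fun_finsetSum (Finset.range M) fun i => smulF (P.S i u) w t] with x a1 a2 a3 a4 a5 a6
  rw [a1, a4, a5, Pi.add_apply, a6, a2, add_smul, Finset.sum_smul]
  simp_rw [a3]

theorem S_congr_sum (k : ℕ) {w : ℝ → L2 d V} {t : ℝ} {ι : Type*} (s : Finset ι)
    {p : ι → ℝ → L2 d V} {q : ℝ → L2 d V} (h : w t = ∑ i ∈ s, p i t + q t) :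
    P.S k w t = ∑ i ∈ s, P.S k (p i) t + P.S k q t := by
  simp_rw [S_apply, ← fmul_apply (P.memLp_sym k), h, map_add, map_sum]

end Decomposition

end LocalEnergy

end

noncomputable section

namespace LocalEnergy

open scoped SchwartzMap

variable {d : ℕ} {V : Type*} [NormedAddCommGroup V] [InnerProductSpace ℂ V] [CompleteSpace V]

open LNorm

namespace Decomposition

variable (P : Decomposition d)

/-! ### Bilinear estimates -/

theorem exists_sum_nX_le_envelope (V : Type*) [NormedAddCommGroup V] [InnerProductSpace ℂ V]
    [CompleteSpace V] (s δ C : ℝ) :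
    ∃ K : ℝ≥0∞, K ≠ ⊤ ∧ ∀ (v : ℝ → L2 d V) (b : ℕ → ℝ), AEStronglyMeasurable v timeMeasure →
      P.IsEnvelope δ C s v b → ∀ k : ℕ, ∑ j ∈ Finset.Icc (k - 2) (k + 2), nX j (prof (P.S j v)) ≤
        K * (pw (-(k * s)) * ENNReal.ofReal (b k) * P.l1X s v) := by
  obtain ⟨K, hKt, hK⟩ := P.exists_nX_S_le_envelope V s δ C
  refine ⟨5 * (pw (2 * |s| + 2 * |δ|) * K), by have := pw_ne_top (2 * |s| + 2 * |δ|); finiteness,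
    fun v b hv hb k => ?_⟩
  have h : ∀ j ∈ Finset.Icc (k - 2) (k + 2), nX j (prof (P.S j v)) ≤
      pw (2 * |s| + 2 * |δ|) * K * (pw (-(k * s)) * ENNReal.ofReal (b k) * P.l1X s v) := by
    intro j hj
    rw [Finset.mem_Icc] at hj
    refine (hK v b hv hb j k).trans ?_
    have hjk : |(j : ℝ) - k| ≤ 2 := by
      have h1 : (j : ℝ) ≤ k + 2 := by exact_mod_cast hj.2
      have h2 : (k : ℝ) ≤ j + 2 := by exact_mod_cast (by omega : k ≤ j + 2)
      rw [abs_le]; constructor <;> linarith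
    have h3 : pw (-(j * s) + δ * |(j : ℝ) - k|) ≤ pw (2 * |s| + 2 * |δ|) * pw (-(k * s)) := by
      rw [← pw_add]
      apply pw_mono
      have e1 : ((k : ℝ) - j) * s ≤ 2 * |s| := by
        calc ((k : ℝ) - j) * s ≤ |((k : ℝ) - j) * s| := le_abs_self _
          _ = |(j : ℝ) - k| * |s| := by rw [abs_mul, abs_sub_comm]
          _ ≤ 2 * |s| := by gcongr
      have e2 : δ * |(j : ℝ) - k| ≤ 2 * |δ| := by
        calc δ * |(j : ℝ) - k| ≤ |δ| * |(j : ℝ) - k| := by gcongr; exact le_abs_self _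
          _ ≤ |δ| * 2 := by gcongr
          _ = _ := mul_comm _ _
      nlinarith
    calc K * (pw (-(j * s) + δ * |(j : ℝ) - k|) * ENNReal.ofReal (b k) * P.l1X s v)
        ≤ K * ((pw (2 * |s| + 2 * |δ|) * pw (-(k * s))) * ENNReal.ofReal (b k) * P.l1X s v) := by
          gcongr
      _ = _ := by ring
  refine (Finset.sum_le_sum h).trans ?_
  rw [Finset.sum_const, nsmul_eq_mul, mul_assoc (5 : ℝ≥0∞)]
  gcongr
  rw [Nat.card_Icc]; exact_mod_cast (by omega : k + 2 + 1 - (k - 2) ≤ 5)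

/-- High-high interactions for a family of norms in which S_i u costs 2^{(i-k)g}; ℓ¹Y uses g = d/2
and ℓ¹X uses g = d. The term i carries the power kσ + kd/2 + (i-k)g - i(s₁+s₂) + δ|i-k| of 2. At i =
k it is bounded because σ + d/2 ≤ s₁ + s₂, and it decays in i - k because g + δ < s₁ + s₂. -/
theorem exists_norm_HH_le (V : Type*) [NormedAddCommGroup V] [InnerProductSpace ℂ V]
    [CompleteSpace V] {s₁ s₂ σ δ g : ℝ} (C : ℝ) (N : ℕ → LNorm d) {B c : ℝ≥0}
    (hc : ∀ k, (N k).c = c)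
    (hN : ∀ (k i : ℕ) (u : ℝ → L2 d ℂ), k - 4 ≤ i → AEStronglyMeasurable u timeMeasure →
      N k (prof (P.S i u)) ≤ B * pw (((i : ℝ) - k) * g) * nX i (prof (P.S i u)))
    (hδ : 0 ≤ δ) (h1 : σ + d / 2 ≤ s₁ + s₂) (h2 : g + δ < s₁ + s₂) :
    ∃ K : ℝ≥0∞, K ≠ ⊤ ∧ ∀ (u : ℝ → L2 d ℂ) (v : ℝ → L2 d V) (a : ℕ → ℝ),
      AEStronglyMeasurable u timeMeasure → AEStronglyMeasurable v timeMeasure →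
      (∀ᵐ t ∂timeMeasure, MemLp (u t) ⊤ volume) → P.IsEnvelope δ C s₁ u a → ∀ k : ℕ,
      pw (k * σ) * N k (prof (P.S k (smulF (P.SGe (k - 4) u) (P.SGe (k - 4) v)))) ≤
        K * (ENNReal.ofReal (a k) * P.l1X s₁ u * P.l1X s₂ v) := by
  obtain ⟨K, hKt, hK⟩ := P.exists_nX_S_le_envelope ℂ s₁ δ C
  set e := g - s₁ - s₂ + δ with he
  have he0 : e < 0 := by rw [he]; linarith
  set Q : ℝ≥0∞ := P.kerC * c * wtMass d * B * K * (13 * pw (6 * |s₂|) * P.cutC) * pw (8 * δ) with hQ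
  refine ⟨Q * (pw (-4 * e) * geo e), ?_, fun u v a hu hv hb ha k => ?_⟩
  · have := geo_ne_top he0
    have h3 := pw_ne_top (-4 * e)
    have h4 := pw_ne_top (8 * δ)
    have h5 := pw_ne_top (6 * |s₂|)
    rw [hQ]; finiteness
  refine (mul_le_mul_right (P.norm_HH_le (N k) k hu hv hb) _).trans ?_
  rw [hc]
  have hterm : ∀ i : ℕ, (if k - 4 ≤ i then N k (prof (P.S i u)) else 0) *
        ∑ j ∈ Finset.Icc (i - 6) (i + 6), mixTop (prof (P.S j v)) ≤
      B * K * (13 * pw (6 * |s₂|) * P.cutC) * pw (8 * δ) * pw (-(k * σ) - k * d / 2) *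
        (ENNReal.ofReal (a k) * P.l1X s₁ u * P.l1X s₂ v) *
        (if k - 4 ≤ i then pw (e * ((i : ℝ) - k)) else 0) := by
    intro i
    split_ifs with hi
    · have hik : |(i : ℝ) - k| ≤ (i : ℝ) - k + 8 := by
        have : (k : ℝ) ≤ i + 4 := by exact_mod_cast (by omega : k ≤ i + 4)
        rw [abs_le]; constructor <;> linarith
      have hexp : pw (((i : ℝ) - k) * g) * pw (-(i * s₁) + δ * |(i : ℝ) - k|) * pw (-(i * s₂)) ≤
          pw (8 * δ) * pw (-(k * σ) - k * d / 2) * pw (e * ((i : ℝ) - k)) := by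
        rw [← pw_add, ← pw_add, ← pw_add, ← pw_add]
        apply pw_mono
        have e1 : δ * |(i : ℝ) - k| ≤ δ * ((i : ℝ) - k + 8) := by gcongr
        have e2 : (k : ℝ) * (σ + d / 2) ≤ k * (s₁ + s₂) := by gcongr
        rw [he]; nlinarith
      calc N k (prof (P.S i u)) * ∑ j ∈ Finset.Icc (i - 6) (i + 6), mixTop (prof (P.S j v))
          ≤ (B * pw (((i : ℝ) - k) * g) * (K * (pw (-(i * s₁) + δ * |(i : ℝ) - k|) *
              ENNReal.ofReal (a k) * P.l1X s₁ u))) *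
            (13 * pw (6 * |s₂|) * P.cutC * (pw (-(i * s₂)) * P.l1X s₂ v)) := by
            refine mul_le_mul' ((hN k i u hi hu).trans ?_) (P.sum_mixTop_le s₂ hv i)
            gcongr
            exact hK u a hu ha i k
        _ = B * K * (13 * pw (6 * |s₂|) * P.cutC) *
            (ENNReal.ofReal (a k) * P.l1X s₁ u * P.l1X s₂ v) *
            (pw (((i : ℝ) - k) * g) * pw (-(i * s₁) + δ * |(i : ℝ) - k|) * pw (-(i * s₂))) := by ring
        _ ≤ B * K * (13 * pw (6 * |s₂|) * P.cutC) *
            (ENNReal.ofReal (a k) * P.l1X s₁ u * P.l1X s₂ v) *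
            (pw (8 * δ) * pw (-(k * σ) - k * d / 2) * pw (e * ((i : ℝ) - k))) := by gcongr
        _ = _ := by ring
    · simp
  have hsum := ENNReal.tsum_le_tsum hterm
  rw [ENNReal.tsum_mul_left] at hsum
  have hcancel : pw (k * σ) * pw (k * d / 2) * pw (-(k * σ) - k * d / 2) = 1 := by
    rw [← pw_add, ← pw_add, ← pw_zero]; congr 1; ring
  calc _ ≤ pw (k * σ) * (P.kerC * c * wtMass d * pw (k * d / 2) *
        (B * K * (13 * pw (6 * |s₂|) * P.cutC) * pw (8 * δ) * pw (-(k * σ) - k * d / 2) *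
        (ENNReal.ofReal (a k) * P.l1X s₁ u * P.l1X s₂ v) * (pw (-4 * e) * geo e))) := by
        gcongr
        refine hsum.trans ?_
        gcongr
        exact tsum_ge_pw_le he0.le k
    _ = (pw (k * σ) * pw (k * d / 2) * pw (-(k * σ) - k * d / 2)) * (Q * (pw (-4 * e) * geo e) *
        (ENNReal.ofReal (a k) * P.l1X s₁ u * P.l1X s₂ v)) := by rw [hQ]; ring
    _ = _ := by rw [hcancel, one_mul]

/-- The low-high interactions in `ℓ¹Y`. -/
theorem exists_lsum_LH_le (V : Type*) [NormedAddCommGroup V] [InnerProductSpace ℂ V]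
    [CompleteSpace V] {s₁ s₂ σ : ℝ} (δ C : ℝ) (h1 : σ ≤ s₂ + 1) (h2 : σ - s₂ + d / 2 < s₁) :
    ∃ K : ℝ≥0∞, K ≠ ⊤ ∧ ∀ (u : ℝ → L2 d ℂ) (v : ℝ → L2 d V) (b : ℕ → ℝ),
      AEStronglyMeasurable u timeMeasure → AEStronglyMeasurable v timeMeasure →
      P.IsEnvelope δ C s₂ v b → ∀ k M : ℕ,
      pw (k * σ) * ∑ i ∈ Finset.range (k - 4), pw (((i : ℝ) - k) / 2) *
        lsum i mix2 (prof (P.S k (smulF (P.S i u) (P.SGe M v)))) ≤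
        K * (ENNReal.ofReal (b k) * P.l1X s₁ u * P.l1X s₂ v) := by
  obtain ⟨K, hKt, hK⟩ := P.exists_sum_nX_le_envelope V s₂ δ C
  set e := σ - s₂ + d / 2 - s₁ with he
  have he0 : e < 0 := by rw [he]; linarith
  set A : ℝ≥0∞ := P.kerC * ((2 ^ d * (mix2 (d := d)).c) * wtMass d) with hA
  set B : ℝ≥0∞ := P.kerC * (2 ^ d * (mixTop (d := d)).c * wtMass d) with hB
  refine ⟨A * B * pw 1 * P.cutC * K * geo e, ?_, fun u v b hu hv hb k M => ?_⟩
  · have := geo_ne_top he0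
    have h3 := pw_ne_top 1
    rw [hA, hB]; finiteness
  have hterm : ∀ i ∈ Finset.range (k - 4), pw (k * σ) * (pw (((i : ℝ) - k) / 2) *
      lsum i mix2 (prof (P.S k (smulF (P.S i u) (P.SGe M v))))) ≤
      A * B * pw 1 * P.cutC * K * (ENNReal.ofReal (b k) * P.l1X s₁ u * P.l1X s₂ v) * pw (e * i) := by
    intro i hi
    rw [Finset.mem_range] at hi
    have hc : ((lsum i (mix2 (d := d))).c : ℝ≥0∞) = 2 ^ d * (mix2 (d := d)).c := by simp [lsum]
    have a1 := P.norm_LH_le (lsum i mix2) (i := i) (k := k) (by omega) M hu hv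
    rw [hc, ← hA] at a1
    have a2 : ∀ j ∈ Finset.Icc (k - 2) (k + 2), lsum i mix2 (prof (smulF (P.S i u) (P.S j v))) ≤
        B * (pw (i * d / 2 + i / 2) * nX i (prof (P.S i u))) * (pw 1 * pw (-(k : ℝ) / 2)) *
          nX j (prof (P.S j v)) := by
      intro j hj
      rw [Finset.mem_Icc] at hj
      refine (P.lsum_mix2_smulF_S_le i hu (P.aesm_S hv j)).trans ?_
      have a3 := xN_le_nX j (measP_prof (P.aesm_S hv j))
      have a4 : pw (-(j : ℝ) / 2) ≤ pw 1 * pw (-(k : ℝ) / 2) := by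
        rw [← pw_add]; apply pw_mono
        have : (k : ℝ) ≤ j + 2 := by exact_mod_cast (by omega : k ≤ j + 2)
        linarith
      calc _ ≤ B * (pw (i * d / 2 + i / 2) * nX i (prof (P.S i u)) *
            ((pw 1 * pw (-(k : ℝ) / 2)) * nX j (prof (P.S j v)))) := by
            rw [hB]; gcongr
            exact a3.trans (mul_le_mul_left a4 _)
        _ = _ := by ring
    have a5 := a1.trans (mul_le_mul_right (Finset.sum_le_sum a2) A)
    rw [← Finset.mul_sum] at a5
    -- The exponents add up to e·i + (k-i)(σ-s₂-1). The one derivative allowed by σ ≤ s₂ + 1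
    -- consists of one half from the side of the atoms and one half from the X norm of the high
    -- factor.
    have hexp : pw (k * σ) * pw (((i : ℝ) - k) / 2) * pw (i * d / 2 + i / 2) * pw (-(i * s₁)) *
        pw (-(k : ℝ) / 2) * pw (-(k * s₂)) ≤ pw (e * i) := by
      simp only [← pw_add]
      apply pw_mono
      have hik : (i : ℝ) ≤ k := by exact_mod_cast (by omega : i ≤ k)
      have : ((k : ℝ) - i) * (σ - s₂ - 1) ≤ 0 :=
        mul_nonpos_of_nonneg_of_nonpos (by linarith) (by linarith)
      rw [he]; nlinarith
    calc pw (k * σ) * (pw (((i : ℝ) - k) / 2) *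
          lsum i mix2 (prof (P.S k (smulF (P.S i u) (P.SGe M v)))))
        ≤ pw (k * σ) * (pw (((i : ℝ) - k) / 2) * (A * (B * (pw (i * d / 2 + i / 2) *
          (P.cutC * (pw (-(i * s₁)) * P.l1X s₁ u))) * (pw 1 * pw (-(k : ℝ) / 2)) *
          (K * (pw (-(k * s₂)) * ENNReal.ofReal (b k) * P.l1X s₂ v))))) := by
          gcongr
          refine a5.trans ?_
          gcongr
          · exact P.nX_S_le s₁ hu i
          · exact hK v b hv hb k
      _ = A * B * pw 1 * P.cutC * K * (ENNReal.ofReal (b k) * P.l1X s₁ u * P.l1X s₂ v) *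
          (pw (k * σ) * pw (((i : ℝ) - k) / 2) * pw (i * d / 2 + i / 2) * pw (-(i * s₁)) *
          pw (-(k : ℝ) / 2) * pw (-(k * s₂))) := by ring
      _ ≤ _ := by gcongr
  rw [Finset.mul_sum]
  refine (Finset.sum_le_sum hterm).trans ?_
  rw [← Finset.mul_sum]
  calc _ ≤ A * B * pw 1 * P.cutC * K * (ENNReal.ofReal (b k) * P.l1X s₁ u * P.l1X s₂ v) * geo e := by
        gcongr; exact sum_range_pw_le _ _
    _ = _ := by ring

/-- The low-high interactions in `ℓ¹X`. -/
theorem exists_nX_LH_le (V : Type*) [NormedAddCommGroup V] [InnerProductSpace ℂ V]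
    [CompleteSpace V] {s : ℝ} (δ C : ℝ) (h : (d : ℝ) / 2 < s) :
    ∃ K : ℝ≥0∞, K ≠ ⊤ ∧ ∀ (u : ℝ → L2 d ℂ) (v : ℝ → L2 d V) (b : ℕ → ℝ),
      AEStronglyMeasurable u timeMeasure → AEStronglyMeasurable v timeMeasure →
      P.IsEnvelope δ C s v b → ∀ k M : ℕ,
      pw (k * s) * ∑ i ∈ Finset.range (k - 4),
        nX k (prof (P.S k (smulF (P.S i u) (P.SGe M v)))) ≤
        K * (ENNReal.ofReal (b k) * P.l1X s u * P.l1X s v) := by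
  obtain ⟨K, hKt, hK⟩ := P.exists_sum_nX_le_envelope V s δ C
  set e := d / 2 - s with he
  have he0 : e < 0 := by rw [he]; linarith
  set A : ℝ≥0∞ := P.kerC * ((2 ^ d * 2 ^ d) * wtMass d) with hA
  set B : ℝ≥0∞ := P.kerC * wtMass d * 2 ^ (2 * d + 2) with hB
  refine ⟨A * B * P.cutC * K * geo e, ?_, fun u v b hu hv hb k M => ?_⟩
  · have := geo_ne_top he0
    rw [hA, hB]; finiteness
  have hterm : ∀ i ∈ Finset.range (k - 4), pw (k * s) *
      nX k (prof (P.S k (smulF (P.S i u) (P.SGe M v)))) ≤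
      A * B * P.cutC * K * (ENNReal.ofReal (b k) * P.l1X s u * P.l1X s v) * pw (e * i) := by
    intro i hi
    rw [Finset.mem_range] at hi
    have a1 := P.norm_LH_le (nX k) (i := i) (k := k) (by omega) M hu hv
    simp only [nX_c, ENNReal.coe_mul, ENNReal.coe_pow, ENNReal.coe_ofNat] at a1
    rw [← hA] at a1
    have a2 : ∀ j ∈ Finset.Icc (k - 2) (k + 2), nX k (prof (smulF (P.S i u) (P.S j v))) ≤
        B * (pw (i * d / 2) * (P.cutC * (pw (-(i * s)) * P.l1X s u))) * nX j (prof (P.S j v)) := by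
      intro j hj
      rw [Finset.mem_Icc] at hj
      refine (P.norm_smulF_S_le (nX k) i u (P.aesm_S hv j)).trans ?_
      have a3 := nX_le_nX (j := j) (k := k) (r := 2) (by omega) (by omega)
        (measP_prof (P.aesm_S hv j))
      calc _ ≤ P.kerC * wtMass d * (pw (i * d / 2) * (P.cutC * (pw (-(i * s)) * P.l1X s u)) *
            (2 ^ (2 * d + 2) * nX j (prof (P.S j v)))) := by
            gcongr
            exact P.mixTop_S_le s hu i
        _ = _ := by rw [hB]; ring
    have a5 := a1.trans (mul_le_mul_right (Finset.sum_le_sum a2) A)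
    rw [← Finset.mul_sum] at a5
    have hexp : pw (k * s) * pw (i * d / 2) * pw (-(i * s)) * pw (-(k * s)) ≤ pw (e * i) := by
      simp only [← pw_add]
      apply pw_mono
      rw [he]; nlinarith
    calc pw (k * s) * nX k (prof (P.S k (smulF (P.S i u) (P.SGe M v))))
        ≤ pw (k * s) * (A * (B * (pw (i * d / 2) * (P.cutC * (pw (-(i * s)) * P.l1X s u))) *
          (K * (pw (-(k * s)) * ENNReal.ofReal (b k) * P.l1X s v)))) := by
          gcongr
          refine a5.trans ?_
          gcongr
          exact hK v b hv hb k
      _ = A * B * P.cutC * K * (ENNReal.ofReal (b k) * P.l1X s u * P.l1X s v) *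
          (pw (k * s) * pw (i * d / 2) * pw (-(i * s)) * pw (-(k * s))) := by ring
      _ ≤ _ := by gcongr
  rw [Finset.mul_sum]
  refine (Finset.sum_le_sum hterm).trans ?_
  rw [← Finset.mul_sum]
  calc _ ≤ A * B * P.cutC * K * (ENNReal.ofReal (b k) * P.l1X s u * P.l1X s v) * geo e := by
        gcongr; exact sum_range_pw_le _ _
    _ = _ := by ring

theorem norm_add_le (N : LNorm d) {u v : ℝ → L2 d V} (hu : AEStronglyMeasurable u timeMeasure)
    (hv : AEStronglyMeasurable v timeMeasure) :
    N (prof (u + v)) ≤ N (prof u) + N (prof v) := by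
  have h := norm_sum_le N (Finset.univ : Finset Bool) (fun b => cond b u v) (by simp [hu, hv])
  simpa using h

/-- The decomposition of a product into low-high, high-low and high-high interactions. -/
theorem S_mul_split {u v : ℝ → L2 d ℂ} {t : ℝ} (hu : MemLp (u t) ⊤ volume)
    (k M : ℕ) : P.S k (smulF u v) t =
      ∑ i ∈ Finset.range M, P.S k (smulF (P.S i u) (P.SGe 0 v)) t +
      (∑ i ∈ Finset.range M, P.S k (smulF (P.S i v) (P.SGe M u)) t +
        P.S k (smulF (P.SGe M u) (P.SGe M v)) t) := by
  rw [P.SGe_zero]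
  rw [P.S_congr_sum k (Finset.range M) (P.smulF_split hu M v)]
  congr 1
  have h2 : smulF (P.SGe M u) v t =
      ∑ i ∈ Finset.range M, smulF (P.S i v) (P.SGe M u) t + smulF (P.SGe M u) (P.SGe M v) t := by
    have hb := P.memLp_top_SGe hu M
    have e : smulF (P.SGe M u) v t = bmul _ hb (∑ i ∈ Finset.range M, P.S i v t + P.SGe M v t) := by
      rw [smulF_apply v hb, ← SLt_apply, ← P.SLt_add_SGe]
    rw [e, map_add, map_sum]
    congr 1
    refine Finset.sum_congr rfl fun i _ => ?_
    rw [smulF_comm]; rfl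
  exact P.S_congr_sum k (Finset.range M) h2

theorem S_mul_SGe_split {u v : ℝ → L2 d ℂ} {t : ℝ} (hu : MemLp (u t) ⊤ volume) (k M : ℕ) :
    P.S k (smulF u (P.SGe M v)) t = ∑ i ∈ Finset.range M, P.S k (smulF (P.S i u) (P.SGe M v)) t +
      P.S k (smulF (P.SGe M u) (P.SGe M v)) t :=
  P.S_congr_sum k (Finset.range M) (P.smulF_split hu M _)

/-- The scales for the atoms: the i-th low-high and high-low pieces are cut into cubes of side 2^i,
and the high-high remainder into cubes of side 2^{k-3}. All of them respect the bound k - 3 on the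
scale in `exists_l1Y_le`. -/
theorem exists_l1Y_S_le (V : Type*) [NormedAddCommGroup V] [InnerProductSpace ℂ V]
    [CompleteSpace V] (σ : ℝ) :
    ∃ K : ℝ≥0∞, K ≠ ⊤ ∧ ∀ (w : ℝ → L2 d V) (p q : ℕ → ℝ → L2 d V) (r : ℝ → L2 d V) (k : ℕ),
      (∀ i, AEStronglyMeasurable (p i) timeMeasure) → (∀ i, AEStronglyMeasurable (q i) timeMeasure) →
      AEStronglyMeasurable r timeMeasure →
      (∀ᵐ t ∂timeMeasure, P.S k w t = ∑ i ∈ Finset.range (k - 4), p i t +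
        (∑ i ∈ Finset.range (k - 4), q i t + r t)) →
      P.l1Y σ (P.S k w) ≤ K * (pw (k * σ) *
        ∑ i ∈ Finset.range (k - 4), pw (((i : ℝ) - k) / 2) * lsum i mix2 (prof (p i)) +
        pw (k * σ) * ∑ i ∈ Finset.range (k - 4), pw (((i : ℝ) - k) / 2) * lsum i mix2 (prof (q i)) +
        pw (k * σ) * lsum (k - 3) mix2 (prof r)) := by
  obtain ⟨K, hK⟩ := P.exists_l1Y_le (V := V) σ
  refine ⟨K, ENNReal.coe_ne_top, fun w p q r k hp hq hr hw => ?_⟩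
  set ι := Option (Fin (k - 4) ⊕ Fin (k - 4))
  set f : ι → ℝ → L2 d V := fun i => Option.elim i r (Sum.elim (fun i => p i) fun i => q i) with hf
  set l : ι → ℕ := fun i => Option.elim i (k - 3) (Sum.elim (fun i => (i : ℕ)) fun i => (i : ℕ)) with hl
  refine (hK ι f l (P.S k w) k ?_ ?_ ?_ ?_).trans ?_
  · rintro (_ | i | i)
    · exact hr
    · exact hp i
    · exact hq i
  · filter_upwards [hw] with t ht
    rw [ht, Fintype.sum_option, Fintype.sum_sum_type]
    simp only [hf, Option.elim_some, Option.elim_none, Sum.elim_inl, Sum.elim_inr]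
    rw [Fin.sum_univ_eq_sum_range (fun i => p i t), Fin.sum_univ_eq_sum_range (fun i => q i t)]
    abel
  · rintro (_ | i | i)
    · exact le_rfl
    · have := i.2; simp only [hl, Option.elim_some, Sum.elim_inl]; omega
    · have := i.2; simp only [hl, Option.elim_some, Sum.elim_inr]; omega
  · intro j hj
    refine .of_forall fun t => ?_
    rw [P.S_S_eq_zero (by omega)]; rfl
  · gcongr
    rw [Fintype.sum_option, Fintype.sum_sum_type]
    simp only [hf, hl, Option.elim_some, Option.elim_none, Sum.elim_inl, Sum.elim_inr]
    rw [Fin.sum_univ_eq_sum_range (fun i => pw (((i : ℝ) - k) / 2) * lsum i mix2 (prof (p i))),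
      Fin.sum_univ_eq_sum_range (fun i => pw (((i : ℝ) - k) / 2) * lsum i mix2 (prof (q i))),
      ← mul_add, ← mul_add]
    refine mul_le_mul_right ((add_comm _ _).le.trans (add_le_add le_rfl ?_)) _
    -- The remainder has atoms at nearly the scale 2^k, so its factor 2^{(l-k)/2} is at most one and
    -- is dropped.
    refine mul_le_of_le_one_left' ?_
    rw [← pw_zero]; apply pw_mono
    have : ((k - 3 : ℕ) : ℝ) ≤ k := by exact_mod_cast Nat.sub_le _ _
    linarith

theorem hN_lsum (k i : ℕ) (u : ℝ → L2 d ℂ) (h : k - 4 ≤ i)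
    (hu : AEStronglyMeasurable u timeMeasure) : lsum (k - 3) mix2 (prof (P.S i u)) ≤
      ((pw (2 * d)).toNNReal : ℝ≥0∞) * pw (((i : ℝ) - k) * (d / 2)) * nX i (prof (P.S i u)) := by
  rw [coe_toNNReal_pw, ← mul_div_assoc]
  exact P.lsum_mix2_S_le h hu

/-- The bilinear bound in `ℓ¹Y^σ`, with the second factor restricted to high frequencies. -/
theorem exists_l1Y_mul_SGe_le {s₁ s₂ σ δ : ℝ} (C : ℝ) (hδ : 0 ≤ δ) (h1 : σ ≤ s₂ + 1)
    (h2 : σ - s₂ + d / 2 < s₁) (h3 : d / 2 + δ < s₁ + s₂) :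
    ∃ K : ℝ≥0, ∀ (u v : ℝ → L2 d ℂ) (a b : ℕ → ℝ),
      AEStronglyMeasurable u timeMeasure → AEStronglyMeasurable v timeMeasure →
      (∀ᵐ t ∂timeMeasure, MemLp (u t) ⊤ volume) → P.IsEnvelope δ C s₁ u a →
      P.IsEnvelope δ C s₂ v b → ∀ k : ℕ,
      P.l1Y σ (P.S k (mul u (P.SGe (k - 4) v))) ≤
        K * ENNReal.ofReal (a k + b k) * P.l1X s₁ u * P.l1X s₂ v := by
  obtain ⟨K₁, hK₁t, hK₁⟩ := P.exists_l1Y_S_le ℂ σ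
  obtain ⟨K₂, hK₂t, hK₂⟩ := P.exists_lsum_LH_le ℂ δ C h1 h2
  obtain ⟨K₃, hK₃t, hK₃⟩ := P.exists_norm_HH_le ℂ (s₁ := s₁) (s₂ := s₂) (σ := σ) C
    (fun k => lsum (k - 3) mix2) (fun k => rfl) P.hN_lsum hδ (by linarith) h3
  refine ⟨(K₁ * (K₂ + K₃)).toNNReal, fun u v a b hu hv hb ha hb' k => ?_⟩
  rw [ENNReal.coe_toNNReal (by finiteness)]
  have hp : ∀ i, AEStronglyMeasurable (P.S k (smulF (P.S i u) (P.SGe (k - 4) v))) timeMeasure :=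
    fun i => P.aesm_S (P.aesm_smulF_S hu (P.aesm_SGe hv _) i) k
  have hr : AEStronglyMeasurable (P.S k (smulF (P.SGe (k - 4) u) (P.SGe (k - 4) v))) timeMeasure :=
    P.aesm_S (P.aesm_smulF (P.aesm_SGe hu _) (P.aesm_SGe hv _)
      (hb.mono fun t ht => P.memLp_top_SGe ht _)) k
  -- The second factor has no frequencies below about 2^{k-4}, so there is no high-low part and its
  -- slot is filled with zero. This removes the condition σ ≤ s₁ + 1.
  have h := hK₁ (smulF u (P.SGe (k - 4) v)) _ (fun _ => 0) _ k hp (fun _ => aestronglyMeasurable_const)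
    hr (hb.mono fun t ht => by
      rw [P.S_mul_SGe_split ht k (k - 4)]; simp)
  simp only [prof_zero', LNorm.zero, mul_zero, Finset.sum_const_zero, add_zero] at h
  rw [mul_eq_smulF]
  refine h.trans ?_
  calc _ ≤ K₁ * (K₂ * (ENNReal.ofReal (a k + b k) * P.l1X s₁ u * P.l1X s₂ v) +
        K₃ * (ENNReal.ofReal (a k + b k) * P.l1X s₁ u * P.l1X s₂ v)) := by
        refine mul_le_mul_right (add_le_add ?_ ?_) _
        · refine (hK₂ u v b hu hv hb' k (k - 4)).trans ?_
          gcongr; linarith [ha.pos k]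
        · refine (hK₃ u v a hu hv hb ha k).trans ?_
          gcongr; linarith [hb'.pos k]
    _ = _ := by ring

/-- The bilinear bound in `ℓ¹Y^σ`. -/
theorem exists_l1Y_mul_le {s₁ s₂ σ δ : ℝ} (C : ℝ) (hδ : 0 ≤ δ) (h1 : σ ≤ s₂ + 1)
    (h1' : σ ≤ s₁ + 1) (h2 : σ - s₂ + d / 2 < s₁) (h3 : d / 2 + δ < s₁ + s₂) :
    ∃ K : ℝ≥0, ∀ (u v : ℝ → L2 d ℂ) (a b : ℕ → ℝ),
      AEStronglyMeasurable u timeMeasure → AEStronglyMeasurable v timeMeasure →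
      (∀ᵐ t ∂timeMeasure, MemLp (u t) ⊤ volume) → P.IsEnvelope δ C s₁ u a →
      P.IsEnvelope δ C s₂ v b → ∀ k : ℕ,
      P.l1Y σ (P.S k (mul u v)) ≤
        K * ENNReal.ofReal (a k + b k) * P.l1X s₁ u * P.l1X s₂ v := by
  obtain ⟨K₁, hK₁t, hK₁⟩ := P.exists_l1Y_S_le ℂ σ
  obtain ⟨K₂, hK₂t, hK₂⟩ := P.exists_lsum_LH_le ℂ δ C h1 h2
  -- High-low is low-high with the factors exchanged, which is why σ ≤ s₁ + 1 is required as well.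
  -- The strict condition on s₁ + s₂ is symmetric.
  obtain ⟨K₄, hK₄t, hK₄⟩ := P.exists_lsum_LH_le ℂ (s₁ := s₂) (s₂ := s₁) (σ := σ) δ C h1'
    (by linarith)
  obtain ⟨K₃, hK₃t, hK₃⟩ := P.exists_norm_HH_le ℂ (s₁ := s₁) (s₂ := s₂) (σ := σ) C
    (fun k => lsum (k - 3) mix2) (fun k => rfl) P.hN_lsum hδ (by linarith) h3
  refine ⟨(K₁ * (K₂ + K₄ + K₃)).toNNReal, fun u v a b hu hv hb ha hb' k => ?_⟩
  rw [ENNReal.coe_toNNReal (by finiteness)]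
  have hp : ∀ i, AEStronglyMeasurable (P.S k (smulF (P.S i u) (P.SGe 0 v))) timeMeasure :=
    fun i => P.aesm_S (P.aesm_smulF_S hu (P.aesm_SGe hv _) i) k
  have hq : ∀ i, AEStronglyMeasurable (P.S k (smulF (P.S i v) (P.SGe (k - 4) u))) timeMeasure :=
    fun i => P.aesm_S (P.aesm_smulF_S hv (P.aesm_SGe hu _) i) k
  have hr : AEStronglyMeasurable (P.S k (smulF (P.SGe (k - 4) u) (P.SGe (k - 4) v))) timeMeasure :=
    P.aesm_S (P.aesm_smulF (P.aesm_SGe hu _) (P.aesm_SGe hv _)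
      (hb.mono fun t ht => P.memLp_top_SGe ht _)) k
  have h := hK₁ (smulF u v) _ _ _ k hp hq hr (hb.mono fun t ht => P.S_mul_split ht k (k - 4))
  rw [mul_eq_smulF]
  refine h.trans ?_
  calc _ ≤ K₁ * (K₂ * (ENNReal.ofReal (a k + b k) * P.l1X s₁ u * P.l1X s₂ v) +
        K₄ * (ENNReal.ofReal (a k + b k) * P.l1X s₂ v * P.l1X s₁ u) +
        K₃ * (ENNReal.ofReal (a k + b k) * P.l1X s₁ u * P.l1X s₂ v)) := by
        refine mul_le_mul_right (add_le_add (add_le_add ?_ ?_) ?_) _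
        · refine (hK₂ u v b hu hv hb' k 0).trans ?_
          gcongr; linarith [ha.pos k]
        · refine (hK₄ v u a hv hu ha k (k - 4)).trans ?_
          gcongr; linarith [hb'.pos k]
        · refine (hK₃ u v a hu hv hb ha k).trans ?_
          gcongr; linarith [hb'.pos k]
    _ = _ := by ring

/-- The algebra property of `ℓ¹X^s`. -/
theorem exists_l1X_mul_le {s δ : ℝ} (C : ℝ) (hδ : 0 ≤ δ) (hs : (d : ℝ) / 2 < s)
    (h3 : δ < s - d / 2) :
    ∃ K : ℝ≥0, ∀ (u v : ℝ → L2 d ℂ) (a b : ℕ → ℝ),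
      AEStronglyMeasurable u timeMeasure → AEStronglyMeasurable v timeMeasure →
      (∀ᵐ t ∂timeMeasure, MemLp (u t) ⊤ volume) → P.IsEnvelope δ C s u a →
      P.IsEnvelope δ C s v b → ∀ k : ℕ,
      P.l1X s (P.S k (mul u v)) ≤
        K * ENNReal.ofReal (a k + b k) * P.l1X s u * P.l1X s v := by
  obtain ⟨K₁, hK₁⟩ := P.exists_l1X_S_le (V := ℂ) s
  obtain ⟨K₂, hK₂t, hK₂⟩ := P.exists_nX_LH_le ℂ δ C hs
  -- The cost g = d of refining the cubes in X_k is affordable because both factors have regularity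
  -- s: adding δ < s - d/2 and d/2 < s gives d + δ < 2s.
  obtain ⟨K₃, hK₃t, hK₃⟩ := P.exists_norm_HH_le ℂ (s₁ := s) (s₂ := s) (σ := s) (g := d) C nX
    (B := (pw (2 + 4 * d)).toNNReal) nX_c
    (fun k i u h hu => by rw [coe_toNNReal_pw]; exact P.nX_S_fine_le h hu) hδ (by linarith)
    (by linarith)
  refine ⟨(K₁ * (K₂ + K₂ + K₃)).toNNReal, fun u v a b hu hv hb ha hb' k => ?_⟩
  rw [ENNReal.coe_toNNReal (by finiteness)]
  have hp : ∀ i, AEStronglyMeasurable (P.S k (smulF (P.S i u) (P.SGe 0 v))) timeMeasure :=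
    fun i => P.aesm_S (P.aesm_smulF_S hu (P.aesm_SGe hv _) i) k
  have hq : ∀ i, AEStronglyMeasurable (P.S k (smulF (P.S i v) (P.SGe (k - 4) u))) timeMeasure :=
    fun i => P.aesm_S (P.aesm_smulF_S hv (P.aesm_SGe hu _) i) k
  have hr : AEStronglyMeasurable (P.S k (smulF (P.SGe (k - 4) u) (P.SGe (k - 4) v))) timeMeasure :=
    P.aesm_S (P.aesm_smulF (P.aesm_SGe hu _) (P.aesm_SGe hv _)
      (hb.mono fun t ht => P.memLp_top_SGe ht _)) k
  have hsplit : nX k (prof (P.S k (smulF u v))) ≤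
      ∑ i ∈ Finset.range (k - 4), nX k (prof (P.S k (smulF (P.S i u) (P.SGe 0 v)))) +
      ∑ i ∈ Finset.range (k - 4), nX k (prof (P.S k (smulF (P.S i v) (P.SGe (k - 4) u)))) +
      nX k (prof (P.S k (smulF (P.SGe (k - 4) u) (P.SGe (k - 4) v)))) := by
    have h1 := Finset.aestronglyMeasurable_sum (Finset.range (k - 4)) fun i _ => hp i
    have h2 := Finset.aestronglyMeasurable_sum (Finset.range (k - 4)) fun i _ => hq i
    refine ((nX k).mono (G := prof (∑ i ∈ Finset.range (k - 4), P.S k (smulF (P.S i u) (P.SGe 0 v)) +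
      (∑ i ∈ Finset.range (k - 4), P.S k (smulF (P.S i v) (P.SGe (k - 4) u)) +
      P.S k (smulF (P.SGe (k - 4) u) (P.SGe (k - 4) v))))) (hb.mono fun t ht n =>
        le_of_eq (prof_congr ?_ n))).trans ?_
    · rw [P.S_mul_split ht k (k - 4), Pi.add_apply, Pi.add_apply, Finset.sum_apply, Finset.sum_apply]
    · refine (norm_add_le _ h1 (h2.add hr)).trans ?_
      rw [add_assoc]
      refine add_le_add (norm_sum_le _ _ _ fun i _ => hp i) ((norm_add_le _ h2 hr).trans ?_)
      exact add_le_add (norm_sum_le _ _ _ fun i _ => hq i) le_rfl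
  rw [mul_eq_smulF]
  refine (hK₁ _ (P.aesm_smulF hu hv hb) k).trans ?_
  calc _ ≤ K₁ * (K₂ * (ENNReal.ofReal (a k + b k) * P.l1X s u * P.l1X s v) +
        K₂ * (ENNReal.ofReal (a k + b k) * P.l1X s v * P.l1X s u) +
        K₃ * (ENNReal.ofReal (a k + b k) * P.l1X s u * P.l1X s v)) := by
        refine mul_le_mul_right ((mul_le_mul_right hsplit _).trans ?_) _
        rw [mul_add, mul_add]
        refine add_le_add (add_le_add ?_ ?_) ?_
        · refine (hK₂ u v b hu hv hb' k 0).trans ?_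
          gcongr; linarith [ha.pos k]
        · refine (hK₂ v u a hv hu ha k (k - 4)).trans ?_
          gcongr; linarith [hb'.pos k]
        · refine (hK₃ u v a hu hv hb ha k).trans ?_
          gcongr; linarith [hb'.pos k]
    _ = _ := by ring

theorem ae_memLp_mul {s : ℝ} (hs : (d : ℝ) / 2 < s) {u : ℝ → L2 d ℂ} (hu : P.MemL1X s u)
    (v : ℝ → L2 d ℂ) : ∀ᵐ t ∂timeMeasure, MemLp (fun x => u t x * v t x) 2 volume :=
  (P.ae_memLp_top hs hu).mono fun t ht => memLp_bmul ht (v t)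

end Decomposition

end LocalEnergy

end

noncomputable section

namespace LocalEnergy

open scoped SchwartzMap

variable {d : ℕ} {V : Type*} [NormedAddCommGroup V] [InnerProductSpace ℂ V] [CompleteSpace V]

open LNorm

/-! ### Real linear maps and multipliers with real kernels -/

/-- The symbols of S_k are real and even, so their kernels are real and S_k commutes with real
linear maps. This matters because the derivative of F is only real linear. -/
theorem conj_fourierInv {m : 𝓢(E d, ℂ)} (hm : ∀ ξ, starRingEnd ℂ (m ξ) = m (-ξ)) (y : E d) :
    starRingEnd ℂ ((𝓕⁻ m : 𝓢(E d, ℂ)) y) = (𝓕⁻ m : 𝓢(E d, ℂ)) y := by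
  rw [SchwartzMap.fourierInv_coe, Real.fourierInv_eq', ← integral_conj, ← integral_neg_eq_self]
  refine integral_congr_ae (.of_forall fun v => ?_)
  simp only [smul_eq_mul, map_mul, ← Complex.exp_conj, hm, neg_neg, inner_neg_left,
    Complex.conj_ofReal, Complex.conj_I]
  congr 2
  push_cast; ring

section RealLinear

variable {W : Type*} [NormedAddCommGroup W] [InnerProductSpace ℂ W] [CompleteSpace W]

/-- The composition with a real linear map. -/
def lmap (L : V →L[ℝ] W) (u : ℝ → L2 d V) : ℝ → L2 d W := fun t => L.compLp (u t)

theorem lmap_ae (L : V →L[ℝ] W) (u : ℝ → L2 d V) (t : ℝ) :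
    ∀ᵐ x, lmap L u t x = L (u t x) := L.coeFn_compLp (u t)

theorem aesm_lmap (L : V →L[ℝ] W) {u : ℝ → L2 d V} (hu : AEStronglyMeasurable u timeMeasure) :
    AEStronglyMeasurable (lmap L u) timeMeasure :=
  (L.compLpL 2 volume).continuous.comp_aestronglyMeasurable hu

theorem prof_lmap_le (L : V →L[ℝ] W) (u : ℝ → L2 d V) (t : ℝ) (n : Idx d) :
    prof (lmap L u) t n ≤ ‖L‖ₑ * prof u t n := by
  unfold prof
  rw [← pr2_const_mul _ (measurable_enorm (u t))]
  refine pr2_mono ?_ n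
  filter_upwards [lmap_ae L u t] with x hx
  rw [hx]
  exact L.le_opENorm _

theorem norm_lmap_le (N : LNorm d) (L : V →L[ℝ] W) {u : ℝ → L2 d V}
    (hu : AEStronglyMeasurable u timeMeasure) : N (prof (lmap L u)) ≤ ‖L‖ₑ * N (prof u) :=
  (N.mono (.of_forall fun t n => prof_lmap_le L u t n)).trans (N.smul_le _ (measP_prof hu))

theorem conv_comp_real {K : 𝓢(E d, ℂ)} (hK : ∀ y, starRingEnd ℂ (K y) = K y) (L : V →L[ℝ] W)
    {f : E d → V} (hf : MemLp f 2 volume) (x : E d) :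
    conv K (fun y => L (f y)) x = L (conv K f x) := by
  rw [conv, conv, ← L.integral_comp_comm (integrable_conv K hf x)]
  refine integral_congr_ae (.of_forall fun y => ?_)
  dsimp only
  obtain ⟨r, hr⟩ := Complex.conj_eq_iff_real.1 (hK (x - y))
  rw [hr, Complex.coe_smul, Complex.coe_smul, map_smul]

theorem fourierMul_lmap {m : 𝓢(E d, ℂ)} (hm : ∀ ξ, starRingEnd ℂ (m ξ) = m (-ξ)) (L : V →L[ℝ] W)
    (u : ℝ → L2 d V) (t : ℝ) :
    fourierMul m (lmap L u t) = lmap L (fun t => fourierMul m (u t)) t := by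
  apply Lp.ext
  filter_upwards [fourierMul_ae_eq_conv m (lmap L u t), fourierMul_ae_eq_conv m (u t),
    lmap_ae L (fun t => fourierMul m (u t)) t] with x h1 h2 h3
  rw [h1, h3, h2, ← conv_comp_real (conj_fourierInv hm) L (Lp.memLp _)]
  exact conv_congr _ (lmap_ae L u t) x

theorem Decomposition.S_lmap (P : Decomposition d) (L : V →L[ℝ] W) (k : ℕ) (u : ℝ → L2 d V) :
    P.S k (lmap L u) = lmap L (P.S k u) := by
  funext t
  rw [P.S_apply, fourierMul_lmap]
  · change _ = lmap L (fun t => P.S k u t) t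
    simp_rw [P.S_apply]
  · intro ξ
    rw [P.sym_apply, P.sym_apply, norm_neg, Complex.conj_ofReal]

end RealLinear

/-! ### Multipliers with dilated symbols -/

theorem prof_fourierMul_dil_le (k : ℕ) (m : 𝓢(E d, ℂ)) (u : ℝ → L2 d V) (t : ℝ) (n : Idx d) :
    prof (fun t => fourierMul (dil k m) (u t)) t n ≤
      ENNReal.ofReal (kerBound (𝓕⁻ m) 0) * smear wt (prof u) t n := by
  have h : ∀ᵐ x, ‖fourierMul (dil k m) (u t) x‖ₑ ≤
      ENNReal.ofReal (kerBound (𝓕⁻ m) 0) * mconv k (fun y => ‖u t y‖ₑ) x := by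
    filter_upwards [fourierMul_ae_eq_conv (dil k m) (u t)] with x hx
    rw [hx]; exact enorm_conv_dil_le k m _ x
  refine (pr2_mono h n).trans ?_
  rw [pr2_const_mul _ (measurable_mconv k (measurable_enorm (u t)))]
  gcongr
  exact pr2_mconv_le k (measurable_enorm (u t)) n

theorem norm_fourierMul_dil_le (N : LNorm d) (k : ℕ) (m : 𝓢(E d, ℂ)) {u : ℝ → L2 d V}
    (hu : AEStronglyMeasurable u timeMeasure) :
    N (prof fun t => fourierMul (dil k m) (u t)) ≤
      ENNReal.ofReal (kerBound (𝓕⁻ m) 0) * (N.c * wtMass d) * N (prof u) := by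
  refine (N.mono (.of_forall fun t n => prof_fourierMul_dil_le k m u t n)).trans ?_
  refine (N.smul_le _ ((measP_prof hu).smear wt)).trans ?_
  rw [mul_assoc, coe_wtMass]
  gcongr
  exact N.smear_le (measP_prof hu) wt

theorem aesm_fourierMul {m : E d → ℂ} (hm : MemLp m ⊤ volume) {u : ℝ → L2 d V}
    (hu : AEStronglyMeasurable u timeMeasure) :
    AEStronglyMeasurable (fun t => fourierMul m (u t)) timeMeasure :=
  (fmul (V := V) m hm).continuous.comp_aestronglyMeasurable hu

/-- The kernel bounds are controlled by seminorms of the symbol. -/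
theorem exists_kerBound_le {ι : Type*} (m : ι → 𝓢(E d, ℂ))
    (hm : ∀ a b, ∃ C : ℝ, ∀ i ξ, ‖ξ‖ ^ a * ‖iteratedFDeriv ℝ b (m i) ξ‖ ≤ C) (n : ℕ) :
    ∃ C : ℝ, ∀ i, kerBound (𝓕⁻ (m i)) n ≤ C := by
  set T : 𝓢(E d, ℂ) →L[ℝ] 𝓢(E d, ℂ) := FourierTransform.fourierInvCLM ℝ 𝓢(E d, ℂ)
  set q : Seminorm ℝ 𝓢(E d, ℂ) :=
    (Finset.Iic (2 * d + 3, n)).sup (schwartzSeminormFamily ℝ (E d) ℂ)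
  have hq : Continuous q :=
    Seminorm.continuous_finsetSup fun p _ =>
      (schwartz_withSeminorms ℝ (E d) ℂ).continuous_seminorm p
  -- The inverse Fourier transform is continuous on Schwartz space, so finitely many seminorms of
  -- the symbol control the kernel, uniformly over the family.
  obtain ⟨s, C, -, hC⟩ := Seminorm.bound_of_continuous (schwartz_withSeminorms ℝ (E d) ℂ)
    (q.comp T.toLinearMap) (hq.comp T.continuous)
  choose B hB using hm
  refine ⟨2 ^ (2 * d + 3) * (C * ∑ p ∈ s, |B p.1 p.2|), fun i => ?_⟩
  unfold kerBound
  gcongr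
  refine (hC (m i)).trans ?_
  change (C : ℝ) * (s.sup (schwartzSeminormFamily ℝ (E d) ℂ)) (m i) ≤ _
  gcongr
  refine Seminorm.finset_sup_apply_le (by positivity) fun p hp => ?_
  refine (SchwartzMap.seminorm_le_bound ℝ p.1 p.2 (m i) (abs_nonneg (B p.1 p.2)) fun ξ =>
    (hB p.1 p.2 i ξ).trans (le_abs_self _)).trans ?_
  exact Finset.single_le_sum (f := fun p : ℕ × ℕ => |B p.1 p.2|) (fun _ _ => abs_nonneg _) hp

namespace Decomposition

variable (P : Decomposition d)

/-! ### A fat annulus -/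

/-- A symbol that is `1` on a large annulus. -/
def fat : 𝓢(E d, ℂ) :=
  dil 3 P.base - SchwartzMap.compCLMOfContinuousLinearEquiv ℂ (homot 16 (by norm_num)) P.base

theorem fat_apply (ξ : E d) : P.fat ξ = P.phi (‖ξ‖ / 8) - P.phi (16 * ‖ξ‖) := by
  change dil 3 P.base ξ - P.base ((16 : ℝ) • ξ) = _
  rw [dil_apply, base_apply, base_apply, norm_smul, norm_smul]
  norm_num
  congr 1; ring

theorem fat_eq_one {ξ : E d} (h1 : 1 / 8 ≤ ‖ξ‖) (h2 : ‖ξ‖ ≤ 8) : P.fat ξ = 1 := by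
  rw [fat_apply, P.phi_one _ (by positivity) (by linarith), P.phi_zero _ (by linarith)]
  simp

theorem fat_eq_zero {ξ : E d} (h : ‖ξ‖ ≤ 1 / 16 ∨ 16 ≤ ‖ξ‖) : P.fat ξ = 0 := by
  rw [fat_apply]
  rcases h with h | h
  · rw [P.phi_one _ (by positivity) (by linarith), P.phi_one _ (by positivity) (by linarith)]
    simp
  · rw [P.phi_zero _ (by linarith), P.phi_zero _ (by linarith)]
    simp

theorem tsupport_fat_subset : tsupport (P.fat : E d → ℂ) ⊆ {ξ | 1 / 16 ≤ ‖ξ‖ ∧ ‖ξ‖ ≤ 16} := by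
  refine closure_minimal (fun ξ hξ => ?_) ?_
  · by_contra h
    refine hξ (P.fat_eq_zero ?_)
    rw [Set.mem_ofPred_eq, not_and_or, not_le, not_le] at h
    exact h.imp le_of_lt le_of_lt
  · exact (isClosed_le continuous_const continuous_norm).inter
      (isClosed_le continuous_norm continuous_const)

theorem hasCompactSupport_fat : HasCompactSupport (P.fat : E d → ℂ) :=
  HasCompactSupport.of_support_subset_isCompact (isCompact_closedBall (0 : E d) 16) fun _ hξ =>
    mem_closedBall_zero_iff.2 (P.tsupport_fat_subset (subset_tsupport _ hξ)).2

/-- The product of a smooth function with the symbol of the fat annulus. -/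
def cutSym (g : E d → ℂ) (hg : ContDiff ℝ ∞ g) : 𝓢(E d, ℂ) :=
  (P.hasCompactSupport_fat.mul_right (f' := g)).toSchwartzMap (P.fat.smooth'.mul hg)

theorem cutSym_apply (g : E d → ℂ) (hg : ContDiff ℝ ∞ g) (ξ : E d) :
    P.cutSym g hg ξ = P.fat ξ * g ξ := rfl

/-- The functions g i need bounds on a fixed annulus only, as the fat symbol vanishes off it.
Applied to ξ ↦ A(2^k ξ), this gives kernel bounds uniform in k although the kernel of A(D) itself
may be singular. -/
theorem exists_kerBound_cutSym_le {ι : Type*} (g : ι → E d → ℂ) (hg : ∀ i, ContDiff ℝ ∞ (g i))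
    (hb : ∀ n, ∃ C : ℝ, ∀ i ξ, 1 / 16 ≤ ‖ξ‖ → ‖ξ‖ ≤ 16 → ‖iteratedFDeriv ℝ n (g i) ξ‖ ≤ C) (n : ℕ) :
    ∃ C : ℝ, ∀ i, kerBound (𝓕⁻ (P.cutSym (g i) (hg i))) n ≤ C := by
  refine exists_kerBound_le _ (fun a b => ?_) n
  choose B hB using hb
  refine ⟨16 ^ a * ∑ j ∈ Finset.range (b + 1),
    b.choose j * SchwartzMap.seminorm ℝ 0 j P.fat * |B (b - j)|, fun i ξ => ?_⟩
  have h0 : 0 ≤ ∑ j ∈ Finset.range (b + 1),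
      b.choose j * SchwartzMap.seminorm ℝ 0 j P.fat * |B (b - j)| :=
    Finset.sum_nonneg fun j _ => by positivity
  have h1 := norm_iteratedFDeriv_mul_le (𝕜 := ℝ) (P.fat.smooth') (hg i) ξ (n := b)
    (by exact_mod_cast le_top)
  by_cases hξ : ξ ∈ {ξ : E d | 1 / 16 ≤ ‖ξ‖ ∧ ‖ξ‖ ≤ 16}
  · gcongr
    · exact hξ.2
    · refine h1.trans (Finset.sum_le_sum fun j _ => ?_)
      gcongr
      · have := SchwartzMap.le_seminorm ℝ 0 j P.fat ξ
        rwa [pow_zero, one_mul] at this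
      · exact (hB _ i ξ hξ.1 hξ.2).trans (le_abs_self _)
  · have h2 : ∀ j, iteratedFDeriv ℝ j P.fat ξ = 0 := fun j => by
      by_contra hne
      exact hξ (P.tsupport_fat_subset (support_iteratedFDeriv_subset j hne))
    have h3 : ‖iteratedFDeriv ℝ b (P.cutSym (g i) (hg i)) ξ‖ ≤ 0 := by
      refine h1.trans (Finset.sum_nonpos fun j _ => ?_)
      have := h2 j
      rw [show (iteratedFDeriv ℝ j P.fat.toFun ξ) = 0 from this]; simp
    have h4 : ‖iteratedFDeriv ℝ b (P.cutSym (g i) (hg i)) ξ‖ = 0 := le_antisymm h3 (norm_nonneg _)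
    rw [h4, mul_zero]
    positivity

theorem dil_fat_eq_one {k q : ℕ} (h1 : q ≤ k + 2) (h2 : k ≤ q + 2) (hq : 0 < q) {ξ : E d}
    (hξ : P.sym q ξ ≠ 0) : dil k P.fat ξ = 1 := by
  have a1 : ‖ξ‖ < 2 ^ (q + 1) := not_le.1 fun h => hξ (P.sym_eq_zero_of_le h)
  have a2 : 2 ^ (q - 1) < ‖ξ‖ := not_le.1 fun h => hξ (P.sym_eq_zero_of_ge hq h)
  have hp : (0 : ℝ) < 2 ^ k := by positivity
  have b1 : (2 : ℝ) ^ (q + 1) ≤ 2 ^ (k + 3) := pow_le_pow_right₀ (by norm_num) (by omega)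
  have b2 : (2 : ℝ) ^ k ≤ 2 ^ ((q - 1) + 3) := pow_le_pow_right₀ (by norm_num) (by omega)
  rw [pow_add 2 k] at b1
  rw [pow_add] at b2
  rw [dil_apply]
  refine P.fat_eq_one ?_ ?_ <;>
    rw [norm_smul, norm_inv, Real.norm_of_nonneg hp.le, ← div_eq_inv_mul]
  · rw [le_div_iff₀ hp]; linarith
  · rw [div_le_iff₀ hp]; linarith

theorem dil_fat_mul_sym {k q : ℕ} (h1 : q ≤ k + 2) (h2 : k ≤ q + 2) (hq : 0 < q) (ξ : E d) :
    dil k P.fat ξ * P.sym q ξ = P.sym q ξ := by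
  by_cases hξ : P.sym q ξ = 0
  · rw [hξ, mul_zero]
  · rw [P.dil_fat_eq_one h1 h2 hq hξ, one_mul]

/-- Functions with frequencies comparable to `2^k`. -/
theorem fat_eq_self {k : ℕ} (hk : 3 ≤ k) {f : ℝ → L2 d V} {t : ℝ}
    (h : ∀ q, q + 2 < k ∨ k + 2 < q → P.S q f t = 0) :
    fourierMul (dil k P.fat) (f t) = f t := by
  have h1 : f t = ∑ q ∈ Finset.Icc (k - 2) (k + 2), P.S q f t := by
    refine tendsto_nhds_unique (P.tendsto_SLt f t) (tendsto_const_nhds.congr' ?_)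
    filter_upwards [Filter.eventually_ge_atTop (k + 3)] with N hN
    rw [P.SLt_apply]
    refine Finset.sum_subset (fun q hq => ?_) fun q _ hq => ?_
    · simp only [Finset.mem_Icc, Finset.mem_range] at hq ⊢; omega
    · refine h q ?_
      simp only [Finset.mem_Icc] at hq; omega
  conv_rhs => rw [h1]
  conv_lhs => rw [h1]
  rw [fourierMul_sum _ _ ((dil k P.fat).memLp_top volume)]
  refine Finset.sum_congr rfl fun q hq => ?_
  rw [Finset.mem_Icc] at hq
  -- Here q ≥ k - 2 ≥ 1, so the symbol of S_q vanishes near the origin, where the fat symbol is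
  -- zero. This is the reason for the hypothesis 3 ≤ k.
  rw [P.S_apply, fourierMul_fourierMul _ (P.memLp_sym q)]
  congr 1; funext ξ; exact P.dil_fat_mul_sym (by omega) (by omega) (by omega) ξ

end Decomposition

end LocalEnergy

end

noncomputable section

namespace LocalEnergy

open scoped SchwartzMap

variable {d : ℕ} {V : Type*} [NormedAddCommGroup V] [InnerProductSpace ℂ V] [CompleteSpace V]

open LNorm

/-! ### The commutator of a multiplier with a low frequency function -/

/-- A Lipschitz bound at frequency 2^i in which the majorant is evaluated at both endpoints. Unlike
a global bound on the gradient it retains the localization of β to unit cubes. -/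
theorem enorm_conv_sub_conv_le (i : ℕ) (m : 𝓢(E d, ℂ)) (β : L2 d V) (x y : E d) :
    ‖conv (𝓕⁻ (dil i m) : 𝓢(E d, ℂ)) β x - conv (𝓕⁻ (dil i m) : 𝓢(E d, ℂ)) β y‖ₑ ≤
      ENNReal.ofReal (2 ^ (2 * d + 2) * kerBound (𝓕⁻ m) 1 * (2 ^ i * ‖x - y‖)) *
        (mconv i (fun z => ‖β z‖ₑ) x + mconv i (fun z => ‖β z‖ₑ) y) := by
  set J : 𝓢(E d, ℂ) := 𝓕⁻ (dil i m)
  have hm : ∀ x : E d, Measurable fun z => ENNReal.ofReal (maj i (x - z)) * ‖β z‖ₑ := fun x =>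
    ((continuous_maj i).comp (continuous_const.sub continuous_id)).measurable.ennreal_ofReal.mul
      (measurable_enorm β)
  rw [conv, conv, ← integral_sub (integrable_conv J (Lp.memLp β) x)
    (integrable_conv J (Lp.memLp β) y), mconv, mconv, ← lintegral_add_left (hm x),
    ← lintegral_const_mul' _ _ ENNReal.ofReal_ne_top]
  refine (enorm_integral_le_lintegral_enorm _).trans (lintegral_mono fun z => ?_)
  rw [← sub_smul, enorm_smul, ← add_mul, ← mul_assoc]
  gcongr
  rw [← ENNReal.ofReal_add (maj_nonneg _ _) (maj_nonneg _ _), ← ENNReal.ofReal_mul ?_, ← ofReal_norm]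
  · refine ENNReal.ofReal_le_ofReal ?_
    have h := norm_sub_dil_le i m (x - z) (x - y)
    rwa [show x - z - (x - y) = y - z by abel] at h
  · have := kerBound_nonneg (𝓕⁻ m : 𝓢(E d, ℂ)) 1
    positivity

/-- The commutator has the kernel K(x-y)(β(x)-β(y)). The difference is bounded with the factor
2^i‖x-y‖, and 2^k‖x-y‖‖K(x-y)‖ is still dominated by `maj k`; together they gain 2^{i-k} over the
product. -/
theorem enorm_mul_sub_conv_le (i k : ℕ) (m m' : 𝓢(E d, ℂ)) {β : L2 d ℂ} (g : L2 d ℂ)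
    (hβ : fourierMul (dil i m') β = β) :
    ∀ᵐ x, ‖β x * conv (𝓕⁻ (dil k m) : 𝓢(E d, ℂ)) g x -
        conv (𝓕⁻ (dil k m) : 𝓢(E d, ℂ)) (fun y => β y * g y) x‖ₑ ≤
      ENNReal.ofReal (2 ^ (2 * d + 2) * kerBound (𝓕⁻ m') 1) *
        ENNReal.ofReal (kerBound (𝓕⁻ m) 0) * pw ((i : ℝ) - k) *
        (mconv i (fun z => ‖β z‖ₑ) x * mconv k (fun z => ‖g z‖ₑ) x +
          mconv k (fun y => mconv i (fun z => ‖β z‖ₑ) y * ‖g y‖ₑ) x) := by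
  set K : 𝓢(E d, ℂ) := 𝓕⁻ (dil k m)
  set B := mconv i (fun z => ‖β z‖ₑ)
  have hB : Measurable B := measurable_mconv i (measurable_enorm β)
  have htop : MemLp β ⊤ volume := by rw [← hβ]; exact memLp_top_fourierMul _ _
  have h0 := fourierMul_ae_eq_conv (dil i m') β
  rw [hβ] at h0
  filter_upwards [h0] with x hx
  have e1 : β x * conv K g x - conv K (fun y => β y * g y) x =
      ∫ y, K (x - y) • ((β x - β y) * g y) := by
    have i1 := (integrable_conv K (Lp.memLp g) x).const_mul (β x)
    have i2 : Integrable fun y => K (x - y) • (β y * g y) := integrable_conv K (memLp_bmul htop g) x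
    rw [conv, conv, ← integral_const_mul, ← integral_sub i1 i2]
    refine integral_congr_ae (.of_forall fun y => ?_)
    simp only [smul_eq_mul]; ring
  rw [e1]
  refine (enorm_integral_le_lintegral_enorm _).trans ?_
  have hmk : Measurable fun z => ENNReal.ofReal (maj k (x - z)) :=
    ((continuous_maj k).comp (continuous_const.sub continuous_id)).measurable.ennreal_ofReal
  set c1 := 2 ^ (2 * d + 2) * kerBound (𝓕⁻ m') 1
  set c2 := kerBound (𝓕⁻ m) 0
  have hc1 : 0 ≤ c1 := mul_nonneg (by positivity) (kerBound_nonneg _ _)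
  have hc2 : 0 ≤ c2 := kerBound_nonneg _ _
  have hmg : Measurable fun y => ENNReal.ofReal (maj k (x - y)) * ‖g y‖ₑ := hmk.mul (measurable_enorm g)
  have hpt : ∀ᵐ y, ‖K (x - y) • ((β x - β y) * g y)‖ₑ ≤
      ENNReal.ofReal c1 * ENNReal.ofReal c2 * pw ((i : ℝ) - k) *
        (B x * (ENNReal.ofReal (maj k (x - y)) * ‖g y‖ₑ) +
          ENNReal.ofReal (maj k (x - y)) * (B y * ‖g y‖ₑ)) := by
    filter_upwards [h0] with y hy
    rw [enorm_smul, enorm_mul, hx, hy]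
    have a1 := enorm_conv_sub_conv_le i m' β x y
    have a2 : ‖K (x - y)‖ₑ * ENNReal.ofReal (c1 * (2 ^ i * ‖x - y‖)) ≤
        ENNReal.ofReal c1 * ENNReal.ofReal c2 * pw ((i : ℝ) - k) * ENNReal.ofReal (maj k (x - y)) := by
      rw [← ofReal_norm, ← ENNReal.ofReal_mul (norm_nonneg _), pw_eq_ofReal,
        ← ENNReal.ofReal_mul hc1, ← ENNReal.ofReal_mul (by positivity),
        ← ENNReal.ofReal_mul (by positivity)]
      refine ENNReal.ofReal_le_ofReal ?_
      have h := norm_mul_dil_le k m (x - y)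
      rw [Real.rpow_sub (by norm_num), Real.rpow_natCast, Real.rpow_natCast]
      calc ‖K (x - y)‖ * (c1 * (2 ^ i * ‖x - y‖))
          = c1 * (2 ^ i / 2 ^ k) * (2 ^ k * (‖x - y‖ * ‖K (x - y)‖)) := by field_simp
        _ ≤ c1 * (2 ^ i / 2 ^ k) * (c2 * maj k (x - y)) := by gcongr
        _ = _ := by ring
    calc _ ≤ ‖K (x - y)‖ₑ * (ENNReal.ofReal (c1 * (2 ^ i * ‖x - y‖)) * (B x + B y) * ‖g y‖ₑ) := by
          gcongr
      _ = (‖K (x - y)‖ₑ * ENNReal.ofReal (c1 * (2 ^ i * ‖x - y‖))) * ((B x + B y) * ‖g y‖ₑ) := by ring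
      _ ≤ _ := mul_le_mul_left a2 _
      _ = _ := by ring
  refine (lintegral_mono_ae hpt).trans (le_of_eq ?_)
  rw [lintegral_const_mul' _ _ (by have := pw_ne_top ((i : ℝ) - k); finiteness), lintegral_add_left
    (hmg.const_mul _), lintegral_const_mul _ hmg]
  rfl

namespace Decomposition

variable (P : Decomposition d)

/-- The commutator of `S_i η` with the multiplier of symbol `m(2^{-k} ξ)`. -/
def commPiece (m : 𝓢(E d, ℂ)) (i k : ℕ) (η w : ℝ → L2 d ℂ) : ℝ → L2 d ℂ := fun t =>
  smulF (P.S i η) (fun t => fourierMul (dil k m) (w t)) t - fourierMul (dil k m) (smulF (P.S i η) w t)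

theorem aesm_commPiece (m : 𝓢(E d, ℂ)) (i k : ℕ) {η w : ℝ → L2 d ℂ}
    (hη : AEStronglyMeasurable η timeMeasure) (hw : AEStronglyMeasurable w timeMeasure) :
    AEStronglyMeasurable (P.commPiece m i k η w) timeMeasure :=
  (P.aesm_smulF_S hη (aesm_fourierMul ((dil k m).memLp_top volume) hw) i).sub
    (aesm_fourierMul ((dil k m).memLp_top volume) (P.aesm_smulF_S hη hw i))

theorem enorm_commPiece_le (m : 𝓢(E d, ℂ)) (i k : ℕ) (η w : ℝ → L2 d ℂ) (t : ℝ) :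
    ∀ᵐ x, ‖P.commPiece m i k η w t x‖ₑ ≤
      ENNReal.ofReal (2 ^ (2 * d + 2) * kerBound (𝓕⁻ (dil 1 P.base)) 1) *
        ENNReal.ofReal (kerBound (𝓕⁻ m) 0) * pw ((i : ℝ) - k) *
        (mconv i (fun z => ‖P.S i η t z‖ₑ) x * mconv k (fun z => ‖w t z‖ₑ) x +
          mconv k (fun y => mconv i (fun z => ‖P.S i η t z‖ₑ) y * ‖w t y‖ₑ) x) := by
  have hβ : fourierMul (dil i (dil 1 P.base)) (P.S i η t) = P.S i η t := by
    rw [dil_dil]; exact P.low_S (Nat.lt_succ_self i) η t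
  have hT := P.memLp_top_S i η t
  filter_upwards [enorm_mul_sub_conv_le i k m (dil 1 P.base) (w t) hβ,
    Lp.coeFn_sub (smulF (P.S i η) (fun t => fourierMul (dil k m) (w t)) t)
      (fourierMul (dil k m) (smulF (P.S i η) w t)),
    smulF_ae (fun t => fourierMul (dil k m) (w t)) hT,
    fourierMul_ae_eq_conv (dil k m) (w t),
    fourierMul_ae_eq_conv (dil k m) (smulF (P.S i η) w t)] with x h1 h2 h3 h4 h5
  refine le_of_eq_of_le ?_ h1
  rw [commPiece, h2, Pi.sub_apply, h3, h4, h5, smul_eq_mul, conv_congr _ (smulF_ae w hT)]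
  rfl

theorem prof_commPiece_le (m : 𝓢(E d, ℂ)) (i k : ℕ) (η w : ℝ → L2 d ℂ) (t : ℝ) (n : Idx d) :
    prof (P.commPiece m i k η w) t n ≤
      ENNReal.ofReal (2 ^ (2 * d + 2) * kerBound (𝓕⁻ (dil 1 P.base)) 1) *
        ENNReal.ofReal (kerBound (𝓕⁻ m) 0) * pw ((i : ℝ) - k) * pw (i * d / 2) *
        (smear wt (prof (P.S i η)) t n * smear wt (prof w) t n +
          smear wt (fun t n => smear wt (prof (P.S i η)) t n * prof w t n) t n) := by
  set B := mconv i (fun z => ‖P.S i η t z‖ₑ)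
  have hB : Measurable B := measurable_mconv i (measurable_enorm _)
  have hw := measurable_enorm (w t)
  have hBn : ∀ n, ∀ x ∈ (cube 0 n : Set (E d)), B x ≤ pw (i * d / 2) * smear wt (prof (P.S i η)) t n :=
    fun n x hx => mconv_le i (measurable_enorm _) hx
  have m1 : Measurable fun x => B x * mconv k (fun z => ‖w t z‖ₑ) x := hB.mul (measurable_mconv k hw)
  have m2 : Measurable fun x => mconv k (fun y => B y * ‖w t y‖ₑ) x := measurable_mconv k (hB.mul hw)
  refine (pr2_mono (P.enorm_commPiece_le m i k η w t) n).trans ?_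
  have m3 : Measurable fun x => B x * mconv k (fun z => ‖w t z‖ₑ) x +
      mconv k (fun y => B y * ‖w t y‖ₑ) x := m1.add m2
  rw [pr2_const_mul _ m3, mul_assoc _ (pw (i * d / 2)), mul_add (pw (i * d / 2))]
  gcongr
  refine (pr2_add_le m1 m2 n).trans (add_le_add ?_ ?_)
  · refine (pr2_mul_le (measurable_mconv k hw) (hBn n)).trans ?_
    rw [← mul_assoc]
    gcongr
    exact pr2_mconv_le k hw n
  · refine (pr2_mconv_le k (hB.mul hw) n).trans ?_
    unfold smear
    rw [← ENNReal.tsum_mul_left]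
    refine ENNReal.tsum_le_tsum fun l => ?_
    rw [mul_left_comm]
    gcongr
    refine (pr2_mul_le hw (hBn (n - l))).trans (le_of_eq ?_)
    rw [← mul_assoc]; rfl

/-- The product bound `lsum_mix2_smulF_S_le` with the additional gain 2^{i-k}. The majorant of β at
x gives a product of two smeared profiles, the one at y the smearing of a product; in both the ℓ¹
sum falls on S_i η. -/
theorem exists_lsum_commPiece_le :
    ∃ C : ℝ≥0∞, C ≠ ⊤ ∧ ∀ (m : 𝓢(E d, ℂ)) (i k : ℕ) (η w : ℝ → L2 d ℂ),
      AEStronglyMeasurable η timeMeasure → AEStronglyMeasurable w timeMeasure →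
      lsum i mix2 (prof (P.commPiece m i k η w)) ≤ C * ENNReal.ofReal (kerBound (𝓕⁻ m) 0) *
        (pw (i - k + i * d / 2 + i / 2) * nX i (prof (P.S i η)) * xN (prof w)) := by
  set c1 := ENNReal.ofReal (2 ^ (2 * d + 2) * kerBound (𝓕⁻ (dil 1 P.base)) 1)
  have hT : ∀ i, ((lsum i (mixTop (d := d))).c : ℝ≥0∞) = 2 ^ d * (mixTop (d := d)).c := by simp [lsum]
  have h2 : ∀ i, ((lsum i (mix2 (d := d))).c : ℝ≥0∞) = 2 ^ d * (mix2 (d := d)).c := by simp [lsum]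
  set a := (2 ^ d * ((mixTop (d := d)).c : ℝ≥0∞) * wtMass d)
  set b := (2 ^ d * ((mix2 (d := d)).c : ℝ≥0∞) * wtMass d)
  set e := (((xN (d := d)).c : ℝ≥0∞) * wtMass d)
  refine ⟨c1 * (a * e + b * a), by finiteness, fun m i k η w hη hw => ?_⟩
  have hS := measP_prof (P.aesm_S hη i)
  have hw' := measP_prof hw
  set Q := ENNReal.ofReal (kerBound (𝓕⁻ m) 0)
  set β := smear wt (prof (P.S i η))
  have hβ : MeasP β := hS.smear wt
  have hβn : lsum i mixTop β ≤ a * nX i (prof (P.S i η)) := by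
    have := (lsum i mixTop).smear_le hS wt
    rw [← coe_wtMass, hT] at this
    exact this.trans (mul_le_mul_right (lsum_mixTop_le_nX i _) _)
  have g1 : lsum i mix2 (fun t n => β t n * smear wt (prof w) t n) ≤
      pw ((i : ℝ) / 2) * (a * nX i (prof (P.S i η))) * (e * xN (prof w)) := by
    refine (lsum_mix2_mul_le i β (hw'.smear wt)).trans ?_
    have h3 := (xN (d := d)).smear_le hw' wt
    rw [← coe_wtMass] at h3
    exact mul_le_mul' (mul_le_mul_right hβn _) h3
  have g2 : lsum i mix2 (smear wt fun t n => β t n * prof w t n) ≤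
      b * (pw ((i : ℝ) / 2) * (a * nX i (prof (P.S i η))) * xN (prof w)) := by
    have h3 := (lsum i mix2).smear_le (hβ.mul hw') wt
    rw [← coe_wtMass, h2] at h3
    refine h3.trans (mul_le_mul_right ((lsum_mix2_mul_le i β hw').trans ?_) _)
    exact mul_le_mul_left (mul_le_mul_right hβn _) _
  have m1 : MeasP fun t n => β t n * smear wt (prof w) t n := hβ.mul (hw'.smear wt)
  have m2 : MeasP (smear wt fun t n => β t n * prof w t n) := (hβ.mul hw').smear wt
  have hm : ∀ s : Bool, MeasP (if s then (fun t n => β t n * smear wt (prof w) t n) else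
      (smear wt fun t n => β t n * prof w t n)) := by
    intro s; cases s
    · exact m2
    · exact m1
  have g3 : lsum i mix2 (fun t n => ∑' s : Bool, (if s then
      (fun t n => β t n * smear wt (prof w) t n) else
      (smear wt fun t n => β t n * prof w t n)) t n) ≤
      lsum i mix2 (fun t n => β t n * smear wt (prof w) t n) +
        lsum i mix2 (smear wt fun t n => β t n * prof w t n) := by
    refine ((lsum i mix2).tsum_le hm).trans (le_of_eq ?_)
    rw [tsum_fintype, Fintype.sum_bool]; rfl
  calc lsum i mix2 (prof (P.commPiece m i k η w))
      ≤ lsum i mix2 (fun t n => (c1 * Q * pw ((i : ℝ) - k) * pw (i * d / 2)) * ∑' s : Bool, (if s then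
          (fun t n => β t n * smear wt (prof w) t n) else
          (smear wt fun t n => β t n * prof w t n)) t n) := by
        refine (lsum i mix2).mono (.of_forall fun t n => ?_)
        rw [tsum_fintype, Fintype.sum_bool]
        exact P.prof_commPiece_le m i k η w t n
    _ ≤ (c1 * Q * pw ((i : ℝ) - k) * pw (i * d / 2)) * (pw ((i : ℝ) / 2) *
          (a * nX i (prof (P.S i η))) * (e * xN (prof w)) + b * (pw ((i : ℝ) / 2) *
            (a * nX i (prof (P.S i η))) * xN (prof w))) := by
        refine ((lsum i mix2).smul_le _ (MeasP.tsum hm)).trans (mul_le_mul_right ?_ _)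
        exact g3.trans (add_le_add g1 g2)
    _ = _ := by rw [pw_add, pw_add]; ring

end Decomposition

end LocalEnergy

end

noncomputable section

namespace LocalEnergy

open scoped SchwartzMap

variable {d : ℕ} {V : Type*} [NormedAddCommGroup V] [InnerProductSpace ℂ V] [CompleteSpace V]

open LNorm

/-! ### The commutator with the metric: localized symbols and the bound in ℓ¹Y⁰ -/

theorem prof_const_smul (c : ℂ) (u : ℝ → L2 d V) (t : ℝ) (n : Idx d) :
    prof (fun t => c • u t) t n = ‖c‖ₑ * prof u t n := by
  rw [prof_eq_enorm, prof_eq_enorm, map_smul, enorm_smul]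

theorem norm_const_smul_le (N : LNorm d) (c : ℂ) {u : ℝ → L2 d V}
    (hu : AEStronglyMeasurable u timeMeasure) : N (prof fun t => c • u t) ≤ ‖c‖ₑ * N (prof u) :=
  (N.mono (.of_forall fun t n => (prof_const_smul c u t n).le)).trans (N.smul_le _ (measP_prof hu))

theorem smulF_congr (f : ℝ → L2 d ℂ) {g g' : ℝ → L2 d V} {t : ℝ} (h : g t = g' t) :
    smulF f g t = smulF f g' t := by
  unfold smulF; rw [h]

theorem fourierMul_comm {m₁ m₂ : E d → ℂ} (h₁ : MemLp m₁ ⊤ volume) (h₂ : MemLp m₂ ⊤ volume)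
    (f : L2 d V) : fourierMul m₁ (fourierMul m₂ f) = fourierMul m₂ (fourierMul m₁ f) := by
  rw [fourierMul_fourierMul _ h₂, fourierMul_fourierMul _ h₁]
  congr 1; funext ξ; exact mul_comm _ _

theorem IsSymbolZero.memLp_top {A : E d → ℂ} (hA : IsSymbolZero A) : MemLp A ⊤ volume := by
  obtain ⟨C, hC⟩ := hA.2 0
  refine memLp_top_of_continuous hA.1.continuous (C := C) fun ξ => ?_
  have := hC ξ
  rwa [norm_iteratedFDeriv_zero, Nat.cast_zero, neg_zero, Real.rpow_zero, mul_one] at this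

/-- The derivatives of a symbol of order zero, rescaled to an annulus. -/
theorem IsSymbolZero.norm_iteratedFDeriv_smul_le {A : E d → ℂ} (hA : IsSymbolZero A) (n : ℕ) :
    ∃ C : ℝ, ∀ (k : ℕ) (ξ : E d), 1 / 16 ≤ ‖ξ‖ → ‖ξ‖ ≤ 16 →
      ‖iteratedFDeriv ℝ n (fun ξ => A ((2 ^ k : ℝ) • ξ)) ξ‖ ≤ C := by
  obtain ⟨C, hC⟩ := hA.2 n
  have hC0 : 0 ≤ C := by
    have := (norm_nonneg _).trans (hC 0)
    simpa using this
  refine ⟨C * 16 ^ n, fun k ξ hξ _ => ?_⟩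
  set L : E d →L[ℝ] E d := (2 ^ k : ℝ) • ContinuousLinearMap.id ℝ (E d)
  have hL : ‖L‖ ≤ 2 ^ k := by
    rw [norm_smul, Real.norm_of_nonneg (by positivity)]
    exact mul_le_of_le_one_right (by positivity) ContinuousLinearMap.norm_id_le
  have h1 := L.iteratedFDeriv_comp_right hA.1 ξ (i := n) (by exact_mod_cast le_top)
  change ‖iteratedFDeriv ℝ n (A ∘ L) ξ‖ ≤ _
  rw [h1]
  refine (ContinuousMultilinearMap.norm_compContinuousLinearMap_le _ _).trans ?_
  rw [Finset.prod_const, Finset.card_univ, Fintype.card_fin]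
  have hx : (0 : ℝ) < 2 ^ k * ‖ξ‖ := mul_pos (by positivity) (by linarith)
  have hLx : ‖L ξ‖ = 2 ^ k * ‖ξ‖ := by
    change ‖(2 ^ k : ℝ) • ξ‖ = _
    rw [norm_smul, Real.norm_of_nonneg (by positivity)]
  have h2 : (1 + ‖L ξ‖) ^ (-(n : ℝ)) ≤ ((2 ^ k * ‖ξ‖) ^ n)⁻¹ := by
    rw [Real.rpow_neg (by positivity), Real.rpow_natCast, hLx]
    gcongr
    linarith
  calc ‖iteratedFDeriv ℝ n A (L ξ)‖ * ‖L‖ ^ n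
      ≤ (C * ((2 ^ k * ‖ξ‖) ^ n)⁻¹) * (2 ^ k) ^ n := by
        gcongr
        exact (hC _).trans (by gcongr)
    _ = C * (‖ξ‖⁻¹) ^ n := by
        have : ‖ξ‖ ≠ 0 := by linarith
        rw [mul_pow, inv_pow]; field_simp
    _ ≤ C * 16 ^ n := by
        gcongr
        exact inv_le_of_inv_le₀ (by norm_num) (by linarith)

namespace Decomposition

variable (P : Decomposition d)

/-- The symbol `2πi ξ_c` on the fat annulus. -/
def dsym (c : Fin d) : 𝓢(E d, ℂ) :=
  P.cutSym (fun ξ => 2 * Real.pi * Complex.I * (ξ c : ℂ))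
    (contDiff_const.mul (Complex.ofRealCLM.contDiff.comp
      (EuclideanSpace.proj c : E d →L[ℝ] ℝ).contDiff))

/-- The symbol `A(2^k ξ)` on the fat annulus. -/
def asym {A : E d → ℂ} (hA : IsSymbolZero A) (k : ℕ) : 𝓢(E d, ℂ) :=
  P.cutSym (fun ξ => A ((2 ^ k : ℝ) • ξ)) (hA.1.comp (contDiff_const_smul _))

/-- On functions reproduced by the fat annulus only the values of the symbol on that annulus count.
So ∂_c and A(D) may be replaced by multipliers with Schwartz symbols. -/
theorem fourierMul_eq_of_fat {k : ℕ} {f : L2 d V} (hf : fourierMul (dil k P.fat) f = f)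
    {g m : E d → ℂ} (h : ∀ ξ, g ξ * dil k P.fat ξ = m ξ) : fourierMul g f = fourierMul m f := by
  conv_lhs => rw [← hf, fourierMul_fourierMul _ ((dil k P.fat).memLp_top volume)]
  congr 1; funext ξ; exact h ξ

theorem fourierMul_symbol_eq {A : E d → ℂ} (hA : IsSymbolZero A) {k : ℕ} {f : L2 d V}
    (hf : fourierMul (dil k P.fat) f = f) : fourierMul A f = fourierMul (dil k (P.asym hA k)) f :=
  P.fourierMul_eq_of_fat hf fun ξ => by
    rw [dil_apply, dil_apply, asym, cutSym_apply, smul_inv_smul₀ (by positivity), mul_comm]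

/-- The derivative of functions with frequencies comparable to `2^k`. -/
def dloc (k : ℕ) (c : Fin d) (f : L2 d ℂ) : L2 d ℂ :=
  (2 ^ k : ℂ) • fourierMul (dil k (P.dsym c)) f

theorem dloc_eq (k : ℕ) (c : Fin d) (f : L2 d ℂ) : P.dloc k c f =
    ((2 ^ k : ℂ) • fmul (V := ℂ) (dil k (P.dsym c)) ((dil k (P.dsym c)).memLp_top volume)) f := rfl

theorem partialDeriv_eq {k : ℕ} (c : Fin d) {f : L2 d ℂ} (hf : fourierMul (dil k P.fat) f = f) :
    partialDeriv c f = P.dloc k c f := by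
  rw [partialDeriv, dloc, ← fourierMul_sym_const_mul _ ((dil k (P.dsym c)).memLp_top volume)]
  refine P.fourierMul_eq_of_fat hf fun ξ => ?_
  rw [dil_apply, dil_apply, dsym, cutSym_apply]
  simp only [PiLp.smul_apply, smul_eq_mul, Complex.ofReal_mul, Complex.ofReal_inv, Complex.ofReal_pow,
    Complex.ofReal_ofNat]
  field_simp

theorem fourierMul_dloc {m : E d → ℂ} (hm : MemLp m ⊤ volume) (k : ℕ) (c : Fin d) (f : L2 d ℂ) :
    fourierMul m (P.dloc k c f) = P.dloc k c (fourierMul m f) := by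
  rw [dloc, dloc, ← fmul_apply hm, map_smul, fmul_apply,
    fourierMul_comm hm ((dil k (P.dsym c)).memLp_top volume)]

theorem aesm_dloc (k : ℕ) (c : Fin d) {u : ℝ → L2 d ℂ} (hu : AEStronglyMeasurable u timeMeasure) :
    AEStronglyMeasurable (fun t => P.dloc k c (u t)) timeMeasure :=
  (aesm_fourierMul ((dil k (P.dsym c)).memLp_top volume) hu).fun_const_smul _

/-- A bound for the kernels of the localized derivatives. -/
def dkerC : ℝ≥0∞ := ∑ c, ENNReal.ofReal (kerBound (𝓕⁻ (P.dsym c)) 0)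

theorem dkerC_ne_top : P.dkerC ≠ ⊤ := ENNReal.sum_ne_top.2 fun _ _ => ENNReal.ofReal_ne_top

theorem norm_dloc_le (N : LNorm d) (k : ℕ) (c : Fin d) {u : ℝ → L2 d ℂ}
    (hu : AEStronglyMeasurable u timeMeasure) :
    N (prof fun t => P.dloc k c (u t)) ≤ P.dkerC * (N.c * wtMass d) * (pw k * N (prof u)) := by
  refine (norm_const_smul_le N _ (aesm_fourierMul ((dil k (P.dsym c)).memLp_top volume) hu)).trans ?_
  have h1 := norm_fourierMul_dil_le N k (P.dsym c) hu
  have h2 : ENNReal.ofReal (kerBound (𝓕⁻ (P.dsym c)) 0) ≤ P.dkerC :=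
    Finset.single_le_sum (f := fun c => ENNReal.ofReal (kerBound (𝓕⁻ (P.dsym c)) 0))
      (fun _ _ => zero_le) (Finset.mem_univ c)
  have h3 : ‖(2 ^ k : ℂ)‖ₑ = pw k := by
    rw [pw_natCast, enorm_pow]; congr 1
    rw [← ofReal_norm]; simp
  rw [h3]
  calc pw k * N (prof fun t => fourierMul (dil k (P.dsym c)) (u t))
      ≤ pw k * (P.dkerC * (N.c * wtMass d) * N (prof u)) := by
        refine mul_le_mul_right (h1.trans ?_) _
        gcongr
    _ = _ := by ring

theorem fat_S {k : ℕ} (hk : 3 ≤ k) (u : ℝ → L2 d V) (t : ℝ) :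
    fourierMul (dil k P.fat) (P.S k u t) = P.S k u t :=
  P.fat_eq_self hk fun q hq => by rw [P.S_S_eq_zero (by omega)]; rfl

theorem fat_smulF {i k : ℕ} (hk : i + 5 ≤ k) (η : ℝ → L2 d ℂ) (v : ℝ → L2 d V) (t : ℝ) :
    fourierMul (dil k P.fat) (smulF (P.S i η) (P.S k v) t) = smulF (P.S i η) (P.S k v) t :=
  P.fat_eq_self (by omega) fun q hq => P.S_smulF_eq_zero (by omega) η v t

theorem fourierMul_S {m : E d → ℂ} (hm : MemLp m ⊤ volume) (k : ℕ) (u : ℝ → L2 d V) :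
    (fun t => fourierMul m (P.S k u t)) = P.S k fun t => fourierMul m (u t) := by
  funext t
  rw [P.S_apply, P.S_apply, fourierMul_comm hm (P.memLp_sym k)]

theorem dloc_S (k q : ℕ) (c : Fin d) (u : ℝ → L2 d ℂ) :
    (fun t => P.dloc k c (P.S q u t)) = P.S q fun t => P.dloc k c (u t) := by
  funext t
  rw [P.S_apply, P.S_apply, P.fourierMul_dloc (P.memLp_sym q)]

theorem S_commPiece_eq_zero (m : 𝓢(E d, ℂ)) {i k q : ℕ} (hk : i + 5 ≤ k)
    (hq : q + 2 < k ∨ k + 2 < q) (η v : ℝ → L2 d ℂ) (t : ℝ) :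
    P.S q (P.commPiece m i k η (P.S k v)) t = 0 := by
  have hm : MemLp (dil k m) ⊤ volume := (dil k m).memLp_top volume
  rw [P.S_apply, commPiece, fourierMul_sub _ (P.memLp_sym q), P.fourierMul_S hm, ← P.S_apply,
    fourierMul_comm (P.memLp_sym q) hm, ← P.S_apply,
    P.S_smulF_eq_zero (by omega), P.S_smulF_eq_zero (by omega), fourierMul_zero, sub_zero]

/-- The entry `(a,c)` of a matrix. -/
def entry (a c : Fin d) : EuclideanSpace ℂ (Fin d × Fin d) →L[ℝ] ℂ :=
  (EuclideanSpace.proj (a, c) : EuclideanSpace ℂ (Fin d × Fin d) →L[ℂ] ℂ).restrictScalars ℝ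

theorem ofFun_lowMetric_mul (h : ℝ → L2 d (EuclideanSpace ℂ (Fin d × Fin d))) (N : ℕ) (t : ℝ)
    (a c : Fin d) (f : L2 d ℂ) :
    ofFun (fun x => P.lowMetric h N t a c x * f x) =
      (if a = c then ∑ k ∈ Finset.range N, (P.phiK k 0 : ℂ) else 0) • f +
        ∑ i ∈ Finset.range N, smulF (P.S i (lmap (entry a c) h)) (fun _ => f) t := by
  symm
  refine eq_ofFun ?_
  set z : ℂ := if a = c then ∑ k ∈ Finset.range N, (P.phiK k 0 : ℂ) else 0
  set w := ∑ i ∈ Finset.range N, smulF (P.S i (lmap (entry a c) h)) (fun _ => f) t with hw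
  have h1 : ∀ᵐ x, ∀ i, smulF (P.S i (lmap (entry a c) h)) (fun _ => f) t x =
      P.S i h t x (a, c) * f x := by
    refine ae_all_iff.2 fun i => ?_
    have e := congrFun (P.S_lmap (entry a c) i h) t
    filter_upwards [smulF_ae (fun _ => f) (P.memLp_top_S i (lmap (entry a c) h) t),
      lmap_ae (entry a c) (P.S i h) t] with x hx1 hx2
    rw [hx1, e, hx2]; rfl
  filter_upwards [h1, Lp.coeFn_add (z • f) w, Lp.coeFn_smul z f,
    Lp.coeFn_fun_finsetSum (Finset.range N) fun i => smulF (P.S i (lmap (entry a c) h)) (fun _ => f) t,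
    Lp.coeFn_fun_finsetSum (Finset.range N) fun i => P.S i h t] with x hx1 hx2 hx3 hx4 hx5
  rw [hx2, Pi.add_apply, hx3, Pi.smul_apply, hw, hx4, lowMetric, P.SLt_apply, hx5]
  simp only [hx1, smul_eq_mul]
  rw [add_mul, ← Finset.sum_mul]
  congr 2
  simp

/-- The contribution of the identity matrix is multiplication by a constant, which commutes with
A(D); only h remains. Both S_k v and S_i h · S_k v with i ≤ k - 5 have frequencies near 2^k, so A
may be replaced by its localization there. -/
theorem commutator_lowMetric_eq (h : ℝ → L2 d (EuclideanSpace ℂ (Fin d × Fin d)))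
    {A : E d → ℂ} (hA : IsSymbolZero A) (k : ℕ) (t : ℝ) (a c : Fin d) (v : ℝ → L2 d ℂ) :
    commutator (P.lowMetric h (k - 4) t a c) A (P.S k v t) =
      ∑ i ∈ Finset.range (k - 4), P.commPiece (P.asym hA k) i k (lmap (entry a c) h) (P.S k v) t := by
  have hT := hA.memLp_top
  rw [commutator, P.ofFun_lowMetric_mul, P.ofFun_lowMetric_mul, fourierMul_add _ hT,
    fourierMul_sum _ _ hT, ← fmul_apply hT (_ • _), map_smul, fmul_apply, add_sub_add_left_eq_sub,
    ← Finset.sum_sub_distrib]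
  refine Finset.sum_congr rfl fun i hi => ?_
  have hi' : i + 5 ≤ k := by have := Finset.mem_range.1 hi; omega
  rw [commPiece]
  congr 1
  · exact smulF_congr _ (P.fourierMul_symbol_eq hA (P.fat_S (by omega) v t))
  · rw [smulF_congr (g' := P.S k v) _ rfl]
    exact P.fourierMul_symbol_eq hA (P.fat_smulF hi' (lmap (entry a c) h) v t)

theorem partialDeriv_S {k : ℕ} (hk : 3 ≤ k) (c : Fin d) (u : ℝ → L2 d ℂ) (t : ℝ) :
    partialDeriv c (P.S k u t) = P.S k (fun t => P.dloc k c (u t)) t := by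
  rw [P.partialDeriv_eq c (P.fat_S hk u t), ← P.dloc_S]

theorem metricCommutator_eq (h : ℝ → L2 d (EuclideanSpace ℂ (Fin d × Fin d)))
    {A : E d → ℂ} (hA : IsSymbolZero A) (k : ℕ) (u : ℝ → L2 d ℂ) (t : ℝ) :
    P.metricCommutator h A k u t = ∑ i ∈ Finset.range (k - 4), ∑ a, ∑ c,
      P.dloc k a (P.commPiece (P.asym hA k) i k (lmap (entry a c) h)
        (P.S k fun t => P.dloc k c (u t)) t) := by
  rw [metricCommutator, Finset.sum_comm]
  simp_rw [Finset.sum_comm (s := Finset.range (k - 4))]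
  rw [Finset.sum_comm]
  refine Finset.sum_congr rfl fun a _ => Finset.sum_congr rfl fun c _ => ?_
  rcases Nat.lt_or_ge k 5 with hk | hk
  · rw [show k - 4 = 0 by omega, Finset.range_zero, Finset.sum_empty, commutator,
      P.ofFun_lowMetric_mul, P.ofFun_lowMetric_mul]
    simp [fourierMul_zero, partialDeriv]
  · rw [P.partialDeriv_S (by omega), P.commutator_lowMetric_eq h hA, P.partialDeriv_eq (k := k)]
    · rw [dloc_eq, map_sum]; rfl
    · rw [fourierMul_sum _ _ ((dil k P.fat).memLp_top volume)]
      refine Finset.sum_congr rfl fun i hi => ?_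
      have hi' : i + 5 ≤ k := by have := Finset.mem_range.1 hi; omega
      exact P.fat_eq_self (by omega) fun q hq => P.S_commPiece_eq_zero _ hi' hq _ _ t

/-- The commutator bound. -/
theorem exists_l1Y_metricCommutator_le {s : ℝ} (hs : (d : ℝ) / 2 + 2 < s) {A : E d → ℂ}
    (hA : IsSymbolZero A) :
    ∃ K : ℝ≥0, ∀ (h : ℝ → L2 d (EuclideanSpace ℂ (Fin d × Fin d))) (u : ℝ → L2 d ℂ) (k : ℕ),
      AEStronglyMeasurable h timeMeasure → AEStronglyMeasurable (P.S k u) timeMeasure →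
      P.l1Y 0 (P.metricCommutator h A k u) ≤ K * P.l1X s h * P.l1X 0 (P.S k u) := by
  obtain ⟨CY, hCY⟩ := P.exists_l1Y_le (V := ℂ) 0
  obtain ⟨CP, hCPt, hCP⟩ := P.exists_lsum_commPiece_le
  obtain ⟨CX, hCX⟩ := P.exists_pw_mul_nX_le_l1X_S (V := ℂ) 0
  obtain ⟨CA, hCA⟩ := P.exists_kerBound_cutSym_le (fun k ξ => A ((2 ^ k : ℝ) • ξ))
    (fun k => hA.1.comp (contDiff_const_smul _)) hA.norm_iteratedFDeriv_smul_le 0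
  set CD := P.dkerC
  have hCD : CD ≠ ⊤ := P.dkerC_ne_top
  set e := -(s - 2 - d / 2) with he
  have hgeo : geo e ≠ ⊤ := geo_ne_top (by rw [he]; linarith)
  have h2 : ∀ i, ((lsum i (mix2 (d := d))).c : ℝ≥0∞) = 2 ^ d * (mix2 (d := d)).c := by simp [lsum]
  set b := (2 ^ d * ((mix2 (d := d)).c : ℝ≥0∞) * wtMass d)
  set f := (((xN (d := d)).c : ℝ≥0∞) * wtMass d)
  set CL : Fin d → Fin d → ℝ≥0∞ := fun a c => ‖entry a c‖ₑ with hCL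
  set M : ℝ≥0∞ := ∑ a, ∑ c, CD * b * (CP * ENNReal.ofReal CA * (CL a c * P.cutC * (CD * f * CX))) with hM
  have hMt : M ≠ ⊤ := by
    refine ENNReal.sum_ne_top.2 fun a _ => ENNReal.sum_ne_top.2 fun c _ => ?_
    simp only [hCL]
    finiteness
  refine ⟨(CY * (M * geo e)).toNNReal, fun h u k hh hu => ?_⟩
  rw [ENNReal.coe_toNNReal (by finiteness)]
  set p : ℕ → ℝ → L2 d ℂ := fun i t => ∑ a, ∑ c,
    P.dloc k a (P.commPiece (P.asym hA k) i k (lmap (entry a c) h)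
      (P.S k fun t => P.dloc k c (u t)) t) with hp
  have hw : ∀ c, AEStronglyMeasurable (P.S k fun t => P.dloc k c (u t)) timeMeasure := by
    intro c; rw [← P.dloc_S]; exact P.aesm_dloc k c hu
  have hη : ∀ a c, AEStronglyMeasurable (lmap (entry a c) h) timeMeasure := fun a c => aesm_lmap _ hh
  have hpc : ∀ i a c, AEStronglyMeasurable (P.commPiece (P.asym hA k) i k (lmap (entry a c) h)
      (P.S k fun t => P.dloc k c (u t))) timeMeasure := fun i a c =>
    P.aesm_commPiece _ i k (hη a c) (hw c)
  have hpd : ∀ i a c, AEStronglyMeasurable (fun t => P.dloc k a (P.commPiece (P.asym hA k) i k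
      (lmap (entry a c) h) (P.S k fun t => P.dloc k c (u t)) t)) timeMeasure := fun i a c =>
    P.aesm_dloc k a (hpc i a c)
  have hpm : ∀ i, AEStronglyMeasurable (p i) timeMeasure := fun i =>
    Finset.aestronglyMeasurable_fun_sum _ fun a _ => Finset.aestronglyMeasurable_fun_sum _ fun c _ => hpd i a c
  have hmain := hCY (Fin (k - 4)) (fun i => p i) (fun i => i) (P.metricCommutator h A k u) k
    (fun i => hpm i) (.of_forall fun t => by
      rw [P.metricCommutator_eq h hA, Fin.sum_univ_eq_sum_range fun i => p i t]) (fun i => by omega)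
    (fun j hj => .of_forall fun t => by
      rw [P.S_apply, P.metricCommutator_eq h hA, fourierMul_sum _ _ (P.memLp_sym j)]
      refine Finset.sum_eq_zero fun i hi => ?_
      have hi' : i + 5 ≤ k := by have := Finset.mem_range.1 hi; omega
      rw [fourierMul_sum _ _ (P.memLp_sym j)]
      refine Finset.sum_eq_zero fun a _ => ?_
      rw [fourierMul_sum _ _ (P.memLp_sym j)]
      refine Finset.sum_eq_zero fun c _ => ?_
      rw [P.fourierMul_dloc (P.memLp_sym j), ← P.S_apply, P.S_commPiece_eq_zero _ hi' (by omega), dloc,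
        fourierMul_zero, smul_zero])
  have hterm : ∀ i : ℕ, pw (((i : ℝ) - k) / 2) * lsum i mix2 (prof (p i)) ≤
      pw (e * i) * (M * (P.l1X s h * P.l1X 0 (P.S k u))) := by
    intro i
    have hx : ∀ c, xN (prof (P.S k fun t => P.dloc k c (u t))) ≤
        CD * f * (pw (k / 2) * (CX * P.l1X 0 (P.S k u))) := by
      intro c
      have a1 := P.norm_dloc_le xN k c hu
      rw [P.dloc_S] at a1
      have a2 := xN_le_nX k (measP_prof hu)
      have a3 := hCX u k hu
      rw [mul_zero, pw_zero, one_mul] at a3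
      calc _ ≤ CD * f * (pw k * xN (prof (P.S k u))) := a1
        _ ≤ CD * f * (pw k * (pw (-(k : ℝ) / 2) * (CX * P.l1X 0 (P.S k u)))) := by
            refine mul_le_mul_right (mul_le_mul_right (a2.trans (mul_le_mul_right a3 _)) _) _
        _ = _ := by
            rw [← mul_assoc (pw k), ← pw_add]; congr 3; ring
    have hn : ∀ a c, nX i (prof (P.S i (lmap (entry a c) h))) ≤
        CL a c * (P.cutC * (pw (-(i * s)) * P.l1X s h)) := by
      intro a c
      rw [P.S_lmap]
      exact (norm_lmap_le _ _ (P.aesm_S hh i)).trans (mul_le_mul_right (P.nX_S_le s hh i) _)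
    have hA' : ENNReal.ofReal (kerBound (𝓕⁻ (P.asym hA k)) 0) ≤ ENNReal.ofReal CA :=
      ENNReal.ofReal_le_ofReal (hCA k)
    have hpiece : ∀ a c, lsum i mix2 (prof fun t => P.dloc k a (P.commPiece (P.asym hA k) i k
        (lmap (entry a c) h) (P.S k fun t => P.dloc k c (u t)) t)) ≤
        CD * b * (pw k * (CP * ENNReal.ofReal CA * (pw (i - k + i * d / 2 + i / 2) *
          (CL a c * (P.cutC * (pw (-(i * s)) * P.l1X s h))) *
            (CD * f * (pw (k / 2) * (CX * P.l1X 0 (P.S k u))))))) := by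
      intro a c
      have b1 := P.norm_dloc_le (lsum i mix2) k a (hpc i a c)
      rw [h2] at b1
      refine b1.trans (mul_le_mul_right (mul_le_mul_right ((hCP _ i k _ _ (hη a c) (hw c)).trans ?_) _) _)
      exact mul_le_mul' (mul_le_mul_right hA' _) (mul_le_mul' (mul_le_mul_right (hn a c) _) (hx c))
    have hsum : lsum i mix2 (prof (p i)) ≤ ∑ a, ∑ c, lsum i mix2 (prof fun t =>
        P.dloc k a (P.commPiece (P.asym hA k) i k
          (lmap (entry a c) h) (P.S k fun t => P.dloc k c (u t)) t)) := by
      have e1 : p i = ∑ a, ∑ c, fun t => P.dloc k a (P.commPiece (P.asym hA k) i k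
          (lmap (entry a c) h) (P.S k fun t => P.dloc k c (u t)) t) := by
        funext t; simp only [hp, Finset.sum_apply]
      rw [e1]
      refine (norm_sum_le _ _ _ fun a _ => Finset.aestronglyMeasurable_sum _ fun c _ => hpd i a c).trans ?_
      exact Finset.sum_le_sum fun a _ => norm_sum_le _ _ _ fun c _ => hpd i a c
    refine (mul_le_mul_right (hsum.trans (Finset.sum_le_sum fun a _ => Finset.sum_le_sum fun c _ =>
      hpiece a c)) _).trans (le_of_eq ?_)
    rw [hM, Finset.sum_mul, Finset.mul_sum, Finset.mul_sum]
    refine Finset.sum_congr rfl fun a _ => ?_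
    rw [Finset.sum_mul, Finset.mul_sum, Finset.mul_sum]
    refine Finset.sum_congr rfl fun c _ => ?_
    -- All powers of 2^k cancel: -k/2 from the atoms, k from the outer derivative, -k from the
    -- commutator, and k/2 from the inner derivative combined with the X norm. What is left is
    -- 2^{i(2+d/2-s)}, summable because s > d/2 + 2.
    have e2 : pw (e * i) = pw (((i : ℝ) - k) / 2) * pw k * pw (i - k + i * d / 2 + i / 2) *
        pw (-(i * s)) * pw (k / 2) := by
      rw [← pw_add, ← pw_add, ← pw_add, ← pw_add, he]; congr 1; ring
    rw [e2]; ring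
  refine hmain.trans ?_
  rw [mul_zero, pw_zero, one_mul]
  calc _ ≤ CY * ∑ i : Fin (k - 4), pw (e * (i : ℕ)) * (M * (P.l1X s h * P.l1X 0 (P.S k u))) := by
        exact mul_le_mul_right (Finset.sum_le_sum fun (i : Fin (k - 4)) _ => hterm i) _
    _ ≤ CY * (geo e * (M * (P.l1X s h * P.l1X 0 (P.S k u)))) := by
        rw [← Finset.sum_mul, Fin.sum_univ_eq_sum_range fun i => pw (e * i)]
        exact mul_le_mul_right (mul_le_mul_left (sum_range_pw_le e _) _) _
    _ = _ := by ring

end Decomposition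

end LocalEnergy

end

noncomputable section

namespace LocalEnergy

open scoped SchwartzMap

variable {d : ℕ} {V : Type*} [NormedAddCommGroup V] [InnerProductSpace ℂ V] [CompleteSpace V]

open LNorm

/-! ### Derivatives of kernels -/

/-- The `i`-th unit vector. -/
def unitVec (i : Fin d) : E d := EuclideanSpace.single i 1

theorem norm_unitVec (i : Fin d) : ‖unitVec i‖ = 1 := by simp [unitVec]

theorem sum_unitVec (v : E d) : ∑ i, v i • unitVec i = v := by
  have := (EuclideanSpace.basisFun (Fin d) ℝ).sum_repr v
  simpa [unitVec] using this

/-- Multiplication of a symbol by `2πi ξ_i`. -/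
def xiSym (i : Fin d) (m : 𝓢(E d, ℂ)) : 𝓢(E d, ℂ) :=
  (2 * Real.pi * Complex.I) • SchwartzMap.smulLeftCLM ℂ (fun ξ : E d => inner ℝ ξ (unitVec i)) m

theorem xiSym_apply (i : Fin d) (m : 𝓢(E d, ℂ)) (ξ : E d) :
    xiSym i m ξ = 2 * Real.pi * Complex.I * ((ξ i : ℝ) * m ξ) := by
  have h : (fun ξ : E d => inner ℝ ξ (unitVec i)).HasTemperateGrowth := by fun_prop
  rw [xiSym, smul_apply, SchwartzMap.smulLeftCLM_apply_apply h]
  simp [unitVec, EuclideanSpace.inner_single_right]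

theorem fderiv_kernel (i : Fin d) (m : 𝓢(E d, ℂ)) (z : E d) :
    fderiv ℝ (𝓕⁻ m : 𝓢(E d, ℂ)) z (unitVec i) = (𝓕⁻ (xiSym i m) : 𝓢(E d, ℂ)) z := by
  rw [← SchwartzMap.lineDerivOp_apply_eq_fderiv, SchwartzMap.lineDerivOp_fourierInv_eq]
  rfl

theorem xiSym_dil (i : Fin d) (k : ℕ) (m : 𝓢(E d, ℂ)) :
    xiSym i (dil k m) = (2 ^ k : ℂ) • dil k (xiSym i m) := by
  ext ξ
  rw [smul_apply, xiSym_apply, dil_apply, dil_apply, xiSym_apply]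
  simp only [PiLp.smul_apply, smul_eq_mul, Complex.ofReal_mul, Complex.ofReal_inv, Complex.ofReal_pow,
    Complex.ofReal_ofNat]
  field_simp

/-- The linear map `w ↦ (v ↦ v_i w)`. -/
def coordSmul (V : Type*) [NormedAddCommGroup V] [NormedSpace ℝ V] (i : Fin d) :
    V →L[ℝ] E d →L[ℝ] V :=
  ContinuousLinearMap.smulRightL ℝ (E d) V (EuclideanSpace.proj i : E d →L[ℝ] ℝ)

theorem coordSmul_apply (i : Fin d) (w : V) (v : E d) : coordSmul V i w v = v i • w := rfl

/-! ### Smoothness of convolutions -/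

theorem maj_zero_le {z w : E d} (h : ‖z - w‖ ≤ 1) : maj 0 w ≤ 2 ^ (2 * d + 2) * maj 0 z := by
  rw [maj_zero, maj_zero, ← div_eq_mul_inv, inv_eq_one_div,
    div_le_div_iff₀ (by positivity) (by positivity), one_mul, ← mul_pow]
  gcongr
  have : ‖z‖ ≤ ‖w‖ + ‖z - w‖ := by
    have := norm_add_le w (z - w); rwa [add_sub_cancel] at this
  linarith [norm_nonneg w]

theorem mconv_lt_top (k : ℕ) (f : L2 d V) (x : E d) : mconv k (fun y => ‖f y‖ₑ) x < ⊤ := by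
  refine lt_of_le_of_lt (mconv_le k (measurable_enorm f) ((mem_cube_zero_iff _ x).2 rfl)) ?_
  change pw (k * d / 2) * _ < _
  have h : ∑' m, wt m * pr2 (fun y => ‖f y‖ₑ) (idx x - m) ≤ wtMass d * ‖f‖ₑ := by
    rw [coe_wtMass, ← ENNReal.tsum_mul_right]
    exact ENNReal.tsum_le_tsum fun m => mul_le_mul_right (prof_le (fun _ => f) 0 _) _
  have h1 := pw_ne_top (k * d / 2)
  refine lt_of_le_of_lt (mul_le_mul_right h _) ?_
  exact lt_top_iff_ne_top.2 (by finiteness)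

theorem integrable_maj_mul (f : L2 d V) (x : E d) : Integrable fun y => maj 0 (x - y) * ‖f y‖ := by
  refine ⟨((continuous_maj 0).comp (continuous_const.sub continuous_id)).aestronglyMeasurable.mul
    (Lp.aestronglyMeasurable f).norm, ?_⟩
  rw [hasFiniteIntegral_iff_enorm]
  refine lt_of_le_of_lt (le_of_eq (lintegral_congr fun y => ?_)) (mconv_lt_top 0 f x)
  rw [enorm_mul, enorm_norm, Real.enorm_of_nonneg (maj_nonneg _ _)]

theorem hasFDerivAt_kernel_smul (m : 𝓢(E d, ℂ)) (y z : E d) (v : V) :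
    HasFDerivAt (fun w => (𝓕⁻ m : 𝓢(E d, ℂ)) (w - y) • v)
      (∑ i, coordSmul V i ((𝓕⁻ (xiSym i m) : 𝓢(E d, ℂ)) (z - y) • v)) z := by
  have h1 : HasFDerivAt (fun w => (𝓕⁻ m : 𝓢(E d, ℂ)) (w - y))
      (fderiv ℝ (𝓕⁻ m : 𝓢(E d, ℂ)) (z - y)) z := by
    have h2 : HasFDerivAt (𝓕⁻ m : 𝓢(E d, ℂ)) (fderiv ℝ (𝓕⁻ m : 𝓢(E d, ℂ)) (z - y)) (z - y) :=
      ((𝓕⁻ m : 𝓢(E d, ℂ)).differentiableAt).hasFDerivAt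
    exact h2.comp z ((hasFDerivAt_id z).sub_const y)
  refine (h1.smul_const v).congr_fderiv ?_
  ext w
  rw [ContinuousLinearMap.smulRight_apply, sum_apply]
  simp only [coordSmul_apply]
  conv_lhs => rw [← sum_unitVec w, map_sum, Finset.sum_smul]
  refine Finset.sum_congr rfl fun i _ => ?_
  rw [map_smul, fderiv_kernel, smul_assoc]

theorem norm_sum_coordSmul_le (K : Fin d → 𝓢(E d, ℂ)) {x z : E d} (hz : z ∈ Metric.ball x 1)
    (y : E d) (v : V) :
    ‖∑ i, coordSmul V i (K i (z - y) • v)‖ ≤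
      (∑ i, ‖coordSmul (d := d) V i‖ * (kerBound (K i) 0 * 2 ^ (2 * d + 2))) *
        (maj 0 (x - y) * ‖v‖) := by
  rw [Finset.sum_mul]
  refine (norm_sum_le _ _).trans (Finset.sum_le_sum fun i _ => ?_)
  have h1 := norm_fderiv_le_maj (K i) (le_refl 0) (z - y)
  rw [norm_iteratedFDeriv_zero] at h1
  have h2 : maj 0 (z - y) ≤ 2 ^ (2 * d + 2) * maj 0 (x - y) := by
    refine maj_zero_le ?_
    rw [sub_sub_sub_cancel_right, ← dist_eq_norm, dist_comm]
    exact (Metric.mem_ball.1 hz).le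
  have h3 : ‖K i (z - y) • v‖ ≤ kerBound (K i) 0 * (2 ^ (2 * d + 2) * maj 0 (x - y)) * ‖v‖ := by
    rw [norm_smul]
    exact mul_le_mul_of_nonneg_right
      (h1.trans (mul_le_mul_of_nonneg_left h2 (kerBound_nonneg _ _))) (norm_nonneg _)
  calc _ ≤ ‖coordSmul (d := d) V i‖ * ‖K i (z - y) • v‖ := (coordSmul V i).le_opNorm _
    _ ≤ ‖coordSmul (d := d) V i‖ * (kerBound (K i) 0 * (2 ^ (2 * d + 2) * maj 0 (x - y)) * ‖v‖) :=
        mul_le_mul_of_nonneg_left h3 (norm_nonneg (coordSmul (d := d) V i))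
    _ = _ := by ring

theorem integrable_coordSmul_conv (K : 𝓢(E d, ℂ)) (i : Fin d) (f : L2 d V) (x : E d) :
    Integrable fun y => coordSmul V i (K (x - y) • f y) :=
  (coordSmul V i).integrable_comp (integrable_conv K (Lp.memLp f) x)

theorem integral_sum_coordSmul (K : Fin d → 𝓢(E d, ℂ)) (f : L2 d V) (x : E d) :
    ∫ y, ∑ i, coordSmul V i (K i (x - y) • f y) = ∑ i, coordSmul V i (conv (K i) f x) := by
  rw [integral_finsetSum _ fun i _ => integrable_coordSmul_conv (K i) i f x]
  exact Finset.sum_congr rfl fun i _ =>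
    (coordSmul V i).integral_comp_comm (integrable_conv (K i) (Lp.memLp f) x)

theorem hasFDerivAt_conv (m : 𝓢(E d, ℂ)) (f : L2 d V) (x : E d) :
    HasFDerivAt (conv (𝓕⁻ m : 𝓢(E d, ℂ)) f)
      (∑ i, coordSmul V i (conv (𝓕⁻ (xiSym i m) : 𝓢(E d, ℂ)) f x)) x := by
  have hm : AEStronglyMeasurable
      (fun y => ∑ i, coordSmul V i ((𝓕⁻ (xiSym i m) : 𝓢(E d, ℂ)) (x - y) • f y)) volume :=
    Finset.aestronglyMeasurable_fun_sum _ fun i _ =>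
      (integrable_coordSmul_conv (𝓕⁻ (xiSym i m)) i f x).aestronglyMeasurable
  have h := hasFDerivAt_integral_of_dominated_of_fderiv_le (μ := volume) (𝕜 := ℝ)
    (F := fun x y => (𝓕⁻ m : 𝓢(E d, ℂ)) (x - y) • f y)
    (F' := fun x y => ∑ i, coordSmul V i ((𝓕⁻ (xiSym i m) : 𝓢(E d, ℂ)) (x - y) • f y))
    (Metric.ball_mem_nhds x one_pos)
    (.of_forall fun z => (integrable_conv (𝓕⁻ m) (Lp.memLp f) z).1)
    (integrable_conv (𝓕⁻ m) (Lp.memLp f) x) hm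
    (.of_forall fun y z hz => norm_sum_coordSmul_le (fun i => 𝓕⁻ (xiSym i m)) hz y (f y))
    ((integrable_maj_mul f x).const_mul _)
    (.of_forall fun y z _ => hasFDerivAt_kernel_smul m y z (f y))
  rw [integral_sum_coordSmul] at h
  exact h

theorem fderiv_conv (m : 𝓢(E d, ℂ)) (f : L2 d V) :
    fderiv ℝ (conv (𝓕⁻ m : 𝓢(E d, ℂ)) f) =
      fun x => ∑ i, coordSmul V i (conv (𝓕⁻ (xiSym i m) : 𝓢(E d, ℂ)) f x) :=
  funext fun x => (hasFDerivAt_conv m f x).fderiv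

theorem contDiff_conv (m : 𝓢(E d, ℂ)) (f : L2 d V) :
    ContDiff ℝ ∞ (conv (𝓕⁻ m : 𝓢(E d, ℂ)) f) := by
  rw [contDiff_infty]
  intro n
  induction n generalizing m with
  | zero =>
    rw [Nat.cast_zero, contDiff_zero]
    exact continuous_iff_continuousAt.2 fun x => (hasFDerivAt_conv m f x).continuousAt
  | succ n ih =>
    rw [Nat.cast_succ, contDiff_succ_iff_fderiv]
    refine ⟨fun x => (hasFDerivAt_conv m f x).differentiableAt, by simp, ?_⟩
    rw [fderiv_conv]
    exact ContDiff.sum fun i _ => (coordSmul V i).contDiff.comp (ih (xiSym i m))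

theorem conv_smul (c : ℂ) (K : 𝓢(E d, ℂ)) (f : E d → V) (x : E d) :
    conv (c • K : 𝓢(E d, ℂ)) f x = c • conv K f x := by
  rw [conv, conv, ← integral_smul]
  simp [smul_smul]

/-- The derivatives of a function with frequencies below `2^k`. -/
theorem exists_norm_iteratedFDeriv_conv_le (V : Type*) [NormedAddCommGroup V] [InnerProductSpace ℂ V]
    [CompleteSpace V] (j : ℕ) (m : 𝓢(E d, ℂ)) :
    ∃ C : ℝ, 0 ≤ C ∧ ∀ (k : ℕ) (f : L2 d V) (x : E d),
      ‖iteratedFDeriv ℝ j (conv (𝓕⁻ (dil k m) : 𝓢(E d, ℂ)) f) x‖ ≤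
        C * (2 ^ k) ^ j * (mconv k (fun y => ‖f y‖ₑ) x).toReal := by
  induction j generalizing m with
  | zero =>
    refine ⟨kerBound (𝓕⁻ m) 0, kerBound_nonneg _ _, fun k f x => ?_⟩
    rw [norm_iteratedFDeriv_zero, pow_zero, mul_one]
    have h := ENNReal.toReal_mono (ENNReal.mul_ne_top ENNReal.ofReal_ne_top (mconv_lt_top k f x).ne)
      (enorm_conv_dil_le k m f x)
    rwa [toReal_enorm, ENNReal.toReal_mul, ENNReal.toReal_ofReal (kerBound_nonneg _ _)] at h
  | succ j ih =>
    choose C hC0 hC using fun i => ih (xiSym i m)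
    refine ⟨∑ i, ‖coordSmul (d := d) V i‖ * C i, Finset.sum_nonneg fun i _ =>
        mul_nonneg (norm_nonneg (coordSmul (d := d) V i)) (hC0 i),
      fun k f x => ?_⟩
    rw [← norm_iteratedFDeriv_fderiv, fderiv_conv]
    have hs : ∀ i, ContDiff ℝ ∞ fun x => coordSmul V i (conv (𝓕⁻ (xiSym i (dil k m)) : 𝓢(E d, ℂ)) f x) :=
      fun i => (coordSmul V i).contDiff.comp (contDiff_conv (xiSym i (dil k m)) f)
    rw [iteratedFDeriv_sum fun i _ => (hs i).of_le (by exact_mod_cast le_top), Finset.sum_apply]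
    refine (norm_sum_le _ _).trans ?_
    rw [Finset.sum_mul, Finset.sum_mul]
    refine Finset.sum_le_sum fun i _ => ?_
    refine ((coordSmul V i).norm_iteratedFDeriv_comp_left (N := ∞)
      (contDiff_conv (xiSym i (dil k m)) f).contDiffAt (by exact_mod_cast le_top)).trans ?_
    rw [mul_assoc, mul_assoc]
    gcongr
    -- Multiplication by 2πiξ_i of a symbol at scale 2^k is 2^k times the dilate of a fixed symbol,
    -- so each derivative costs exactly 2^k.
    have e : conv (𝓕⁻ (xiSym i (dil k m)) : 𝓢(E d, ℂ)) f =
        (2 ^ k : ℂ) • conv (𝓕⁻ (dil k (xiSym i m)) : 𝓢(E d, ℂ)) f := by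
      funext y
      rw [xiSym_dil, FourierTransform.fourierInv_smul, conv_smul]; rfl
    have e2 : (2 ^ k : ℂ) • conv (𝓕⁻ (dil k (xiSym i m)) : 𝓢(E d, ℂ)) f =
        (2 ^ k : ℝ) • conv (𝓕⁻ (dil k (xiSym i m)) : 𝓢(E d, ℂ)) f := by
      funext y
      simp only [Pi.smul_apply]
      rw [← Complex.coe_smul]; push_cast; rfl
    rw [e, e2, iteratedFDeriv_const_smul_apply ((contDiff_conv _ f).contDiffAt.of_le (by exact_mod_cast le_top)),
      norm_smul, Real.norm_of_nonneg (by positivity)]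
    calc _ ≤ 2 ^ k * (C i * (2 ^ k) ^ j * (mconv k (fun y => ‖f y‖ₑ) x).toReal) := by
          gcongr; exact hC i k f x
      _ = _ := by ring

/-! ### Gain of derivatives at high frequencies -/

theorem integrable_conv_bdd (K : 𝓢(E d, ℂ)) {w : E d → V} (hw : Continuous w) {B : ℝ}
    (hB : ∀ y, ‖w y‖ ≤ B) (x : E d) : Integrable fun y => K (x - y) • w y :=
  Integrable.smul_bdd (memLp_one_iff_integrable.1 (memLp_schwartz_shift K x 1)) B
    hw.aestronglyMeasurable (.of_forall hB)

/-- Integration by parts. The kernel is a Schwartz function, so bounded derivatives of w are enough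
and no decay of w is needed. -/
theorem conv_xiSym (i : Fin d) (m : 𝓢(E d, ℂ)) {w : E d → V} (hw : ContDiff ℝ ∞ w)
    (hb : ∀ n, ∃ B : ℝ, ∀ y, ‖iteratedFDeriv ℝ n w y‖ ≤ B) (x : E d) :
    conv (𝓕⁻ (xiSym i m) : 𝓢(E d, ℂ)) w x =
      conv (𝓕⁻ m : 𝓢(E d, ℂ)) (fun y => fderiv ℝ w y (unitVec i)) x := by
  obtain ⟨B₀, hB₀⟩ := hb 0
  obtain ⟨B₁, hB₁⟩ := hb 1
  simp only [norm_iteratedFDeriv_zero, norm_iteratedFDeriv_one] at hB₀ hB₁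
  have hw1 : Continuous fun y => fderiv ℝ w y (unitVec i) :=
    (hw.continuous_fderiv (by simp)).clm_apply continuous_const
  have hb1 : ∀ y, ‖fderiv ℝ w y (unitVec i)‖ ≤ B₁ := fun y =>
    ((fderiv ℝ w y).le_opNorm _).trans (by rw [norm_unitVec, mul_one]; exact hB₁ y)
  have hf : ∀ y, HasFDerivAt (fun y => (𝓕⁻ m : 𝓢(E d, ℂ)) (x - y))
      (-fderiv ℝ (𝓕⁻ m : 𝓢(E d, ℂ)) (x - y)) y := by
    intro y
    have h2 : HasFDerivAt (𝓕⁻ m : 𝓢(E d, ℂ)) (fderiv ℝ (𝓕⁻ m : 𝓢(E d, ℂ)) (x - y)) (x - y) :=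
      ((𝓕⁻ m : 𝓢(E d, ℂ)).differentiableAt).hasFDerivAt
    have h3 := h2.comp y ((hasFDerivAt_id y).const_sub x)
    refine HasFDerivAt.congr_fderiv h3 ?_
    ext w; simp
  have key := integral_bilinear_hasFDerivAt_right_eq_neg_left_of_integrable (μ := volume)
    (B := (ContinuousLinearMap.lsmul ℝ ℂ : ℂ →L[ℝ] V →L[ℝ] V)) (v := unitVec i)
    (f := fun y => (𝓕⁻ m : 𝓢(E d, ℂ)) (x - y)) (f' := fun y => -fderiv ℝ (𝓕⁻ m : 𝓢(E d, ℂ)) (x - y))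
    (g := w) (g' := fderiv ℝ w) ?_ ?_ ?_ (fun y _ => hf y)
    (fun y _ => (hw.differentiable (by simp) y).hasFDerivAt)
  · simp only [ContinuousLinearMap.lsmul_apply, neg_apply, fderiv_kernel,
      neg_smul, integral_neg, neg_neg] at key
    exact key.symm
  · simp only [ContinuousLinearMap.lsmul_apply, neg_apply, fderiv_kernel, neg_smul]
    exact (integrable_conv_bdd _ hw.continuous hB₀ x).neg
  · exact integrable_conv_bdd _ hw1 hb1 x
  · exact integrable_conv_bdd _ hw.continuous hB₀ x

/-- Compactly supported symbols that vanish near zero. -/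
def Annular (m : 𝓢(E d, ℂ)) : Prop :=
  HasCompactSupport m ∧ ∃ ε > 0, ∀ ξ, ‖ξ‖ < ε → m ξ = 0

/-- The identity m(ξ) = ∑ ξ_i · (ξ_i |ξ|^{-2} m(ξ)), in which division by |ξ|² is harmless because m
vanishes near the origin. An annular symbol is thus a divergence of annular symbols, and the
argument can be iterated. -/
theorem Annular.exists_eq_sum {m : 𝓢(E d, ℂ)} (hm : Annular m) :
    ∃ q : Fin d → 𝓢(E d, ℂ), (∀ i, Annular (q i)) ∧ m = ∑ i, xiSym i (q i) := by
  obtain ⟨hc, ε, hε, h0⟩ := hm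
  have hg : ∀ i, ContDiff ℝ ∞ fun ξ : E d => ((ξ i / ‖ξ‖ ^ 2 : ℝ) : ℂ) * ((2 * Real.pi * Complex.I)⁻¹ * m ξ) := by
    intro i
    rw [contDiff_iff_contDiffAt]
    intro ξ
    by_cases hξ : ξ = 0
    · refine (contDiffAt_const (c := (0 : ℂ))).congr_of_eventuallyEq ?_
      rw [hξ]
      filter_upwards [Metric.ball_mem_nhds (0 : E d) hε] with η hη
      rw [h0 η (mem_ball_zero_iff.1 hη)]; simp
    · refine ContDiffAt.mul ?_ (contDiffAt_const.mul m.smooth'.contDiffAt)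
      refine Complex.ofRealCLM.contDiff.contDiffAt.comp ξ (ContDiffAt.div ?_ ?_ ?_)
      · exact (EuclideanSpace.proj i : E d →L[ℝ] ℝ).contDiff.contDiffAt
      · exact (contDiff_norm_sq ℝ).contDiffAt
      · simpa using hξ
  have hs : ∀ i, HasCompactSupport fun ξ : E d =>
      ((ξ i / ‖ξ‖ ^ 2 : ℝ) : ℂ) * ((2 * Real.pi * Complex.I)⁻¹ * m ξ) := fun i =>
    (HasCompactSupport.mul_left (f := fun _ => (2 * Real.pi * Complex.I)⁻¹) hc).mul_left
  refine ⟨fun i => (hs i).toSchwartzMap (hg i), fun i => ⟨hs i, ε, hε, fun ξ hξ => ?_⟩, ?_⟩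
  · change _ * (_ * m ξ) = 0
    rw [h0 ξ hξ]; simp
  · ext ξ
    rw [sum_apply]
    simp only [xiSym_apply]
    change m ξ = ∑ i, 2 * Real.pi * Complex.I * ((ξ i : ℝ) *
      (((ξ i / ‖ξ‖ ^ 2 : ℝ) : ℂ) * ((2 * Real.pi * Complex.I)⁻¹ * m ξ)))
    by_cases hξ : ξ = 0
    · rw [h0 ξ (by rw [hξ, norm_zero]; exact hε)]; simp
    · have h1 : ∑ i, (ξ i : ℂ) * ((ξ i / ‖ξ‖ ^ 2 : ℝ) : ℂ) = 1 := by
        have : ∑ i, ξ i * (ξ i / ‖ξ‖ ^ 2) = 1 := by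
          simp_rw [mul_div_assoc']
          rw [← Finset.sum_div, EuclideanSpace.norm_sq_eq]
          simp_rw [Real.norm_eq_abs, sq_abs, ← sq]
          refine div_self ?_
          have h2 : ∑ i, ξ i ^ 2 = ‖ξ‖ ^ 2 := by
            rw [EuclideanSpace.norm_sq_eq]; simp
          rw [h2]; simpa using hξ
        exact_mod_cast this
      have hpi : (2 * Real.pi * Complex.I : ℂ) ≠ 0 := by
        simp [Real.pi_ne_zero]
      calc m ξ = (∑ i, (ξ i : ℂ) * ((ξ i / ‖ξ‖ ^ 2 : ℝ) : ℂ)) * m ξ := by rw [h1, one_mul]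
        _ = _ := by
          rw [Finset.sum_mul]
          refine Finset.sum_congr rfl fun i _ => ?_
          field_simp

theorem conv_sum {ι : Type*} (s : Finset ι) (K : ι → 𝓢(E d, ℂ)) {w : E d → V} (hw : Continuous w)
    {B : ℝ} (hB : ∀ y, ‖w y‖ ≤ B) (x : E d) :
    conv (∑ i ∈ s, K i : 𝓢(E d, ℂ)) w x = ∑ i ∈ s, conv (K i) w x := by
  simp only [conv]
  rw [← integral_finsetSum _ fun i _ => integrable_conv_bdd (K i) hw hB x]
  simp [Finset.sum_smul]

/-- Each integration by parts moves one derivative onto w and gains 2^{-k}. So a function whose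
derivatives of order N are of size 2^{lN} has a part at frequency 2^k of size 2^{-N(k-l)}. -/
theorem Annular.exists_enorm_conv_le {m : 𝓢(E d, ℂ)} (hm : Annular m) (V : Type*)
    [NormedAddCommGroup V] [InnerProductSpace ℂ V] [CompleteSpace V] (N : ℕ) :
    ∃ C : ℝ≥0∞, C ≠ ⊤ ∧ ∀ (k : ℕ) (w : E d → V), ContDiff ℝ ∞ w →
      (∀ n, ∃ B : ℝ, ∀ y, ‖iteratedFDeriv ℝ n w y‖ ≤ B) → ∀ x,
      ‖conv (𝓕⁻ (dil k m) : 𝓢(E d, ℂ)) w x‖ₑ ≤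
        C * pw (-(k * N)) * mconv k (fun y => ‖iteratedFDeriv ℝ N w y‖ₑ) x := by
  induction N generalizing m with
  | zero =>
    refine ⟨ENNReal.ofReal (kerBound (𝓕⁻ m) 0), ENNReal.ofReal_ne_top, fun k w _ _ x => ?_⟩
    rw [Nat.cast_zero, mul_zero, neg_zero, pw_zero, mul_one]
    refine (enorm_conv_dil_le k m w x).trans (le_of_eq ?_)
    congr 2; funext y
    rw [← ofReal_norm, ← ofReal_norm, norm_iteratedFDeriv_zero]
  | succ N ih =>
    obtain ⟨q, hq, hmq⟩ := hm.exists_eq_sum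
    choose C hCt hC using fun i => ih (hq i)
    refine ⟨∑ i, C i, ENNReal.sum_ne_top.2 fun i _ => hCt i, fun k w hw hb x => ?_⟩
    obtain ⟨B₀, hB₀⟩ := hb 0
    simp only [norm_iteratedFDeriv_zero] at hB₀
    have e1 : dil k m = ∑ i, ((2 ^ k : ℂ)⁻¹) • xiSym i (dil k (q i)) := by
      have h2 : (2 ^ k : ℂ) ≠ 0 := pow_ne_zero _ two_ne_zero
      simp_rw [xiSym_dil, smul_smul, inv_mul_cancel₀ h2, one_smul]
      ext ξ
      rw [dil_apply, hmq, sum_apply, sum_apply]; rfl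
    have e2 : (𝓕⁻ (dil k m) : 𝓢(E d, ℂ)) = ∑ i, ((2 ^ k : ℂ)⁻¹) • (𝓕⁻ (xiSym i (dil k (q i))) : 𝓢(E d, ℂ)) := by
      rw [e1, FourierTransform.fourierInv_sum]
      simp_rw [FourierTransform.fourierInv_smul]
    rw [e2, conv_sum _ _ hw.continuous hB₀, Finset.sum_mul, Finset.sum_mul]
    refine (enorm_sum_le _ _).trans (Finset.sum_le_sum fun i _ => ?_)
    have hfd : ContDiff ℝ ∞ (fderiv ℝ w) := hw.fderiv_right (by simp)
    have hw1 : ContDiff ℝ ∞ fun y => fderiv ℝ w y (unitVec i) := hfd.clm_apply contDiff_const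
    have hd : ∀ n y, ‖iteratedFDeriv ℝ n (fun y => fderiv ℝ w y (unitVec i)) y‖ ≤
        ‖iteratedFDeriv ℝ (n + 1) w y‖ := by
      intro n y
      have := norm_iteratedFDeriv_clm_apply_const (c := unitVec i) (n := n) (hfd.contDiffAt (x := y))
        (by exact_mod_cast le_top)
      rwa [norm_unitVec, one_mul, norm_iteratedFDeriv_fderiv] at this
    have hb1 : ∀ n, ∃ B : ℝ, ∀ y, ‖iteratedFDeriv ℝ n (fun y => fderiv ℝ w y (unitVec i)) y‖ ≤ B :=
      fun n => (hb (n + 1)).imp fun B hB y => (hd n y).trans (hB y)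
    rw [conv_smul, conv_xiSym i _ hw hb, enorm_smul]
    have e3 : ‖(2 ^ k : ℂ)⁻¹‖ₑ = pw (-k) := by
      rw [← ofReal_norm, pw_eq_ofReal, Real.rpow_neg (by norm_num), Real.rpow_natCast]; simp
    rw [e3]
    calc _ ≤ pw (-k) * (C i * pw (-(k * N)) * mconv k (fun y =>
          ‖iteratedFDeriv ℝ N (fun y => fderiv ℝ w y (unitVec i)) y‖ₑ) x) :=
          mul_le_mul_right (hC i k _ hw1 hb1 x) _
      _ ≤ pw (-k) * (C i * pw (-(k * N)) * mconv k (fun y => ‖iteratedFDeriv ℝ (N + 1) w y‖ₑ) x) := by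
          refine mul_le_mul_right (mul_le_mul_right (mconv_mono k (.of_forall fun y => ?_) x) _) _
          rw [← ofReal_norm, ← ofReal_norm]
          exact ENNReal.ofReal_le_ofReal (hd N y)
      _ = _ := by
          rw [show (-(k * (N + 1 : ℕ)) : ℝ) = -k + -(k * N) by push_cast; ring, pw_add]; ring

theorem Decomposition.annular_ann (P : Decomposition d) : Annular P.ann := by
  refine ⟨?_, 1 / 2, by norm_num, fun ξ hξ => ?_⟩
  · refine HasCompactSupport.of_support_subset_isCompact (isCompact_closedBall (0 : E d) 2) fun ξ hξ => ?_
    rw [mem_closedBall_zero_iff]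
    by_contra hcon
    refine hξ ?_
    rw [P.ann_apply, P.phi_zero _ (not_le.1 hcon).le, P.phi_zero _ (by linarith [not_le.1 hcon])]
    simp
  · rw [P.ann_apply, P.phi_one _ (norm_nonneg _) (by linarith), P.phi_one _ (by positivity) (by linarith)]
    simp

end LocalEnergy

end

noncomputable section

namespace LocalEnergy

open scoped SchwartzMap

variable {d : ℕ} {V : Type*} [NormedAddCommGroup V] [InnerProductSpace ℂ V] [CompleteSpace V]

open LNorm

/-! ### Smooth functions with bounded derivatives -/

section BddSmooth

universe u

variable {X : Type*} {V W : Type u} [NormedAddCommGroup X] [NormedSpace ℝ X] [NormedAddCommGroup V]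
  [NormedSpace ℝ V] [NormedAddCommGroup W] [NormedSpace ℝ W]

/-- Smooth functions all of whose derivatives are bounded. -/
structure BddSmooth (Γ : V → W) : Prop where
  smooth : ContDiff ℝ ∞ Γ
  bdd : ∀ n : ℕ, ∃ C : ℝ, ∀ v, ‖iteratedFDeriv ℝ n Γ v‖ ≤ C

variable {Γ : V → W}

theorem BddSmooth.exists_bound (h : BddSmooth Γ) (n : ℕ) :
    ∃ C : ℝ, 0 ≤ C ∧ ∀ i ≤ n, ∀ v, ‖iteratedFDeriv ℝ i Γ v‖ ≤ C := by
  choose C hC using h.bdd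
  refine ⟨∑ i ∈ Finset.range (n + 1), |C i|, Finset.sum_nonneg fun i _ => abs_nonneg _,
    fun i hi v => ((hC i v).trans (le_abs_self _)).trans ?_⟩
  exact Finset.single_le_sum (f := fun i => |C i|) (fun i _ => abs_nonneg _)
    (Finset.mem_range.2 (by omega))

theorem BddSmooth.fderiv (h : BddSmooth Γ) : BddSmooth (fderiv ℝ Γ) :=
  ⟨h.smooth.fderiv_right (by simp), fun n => (h.bdd (n + 1)).imp fun C hC v => by
    rw [norm_iteratedFDeriv_fderiv]; exact hC v⟩

theorem BddSmooth.exists_norm_sub_le (h : BddSmooth Γ) :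
    ∃ C : ℝ≥0, ∀ v w, ‖Γ v - Γ w‖ ≤ C * ‖v - w‖ := by
  obtain ⟨C, hC⟩ := h.bdd 1
  refine ⟨C.toNNReal, fun v w => ?_⟩
  refine Convex.norm_image_sub_le_of_norm_fderiv_le (𝕜 := ℝ) (s := Set.univ)
    (fun x _ => h.smooth.differentiable (by simp) x) (fun x _ => ?_) convex_univ (Set.mem_univ _)
    (Set.mem_univ _)
  rw [← norm_iteratedFDeriv_one]
  exact (hC x).trans (Real.le_coe_toNNReal C)

theorem BddSmooth.exists_norm_taylor_le (h : BddSmooth Γ) :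
    ∃ C : ℝ≥0, ∀ v w, ‖Γ (v + w) - Γ v - _root_.fderiv ℝ Γ v w‖ ≤ C * (‖w‖ * ‖w‖) := by
  obtain ⟨C, hC⟩ := h.fderiv.exists_norm_sub_le
  refine ⟨C, fun v w => ?_⟩
  have := Convex.norm_image_sub_le_of_norm_fderiv_le' (𝕜 := ℝ) (f := Γ) (C := C * ‖w‖)
    (s := Metric.closedBall v ‖w‖) (x := v) (y := v + w) (φ := _root_.fderiv ℝ Γ v)
    (fun x _ => h.smooth.differentiable (by simp) x) (fun x hx => ?_)
    (convex_closedBall v ‖w‖) (Metric.mem_closedBall_self (norm_nonneg _)) (by simp)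
  · rw [add_sub_cancel_left] at this
    linarith
  · refine (hC x v).trans ?_
    rw [Metric.mem_closedBall, dist_eq_norm] at hx
    gcongr

theorem BddSmooth.exists_lipschitz (h : BddSmooth Γ) : ∃ C : ℝ≥0, LipschitzWith C Γ := by
  obtain ⟨C, hC⟩ := h.exists_norm_sub_le
  exact ⟨C, LipschitzWith.of_dist_le_mul fun v w => by rw [dist_eq_norm, dist_eq_norm]; exact hC v w⟩

theorem BddSmooth.exists_norm_iteratedFDeriv_comp_le (h : BddSmooth Γ) {A : ℕ → ℝ}
    (hA : ∀ j, 0 ≤ A j) (n : ℕ) :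
    ∃ C : ℝ, 0 ≤ C ∧ ∀ r : ℝ, 1 ≤ r → ∀ p : X → V, ContDiff ℝ ∞ p →
      (∀ j x, ‖iteratedFDeriv ℝ j p x‖ ≤ A j * r ^ j) → ∀ x,
      ‖iteratedFDeriv ℝ n (fun x => Γ (p x)) x‖ ≤ C * r ^ n := by
  obtain ⟨C, hC0, hC⟩ := h.exists_bound n
  set D := 1 + ∑ j ∈ Finset.range (n + 1), A j with hD
  have hD1 : 1 ≤ D := by
    have : 0 ≤ ∑ j ∈ Finset.range (n + 1), A j := Finset.sum_nonneg fun j _ => hA j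
    linarith
  refine ⟨n.factorial * C * D ^ n, by positivity, fun r hr p hp hb x => ?_⟩
  have := norm_iteratedFDeriv_comp_le (n := n) (D := D * r) h.smooth hp (by exact_mod_cast le_top) x
    (fun i hi => hC i hi (p x)) (fun i hi1 hi => ?_)
  · rw [mul_pow, ← mul_assoc] at this
    exact this
  · refine (hb i x).trans ?_
    rw [mul_pow]
    refine mul_le_mul_of_nonneg_right ?_ (by positivity)
    calc A i ≤ ∑ j ∈ Finset.range (n + 1), A j :=
          Finset.single_le_sum (fun j _ => hA j) (Finset.mem_range.2 (by omega))
      _ ≤ D := by linarith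
      _ ≤ D ^ i := le_self_pow₀ hD1 (by omega)

theorem norm_iteratedFDeriv_compL_le {a : X → V →L[ℝ] W} {b : X → X →L[ℝ] V}
    (ha : ContDiff ℝ ∞ a) (hb : ContDiff ℝ ∞ b) (n : ℕ) (x : X) {r Q : ℝ} {α β : ℕ → ℝ}
    (h : ∀ i ≤ n, ‖iteratedFDeriv ℝ i a x‖ * ‖iteratedFDeriv ℝ (n - i) b x‖ ≤
      α i * r ^ i * (β (n - i) * r ^ (n - i + 1)) * Q) :
    ‖iteratedFDeriv ℝ n (fun y => (a y).comp (b y)) x‖ ≤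
      (∑ i ∈ Finset.range (n + 1), n.choose i * α i * β (n - i)) * r ^ (n + 1) * Q := by
  have h1 := (ContinuousLinearMap.compL ℝ X V W).norm_iteratedFDeriv_le_of_bilinear_of_le_one
    ha hb x (n := n) (by exact_mod_cast le_top) (ContinuousLinearMap.norm_compL_le ℝ X V W)
  refine h1.trans ?_
  rw [Finset.sum_mul, Finset.sum_mul]
  refine Finset.sum_le_sum fun i hi => ?_
  have hi' : i ≤ n := by have := Finset.mem_range.1 hi; omega
  calc _ = n.choose i * (‖iteratedFDeriv ℝ i a x‖ * ‖iteratedFDeriv ℝ (n - i) b x‖) := by ring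
    _ ≤ n.choose i * (α i * r ^ i * (β (n - i) * r ^ (n - i + 1)) * Q) :=
        mul_le_mul_of_nonneg_left (h i hi') (by positivity)
    _ = _ := by
        rw [show n + 1 = i + (n - i + 1) by omega, pow_add]
        ring

/-- The derivatives of the increments of a superposition. -/
theorem BddSmooth.exists_norm_iteratedFDeriv_sub_le (h : BddSmooth Γ) {A : ℕ → ℝ}
    (hA : ∀ j, 0 ≤ A j) {R : ℝ} (hR : 0 ≤ R) (n : ℕ) :
    ∃ C : ℝ, 0 ≤ C ∧ ∀ r : ℝ, 1 ≤ r → ∀ (p q : X → V) (Q : X → ℝ), ContDiff ℝ ∞ p →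
      ContDiff ℝ ∞ q → (∀ x, 0 ≤ Q x) → (∀ x, Q x ≤ R) →
      (∀ j x, ‖iteratedFDeriv ℝ j p x‖ ≤ A j * r ^ j) →
      (∀ j x, ‖iteratedFDeriv ℝ j q x‖ ≤ A j * r ^ j * Q x) → ∀ x,
      ‖iteratedFDeriv ℝ n (fun x => Γ (p x + q x) - Γ (p x)) x‖ ≤ C * r ^ n * Q x := by
  -- The derivative of Γ(p+q) - Γ(p) is (DΓ(p+q) - DΓ(p))∘Dp + DΓ(p+q)∘Dq. The first factor is an
  -- increment of the same kind for DΓ, so the target must vary in the induction; V and W share a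
  -- universe for this reason. Every term retains one factor Q.
  induction n using Nat.strong_induction_on generalizing W with
  | _ n ih =>
  rcases n with _ | n
  · obtain ⟨C, hC⟩ := h.exists_norm_sub_le
    refine ⟨C * A 0, mul_nonneg C.2 (hA 0), fun r hr p q Q hp hq hQ0 hQ hpb hqb x => ?_⟩
    have h1 := hqb 0 x
    rw [norm_iteratedFDeriv_zero] at h1 ⊢
    have h2 := hC (p x + q x) (p x)
    rw [add_sub_cancel_left] at h2
    calc _ ≤ C * ‖q x‖ := h2
      _ ≤ C * (A 0 * r ^ 0 * Q x) := mul_le_mul_of_nonneg_left h1 C.2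
      _ = _ := by ring
  have hI : ∀ i, ∃ C : ℝ, 0 ≤ C ∧ (i ≤ n → ∀ r : ℝ, 1 ≤ r → ∀ (p q : X → V) (Q : X → ℝ),
      ContDiff ℝ ∞ p → ContDiff ℝ ∞ q → (∀ x, 0 ≤ Q x) → (∀ x, Q x ≤ R) →
      (∀ j x, ‖iteratedFDeriv ℝ j p x‖ ≤ A j * r ^ j) →
      (∀ j x, ‖iteratedFDeriv ℝ j q x‖ ≤ A j * r ^ j * Q x) → ∀ x,
      ‖iteratedFDeriv ℝ i (fun x => _root_.fderiv ℝ Γ (p x + q x) - _root_.fderiv ℝ Γ (p x)) x‖ ≤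
        C * r ^ i * Q x) := by
    intro i
    by_cases hi : i ≤ n
    · obtain ⟨C, hC0, hC⟩ := ih i (by omega) h.fderiv
      exact ⟨C, hC0, fun _ => hC⟩
    · exact ⟨0, le_rfl, fun h => absurd h hi⟩
  choose α hα0 hα using hI
  choose α' hα'0 hα' using fun i => h.fderiv.exists_norm_iteratedFDeriv_comp_le (X := X)
    (A := fun j => A j * (1 + R)) (fun j => mul_nonneg (hA j) (by linarith)) i
  refine ⟨(∑ i ∈ Finset.range (n + 1), n.choose i * α i * A (n - i + 1)) +
    ∑ i ∈ Finset.range (n + 1), n.choose i * α' i * A (n - i + 1), ?_, ?_⟩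
  · refine add_nonneg (Finset.sum_nonneg fun i _ => ?_) (Finset.sum_nonneg fun i _ => ?_)
    · exact mul_nonneg (mul_nonneg (by positivity) (hα0 i)) (hA _)
    · exact mul_nonneg (mul_nonneg (by positivity) (hα'0 i)) (hA _)
  intro r hr p q Q hp hq hQ0 hQ hpb hqb x
  have hΓ' := h.fderiv.smooth
  have hpq : ContDiff ℝ ∞ fun x => p x + q x := hp.add hq
  have hp' : ContDiff ℝ ∞ (_root_.fderiv ℝ p) := hp.fderiv_right (by simp)
  have hq' : ContDiff ℝ ∞ (_root_.fderiv ℝ q) := hq.fderiv_right (by simp)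
  have hb1 : ContDiff ℝ ∞ fun x => _root_.fderiv ℝ Γ (p x + q x) := hΓ'.comp hpq
  have hb2 : ContDiff ℝ ∞ fun x => _root_.fderiv ℝ Γ (p x) := hΓ'.comp hp
  have hpqb : ∀ j x, ‖iteratedFDeriv ℝ j (fun x => p x + q x) x‖ ≤ A j * (1 + R) * r ^ j := by
    intro j x
    have e : iteratedFDeriv ℝ j (fun x => p x + q x) x =
        iteratedFDeriv ℝ j p x + iteratedFDeriv ℝ j q x :=
      iteratedFDeriv_add_apply (hp.contDiffAt.of_le (by exact_mod_cast le_top))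
        (hq.contDiffAt.of_le (by exact_mod_cast le_top))
    rw [e]
    have hc : 0 ≤ A j * r ^ j := mul_nonneg (hA j) (by positivity)
    calc _ ≤ A j * r ^ j + A j * r ^ j * Q x := (norm_add_le _ _).trans (add_le_add (hpb j x) (hqb j x))
      _ ≤ A j * r ^ j + A j * r ^ j * R := by gcongr; exact hQ x
      _ = _ := by ring
  have hfd : _root_.fderiv ℝ (fun x => Γ (p x + q x) - Γ (p x)) = fun x =>
      (_root_.fderiv ℝ Γ (p x + q x) - _root_.fderiv ℝ Γ (p x)).comp (_root_.fderiv ℝ p x) +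
        (_root_.fderiv ℝ Γ (p x + q x)).comp (_root_.fderiv ℝ q x) := by
    funext y
    have d1 : HasFDerivAt p (_root_.fderiv ℝ p y) y := (hp.differentiable (by simp) y).hasFDerivAt
    have d2 : HasFDerivAt q (_root_.fderiv ℝ q y) y := (hq.differentiable (by simp) y).hasFDerivAt
    have d3 : ∀ z, HasFDerivAt Γ (_root_.fderiv ℝ Γ z) z := fun z =>
      (h.smooth.differentiable (by simp) z).hasFDerivAt
    have d4 := ((d3 (p y + q y)).comp y (d1.add d2)).sub ((d3 (p y)).comp y d1)
    refine d4.fderiv.trans ?_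
    rw [ContinuousLinearMap.comp_add, ContinuousLinearMap.sub_comp]
    abel
  rw [← norm_iteratedFDeriv_fderiv, hfd]
  have hc1 : ContDiff ℝ ∞ fun x =>
      (_root_.fderiv ℝ Γ (p x + q x) - _root_.fderiv ℝ Γ (p x)).comp (_root_.fderiv ℝ p x) :=
    (hb1.sub hb2).clm_comp hp'
  have hc2 : ContDiff ℝ ∞ fun x => (_root_.fderiv ℝ Γ (p x + q x)).comp (_root_.fderiv ℝ q x) :=
    hb1.clm_comp hq'
  have e2 := iteratedFDeriv_add_apply (i := n) (x := x)
    (hc1.contDiffAt.of_le (by exact_mod_cast le_top)) (hc2.contDiffAt.of_le (by exact_mod_cast le_top))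
  have e3 := (congrArg norm e2).trans_le (norm_add_le _ _)
  refine (le_of_eq rfl).trans (e3.trans ?_)
  rw [add_mul, add_mul]
  refine add_le_add ?_ ?_
  · refine norm_iteratedFDeriv_compL_le (hb1.sub hb2) hp' n x
      (β := fun j => A (j + 1)) fun i hi => ?_
    rw [norm_iteratedFDeriv_fderiv]
    calc _ ≤ (α i * r ^ i * Q x) * (A (n - i + 1) * r ^ (n - i + 1)) :=
          mul_le_mul (hα i hi r hr p q Q hp hq hQ0 hQ hpb hqb x) (hpb _ x) (norm_nonneg _)
            (mul_nonneg (mul_nonneg (hα0 i) (by positivity)) (hQ0 x))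
      _ = _ := by ring
  · refine norm_iteratedFDeriv_compL_le hb1 hq' n x
      (β := fun j => A (j + 1)) fun i hi => ?_
    rw [norm_iteratedFDeriv_fderiv]
    calc _ ≤ (α' i * r ^ i) * (A (n - i + 1) * r ^ (n - i + 1) * Q x) :=
          mul_le_mul (hα' i r hr _ hpq hpqb x) (hqb _ x) (norm_nonneg _)
            (mul_nonneg (hα'0 i) (by positivity))
      _ = _ := by ring

end BddSmooth

end LocalEnergy

end

noncomputable section

namespace LocalEnergy

open scoped SchwartzMap

variable {d : ℕ} {V : Type*} [NormedAddCommGroup V] [InnerProductSpace ℂ V] [CompleteSpace V]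

open LNorm

/-! ### Superposition operators -/

section Superposition

universe u

variable {V W : Type u} [NormedAddCommGroup V] [InnerProductSpace ℂ V] [CompleteSpace V]
  [NormedAddCommGroup W] [InnerProductSpace ℂ W] [CompleteSpace W] {Γ : V → W}

theorem comp_eq_compLp {c : ℝ≥0} (hΓ : LipschitzWith c Γ) (h0 : Γ 0 = 0) (u : ℝ → L2 d V) (t : ℝ) :
    comp Γ u t = hΓ.compLp h0 (u t) := by
  exact (ofFun_congr (hΓ.coeFn_compLp h0 (u t)).symm).trans (ofFun_coeFn _)

theorem BddSmooth.comp_ae (hΓ : BddSmooth Γ) (h0 : Γ 0 = 0) (u : ℝ → L2 d V) (t : ℝ) :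
    comp Γ u t =ᵐ[volume] fun x => Γ (u t x) := by
  obtain ⟨c, hc⟩ := hΓ.exists_lipschitz
  rw [comp_eq_compLp hc h0]
  exact hc.coeFn_compLp h0 (u t)

theorem BddSmooth.aesm_comp (hΓ : BddSmooth Γ) (h0 : Γ 0 = 0) {u : ℝ → L2 d V}
    (hu : AEStronglyMeasurable u timeMeasure) : AEStronglyMeasurable (comp Γ u) timeMeasure := by
  obtain ⟨c, hc⟩ := hΓ.exists_lipschitz
  rw [show comp Γ u = fun t => hc.compLp h0 (u t) from funext (comp_eq_compLp hc h0 u)]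
  exact (hc.continuous_compLp h0).comp_aestronglyMeasurable hu

theorem BddSmooth.tendsto_comp (hΓ : BddSmooth Γ) (h0 : Γ 0 = 0) {u : ℝ → L2 d V}
    {p : ℕ → ℝ → L2 d V} {t : ℝ} (h : Filter.Tendsto (fun N => p N t) Filter.atTop (nhds (u t))) :
    Filter.Tendsto (fun N => comp Γ (p N) t) Filter.atTop (nhds (comp Γ u t)) := by
  obtain ⟨c, hc⟩ := hΓ.exists_lipschitz
  simp_rw [comp_eq_compLp hc h0]
  exact ((hc.continuous_compLp h0).tendsto _).comp h

theorem mconv_le_of_le (k : ℕ) {f : E d → ℝ≥0∞} {a : ℝ≥0∞} (h : ∀ᵐ y, f y ≤ a) (x : E d) :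
    mconv k f x ≤ coreMass d * a := by
  have h1 : ∀ y : E d, maj k y ≤ core k y := fun y => by
    refine (maj_le_core k y).trans (mul_le_of_le_one_left (core_nonneg k y) ?_)
    exact inv_le_one_of_one_le₀ (one_le_pow₀ (by linarith [norm_nonneg y]))
  rw [← lintegral_core_sub_left k x, ← lintegral_mul_const'' _ ?_]
  · refine lintegral_mono_ae (h.mono fun y hy => ?_)
    exact mul_le_mul' (ENNReal.ofReal_le_ofReal (h1 _)) hy
  · have : Continuous (core k : E d → ℝ) := by
      unfold core
      exact continuous_const.mul (Continuous.inv₀ (by fun_prop) fun x => by positivity)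
    exact ((this.comp (continuous_const.sub continuous_id)).measurable.ennreal_ofReal).aemeasurable

namespace Decomposition

variable (P : Decomposition d)

/-- The increment `Γ(S_{<l+1} u) - Γ(S_{<l} u)`. -/
def incr (Γ : V → W) (u : ℝ → L2 d V) (l : ℕ) : ℝ → L2 d W :=
  fun t => comp Γ (P.SLt (l + 1) u) t - comp Γ (P.SLt l u) t

theorem aesm_incr (hΓ : BddSmooth Γ) (h0 : Γ 0 = 0) {u : ℝ → L2 d V}
    (hu : AEStronglyMeasurable u timeMeasure) (l : ℕ) :
    AEStronglyMeasurable (P.incr Γ u l) timeMeasure :=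
  (hΓ.aesm_comp h0 (P.aesm_SLt hu _)).sub (hΓ.aesm_comp h0 (P.aesm_SLt hu _))

/-- The smooth representative of `S_{<l} u(t)`. -/
def lowFun (u : ℝ → L2 d V) (t : ℝ) (l : ℕ) : E d → V :=
  if l = 0 then 0 else conv (𝓕⁻ (P.low (l - 1)) : 𝓢(E d, ℂ)) (u t)

/-- The smooth representative of `S_l u(t)`. -/
def pieceFun (u : ℝ → L2 d V) (t : ℝ) (l : ℕ) : E d → V :=
  conv (𝓕⁻ (dil l (dil 1 P.base)) : 𝓢(E d, ℂ)) (P.S l u t)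

theorem SLt_ae (u : ℝ → L2 d V) (t : ℝ) (l : ℕ) : P.SLt l u t =ᵐ[volume] P.lowFun u t l := by
  rcases l with _ | l
  · rw [SLt_apply, lowFun, if_pos rfl, Finset.sum_range_zero]
    exact Lp.coeFn_zero _ _ _
  · rw [SLt_succ_apply, lowFun, if_neg l.succ_ne_zero]
    exact fourierMul_ae_eq_conv _ _

theorem S_ae (u : ℝ → L2 d V) (t : ℝ) (l : ℕ) : P.S l u t =ᵐ[volume] P.pieceFun u t l := by
  conv_lhs => rw [← P.low_S l.lt_succ_self u t]
  rw [pieceFun, dil_dil]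
  exact fourierMul_ae_eq_conv _ _

theorem SLt_succ_ae (u : ℝ → L2 d V) (t : ℝ) (l : ℕ) :
    P.SLt (l + 1) u t =ᵐ[volume] fun x => P.SLt l u t x + P.S l u t x := by
  rw [SLt_apply, Finset.sum_range_succ, ← SLt_apply]
  exact Lp.coeFn_add _ _

theorem contDiff_lowFun (u : ℝ → L2 d V) (t : ℝ) (l : ℕ) : ContDiff ℝ ∞ (P.lowFun u t l) := by
  unfold lowFun
  split_ifs
  · exact contDiff_const
  · exact contDiff_conv _ _

/-- The majorant of `S_l u(t)`. -/
def pieceMaj (u : ℝ → L2 d V) (t : ℝ) (l : ℕ) (x : E d) : ℝ :=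
  (mconv l (fun y => ‖P.S l u t y‖ₑ) x).toReal

/-- The derivatives of order j of S_{<l}u and S_l u cost 2^{lj}, with constants that depend on u
only through the bound R for |u|. Those of S_l u keep its majorant as a factor, so that increments
remain linear in S_l u. -/
theorem exists_lowFun_le (V : Type u) [NormedAddCommGroup V] [InnerProductSpace ℂ V]
    [CompleteSpace V] (R : ℝ≥0) :
    ∃ (A : ℕ → ℝ) (R' : ℝ), (∀ j, 0 ≤ A j) ∧ 0 ≤ R' ∧ ∀ (u : ℝ → L2 d V) (t : ℝ),
      (∀ᵐ x, ‖u t x‖ₑ ≤ R) → ∀ l : ℕ,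
      (∀ j x, ‖iteratedFDeriv ℝ j (P.lowFun u t l) x‖ ≤ A j * (2 ^ l) ^ j) ∧
      (∀ j x, ‖iteratedFDeriv ℝ j (P.pieceFun u t l) x‖ ≤ A j * (2 ^ l) ^ j * P.pieceMaj u t l x) ∧
      ∀ x, P.pieceMaj u t l x ≤ R' := by
  choose C₁ hC₁0 hC₁ using fun j => exists_norm_iteratedFDeriv_conv_le V j P.base
  choose C₂ hC₂0 hC₂ using fun j => exists_norm_iteratedFDeriv_conv_le V j (dil 1 P.base)
  have hcm := coreMass_ne_top (d := d)
  have hM : ∀ (k : ℕ) (f : L2 d V) (a : ℝ≥0∞), a ≠ ⊤ → (∀ᵐ y, ‖f y‖ₑ ≤ a) → ∀ x,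
      (mconv k (fun y => ‖f y‖ₑ) x).toReal ≤ (coreMass d * a).toReal := fun k f a ha h x =>
    ENNReal.toReal_mono (by finiteness) (mconv_le_of_le k h x)
  set b₁ := (coreMass d * R).toReal
  set b₂ := (coreMass d * (P.kerC * (coreMass d * R))).toReal
  have hb₁ : 0 ≤ b₁ := ENNReal.toReal_nonneg
  refine ⟨fun j => C₁ j * b₁ + C₂ j, b₂, fun j => add_nonneg (mul_nonneg (hC₁0 j) hb₁) (hC₂0 j),
    ENNReal.toReal_nonneg, fun u t hu l => ⟨fun j x => ?_, fun j x => ?_, fun x => ?_⟩⟩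
  · rcases l with _ | l
    · have : iteratedFDeriv ℝ j (P.lowFun u t 0) x = 0 := by
        rw [lowFun, if_pos rfl]
        simp
      rw [this, norm_zero]
      exact mul_nonneg (add_nonneg (mul_nonneg (hC₁0 j) hb₁) (hC₂0 j)) (by positivity)
    · rw [lowFun, if_neg l.succ_ne_zero, Nat.add_sub_cancel, low]
      refine (hC₁ j l (u t) x).trans ?_
      calc _ ≤ C₁ j * (2 ^ l) ^ j * b₁ := mul_le_mul_of_nonneg_left
            (hM l (u t) R ENNReal.coe_ne_top hu x) (mul_nonneg (hC₁0 j) (by positivity))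
        _ ≤ C₁ j * (2 ^ (l + 1)) ^ j * b₁ := by
            have := hC₁0 j
            gcongr
            · norm_num
            · omega
        _ ≤ (C₁ j * b₁ + C₂ j) * (2 ^ (l + 1)) ^ j := by
            have := mul_nonneg (hC₂0 j) (show (0 : ℝ) ≤ (2 ^ (l + 1)) ^ j by positivity)
            linarith
  · refine (hC₂ j l (P.S l u t) x).trans ?_
    refine mul_le_mul_of_nonneg_right (mul_le_mul_of_nonneg_right ?_ (by positivity))
      ENNReal.toReal_nonneg
    linarith [mul_nonneg (hC₁0 j) hb₁]
  · refine hM l (P.S l u t) _ (by finiteness) ?_ x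
    filter_upwards [P.enorm_S_le l u t] with y hy
    exact hy.trans (mul_le_mul_right (mconv_le_of_le l hu y) _)

/-- The N-th derivative of the increment is of size 2^{lN} times the majorant of S_l u, and N
integrations by parts against the annular symbol of S_j divide by 2^{jN}. The symbol of S_0 is not
annular, but for j = 0 the asserted factor 2^{Nl} is at least one and the trivial bound suffices. -/
theorem exists_enorm_S_incr_le (hΓ : BddSmooth Γ) (h0 : Γ 0 = 0) (R : ℝ≥0) (N : ℕ) :
    ∃ K : ℝ≥0∞, K ≠ ⊤ ∧ ∀ (u : ℝ → L2 d V) (t : ℝ), (∀ᵐ x, ‖u t x‖ₑ ≤ R) → ∀ j l : ℕ,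
      ∀ᵐ x, ‖P.S j (P.incr Γ u l) t x‖ₑ ≤
        K * pw (-(N * ((j : ℝ) - l))) * mconv j (mconv l fun y => ‖P.S l u t y‖ₑ) x := by
  obtain ⟨A, R', hA, hR', hb⟩ := P.exists_lowFun_le V R
  choose C hC0 hC using fun n => hΓ.exists_norm_iteratedFDeriv_sub_le (X := E d) hA hR' n
  obtain ⟨K₁, hK₁t, hK₁⟩ := P.annular_ann.exists_enorm_conv_le W N
  refine ⟨K₁ * ENNReal.ofReal (C N) + ENNReal.ofReal (kerBound (𝓕⁻ P.base) 0) * ENNReal.ofReal (C 0),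
    by finiteness, fun u t hu j l => ?_⟩
  obtain ⟨h1, h2, h3⟩ := hb u t hu l
  have hmt := fun x => (mconv_lt_top l (P.S l u t) x).ne
  set w : E d → W := fun x => Γ (P.lowFun u t l x + P.pieceFun u t l x) - Γ (P.lowFun u t l x)
  have hcp := P.contDiff_lowFun u t l
  have hcq : ContDiff ℝ ∞ (P.pieceFun u t l) := contDiff_conv _ _
  have hcw : ContDiff ℝ ∞ w := (hΓ.smooth.comp (hcp.add hcq)).sub (hΓ.smooth.comp hcp)
  have hQ0 : ∀ x, 0 ≤ P.pieceMaj u t l x := fun x => ENNReal.toReal_nonneg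
  have hw : ∀ n x, ‖iteratedFDeriv ℝ n w x‖ ≤ C n * (2 ^ l) ^ n * P.pieceMaj u t l x := fun n x =>
    hC n (2 ^ l) (one_le_pow₀ (by norm_num)) _ _ _ hcp hcq hQ0 h3 h1 h2 x
  have hwe : ∀ n x, ‖iteratedFDeriv ℝ n w x‖ₑ ≤
      ENNReal.ofReal (C n) * pw (l * n) * mconv l (fun y => ‖P.S l u t y‖ₑ) x := by
    intro n x
    rw [← ofReal_norm]
    refine (ENNReal.ofReal_le_ofReal (hw n x)).trans (le_of_eq ?_)
    rw [ENNReal.ofReal_mul (mul_nonneg (hC0 n) (by positivity)), ENNReal.ofReal_mul (hC0 n), pieceMaj,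
      ENNReal.ofReal_toReal (hmt x), pw_eq_ofReal, Real.rpow_mul (by norm_num), Real.rpow_natCast,
      Real.rpow_natCast]
  have hinc : P.incr Γ u l t =ᵐ[volume] w := by
    filter_upwards [Lp.coeFn_sub (comp Γ (P.SLt (l + 1) u) t) (comp Γ (P.SLt l u) t),
      hΓ.comp_ae h0 (P.SLt (l + 1) u) t, hΓ.comp_ae h0 (P.SLt l u) t, P.SLt_succ_ae u t l,
      P.SLt_ae u t l, P.S_ae u t l] with x e1 e2 e3 e4 e5 e6
    change (comp Γ (P.SLt (l + 1) u) t - comp Γ (P.SLt l u) t) x = _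
    rw [e1, Pi.sub_apply, e2, e3, e4, e5, e6]
  have hmc : ∀ n (x : E d), mconv j (fun y => ‖iteratedFDeriv ℝ n w y‖ₑ) x ≤
      ENNReal.ofReal (C n) * pw (l * n) * mconv j (mconv l fun y => ‖P.S l u t y‖ₑ) x := by
    intro n x
    have hf := pw_ne_top (l * n)
    refine (mconv_mono j (.of_forall (hwe n)) x).trans (le_of_eq ?_)
    rw [mconv, mconv, ← lintegral_const_mul' _ _ (by finiteness)]
    exact lintegral_congr fun y => by ring
  filter_upwards [fourierMul_ae_eq_conv (P.sym j) (P.incr Γ u l t)] with x hx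
  rw [S_apply, hx, conv_congr _ hinc, sym]
  set M := mconv j (mconv l fun y => ‖P.S l u t y‖ₑ) x
  by_cases hj : j = 0
  · rw [if_pos hj]
    refine (enorm_conv_dil_le j P.base w x).trans ?_
    have e : (fun y => ‖w y‖ₑ) = fun y => ‖iteratedFDeriv ℝ 0 w y‖ₑ := by
      funext y
      rw [← ofReal_norm, ← ofReal_norm, norm_iteratedFDeriv_zero]
    have h4 := hmc 0 x
    rw [Nat.cast_zero, mul_zero, pw_zero, mul_one] at h4
    have h5 : 1 ≤ pw (-(N * ((j : ℝ) - l))) := by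
      rw [← pw_zero]
      refine pw_mono ?_
      rw [hj, Nat.cast_zero, zero_sub, mul_neg, neg_neg]
      positivity
    rw [e]
    calc _ ≤ ENNReal.ofReal (kerBound (𝓕⁻ P.base) 0) * (ENNReal.ofReal (C 0) * M) :=
          mul_le_mul_right h4 _
      _ = ENNReal.ofReal (kerBound (𝓕⁻ P.base) 0) * ENNReal.ofReal (C 0) * 1 * M := by ring
      _ ≤ _ := mul_le_mul_left (mul_le_mul' le_add_self h5) _
  · rw [if_neg hj]
    refine (hK₁ j w hcw (fun n => ⟨C n * (2 ^ l) ^ n * R', fun y => (hw n y).trans ?_⟩) x).trans ?_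
    · exact mul_le_mul_of_nonneg_left (h3 y) (mul_nonneg (hC0 n) (by positivity))
    · calc _ ≤ K₁ * pw (-(j * N)) * (ENNReal.ofReal (C N) * pw (l * N) * M) :=
            mul_le_mul_right (hmc N x) _
        _ = K₁ * ENNReal.ofReal (C N) * pw (-(N * ((j : ℝ) - l))) * M := by
            rw [show -(N * ((j : ℝ) - l)) = -(j * N) + l * N by ring, pw_add]; ring
        _ ≤ _ := mul_le_mul_left (mul_le_mul_left le_self_add _) _

/-- The frequency localization of the increments of a superposition. -/
theorem exists_norm_S_incr_le (hΓ : BddSmooth Γ) (h0 : Γ 0 = 0) (R : ℝ≥0) (N : ℕ) :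
    ∃ K : ℝ≥0∞, K ≠ ⊤ ∧ ∀ (u : ℝ → L2 d V), AEStronglyMeasurable u timeMeasure →
      (∀ᵐ t ∂timeMeasure, ∀ᵐ x, ‖u t x‖ₑ ≤ R) → ∀ (𝒩 : LNorm d) (j l : ℕ),
      𝒩 (prof (P.S j (P.incr Γ u l))) ≤
        K * 𝒩.c ^ 2 * (pw (-(N * ((j : ℝ) - l))) * 𝒩 (prof (P.S l u))) := by
  obtain ⟨K, hKt, hK⟩ := P.exists_enorm_S_incr_le hΓ h0 R N
  refine ⟨K * wtMass d ^ 2, by finiteness, fun u hu hb 𝒩 j l => ?_⟩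
  have hm := measP_prof (P.aesm_S hu l)
  have h1 : ∀ᵐ t ∂timeMeasure, ∀ n, prof (P.S j (P.incr Γ u l)) t n ≤
      K * pw (-(N * ((j : ℝ) - l))) * smear wt (smear wt (prof (P.S l u))) t n := by
    filter_upwards [hb] with t ht n
    have m1 := measurable_mconv l (measurable_enorm (P.S l u t))
    refine (pr2_mono (hK u t ht j l) n).trans ?_
    rw [pr2_const_mul _ (measurable_mconv j m1)]
    refine mul_le_mul_right ((pr2_mconv_le j m1 n).trans ?_) _
    exact ENNReal.tsum_le_tsum fun m => mul_le_mul_right (pr2_mconv_le l (measurable_enorm _) _) _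
  refine (𝒩.mono h1).trans ((𝒩.smul_le _ ((hm.smear wt).smear wt)).trans ?_)
  have h2 := 𝒩.smear_le (hm.smear wt) wt
  have h3 := 𝒩.smear_le hm wt
  rw [← coe_wtMass] at h2 h3
  calc _ ≤ K * pw (-(N * ((j : ℝ) - l))) *
        (𝒩.c * wtMass d * (𝒩.c * wtMass d * 𝒩 (prof (P.S l u)))) :=
        mul_le_mul_right (h2.trans (mul_le_mul_right h3 _)) _
    _ = _ := by ring

end Decomposition

end Superposition

end LocalEnergy

end

noncomputable section

namespace LocalEnergy

open scoped SchwartzMap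

variable {d : ℕ} {V : Type*} [NormedAddCommGroup V] [InnerProductSpace ℂ V] [CompleteSpace V]

open LNorm

/-! ### Superpositions in frequency-localized spaces -/

theorem sum_range_pw_reflect_le (e : ℝ) (n : ℕ) :
    ∑ l ∈ Finset.range n, pw (e * ((n : ℝ) - 1 - l)) ≤ geo e := by
  rw [← Finset.sum_range_reflect]
  refine (le_of_eq (Finset.sum_congr rfl fun l hl => ?_)).trans (sum_range_pw_le e n)
  have := Finset.mem_range.1 hl
  congr 2
  rw [Nat.cast_sub (by omega), Nat.cast_sub (by omega)]
  push_cast; ring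

section Superposition

universe u

variable {V W : Type u} [NormedAddCommGroup V] [InnerProductSpace ℂ V] [CompleteSpace V]
  [NormedAddCommGroup W] [InnerProductSpace ℂ W] [CompleteSpace W] {Γ : V → W}

/-- The increment of the directional derivative of `Γ` from the origin. -/
def slope (Γ : V → W) (e v : V) : W := fderiv ℝ Γ v e - fderiv ℝ Γ 0 e

theorem slope_zero (e : V) : slope Γ e 0 = 0 := sub_self _

theorem BddSmooth.slope (h : BddSmooth Γ) (e : V) : BddSmooth (slope Γ e) := by
  have h1 : ContDiff ℝ ∞ fun v => _root_.fderiv ℝ Γ v e := h.fderiv.smooth.clm_apply contDiff_const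
  have h2 : ContDiff ℝ ∞ fun _ : V => _root_.fderiv ℝ Γ 0 e := contDiff_const
  refine ⟨h1.sub h2, fun n => ?_⟩
  obtain ⟨C, hC⟩ := h.fderiv.bdd n
  refine ⟨‖e‖ * C + ‖_root_.fderiv ℝ Γ 0 e‖, fun v => ?_⟩
  have e1 := iteratedFDeriv_sub_apply (i := n) (x := v)
    (h1.contDiffAt.of_le (by exact_mod_cast le_top)) (h2.contDiffAt.of_le (by exact_mod_cast le_top))
  refine ((congrArg norm e1).trans_le (_root_.norm_sub_le _ _)).trans (add_le_add ?_ ?_)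
  · refine (norm_iteratedFDeriv_clm_apply_const (N := ∞) h.fderiv.smooth.contDiffAt
      (by exact_mod_cast le_top)).trans ?_
    exact mul_le_mul_of_nonneg_left (hC v) (norm_nonneg _)
  · rcases n with _ | n
    · rw [norm_iteratedFDeriv_zero]
    · rw [iteratedFDeriv_const_of_ne n.succ_ne_zero]
      simp

theorem lmap_zero (L : V →L[ℝ] W) : lmap L (0 : ℝ → L2 d V) = 0 := by
  funext t
  apply Lp.ext
  filter_upwards [lmap_ae L (0 : ℝ → L2 d V) t, Lp.coeFn_zero V 2 (volume : Measure (E d)),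
    Lp.coeFn_zero W 2 (volume : Measure (E d))] with x h1 h2 h3
  rw [h1, Pi.zero_apply, Pi.zero_apply, h2, h3, Pi.zero_apply, Pi.zero_apply, map_zero]

namespace Decomposition

variable (P : Decomposition d)

theorem comp_SLt_eq_sum (hΓ : BddSmooth Γ) (h0 : Γ 0 = 0) (u : ℝ → L2 d V) (h : ℕ) (t : ℝ) :
    comp Γ (P.SLt h u) t = ∑ l ∈ Finset.range h, P.incr Γ u l t := by
  induction h with
  | zero =>
    rw [Finset.sum_range_zero]
    apply Lp.ext
    filter_upwards [hΓ.comp_ae h0 (P.SLt 0 u) t, P.SLt_ae u t 0,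
      Lp.coeFn_zero W 2 (volume : Measure (E d))] with x h1 h2 h3
    rw [h1, h2, h3, lowFun, if_pos rfl, Pi.zero_apply, Pi.zero_apply, h0]
  | succ h ih =>
    rw [Finset.sum_range_succ, ← ih, incr, add_sub_cancel]

theorem mixTop_SGe_le {v : ℝ → L2 d V} (hv : AEStronglyMeasurable v timeMeasure) (M : ℕ) :
    mixTop (prof (P.SGe M v)) ≤ ∑' j, if M ≤ j then mixTop (prof (P.S j v)) else 0 := by
  refine (mixTop.le_tsum (fun j => measP_prof (P.aesm_piece hv M j))
    (.of_forall fun t n => prof_le_tsum (P.tendsto_piece M v t) n)).trans ?_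
  refine ENNReal.tsum_le_tsum fun j => ?_
  unfold piece
  split_ifs
  · exact le_rfl
  · rw [prof_zero', LNorm.zero]

/-- The superposition Γ(S_{<h}u) is the sum of its increments l < h, whose parts at frequency 2^j
have size 2^{-N(j-l)} 2^{-ls}. With N ≥ |s| + 1 the sum over l is dominated by l close to h, and the
sum over j ≥ h - 4 is geometric, which leaves 2^{-hs}. -/
theorem exists_mixTop_SGe_comp_le (hΓ : BddSmooth Γ) (h0 : Γ 0 = 0) (R : ℝ≥0) (s : ℝ) :
    ∃ K : ℝ≥0∞, K ≠ ⊤ ∧ ∀ (u : ℝ → L2 d V), AEStronglyMeasurable u timeMeasure →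
      (∀ᵐ t ∂timeMeasure, ∀ᵐ x, ‖u t x‖ₑ ≤ R) → ∀ h : ℕ,
      mixTop (prof (P.SGe (h - 4) (comp Γ (P.SLt h u)))) ≤ K * (pw (-(h * s)) * P.l1X s u) := by
  obtain ⟨N, hN⟩ := exists_nat_ge (|s| + 1)
  have hN1 : (0 : ℝ) < N := by linarith [abs_nonneg s]
  have hNs : 1 ≤ N - s := by linarith [le_abs_self s]
  obtain ⟨K, hKt, hK⟩ := P.exists_norm_S_incr_le hΓ h0 R N
  set c : ℝ≥0∞ := K * (mixTop (d := d)).c ^ 2 * P.cutC with hc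
  refine ⟨c * geo (-1) * (pw (-4 * -N) * geo (-N)), ?_, fun u hu hb h => ?_⟩
  · have h1 := geo_ne_top (e := -1) (by norm_num)
    have h2 := geo_ne_top (e := -N) (by linarith)
    have h3 := pw_ne_top (-4 * -N)
    rw [hc]; finiteness
  have hv : AEStronglyMeasurable (comp Γ (P.SLt h u)) timeMeasure := hΓ.aesm_comp h0 (P.aesm_SLt hu h)
  have hi := fun l => P.aesm_incr hΓ h0 hu l
  have hj : ∀ j : ℕ, mixTop (prof (P.S j (comp Γ (P.SLt h u)))) ≤
      c * geo (-1) * (pw (-(h * s)) * P.l1X s u) * pw (-N * ((j : ℝ) - h)) := by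
    intro j
    have h1 : mixTop (prof (P.S j (comp Γ (P.SLt h u)))) ≤
        ∑ l ∈ Finset.range h, mixTop (prof (P.S j (P.incr Γ u l))) := by
      refine (mixTop.mono (G := prof (∑ l ∈ Finset.range h, P.S j (P.incr Γ u l)))
        (.of_forall fun t n => le_of_eq (prof_congr ?_ n))).trans
        (norm_sum_le _ _ _ fun l _ => P.aesm_S (hi l) j)
      rw [P.S_congr_sum j (Finset.range h) (p := P.incr Γ u) (q := 0)
        (by rw [P.comp_SLt_eq_sum hΓ h0, Pi.zero_apply, add_zero]), S_zero, Pi.zero_apply, add_zero,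
        Finset.sum_apply]
    have h2 : ∀ l ∈ Finset.range h, mixTop (prof (P.S j (P.incr Γ u l))) ≤
        c * (pw (-(h * s)) * P.l1X s u) * pw (-N * ((j : ℝ) - h)) *
          pw (-1 * ((h : ℝ) - 1 - l)) := by
      intro l hl
      have hl' : (l : ℝ) + 1 ≤ h := by exact_mod_cast Finset.mem_range.1 hl
      have h3 : pw (-(N * ((j : ℝ) - l))) * pw (-(l * s)) ≤
          pw (-(h * s)) * pw (-N * ((j : ℝ) - h)) * pw (-1 * ((h : ℝ) - 1 - l)) := by
        rw [← pw_add, ← pw_add, ← pw_add]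
        refine pw_mono ?_
        nlinarith [mul_le_mul_of_nonneg_right hNs (show 0 ≤ (h : ℝ) - l by linarith)]
      calc _ ≤ K * (mixTop (d := d)).c ^ 2 * (pw (-(N * ((j : ℝ) - l))) *
            (P.cutC * (pw (-(l * s)) * P.l1X s u))) :=
            (hK u hu hb mixTop j l).trans
              (mul_le_mul_right (mul_le_mul_right (P.mixTop_S_le s hu l) _) _)
        _ = c * P.l1X s u * (pw (-(N * ((j : ℝ) - l))) * pw (-(l * s))) := by rw [hc]; ring
        _ ≤ c * P.l1X s u * (pw (-(h * s)) * pw (-N * ((j : ℝ) - h)) * pw (-1 * ((h : ℝ) - 1 - l))) :=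
            mul_le_mul_right h3 _
        _ = _ := by ring
    refine (h1.trans (Finset.sum_le_sum h2)).trans ?_
    rw [← Finset.mul_sum]
    refine (mul_le_mul_right (sum_range_pw_reflect_le (-1) h) _).trans (le_of_eq ?_)
    ring
  refine (P.mixTop_SGe_le hv _).trans ?_
  calc _ ≤ ∑' j : ℕ, c * geo (-1) * (pw (-(h * s)) * P.l1X s u) *
        (if h - 4 ≤ j then pw (-N * ((j : ℝ) - h)) else 0) := by
        refine ENNReal.tsum_le_tsum fun j => ?_
        split_ifs
        · exact hj j
        · simp
    _ ≤ c * geo (-1) * (pw (-(h * s)) * P.l1X s u) * (pw (-4 * -N) * geo (-N)) := by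
        rw [ENNReal.tsum_mul_left]
        exact mul_le_mul_right (tsum_ge_pw_le (by linarith) h) _
    _ = _ := by ring

/-- Bringing S_h q down to the frequency 2^k, k ≤ h - 3, requires a partner at frequency about 2^h,
so the part of v below 2^{h-4} is irrelevant. -/
theorem S_smulF_S_eq_SGe {k h : ℕ} (hkh : k + 3 ≤ h) (q : ℝ → L2 d ℂ) (v : ℝ → L2 d V) (t : ℝ) :
    P.S k (smulF (P.S h q) v) t = P.S k (smulF (P.S h q) (P.SGe (h - 4) v)) t := by
  have hb := P.memLp_top_S h q t
  have h2 : smulF (P.S h q) v t = ∑ i ∈ Finset.range (h - 4), smulF (P.S h q) (P.S i v) t +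
      smulF (P.S h q) (P.SGe (h - 4) v) t := by
    have e : smulF (P.S h q) v t =
        bmul _ hb (∑ i ∈ Finset.range (h - 4), P.S i v t + P.SGe (h - 4) v t) := by
      rw [smulF_apply v hb, ← SLt_apply, ← P.SLt_add_SGe]
    rw [e, map_add, map_sum, smulF_apply _ hb]
    congr 1
  rw [P.S_congr_sum k (Finset.range (h - 4)) h2, Finset.sum_eq_zero, zero_add]
  intro i hi
  have := Finset.mem_range.1 hi
  exact P.S_smulF_eq_zero (.inr (.inr ⟨by omega, hkh⟩)) q v t

theorem norm_S_smulF_le (𝒩 : LNorm d) (k : ℕ) {q : ℝ → L2 d ℂ} {v : ℝ → L2 d V}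
    (hq : AEStronglyMeasurable q timeMeasure) (hv : AEStronglyMeasurable v timeMeasure) (h : ℕ) :
    𝒩 (prof (P.S k (smulF (P.S h q) v))) ≤ P.kerC * 𝒩.c * wtMass d *
      (pw (k * d / 2) * mixTop (prof v) * 𝒩 (prof (P.S h q))) := by
  have := P.norm_S_le_of_le_mul 𝒩 k (w := smulF (P.S h q) v) (a := 1) hv (P.aesm_S hq h)
    (.of_forall fun t => ?_)
  · simpa using this
  · filter_upwards [smulF_ae v (P.memLp_top_S h q t)] with x hx
    rw [hx, enorm_smul, ENNReal.coe_one, one_mul, mul_comm]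

/-- The output of the high frequency increments at low frequencies. -/
theorem exists_nX_S_incr_high_le [FiniteDimensional ℝ V] (hΓ : BddSmooth Γ) (h0 : Γ 0 = 0)
    (R : ℝ≥0) (s : ℝ) :
    ∃ K : ℝ≥0∞, K ≠ ⊤ ∧ ∀ (u : ℝ → L2 d V), AEStronglyMeasurable u timeMeasure →
      (∀ᵐ t ∂timeMeasure, ∀ᵐ x, ‖u t x‖ₑ ≤ R) → ∀ k h : ℕ, k + 3 ≤ h →
      nX k (prof (P.S k (P.incr Γ u h))) ≤
        K * (pw (k * d / 2) * (pw (-(h * s)) * P.l1X s u) * nX k (prof (P.S h u))) := by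
  -- In a real basis, DΓ(p)q is the sum of q_a DΓ(p)b_a, and each term is a product to which the
  -- scalar theory applies. The real coordinates are embedded in ℂ for this.
  set b := Module.finBasis ℝ V
  set L : Fin (Module.finrank ℝ V) → V →L[ℝ] ℂ := fun a =>
    Complex.ofRealCLM.comp (LinearMap.toContinuousLinearMap (b.coord a)) with hL
  obtain ⟨C, hC⟩ := hΓ.exists_norm_taylor_le
  choose K hKt hK using fun a => P.exists_mixTop_SGe_comp_le (hΓ.slope (b a)) (slope_zero _) R s
  set κ : ℝ≥0∞ := P.kerC * (2 ^ d * 2 ^ d) * wtMass d with hκ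
  refine ⟨∑ a, κ * (K a * ‖L a‖ₑ) + κ * C * P.cutC, ?_, fun u hu hb k h hkh => ?_⟩
  · have : ∑ a, κ * (K a * ‖L a‖ₑ) ≠ ⊤ := ENNReal.sum_ne_top.2 fun a _ => by
      have := hKt a
      rw [hκ]; finiteness
    refine ENNReal.add_ne_top.2 ⟨this, ?_⟩
    rw [hκ]; finiteness
  set D := fderiv ℝ Γ 0
  set v : Fin (Module.finrank ℝ V) → ℝ → L2 d W := fun a => comp (slope Γ (b a)) (P.SLt h u) with hv
  set T : Fin (Module.finrank ℝ V) → ℝ → L2 d W := fun a => smulF (P.S h (lmap (L a) u)) (v a) with hT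
  -- Taylor's formula with p = S_{<h}u and q = S_h u. The terms `T a` sum to (DΓ(p) - DΓ(0))q, where
  -- DΓ(0) is subtracted so that `slope` vanishes at zero and the superposition stays in L². The
  -- linear term DΓ(0)q is annihilated by S_k, and `Rm` is quadratic in q.
  set Rm : ℝ → L2 d W := fun t => P.incr Γ u h t - ∑ a, T a t - lmap D (P.S h u) t with hRm
  have hSu := P.aesm_S hu h
  have hvm : ∀ a, AEStronglyMeasurable (v a) timeMeasure := fun a =>
    (hΓ.slope (b a)).aesm_comp (slope_zero _) (P.aesm_SLt hu h)
  have hqm : ∀ a, AEStronglyMeasurable (lmap (L a) u) timeMeasure := fun a => aesm_lmap _ hu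
  have hTm : ∀ a, AEStronglyMeasurable (T a) timeMeasure := fun a => P.aesm_smulF_S (hqm a) (hvm a) h
  have hRmm : AEStronglyMeasurable Rm timeMeasure :=
    ((P.aesm_incr hΓ h0 hu h).sub (Finset.aestronglyMeasurable_fun_sum _ fun a _ => hTm a)).sub
      (aesm_lmap _ hSu)
  have hrem : ∀ t, ∀ᵐ x, ‖Rm t x‖ₑ ≤ C * (‖P.S h u t x‖ₑ * ‖P.S h u t x‖ₑ) := by
    intro t
    have hTa : ∀ᵐ x, ∀ a, T a t x = ((b.coord a (P.S h u t x) : ℝ) : ℂ) •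
        (fderiv ℝ Γ (P.SLt h u t x) (b a) - D (b a)) := by
      refine ae_all_iff.2 fun a => ?_
      have e : P.S h (lmap (L a) u) t = lmap (L a) (P.S h u) t := by rw [P.S_lmap]
      filter_upwards [smulF_ae (v a) (P.memLp_top_S h (lmap (L a) u) t),
        lmap_ae (L a) (P.S h u) t, (hΓ.slope (b a)).comp_ae (slope_zero _) (P.SLt h u) t]
        with x h1 h2 h3
      rw [h1, e, h2, hv, h3]
      rfl
    filter_upwards [Lp.coeFn_sub (P.incr Γ u h t - ∑ a, T a t) (lmap D (P.S h u) t),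
      Lp.coeFn_sub (P.incr Γ u h t) (∑ a, T a t), Lp.coeFn_fun_finsetSum Finset.univ fun a => T a t,
      Lp.coeFn_sub (comp Γ (P.SLt (h + 1) u) t) (comp Γ (P.SLt h u) t),
      hΓ.comp_ae h0 (P.SLt (h + 1) u) t, hΓ.comp_ae h0 (P.SLt h u) t, P.SLt_succ_ae u t h,
      lmap_ae D (P.S h u) t, hTa] with x e1 e2 e3 e4 e5 e6 e7 e8 e9
    have e10 : P.incr Γ u h t x = Γ (P.SLt h u t x + P.S h u t x) - Γ (P.SLt h u t x) := by
      change (comp Γ (P.SLt (h + 1) u) t - comp Γ (P.SLt h u) t) x = _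
      rw [e4, Pi.sub_apply, e5, e6, e7]
    have e11 : ∑ a, T a t x = fderiv ℝ Γ (P.SLt h u t x) (P.S h u t x) - D (P.S h u t x) := by
      have hq : P.S h u t x = ∑ a, b.coord a (P.S h u t x) • b a := (b.sum_repr _).symm
      conv_rhs => rw [hq, map_sum, map_sum, ← Finset.sum_sub_distrib]
      refine Finset.sum_congr rfl fun a _ => ?_
      rw [e9, map_smul, map_smul, ← smul_sub, Complex.coe_smul]
    have e12 : Rm t x = Γ (P.SLt h u t x + P.S h u t x) - Γ (P.SLt h u t x) -
        fderiv ℝ Γ (P.SLt h u t x) (P.S h u t x) := by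
      change (P.incr Γ u h t - ∑ a, T a t - lmap D (P.S h u) t) x = _
      rw [e1, Pi.sub_apply, e2, Pi.sub_apply, e3, e8, e10, e11]
      abel
    rw [e12, ← ofReal_norm, ← ofReal_norm, ← ENNReal.ofReal_mul (norm_nonneg _),
      ← ENNReal.ofReal_coe_nnreal, ← ENNReal.ofReal_mul (NNReal.coe_nonneg C)]
    exact ENNReal.ofReal_le_ofReal (hC _ _)
  have hsplit : ∀ t, P.S k (P.incr Γ u h) t =
      ∑ a, P.S k (smulF (P.S h (lmap (L a) u)) (P.SGe (h - 4) (v a))) t + P.S k Rm t := by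
    intro t
    rw [P.S_congr_sum k Finset.univ (p := T) (q := Rm + lmap D (P.S h u))
      (by
        change _ = _ + (P.incr Γ u h t - ∑ a, T a t - lmap D (P.S h u) t + lmap D (P.S h u) t)
        rw [sub_add_cancel, add_sub_cancel])]
    congr 1
    · exact Finset.sum_congr rfl fun a _ => P.S_smulF_S_eq_SGe hkh _ _ t
    · have h1 : P.S k (lmap D (P.S h u)) = 0 := by
        rw [P.S_lmap, P.S_S_eq_zero (.inl (by omega)), lmap_zero]
      have h2 := congrFun h1 t
      rw [S_apply, Pi.zero_apply] at h2
      rw [S_apply, Pi.add_apply, fourierMul_add _ (P.memLp_sym k), h2, add_zero, ← S_apply]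
  have hGm : ∀ a, AEStronglyMeasurable
      (P.S k (smulF (P.S h (lmap (L a) u)) (P.SGe (h - 4) (v a)))) timeMeasure := fun a =>
    P.aesm_S (P.aesm_smulF_S (hqm a) (P.aesm_SGe (hvm a) _) h) k
  set X := pw (k * d / 2) * (pw (-(h * s)) * P.l1X s u) * nX k (prof (P.S h u)) with hX
  have hmid : ∀ a, nX k (prof (P.S k (smulF (P.S h (lmap (L a) u)) (P.SGe (h - 4) (v a))))) ≤
      κ * (K a * ‖L a‖ₑ) * X := by
    intro a
    have h1 := P.norm_S_smulF_le (nX k) k (hqm a) (P.aesm_SGe (hvm a) (h - 4)) h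
    have h2 := norm_lmap_le (nX k) (L a) hSu
    rw [P.S_lmap, nX_c] at h1
    rw [P.S_lmap]
    refine h1.trans ?_
    push_cast
    calc _ ≤ κ * (pw (k * d / 2) * (K a * (pw (-(h * s)) * P.l1X s u)) *
          (‖L a‖ₑ * nX k (prof (P.S h u)))) :=
          mul_le_mul_right (mul_le_mul' (mul_le_mul_right (hK a u hu hb h) _) h2) _
      _ = _ := by rw [hX]; ring
  have hlast : nX k (prof (P.S k Rm)) ≤ κ * C * P.cutC * X := by
    have h1 := P.norm_S_le_of_le_mul (nX k) k hSu hSu (.of_forall hrem)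
    rw [nX_c] at h1
    refine h1.trans ?_
    push_cast
    calc _ ≤ κ * C * (pw (k * d / 2) * (P.cutC * (pw (-(h * s)) * P.l1X s u)) *
          nX k (prof (P.S h u))) :=
          mul_le_mul_right (mul_le_mul_left (mul_le_mul_right (P.mixTop_S_le s hu h) _) _) _
      _ = _ := by rw [hX]; ring
  refine ((nX k).mono (G := prof
    ((∑ a, P.S k (smulF (P.S h (lmap (L a) u)) (P.SGe (h - 4) (v a)))) + P.S k Rm))
    (.of_forall fun t n => le_of_eq (prof_congr ?_ n))).trans ?_
  · rw [hsplit, Pi.add_apply, Finset.sum_apply]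
  · refine (norm_add_le _ (Finset.aestronglyMeasurable_sum _ fun a _ => hGm a) (P.aesm_S hRmm k)).trans ?_
    rw [add_mul, Finset.sum_mul]
    exact add_le_add ((norm_sum_le _ _ _ fun a _ => hGm a).trans (Finset.sum_le_sum fun a _ => hmid a))
      hlast

end Decomposition

end Superposition

end LocalEnergy

end

noncomputable section

namespace LocalEnergy

open scoped SchwartzMap

variable {d : ℕ} {V : Type*} [NormedAddCommGroup V] [InnerProductSpace ℂ V] [CompleteSpace V]

open LNorm

/-! ### The Moser estimate -/

section Moser

universe u

variable {V W : Type u} [NormedAddCommGroup V] [InnerProductSpace ℂ V] [CompleteSpace V]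
  [NormedAddCommGroup W] [InnerProductSpace ℂ W] [CompleteSpace W] {Γ : V → W}

theorem tsum_lt_pw_le (e : ℝ) (n : ℕ) :
    ∑' h : ℕ, (if h < n then pw (e * ((n : ℝ) - 1 - h)) else 0) ≤ geo e := by
  rw [tsum_eq_sum (s := Finset.range n) fun h hh => if_neg (by simpa using hh)]
  refine le_trans (Finset.sum_le_sum fun h hh => ?_) (sum_range_pw_reflect_le e n)
  rw [if_pos (Finset.mem_range.1 hh)]

/-- F(u) depends only on the values of F on the range of u. Multiplication by a bump function equal
to one on the ball of radius R makes all derivatives bounded, by compactness. -/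
theorem exists_bddSmooth_eq [FiniteDimensional ℝ V] {F : V → W} (hF : ContDiff ℝ ∞ F) (h0 : F 0 = 0)
    (R : ℝ≥0) : ∃ Γ : V → W, BddSmooth Γ ∧ Γ 0 = 0 ∧ ∀ v, ‖v‖ ≤ R → Γ v = F v := by
  have hR : (0 : ℝ) ≤ R := R.2
  set b : ContDiffBump (0 : V) := ⟨R + 1, R + 2, by linarith, by linarith⟩
  have hc : HasCompactSupport fun v => b v • F v := b.hasCompactSupport.smul_right
  have hs : ContDiff ℝ ∞ fun v => b v • F v := b.contDiff.smul hF
  refine ⟨fun v => b v • F v, ⟨hs, fun n => ?_⟩, by simp [h0], fun v hv => ?_⟩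
  · exact (hs.continuous_iteratedFDeriv (by exact_mod_cast le_top)).bounded_above_of_compact_support
      (hc.iteratedFDeriv n)
  · have : b v = 1 := b.one_of_mem_closedBall (by
      rw [mem_closedBall_zero_iff]
      change ‖v‖ ≤ (R : ℝ) + 1
      linarith)
    simp only [this, one_smul]

namespace Decomposition

variable (P : Decomposition d)

/-- The output of the low frequency increments. -/
theorem exists_nX_S_incr_low_le (hΓ : BddSmooth Γ) (h0 : Γ 0 = 0) (R : ℝ≥0) (s C : ℝ) {δ : ℝ}
    (hδ : 0 ≤ δ) :
    ∃ K : ℝ≥0∞, K ≠ ⊤ ∧ ∀ (u : ℝ → L2 d V) (a : ℕ → ℝ), AEStronglyMeasurable u timeMeasure →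
      (∀ᵐ t ∂timeMeasure, ∀ᵐ x, ‖u t x‖ₑ ≤ R) → P.IsEnvelope δ C s u a → ∀ k h : ℕ, h < k + 3 →
      pw (k * s) * nX k (prof (P.S k (P.incr Γ u h))) ≤
        K * (ENNReal.ofReal (a k) * P.l1X s u) * pw (-1 * (((k + 3 : ℕ) : ℝ) - 1 - h)) := by
  -- For h ≤ k the gain 2^{-N(k-h)} has to beat 2^{(k-h)s} from the weights, 2^{(k-h)(d+1)} from the
  -- change of cubes and 2^{δ(k-h)} from the envelope, and still leave 2^{-(k-h)}. The cases h = k +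
  -- 1 and h = k + 2 are absorbed by the constant `c`.
  obtain ⟨N, hN⟩ := exists_nat_ge (s + d + 2 + δ)
  obtain ⟨K₁, hK₁t, hK₁⟩ := P.exists_norm_S_incr_le hΓ h0 R N
  obtain ⟨K₂, hK₂t, hK₂⟩ := P.exists_nX_S_le_envelope V s δ C
  set c : ℝ := 2 * (N + |s| + d + 1 + δ) + 4 with hc
  set κ : ℝ≥0∞ := K₁ * (2 ^ d * 2 ^ d) ^ 2 with hκ
  refine ⟨κ * K₂ * pw c, ?_, fun u a hu hb ha k h hkh => ?_⟩
  · have := pw_ne_top c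
    rw [hκ]; finiteness
  set r : ℕ := (k - h) + (h - k) with hr
  have hr' : (r : ℝ) = |(h : ℝ) - k| := by
    rcases le_total k h with hle | hle
    · rw [hr, Nat.sub_eq_zero_of_le hle, zero_add, Nat.cast_sub hle, abs_of_nonneg]
      exact sub_nonneg.2 (by exact_mod_cast hle)
    · rw [hr, Nat.sub_eq_zero_of_le hle, add_zero, Nat.cast_sub hle, abs_of_nonpos, neg_sub]
      exact sub_nonpos.2 (by exact_mod_cast hle)
  have h1 := hK₁ u hu hb (nX k) k h
  have h2 := nX_le_nX (j := h) (k := k) (r := r) (by omega) (by omega) (measP_prof (P.aesm_S hu h))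
  have h3 := hK₂ u a hu ha h k
  rw [← pw_natCast] at h2
  rw [nX_c] at h1
  push_cast at h1 h2 ⊢
  have hexp : pw (k * s) * pw (-(N * ((k : ℝ) - h))) * pw (r * d + r) *
      pw (-(h * s) + δ * |(h : ℝ) - k|) ≤ pw c * pw (-1 * ((k : ℝ) + 3 - 1 - h)) := by
    rw [← pw_add, ← pw_add, ← pw_add, ← pw_add]
    refine pw_mono ?_
    rw [hr', hc]
    have hd0 : (0 : ℝ) ≤ d := Nat.cast_nonneg d
    have hN0 : (0 : ℝ) ≤ N := Nat.cast_nonneg N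
    have hs1 := neg_abs_le s
    have hs2 := abs_nonneg s
    rcases le_or_gt h k with hle | hlt
    · have hle' : (h : ℝ) ≤ k := by exact_mod_cast hle
      rw [abs_of_nonpos (by linarith)]
      nlinarith [mul_nonneg (sub_nonneg.2 hle') (sub_nonneg.2 hN)]
    · have hlt' : (k : ℝ) + 1 ≤ h := by exact_mod_cast hlt
      have hle' : (h : ℝ) ≤ k + 2 := by exact_mod_cast (by omega : h ≤ k + 2)
      rw [abs_of_nonneg (by linarith)]
      have h4 : 0 ≤ N - s + d + 1 + δ := by linarith
      have h5 : ((h : ℝ) - k) * (N - s + d + 1 + δ) ≤ 2 * (N - s + d + 1 + δ) :=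
        mul_le_mul_of_nonneg_right (by linarith) h4
      nlinarith
  calc _ ≤ pw (k * s) * (κ * (pw (-(N * ((k : ℝ) - h))) * (pw (r * d + r) *
        (K₂ * (pw (-(h * s) + δ * |(h : ℝ) - k|) * ENNReal.ofReal (a k) * P.l1X s u))))) :=
        mul_le_mul_right (h1.trans (mul_le_mul_right (mul_le_mul_right
          (h2.trans (mul_le_mul_right h3 _)) _) _)) _
    _ = κ * K₂ * (ENNReal.ofReal (a k) * P.l1X s u) * (pw (k * s) * pw (-(N * ((k : ℝ) - h))) *
        pw (r * d + r) * pw (-(h * s) + δ * |(h : ℝ) - k|)) := by ring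
    _ ≤ κ * K₂ * (ENNReal.ofReal (a k) * P.l1X s u) *
        (pw c * pw (-1 * ((k : ℝ) + 3 - 1 - h))) := mul_le_mul_right hexp _
    _ = _ := by ring

/-- The Moser estimate for functions with bounded derivatives. -/
theorem exists_l1X_comp_bddSmooth_le [FiniteDimensional ℝ V] (hΓ : BddSmooth Γ) (h0 : Γ 0 = 0)
    (R : ℝ≥0) {s δ : ℝ} (C : ℝ) (hs : (d : ℝ) / 2 < s) (hδ : 0 ≤ δ) (hδs : δ < s - d / 2) :
    ∃ K : ℝ≥0, ∀ (u : ℝ → L2 d V) (w : ℝ → L2 d W) (a : ℕ → ℝ),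
      AEStronglyMeasurable u timeMeasure → (∀ᵐ t ∂timeMeasure, ∀ᵐ x, ‖u t x‖ₑ ≤ R) →
      P.IsEnvelope δ C s u a → (∀ᵐ t ∂timeMeasure, w t = comp Γ u t) → ∀ k : ℕ,
      P.l1X s (P.S k w) ≤ ENNReal.ofReal (a k) * P.l1X s u * (1 + P.l1X s u) * K := by
  obtain ⟨K₀, hK₀⟩ := P.exists_l1X_S_le (V := W) s
  obtain ⟨K₁, hK₁t, hK₁⟩ := P.exists_nX_S_incr_low_le hΓ h0 R s C hδ
  obtain ⟨K₂, hK₂t, hK₂⟩ := P.exists_nX_S_incr_high_le hΓ h0 R s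
  obtain ⟨K₃, hK₃t, hK₃⟩ := P.exists_nX_S_le_envelope V s δ C
  set e : ℝ := d + δ - 2 * s with he
  have he0 : e < 0 := by rw [he]; linarith
  set κ : ℝ≥0∞ := K₂ * pw (2 + 4 * d) * K₃ with hκ
  have hκt : κ ≠ ⊤ := by
    have := pw_ne_top (2 + 4 * d)
    rw [hκ]; finiteness
  set M₁ := K₁ * geo (-1) with hM₁
  set M₂ := κ * (pw (-4 * e) * geo e) with hM₂
  have hM₁t : M₁ ≠ ⊤ := by
    have := geo_ne_top (e := -1) (by norm_num)
    rw [hM₁]; finiteness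
  have hM₂t : M₂ ≠ ⊤ := by
    have := geo_ne_top he0
    have := pw_ne_top (-4 * e)
    rw [hM₂]; finiteness
  refine ⟨(K₀ * (M₁ + M₂)).toNNReal, fun u w a hu hb ha hw k => ?_⟩
  rw [ENNReal.coe_toNNReal (by finiteness)]
  have hi := fun h => P.aesm_incr hΓ h0 hu h
  have hwm : AEStronglyMeasurable w timeMeasure :=
    (hΓ.aesm_comp h0 hu).congr (hw.mono fun t ht => ht.symm)
  set A := ENNReal.ofReal (a k) * P.l1X s u with hA
  have hhigh : ∀ h : ℕ, k + 3 ≤ h → pw (k * s) * nX k (prof (P.S k (P.incr Γ u h))) ≤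
      κ * (A * P.l1X s u) * pw (e * ((h : ℝ) - k)) := by
    intro h hkh
    have h1 := P.nX_S_fine_le (i := h) (k := k) (by omega) hu
    have h2 := hK₃ u a hu ha h k
    have hkh' : (k : ℝ) ≤ h := by exact_mod_cast (by omega : k ≤ h)
    -- The exponents add up to e(h-k) + k(d/2-s). The factor 2^{-hs} appears twice because the bound
    -- is quadratic, and this pays for the 2^{(h-k)d} subcubes under s > d/2 alone; a linear bound
    -- would need s > d.
    have hexp : pw (k * s) * pw (k * d / 2) * pw (-(h * s)) * pw (((h : ℝ) - k) * d) *
        pw (-(h * s) + δ * |(h : ℝ) - k|) ≤ pw (e * ((h : ℝ) - k)) := by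
      rw [← pw_add, ← pw_add, ← pw_add, ← pw_add, abs_of_nonneg (by linarith)]
      refine pw_mono ?_
      rw [he]
      nlinarith [mul_nonneg (Nat.cast_nonneg (α := ℝ) k) (sub_nonneg.2 hs.le)]
    calc _ ≤ pw (k * s) * (K₂ * (pw (k * d / 2) * (pw (-(h * s)) * P.l1X s u) *
          (pw (2 + 4 * d) * pw (((h : ℝ) - k) * d) *
          (K₃ * (pw (-(h * s) + δ * |(h : ℝ) - k|) * ENNReal.ofReal (a k) * P.l1X s u))))) :=
          mul_le_mul_right ((hK₂ u hu hb k h hkh).trans (mul_le_mul_right (mul_le_mul_right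
            (h1.trans (mul_le_mul_right h2 _)) _) _)) _
      _ = κ * (A * P.l1X s u) * (pw (k * s) * pw (k * d / 2) * pw (-(h * s)) *
          pw (((h : ℝ) - k) * d) * pw (-(h * s) + δ * |(h : ℝ) - k|)) := by rw [hκ, hA]; ring
      _ ≤ _ := mul_le_mul_right hexp _
  have hsum : nX k (prof (P.S k w)) ≤ ∑' h, nX k (prof (P.S k (P.incr Γ u h))) := by
    refine (nX k).le_tsum (fun h => measP_prof (P.aesm_S (hi h) k)) (hw.mono fun t ht n => ?_)
    refine P.prof_S_le_tsum k ?_ n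
    rw [ht]
    refine (hΓ.tendsto_comp h0 (p := fun N => P.SLt N u) (P.tendsto_SLt u t)).congr fun N => ?_
    exact P.comp_SLt_eq_sum hΓ h0 u N t
  have hmain : pw (k * s) * nX k (prof (P.S k w)) ≤ K₁ * A * geo (-1) +
      κ * (A * P.l1X s u) * (pw (-4 * e) * geo e) := by
    refine (mul_le_mul_right hsum _).trans ?_
    rw [← ENNReal.tsum_mul_left]
    calc _ ≤ ∑' h : ℕ, (K₁ * A * (if h < k + 3 then pw (-1 * (((k + 3 : ℕ) : ℝ) - 1 - h)) else 0) +
          κ * (A * P.l1X s u) * (if k - 4 ≤ h then pw (e * ((h : ℝ) - k)) else 0)) := by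
          refine ENNReal.tsum_le_tsum fun h => ?_
          by_cases hlt : h < k + 3
          · rw [if_pos hlt]
            exact (hK₁ u a hu hb ha k h hlt).trans le_self_add
          · rw [if_pos (by omega : k - 4 ≤ h)]
            exact (hhigh h (by omega)).trans le_add_self
      _ ≤ _ := by
          rw [ENNReal.tsum_add, ENNReal.tsum_mul_left, ENNReal.tsum_mul_left]
          exact add_le_add (mul_le_mul_right (tsum_lt_pw_le (-1) (k + 3)) _)
            (mul_le_mul_right (tsum_ge_pw_le he0.le k) _)
  calc _ ≤ K₀ * (pw (k * s) * nX k (prof (P.S k w))) := hK₀ w hwm k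
    _ ≤ K₀ * (K₁ * A * geo (-1) + κ * (A * P.l1X s u) * (pw (-4 * e) * geo e)) :=
        mul_le_mul_right hmain _
    _ = K₀ * (A * (1 * M₁ + P.l1X s u * M₂)) := by rw [hM₁, hM₂]; ring
    _ ≤ K₀ * (A * ((1 + P.l1X s u) * M₁ + (1 + P.l1X s u) * M₂)) :=
        mul_le_mul_right (mul_le_mul_right (add_le_add (mul_le_mul_left le_self_add _)
          (mul_le_mul_left le_add_self _)) _) _
    _ = _ := by ring

theorem linftyNorm_lt_top {s : ℝ} (hs : (d : ℝ) / 2 < s) {u : ℝ → L2 d V} (hu : P.MemL1X s u) :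
    linftyNorm u < ⊤ := by
  obtain ⟨B, hB⟩ := P.exists_ae_le hs hu
  refine lt_of_le_of_lt (essSup_le_of_ae_le (B : ℝ≥0∞) (hB.mono fun t ht => ?_)) ENNReal.coe_lt_top
  change eLpNorm (u t) ⊤ volume ≤ B
  rw [eLpNorm_exponent_top]
  exact essSup_le_of_ae_le _ ht

/-- The Moser estimate in `ℓ¹X^s`. -/
theorem exists_l1X_comp_le [FiniteDimensional ℝ V] {F : V → W} (hF : ContDiff ℝ ∞ F) (h0 : F 0 = 0)
    {s δ : ℝ} (C : ℝ) (hs : (d : ℝ) / 2 < s) (hδ : 0 ≤ δ) (hδs : δ < s - d / 2) :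
    ∃ c : ℝ≥0 → ℝ≥0, Monotone c ∧ ∀ (u : ℝ → L2 d V) (a : ℕ → ℝ), P.MemL1X s u →
      P.IsEnvelope δ C s u a → linftyNorm u < ⊤ ∧
      (∀ᵐ t ∂timeMeasure, MemLp (fun x => F (u t x)) 2 volume) ∧
      ∀ k, P.l1X s (P.S k (comp F u)) ≤
        ENNReal.ofReal (a k) * P.l1X s u * (1 + P.l1X s u) * c (linftyNorm u).toNNReal := by
  choose Γ hΓ hΓ0 hΓF using fun n : ℕ => exists_bddSmooth_eq hF h0 n
  choose K hK using fun n : ℕ => P.exists_l1X_comp_bddSmooth_le (hΓ n) (hΓ0 n) n C hs hδ hδs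
  -- The cutoff radius n is the integer just above the supremum of |u|. Summing the constants of all
  -- smaller radii, instead of taking that of radius n, makes c nondecreasing.
  refine ⟨fun r => ∑ n ∈ Finset.range (⌈r⌉₊ + 1), K n, fun r r' h => ?_, fun u a hu ha => ?_⟩
  · refine Finset.sum_le_sum_of_subset (Finset.range_subset_range.2 ?_)
    have := Nat.ceil_mono h
    omega
  have hlt := P.linftyNorm_lt_top hs hu
  set n := ⌈(linftyNorm u).toNNReal⌉₊ with hn
  have hle : linftyNorm u ≤ ((n : ℝ≥0) : ℝ≥0∞) := by
    rw [← ENNReal.coe_toNNReal hlt.ne]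
    exact ENNReal.coe_le_coe.2 (Nat.le_ceil _)
  have hb : ∀ᵐ t ∂timeMeasure, ∀ᵐ x, ‖u t x‖ₑ ≤ ((n : ℝ≥0) : ℝ≥0∞) := by
    filter_upwards [ae_le_essSup (μ := timeMeasure) (f := fun t => eLpNorm (u t) ⊤ volume)] with t ht
    rw [eLpNorm_exponent_top] at ht
    filter_upwards [ae_le_eLpNormEssSup (f := u t) (μ := volume)] with x hx
    exact hx.trans (ht.trans hle)
  have hcongr : ∀ᵐ t ∂timeMeasure, (fun x => F (u t x)) =ᵐ[volume] fun x => Γ n (u t x) := by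
    filter_upwards [hb] with t ht
    filter_upwards [ht] with x hx
    refine (hΓF n _ ?_).symm
    rw [← ofReal_norm, ← ENNReal.ofReal_coe_nnreal,
      ENNReal.ofReal_le_ofReal_iff (NNReal.coe_nonneg _)] at hx
    exact hx
  refine ⟨hlt, hcongr.mono fun t ht => ?_, fun k => ?_⟩
  · exact (memLp_congr_ae (((hΓ n).comp_ae (hΓ0 n) u t).trans ht.symm)).1 (Lp.memLp _)
  · refine (hK n u (comp F u) a hu.1 hb ha (hcongr.mono fun t ht => ofFun_congr ht) k).trans ?_
    refine mul_le_mul_right (ENNReal.coe_le_coe.2 ?_) _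
    exact Finset.single_le_sum (f := K) (fun _ _ => zero_le) (Finset.mem_range.2 n.lt_succ_self)

end Decomposition

end Moser

end LocalEnergy

end

/-! ### The six bounds, by choice of the exponents -/

theorem proposition3p2 (d : ℕ) (hd : 0 < d) (P : Decomposition d) :
    -- (a) algebra property
    (∀ s δ C : ℝ, (d : ℝ) / 2 < s → 0 < δ → δ < s - d / 2 →
      ∃ K : ℝ≥0, ∀ (u v : ℝ → L2 d ℂ) (a b : ℕ → ℝ),
        P.MemL1X s u → P.MemL1X s v → P.IsEnvelope δ C s u a → P.IsEnvelope δ C s v b →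
        (∀ᵐ t ∂timeMeasure, MemLp (fun x => u t x * v t x) 2 volume) ∧
        ∀ k, P.l1X s (P.S k (mul u v)) ≤
          K * ENNReal.ofReal (a k + b k) * P.l1X s u * P.l1X s v) ∧
    -- (a) Moser estimate
    (∀ (m n : ℕ) (F : EuclideanSpace ℂ (Fin m) → EuclideanSpace ℂ (Fin n)),
      ContDiff ℝ ∞ F → F 0 = 0 →
      ∀ s δ C : ℝ, (d : ℝ) / 2 < s → 0 < δ → δ < s - d / 2 →
      ∃ c : ℝ≥0 → ℝ≥0, Monotone c ∧
        ∀ (u : ℝ → L2 d (EuclideanSpace ℂ (Fin m))) (a : ℕ → ℝ),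
          P.MemL1X s u → P.IsEnvelope δ C s u a →
          linftyNorm u < ⊤ ∧
          (∀ᵐ t ∂timeMeasure, MemLp (fun x => F (u t x)) 2 volume) ∧
          ∀ k, P.l1X s (P.S k (comp F u)) ≤
            ENNReal.ofReal (a k) * P.l1X s u * (1 + P.l1X s u) * c (linftyNorm u).toNNReal) ∧
    -- (b) bilinear bounds
    (∀ s σ δ C : ℝ, (d : ℝ) / 2 + 2 < s → 0 ≤ σ → σ ≤ s → 0 < δ → δ < s - d / 2 - 2 →
      ∃ K : ℝ≥0, ∀ (u v : ℝ → L2 d ℂ) (a b : ℕ → ℝ),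
        P.MemL1X (s - 1) u → P.MemL1X (σ - 1) v →
        P.IsEnvelope δ C (s - 1) u a → P.IsEnvelope δ C (σ - 1) v b →
        (∀ᵐ t ∂timeMeasure, MemLp (fun x => u t x * v t x) 2 volume) ∧
        ∀ k, P.l1Y σ (P.S k (mul u v)) ≤
          K * ENNReal.ofReal (a k + b k) * P.l1X (s - 1) u * P.l1X (σ - 1) v) ∧
    (∀ s σ δ C : ℝ, (d : ℝ) / 2 + 2 < s → 0 ≤ σ → σ ≤ s - 1 → 0 < δ → δ < s - d / 2 - 2 →
      ∃ K : ℝ≥0, ∀ (u v : ℝ → L2 d ℂ) (a b : ℕ → ℝ),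
        P.MemL1X (s - 2) u → P.MemL1X σ v →
        P.IsEnvelope δ C (s - 2) u a → P.IsEnvelope δ C σ v b →
        (∀ᵐ t ∂timeMeasure, MemLp (fun x => u t x * v t x) 2 volume) ∧
        ∀ k, P.l1Y σ (P.S k (mul u v)) ≤
          K * ENNReal.ofReal (a k + b k) * P.l1X (s - 2) u * P.l1X σ v) ∧
    (∀ s σ δ C : ℝ, (d : ℝ) / 2 + 2 < s → 0 ≤ σ → σ ≤ s → 0 < δ → δ < s - d / 2 - 2 →
      ∃ K : ℝ≥0, ∀ (u v : ℝ → L2 d ℂ) (a b : ℕ → ℝ),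
        P.MemL1X (s - 2) u → P.MemL1X σ v →
        P.IsEnvelope δ C (s - 2) u a → P.IsEnvelope δ C σ v b →
        ∀ k, (∀ᵐ t ∂timeMeasure, MemLp (fun x => u t x * P.SGe (k - 4) v t x) 2 volume) ∧
          P.l1Y σ (P.S k (mul u (P.SGe (k - 4) v))) ≤
            K * ENNReal.ofReal (a k + b k) * P.l1X (s - 2) u * P.l1X σ v) ∧
    -- (c) commutator bound
    (∀ (s : ℝ) (A : E d → ℂ), (d : ℝ) / 2 + 2 < s → IsSymbolZero A →
      ∃ K : ℝ≥0, ∀ (h : ℝ → L2 d (EuclideanSpace ℂ (Fin d × Fin d))) (u : ℝ → L2 d ℂ) (k : ℕ),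
        P.MemL1X s h → P.MemL1X 0 (P.S k u) →
        P.l1Y 0 (P.metricCommutator h A k u) ≤ K * P.l1X s h * P.l1X 0 (P.S k u)) := by
  refine ⟨?_, ?_, ?_, ?_, ?_, ?_⟩
  · intro s δ C hs hδ hδs
    obtain ⟨K, hK⟩ := P.exists_l1X_mul_le C hδ.le hs hδs
    exact ⟨K, fun u v a b hu hv ha hb => ⟨P.ae_memLp_mul hs hu v,
      hK u v a b hu.1 hv.1 (P.ae_memLp_top hs hu) ha hb⟩⟩
  · intro m n F hF h0 s δ C hs hδ hδs
    exact P.exists_l1X_comp_le hF h0 C hs hδ.le hδs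
  · intro s σ δ C hs hσ hσs hδ hδs
    -- Here σ ≤ s₂ + 1 is an equality, σ ≤ s₁ + 1 reads σ ≤ s, and σ - s₂ + d/2 < s₁ is exactly s >
    -- d/2 + 2.
    obtain ⟨K, hK⟩ := P.exists_l1Y_mul_le (s₁ := s - 1) (s₂ := σ - 1) (σ := σ) C hδ.le
      (by linarith) (by linarith) (by linarith) (by linarith)
    have h : (d : ℝ) / 2 < s - 1 := by linarith
    exact ⟨K, fun u v a b hu hv ha hb => ⟨P.ae_memLp_mul h hu v,
      hK u v a b hu.1 hv.1 (P.ae_memLp_top h hu) ha hb⟩⟩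
  · intro s σ δ C hs hσ hσs hδ hδs
    -- Now σ ≤ s₁ + 1, which comes from the high-low part, reads σ ≤ s - 1, while d/2 < s₁ is again
    -- s > d/2 + 2.
    obtain ⟨K, hK⟩ := P.exists_l1Y_mul_le (s₁ := s - 2) (s₂ := σ) (σ := σ) C hδ.le
      (by linarith) (by linarith) (by linarith) (by linarith)
    have h : (d : ℝ) / 2 < s - 2 := by linarith
    exact ⟨K, fun u v a b hu hv ha hb => ⟨P.ae_memLp_mul h hu v,
      hK u v a b hu.1 hv.1 (P.ae_memLp_top h hu) ha hb⟩⟩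
  · intro s σ δ C hs hσ hσs hδ hδs
    -- With the second factor restricted to high frequencies there is no high-low part, so the
    -- restriction σ ≤ s - 1 of the preceding bound disappears.
    obtain ⟨K, hK⟩ := P.exists_l1Y_mul_SGe_le (s₁ := s - 2) (s₂ := σ) (σ := σ) C hδ.le
      (by linarith) (by linarith) (by linarith)
    have h : (d : ℝ) / 2 < s - 2 := by linarith
    exact ⟨K, fun u v a b hu hv ha hb k => ⟨P.ae_memLp_mul h hu _,
      hK u v a b hu.1 hv.1 (P.ae_memLp_top h hu) ha hb k⟩⟩
  · intro s A hs hA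
    obtain ⟨K, hK⟩ := P.exists_l1Y_metricCommutator_le hs hA
    exact ⟨K, fun h u k hh hu => hK h u k hh.1 hu.1⟩
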